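/- Work on the word RAM: memory cells and a constant number of registers hold signed integers of $w$ bits; copying, loading, storing, loading a constant, $+$, $-$, $\times$, integer division and comparisons take one step each. A \emph{weighted labeled tree} is a finite rooted tree in which every node $u$ has an integer weight $w(u)$, with $w(u)>w(\mathrm{parent}(u))$ for every $u$ other than the root, and in which the leaves carry pairwise distinct integer labels. Ancestors and descendants are not necessarily proper. Given two such trees $\mathcal T_1,\mathcal T_2$, nodes $u\in\mathcal T_1$ and $v\in\mathcal T_2$ are \emph{induced} if there are a leaf $x$ of $\mathcal T_1$ that is a descendant of $u$ and a leaf $y$ of $\mathcal T_2$ that is a descendant of $v$ with the same label. A \emph{Heaviest Induced Ancestors} query $(u,v)$ with $u\in\mathcal T_1$, $v\in\mathcal T_2$ asks for an ancestor $u'$ of $u$ and an ancestor $v'$ of $v$ that are induced and for which $w(u')+w(v')$ is largest among all such pairs (or for the report that no such pair exists, which happens exactly when the trees have no leaf label in common). \textbf{Lemma.} For every constant $\varepsilon>0$ there are a preprocessing program, a query program and a constant $C$ (all depending only on $\varepsilon$) such that the following holds for all weighted labeled trees $\mathcal T_1,\mathcal T_2$, with $n$ nodes in total, given by arrays of parent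 pointers, weights and labels, and for every word length $w\ge C\log_2 n$ for which all weights, all labels and all sums $w(u)+w(v)$ with $u\in\mathcal T_1$, $v\in\mathcal T_2$ fit into words. The preprocessing program builds, in at most $C\,n^{1+\varepsilon}$ steps and using at most $C\,n^{1+\varepsilon}$ memory cells, a data structure from which the query program answers every Heaviest Induced Ancestors query correctly in at most $C$ steps, leaving the data structure unchanged. -/

import Mathlib

namespace HIA

/-! ### Rooted, weighted, labeled trees -/

/-- A finite rooted tree on the nodes `0, …, size - 1`, given by its parent pointers. The parent
pointer of the root points to the root itself. The numbering of the nodes is arbitrary. -/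
structure RootedTree where
  size : ℕ
  parent : Fin size → Fin size
  root : Fin size
  parent_root : parent root = root
  reaches_root : ∀ v, ∃ k : ℕ, parent^[k] v = root

namespace RootedTree

/-- The node `a` is an ancestor of `v` (equivalently `v` is a descendant of `a`), not necessarily
a proper one. -/
def IsAncestor (T : RootedTree) (a v : Fin T.size) : Prop :=
  ∃ k : ℕ, T.parent^[k] v = a

/-- A leaf is a node without children. -/
def IsLeaf (T : RootedTree) (v : Fin T.size) : Prop :=
  ∀ c : Fin T.size, c ≠ T.root → T.parent c ≠ v

end RootedTree

/-- A rooted tree with integer node weights that strictly increase along every root-to-leaf path,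
and with pairwise distinct labels on its leaves. The values of `label` at nodes that are not leaves
are arbitrary and carry no information. -/
structure WLTree extends RootedTree where
  weight : Fin size → ℤ
  weight_parent_lt : ∀ v, v ≠ root → weight (parent v) < weight v
  label : Fin size → ℤ
  label_injective : ∀ x y, toRootedTree.IsLeaf x → toRootedTree.IsLeaf y →
    label x = label y → x = y

/-- The nodes `u` of `T₁` and `v` of `T₂` are induced: some leaf descendant of `u` and some leaf
descendant of `v` carry the same label. -/
def Induced (T₁ T₂ : WLTree) (u : Fin T₁.size) (v : Fin T₂.size) : Prop :=
  ∃ x y, T₁.IsLeaf x ∧ T₂.IsLeaf y ∧ T₁.label x = T₂.label y ∧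
    T₁.IsAncestor u x ∧ T₂.IsAncestor v y

/-- `(u', v')` is an induced pair of ancestors of `u` and `v`. -/
def InducedAncestors (T₁ T₂ : WLTree) (u : Fin T₁.size) (v : Fin T₂.size)
    (u' : Fin T₁.size) (v' : Fin T₂.size) : Prop :=
  T₁.IsAncestor u' u ∧ T₂.IsAncestor v' v ∧ Induced T₁ T₂ u' v'

/-- `(u', v')` is a heaviest induced pair of ancestors of `u` and `v`. -/
def HeaviestInducedAncestors (T₁ T₂ : WLTree) (u : Fin T₁.size) (v : Fin T₂.size)
    (u' : Fin T₁.size) (v' : Fin T₂.size) : Prop :=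
  InducedAncestors T₁ T₂ u v u' v' ∧
    ∀ a b, InducedAncestors T₁ T₂ u v a b →
      T₁.weight a + T₂.weight b ≤ T₁.weight u' + T₂.weight v'

/-- The integers `r₀`, `r₁` are a correct answer to the query `(u, v)`: the numbers of the two
nodes of a heaviest induced pair of ancestors, or `-1, -1` when `u` and `v` have no induced pair of
ancestors at all (which happens exactly when the two trees have no leaf label in common). -/
def CorrectAnswer (T₁ T₂ : WLTree) (u : Fin T₁.size) (v : Fin T₂.size) (r₀ r₁ : ℤ) : Prop :=
  (∃ u' v', HeaviestInducedAncestors T₁ T₂ u v u' v' ∧ r₀ = (u'.val : ℤ) ∧ r₁ = (v'.val : ℤ)) ∨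
  ((¬ ∃ u' v', InducedAncestors T₁ T₂ u v u' v') ∧ r₀ = -1 ∧ r₁ = -1)

/-! ### A word RAM with a step count -/

/-- `x` fits into a machine word of `w` bits: `-2 ^ (w - 1) ≤ x < 2 ^ (w - 1)`. -/
def IsWord (w : ℕ) (x : ℤ) : Prop :=
  -(2 : ℤ) ^ w ≤ 2 * x ∧ 2 * x < (2 : ℤ) ^ w

/-- Registers and memory cells. A program text mentions only finitely many registers; memory is
accessed through addresses that are computed at run time. -/
structure State where
  reg : ℕ → ℤ
  mem : ℕ → ℤ

namespace State

def setReg (s : State) (d : ℕ) (x : ℤ) : State :=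
  { s with reg := Function.update s.reg d x }

def setMem (s : State) (i : ℕ) (x : ℤ) : State :=
  { s with mem := Function.update s.mem i x }

end State

/-- Binary arithmetic instructions; division is integer division, with value `0` for divisor `0`. -/
inductive ArithOp where
  | add | sub | mul | div

def ArithOp.eval : ArithOp → ℤ → ℤ → ℤ
  | .add, a, b => a + b
  | .sub, a, b => a - b
  | .mul, a, b => a * b
  | .div, a, b => a / b

/-- Comparisons between the contents of two registers. -/
inductive Test where
  | lt (a b : ℕ)
  | le (a b : ℕ)
  | eq (a b : ℕ)
  | ne (a b : ℕ)

def Test.Holds : Test → State → Prop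
  | .lt a b, s => s.reg a < s.reg b
  | .le a b, s => s.reg a ≤ s.reg b
  | .eq a b, s => s.reg a = s.reg b
  | .ne a b, s => s.reg a ≠ s.reg b

/-- Programs: register and memory instructions, combined by sequencing, branching and loops.
Arguments of type `ℕ` are register numbers. -/
inductive Prog where
  | skip
  | const (d : ℕ) (c : ℤ)
  | move (d a : ℕ)
  | arith (o : ArithOp) (d a b : ℕ)
  | load (d a : ℕ)
  | store (a b : ℕ)
  | seq (p q : Prog)
  | branch (c : Test) (p q : Prog)
  | loop (c : Test) (p : Prog)

/-- `Run w S p s t s'`: on the machine with words of `w` bits and the `S` memory cells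
`0, …, S - 1`, the program `p`, started in state `s`, halts after `t` steps in state `s'`.
Every instruction and every evaluation of a test costs one step. There is no run (the machine
crashes) if an arithmetic result does not fit into a word or if an address is out of range. -/
inductive Run (w S : ℕ) : Prog → State → ℕ → State → Prop where
  | skip (s : State) : Run w S .skip s 1 s
  | const (s : State) (d : ℕ) (c : ℤ) (hc : IsWord w c) :
      Run w S (.const d c) s 1 (s.setReg d c)
  | move (s : State) (d a : ℕ) : Run w S (.move d a) s 1 (s.setReg d (s.reg a))
  | arith (s : State) (o : ArithOp) (d a b : ℕ) (h : IsWord w (o.eval (s.reg a) (s.reg b))) :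
      Run w S (.arith o d a b) s 1 (s.setReg d (o.eval (s.reg a) (s.reg b)))
  | load (s : State) (d a i : ℕ) (hi : i < S) (ha : s.reg a = (i : ℤ)) :
      Run w S (.load d a) s 1 (s.setReg d (s.mem i))
  | store (s : State) (a b i : ℕ) (hi : i < S) (ha : s.reg a = (i : ℤ)) :
      Run w S (.store a b) s 1 (s.setMem i (s.reg b))
  | seq {s s' s'' : State} {p q : Prog} {k m : ℕ} (hp : Run w S p s k s')
      (hq : Run w S q s' m s'') : Run w S (.seq p q) s (k + m) s''
  | branch_true {s s' : State} {c : Test} {p q : Prog} {k : ℕ} (hc : c.Holds s)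
      (hp : Run w S p s k s') : Run w S (.branch c p q) s (k + 1) s'
  | branch_false {s s' : State} {c : Test} {p q : Prog} {k : ℕ} (hc : ¬ c.Holds s)
      (hq : Run w S q s k s') : Run w S (.branch c p q) s (k + 1) s'
  | loop_true {s s' s'' : State} {c : Test} {p : Prog} {k m : ℕ} (hc : c.Holds s)
      (hp : Run w S p s k s') (hl : Run w S (.loop c p) s' m s'') :
      Run w S (.loop c p) s (k + m + 1) s''
  | loop_false {s : State} {c : Test} {p : Prog} (hc : ¬ c.Holds s) :
      Run w S (.loop c p) s 1 s

/-! ### Input and output conventions -/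

/-- Two arguments are passed in registers `0` and `1`; all other registers are `0`. -/
def args (a b : ℤ) : ℕ → ℤ := fun i => if i = 0 then a else if i = 1 then b else 0

/-- A tree is presented as the array of its parent pointers, followed by the array of its weights
and the array of its labels. -/
def WLTree.encode (T : WLTree) : List ℤ :=
  List.ofFn (fun v : Fin T.size => ((T.parent v).val : ℤ)) ++
    List.ofFn T.weight ++ List.ofFn T.label

/-- The state in which preprocessing starts: the sizes of the trees in registers `0` and `1`, the
encodings of the trees in an initial segment of the memory, and `0` everywhere else. -/
def inputState (T₁ T₂ : WLTree) : State where
  reg := args (T₁.size : ℤ) (T₂.size : ℤ)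
  mem := fun i => (T₁.encode ++ T₂.encode).getD i 0

/-- The state in which the query `(u, v)` starts: the numbers of the two nodes in registers `0`
and `1`, and in memory the data structure `D`. -/
def queryState {T₁ T₂ : WLTree} (D : ℕ → ℤ) (u : Fin T₁.size) (v : Fin T₂.size) : State where
  reg := args (u.val : ℤ) (v.val : ℤ)
  mem := D

/-- All weights, all labels, and the total weight of every pair of nodes fit into words of `w`
bits. -/
def FitsInWords (w : ℕ) (T₁ T₂ : WLTree) : Prop :=
  (∀ u, IsWord w (T₁.weight u) ∧ IsWord w (T₁.label u)) ∧
  (∀ v, IsWord w (T₂.weight v) ∧ IsWord w (T₂.label v)) ∧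
  ∀ u v, IsWord w (T₁.weight u + T₂.weight v)

end HIA

/-! Hang both trees below a new root `0` and number all nodes in preorder. Let `(a, b)` be an
induced pair of ancestors of `(u, v)`, witnessed by leaves `x`, `y` with a common label. Then the
lowest common ancestors of `u`, `x` and of `v`, `y` are induced as well, and at least as heavy since
weights grow downwards. So a query asks for the maximum, over all matched leaf pairs `(x, y)`, of
the weight of lca(u, x) plus that of lca(v, y).

The task is to split lca(u, x) into a part known when `x` is stored and a part known when `u` is
queried. If `c` lies between `u` and `x` in preorder, then lca(u, x) is the higher of lca(u, c) and
lca(x, c) (`Preorderly.lc_between`), and in preorder "higher" means "smaller number". Write numbers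
with `k` digits in radix `B`. A leaf lists all `k * B` block starts around it, a query node needs
only two per level, and some separator between the two nodes is on both lists (`exists_sepr`). Which
of the two numbers lca(u, c), lca(x, c) is smaller is settled by the same device: the leaf lists,
for all levels and digits, on which side of a block its number lies, and the query names the block
of its own number (`exists_digit`). Thus a leaf has `(k * B) ^ 2` keys and a query node has `(2 * k)
^ 2`. Every common key yields a common ancestor (`key_sound`), and some common key yields the lowest
one (`key_complete`). The key alone tells whether the ancestor is supplied by the leaf or by the
query; the other side contributes the number `0`.

A dictionary receives, for every matched leaf pair, all `(k * B) ^ 4` pairs of keys and keeps a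
heaviest pair of stored nodes for each. A query looks up `(2 * k) ^ 4` keys, adds its own nodes, and
takes the heaviest result; `found_sound` and `found_complete` show that this is right. The
dictionary is a trie on the radix-`B` digits of the keys, with depth depending on `k` only.

With `B` of order `n ^ (1 / k)`, time and space are bounded by a constant times `n * B ^ 6`, so `k ≥
6 / ε` suffices. Sorting, by weight for the preorder and by label for the matching, uses a `B`-ary
tournament tree with `k` levels above its leaves and is cheaper than that.

On the machine side, programs are written in a small structured language. Weakest preconditions for
it are sound for the compiled code (`Cmd.run_of_wp`), and the step count is a monomial bound
computed from the nesting of the loops (`Cmd.tm_le`). -/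

namespace HIA

/-! ### A structured language on natural-number variables and two-dimensional arrays -/

/-- Numerical parameters of a compiled program: word length, number of cells, a bound for the
values of natural-number expressions, first cell of the arrays, width and number of the rows of
an array, and the numbers of iterations of the loops. -/
structure Ctx where
  w : ℕ
  S : ℕ
  W : ℕ
  base : ℕ
  Wd : ℕ
  L : ℕ
  rho : ℕ → ℕ

/-- Since `W` is at most half of `2 ^ w`, every natural number below `W` is a signed word; `W` also
dominates all addresses and the constant 40 of the address computation. -/
structure Ctx.Valid (cx : Ctx) : Prop where
  word : 2 * cx.W ≤ 2 ^ cx.w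
  space : cx.base + cx.L * cx.Wd * 40 ≤ cx.S
  space_le : cx.S ≤ cx.W
  forty : 40 < cx.W
  width : 0 < cx.L → 0 < cx.Wd

/-- The cell of slot `sl` of the entry in row `r` and column `c`. -/
def Ctx.addr (cx : Ctx) (r c sl : ℕ) : ℕ := cx.base + (r * cx.Wd + c) * 40 + sl

/-- Values of the variables, of the natural-number arrays and of the integer arrays, and the
read-only input. -/
structure St where
  v : ℕ → ℕ
  a : ℕ → ℕ → ℕ → ℕ
  z : ℕ → ℕ → ℤ
  inp : ℕ → ℤ

namespace St

def setv (σ : St) (x n : ℕ) : St := { σ with v := fun y => if y = x then n else σ.v y }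

def seta (σ : St) (j r c n : ℕ) : St :=
  { σ with a := fun j' r' c' => if j' = j ∧ r' = r ∧ c' = c then n else σ.a j' r' c' }

def setz (σ : St) (j r : ℕ) (n : ℤ) : St :=
  { σ with z := fun j' r' => if j' = j ∧ r' = r then n else σ.z j' r' }

variable (σ : St) (x y n j r c j' r' c' : ℕ) (m : ℤ)

@[simp] theorem setv_v : (σ.setv x n).v y = if y = x then n else σ.v y := rfl
@[simp] theorem setv_a : (σ.setv x n).a = σ.a := rfl
@[simp] theorem setv_z : (σ.setv x n).z = σ.z := rfl
@[simp] theorem setv_inp : (σ.setv x n).inp = σ.inp := rfl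
@[simp] theorem seta_v : (σ.seta j r c n).v = σ.v := rfl
@[simp] theorem seta_a : (σ.seta j r c n).a j' r' c' =
    if j' = j ∧ r' = r ∧ c' = c then n else σ.a j' r' c' := rfl
@[simp] theorem seta_z : (σ.seta j r c n).z = σ.z := rfl
@[simp] theorem seta_inp : (σ.seta j r c n).inp = σ.inp := rfl
@[simp] theorem setz_v : (σ.setz j r m).v = σ.v := rfl
@[simp] theorem setz_a : (σ.setz j r m).a = σ.a := rfl
@[simp] theorem setz_z : (σ.setz j r m).z j' r' = if j' = j ∧ r' = r then m else σ.z j' r' := rfl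
@[simp] theorem setz_inp : (σ.setz j r m).inp = σ.inp := rfl

end St

/-- Natural-number expressions. -/
inductive Exp where
  | var (x : ℕ)
  | lit (n : ℕ)
  | add (a b : Exp)
  | sub (a b : Exp)
  | mul (a b : Exp)
  | div (a b : Exp)
  | mod (a b : Exp)
  | rd (j : ℕ) (r c : Exp)
  | inp (e : Exp)

/-- Integer expressions. -/
inductive ZExp where
  | rd (j : ℕ) (r : Exp)
  | inp (e : Exp)
  | add (a b : ZExp)

/-- Tests. -/
inductive Tst where
  | lt (a b : Exp)
  | le (a b : Exp)
  | eq (a b : Exp)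
  | zlt (a b : ZExp)
  | zeq (a b : ZExp)

/-- Commands; `for_ x n p` executes `p` for `x = 0, …, n - 1`. -/
inductive Cmd where
  | skip
  | asg (x : ℕ) (e : Exp)
  | wr (j : ℕ) (r c e : Exp)
  | wz (j : ℕ) (r : Exp) (e : ZExp)
  | seq (p q : Cmd)
  | ite (t : Tst) (p q : Cmd)
  | for_ (x n : ℕ) (p : Cmd)

infixr:60 " ;; " => Cmd.seq

namespace Exp

@[simp] def eval (σ : St) : Exp → ℕ
  | var x => σ.v x
  | lit n => n
  | add a b => a.eval σ + b.eval σ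
  | sub a b => a.eval σ - b.eval σ
  | mul a b => a.eval σ * b.eval σ
  | div a b => a.eval σ / b.eval σ
  | mod a b => a.eval σ % b.eval σ
  | rd j r c => σ.a j (r.eval σ) (c.eval σ)
  | inp e => (σ.inp (e.eval σ)).toNat

/-- No overflow, no negative difference and no access out of range occurs in the evaluation. -/
@[simp] def ok (cx : Ctx) (σ : St) : Exp → Prop
  | var _ => True
  | lit n => n < cx.W
  | add a b => a.ok cx σ ∧ b.ok cx σ ∧ a.eval σ + b.eval σ < cx.W
  | sub a b => a.ok cx σ ∧ b.ok cx σ ∧ b.eval σ ≤ a.eval σ ∧ a.eval σ < cx.W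
  | mul a b => a.ok cx σ ∧ b.ok cx σ ∧ a.eval σ * b.eval σ < cx.W
  | div a b => a.ok cx σ ∧ b.ok cx σ ∧ a.eval σ < cx.W
  | mod a b => a.ok cx σ ∧ b.ok cx σ ∧ a.eval σ < cx.W
  | rd j r c => r.ok cx σ ∧ c.ok cx σ ∧ j < 20 ∧ r.eval σ < cx.L ∧ c.eval σ < cx.Wd
  | inp e => e.ok cx σ ∧ e.eval σ < cx.base ∧ 0 ≤ σ.inp (e.eval σ)

@[simp] def cost : Exp → ℕ
  | var _ => 1
  | lit _ => 1
  | add a b => a.cost + b.cost + 1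
  | sub a b => a.cost + b.cost + 1
  | mul a b => a.cost + b.cost + 1
  | div a b => a.cost + b.cost + 1
  | mod a b => a.cost + b.cost + 3
  | rd _ r c => r.cost + c.cost + 8
  | inp e => e.cost + 1

end Exp

namespace ZExp

@[simp] def eval (σ : St) : ZExp → ℤ
  | rd j r => σ.z j (r.eval σ)
  | inp e => σ.inp (e.eval σ)
  | add a b => a.eval σ + b.eval σ

@[simp] def ok (cx : Ctx) (σ : St) : ZExp → Prop
  | rd j r => r.ok cx σ ∧ j < 20 ∧ r.eval σ < cx.L
  | inp e => e.ok cx σ ∧ e.eval σ < cx.base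
  | add a b => a.ok cx σ ∧ b.ok cx σ ∧ IsWord cx.w (a.eval σ + b.eval σ)

@[simp] def cost : ZExp → ℕ
  | rd _ r => r.cost + 9
  | inp e => e.cost + 1
  | add a b => a.cost + b.cost + 1

end ZExp

namespace Tst

@[simp] def holds (σ : St) : Tst → Prop
  | lt a b => a.eval σ < b.eval σ
  | le a b => a.eval σ ≤ b.eval σ
  | eq a b => a.eval σ = b.eval σ
  | zlt a b => a.eval σ < b.eval σ
  | zeq a b => a.eval σ = b.eval σ

@[simp] def ok (cx : Ctx) (σ : St) : Tst → Prop
  | lt a b => a.ok cx σ ∧ b.ok cx σ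
  | le a b => a.ok cx σ ∧ b.ok cx σ
  | eq a b => a.ok cx σ ∧ b.ok cx σ
  | zlt a b => a.ok cx σ ∧ b.ok cx σ
  | zeq a b => a.ok cx σ ∧ b.ok cx σ

@[simp] def cost : Tst → ℕ
  | lt a b => a.cost + b.cost
  | le a b => a.cost + b.cost
  | eq a b => a.cost + b.cost
  | zlt a b => a.cost + b.cost
  | zeq a b => a.cost + b.cost

end Tst

namespace Cmd

/-- The variables that a command may change. -/
@[simp] def mv : Cmd → List ℕ
  | skip => []
  | asg x _ => [x]
  | wr _ _ _ _ => []
  | wz _ _ _ => []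
  | seq p q => p.mv ++ q.mv
  | ite _ p q => p.mv ++ q.mv
  | for_ x _ p => x :: p.mv

/-- The natural-number arrays that a command may change. -/
@[simp] def ma : Cmd → List ℕ
  | skip => []
  | asg _ _ => []
  | wr j _ _ _ => [j]
  | wz _ _ _ => []
  | seq p q => p.ma ++ q.ma
  | ite _ p q => p.ma ++ q.ma
  | for_ _ _ p => p.ma

/-- The integer arrays that a command may change. -/
@[simp] def mz : Cmd → List ℕ
  | skip => []
  | asg _ _ => []
  | wr _ _ _ _ => []
  | wz j _ _ => [j]
  | seq p q => p.mz ++ q.mz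
  | ite _ p q => p.mz ++ q.mz
  | for_ _ _ p => p.mz

/-- `σ` and `τ` differ only in what `p` may change. -/
structure Agree (p : Cmd) (σ τ : St) : Prop where
  v : ∀ y, y ∉ p.mv → τ.v y = σ.v y
  a : ∀ j, j ∉ p.ma → τ.a j = σ.a j
  z : ∀ j, j ∉ p.mz → τ.z j = σ.z j
  inp : τ.inp = σ.inp

theorem Agree.refl (p : Cmd) (σ : St) : Agree p σ σ :=
  ⟨fun _ _ => rfl, fun _ _ => rfl, fun _ _ => rfl, rfl⟩

theorem Agree.trans {p : Cmd} {σ τ υ : St} (h : Agree p σ τ) (h' : Agree p τ υ) : Agree p σ υ :=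
  ⟨fun y hy => (h'.v y hy).trans (h.v y hy), fun y hy => (h'.a y hy).trans (h.a y hy),
    fun y hy => (h'.z y hy).trans (h.z y hy), h'.inp.trans h.inp⟩

theorem Agree.mono {p q : Cmd} {σ τ : St} (h : Agree p σ τ) (hv : p.mv ⊆ q.mv)
    (ha : p.ma ⊆ q.ma) (hz : p.mz ⊆ q.mz) : Agree q σ τ :=
  ⟨fun y hy => h.v y fun h' => hy (hv h'), fun y hy => h.a y fun h' => hy (ha h'),
    fun y hy => h.z y fun h' => hy (hz h'), h.inp⟩

theorem Agree.setv_for {x n m : ℕ} {p : Cmd} {σ τ : St} (h : Agree (for_ x n p) σ τ) :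
    Agree (for_ x n p) σ (τ.setv x m) := by
  refine ⟨fun y hy => ?_, h.a, h.z, h.inp⟩
  rw [St.setv_v, if_neg (fun e => hy (by simp [e])), h.v y hy]

/-- Weakest preconditions; loops are annotated with an invariant by the existential. -/
@[simp] def wp (cx : Ctx) : Cmd → (St → Prop) → St → Prop
  | skip, Q, σ => Q σ
  | asg x e, Q, σ => e.ok cx σ ∧ Q (σ.setv x (e.eval σ))
  | wr j r c e, Q, σ => (r.ok cx σ ∧ c.ok cx σ ∧ e.ok cx σ ∧ j < 20 ∧ r.eval σ < cx.L ∧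
      c.eval σ < cx.Wd) ∧ Q (σ.seta j (r.eval σ) (c.eval σ) (e.eval σ))
  | wz j r e, Q, σ => (r.ok cx σ ∧ e.ok cx σ ∧ j < 20 ∧ r.eval σ < cx.L) ∧
      Q (σ.setz j (r.eval σ) (e.eval σ))
  | seq p q, Q, σ => p.wp cx (q.wp cx Q) σ
  | ite t p q, Q, σ => t.ok cx σ ∧ (t.holds σ → p.wp cx Q σ) ∧ (¬ t.holds σ → q.wp cx Q σ)
  -- The number of iterations is fixed in advance by `cx.rho n`, so that the time bound `tm` depends
  -- on `rho` alone and not on the state.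
  | for_ x n p, Q, σ => (σ.v n = cx.rho n ∧ cx.rho n < cx.W ∧ x ∉ p.mv ∧ n ∉ x :: p.mv) ∧
      ∃ I : ℕ → St → Prop, I 0 (σ.setv x 0) ∧
        (∀ i < cx.rho n, ∀ τ, Agree (for_ x n p) σ τ → τ.v x = i → I i τ →
          p.wp cx (fun τ' => I (i + 1) (τ'.setv x (i + 1))) τ) ∧
        ∀ τ, Agree (for_ x n p) σ τ → I (cx.rho n) τ → Q τ

/-- The frame comes for free: the weaker postcondition has to be checked only in states that agree
with `σ` off what `p` may change. Untouched arrays and constants are carried through all later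
proofs in this way. -/
theorem wp_conseq {cx : Ctx} (p : Cmd) : ∀ {Q Q' : St → Prop} {σ : St}, p.wp cx Q σ →
    (∀ τ, Agree p σ τ → Q τ → Q' τ) → p.wp cx Q' σ := by
  induction p with
  | skip => intro Q Q' σ h hQ; exact hQ _ (.refl _ _) h
  | asg x e =>
    intro Q Q' σ h hQ
    refine ⟨h.1, hQ _ ⟨fun y hy => ?_, fun _ _ => rfl, fun _ _ => rfl, rfl⟩ h.2⟩
    rw [St.setv_v, if_neg (by simpa using hy)]
  | wr j r c e =>
    intro Q Q' σ h hQ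
    refine ⟨h.1, hQ _ ⟨fun _ _ => rfl, fun y hy => ?_, fun _ _ => rfl, rfl⟩ h.2⟩
    funext r' c'
    rw [St.seta_a, if_neg (fun h' => hy (by simp [h'.1]))]
  | wz j r e =>
    intro Q Q' σ h hQ
    refine ⟨h.1, hQ _ ⟨fun _ _ => rfl, fun _ _ => rfl, fun y hy => ?_, rfl⟩ h.2⟩
    funext r'
    rw [St.setz_z, if_neg (fun h' => hy (by simp [h'.1]))]
  | seq p q ihp ihq =>
    intro Q Q' σ h hQ
    refine ihp h fun τ hτ h' => ihq h' fun υ hυ h'' => hQ υ ?_ h''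
    exact (hτ.mono (by simp) (by simp) (by simp)).trans (hυ.mono (by simp) (by simp) (by simp))
  | ite t p q ihp ihq =>
    intro Q Q' σ h hQ
    exact ⟨h.1, fun ht => ihp (h.2.1 ht) fun τ hτ => hQ τ (hτ.mono (by simp) (by simp) (by simp)),
      fun ht => ihq (h.2.2 ht) fun τ hτ => hQ τ (hτ.mono (by simp) (by simp) (by simp))⟩
  | for_ x n p ih =>
    intro Q Q' σ h hQ
    obtain ⟨h1, I, h2, h3, h4⟩ := h
    exact ⟨h1, I, h2, h3, fun τ hτ hI => hQ τ hτ (h4 τ hτ hI)⟩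

/-- A bound for the running time of the compiled command. -/
@[simp] def tm (rho : ℕ → ℕ) : Cmd → ℕ
  | skip => 1
  | asg _ e => e.cost + 1
  | wr _ r c e => r.cost + c.cost + e.cost + 8
  | wz _ r e => r.cost + e.cost + 9
  | seq p q => p.tm rho + q.tm rho
  | ite t p q => t.cost + p.tm rho + q.tm rho + 1
  | for_ _ n p => rho n * (p.tm rho + 3) + 2

end Cmd

/-! ### Compilation -/

/-- Register of temporary `d`. -/
def tr (d : ℕ) : ℕ := 2 * d + 7

/-- Replaces row and column in temporaries `d`, `d + 1` by the address of slot `sl`. -/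
def addrProg (d sl : ℕ) : Prog :=
  .seq (.arith .mul (tr d) (tr d) 3) <| .seq (.arith .add (tr d) (tr d) (tr (d + 1))) <|
  .seq (.const (tr (d + 1)) 40) <| .seq (.arith .mul (tr d) (tr d) (tr (d + 1))) <|
  .seq (.const (tr (d + 1)) sl) <| .seq (.arith .add (tr d) (tr d) (tr (d + 1)))
  (.arith .add (tr d) (tr d) 1)

def Exp.comp : Exp → ℕ → Prog
  | .var x, d => .move (tr d) (2 * x)
  | .lit n, d => .const (tr d) n
  | .add a b, d => .seq (a.comp d) <| .seq (b.comp (d + 1)) (.arith .add (tr d) (tr d) (tr (d + 1)))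
  | .sub a b, d => .seq (a.comp d) <| .seq (b.comp (d + 1)) (.arith .sub (tr d) (tr d) (tr (d + 1)))
  | .mul a b, d => .seq (a.comp d) <| .seq (b.comp (d + 1)) (.arith .mul (tr d) (tr d) (tr (d + 1)))
  | .div a b, d => .seq (a.comp d) <| .seq (b.comp (d + 1)) (.arith .div (tr d) (tr d) (tr (d + 1)))
  | .mod a b, d => .seq (a.comp d) <| .seq (b.comp (d + 1)) <|
      .seq (.arith .div (tr (d + 2)) (tr d) (tr (d + 1))) <|
      .seq (.arith .mul (tr (d + 2)) (tr (d + 2)) (tr (d + 1)))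
      (.arith .sub (tr d) (tr d) (tr (d + 2)))
  | .rd j r c, d => .seq (r.comp d) <| .seq (c.comp (d + 1)) <| .seq (addrProg d (2 * j))
      (.load (tr d) (tr d))
  | .inp e, d => .seq (e.comp d) (.load (tr d) (tr d))

def ZExp.comp : ZExp → ℕ → Prog
  | .rd j r, d => .seq (r.comp d) <| .seq (.const (tr (d + 1)) 0) <| .seq (addrProg d (2 * j + 1))
      (.load (tr d) (tr d))
  | .inp e, d => .seq (e.comp d) (.load (tr d) (tr d))
  | .add a b, d => .seq (a.comp d) <| .seq (b.comp (d + 1)) (.arith .add (tr d) (tr d) (tr (d + 1)))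

def Tst.comp : Tst → Prog
  | .lt a b => .seq (a.comp 0) (b.comp 1)
  | .le a b => .seq (a.comp 0) (b.comp 1)
  | .eq a b => .seq (a.comp 0) (b.comp 1)
  | .zlt a b => .seq (a.comp 0) (b.comp 1)
  | .zeq a b => .seq (a.comp 0) (b.comp 1)

def Tst.toTest : Tst → Test
  | .lt _ _ => .lt (tr 0) (tr 1)
  | .le _ _ => .le (tr 0) (tr 1)
  | .eq _ _ => .eq (tr 0) (tr 1)
  | .zlt _ _ => .lt (tr 0) (tr 1)
  | .zeq _ _ => .eq (tr 0) (tr 1)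

def Cmd.comp : Cmd → Prog
  | .skip => .skip
  | .asg x e => .seq (e.comp 0) (.move (2 * x) (tr 0))
  | .wr j r c e => .seq (e.comp 0) <| .seq (r.comp 1) <| .seq (c.comp 2) <|
      .seq (addrProg 1 (2 * j)) (.store (tr 1) (tr 0))
  | .wz j r e => .seq (e.comp 0) <| .seq (r.comp 1) <| .seq (.const (tr 2) 0) <|
      .seq (addrProg 1 (2 * j + 1)) (.store (tr 1) (tr 0))
  | .seq p q => .seq p.comp q.comp
  | .ite t p q => .seq t.comp (.branch t.toTest p.comp q.comp)
  | .for_ x n p => .seq (.const (2 * x) 0) <| .loop (.lt (2 * x) (2 * n)) <|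
      .seq p.comp <| .seq (.const (tr 0) 1) (.arith .add (2 * x) (2 * x) (tr 0))

/-- The machine state `s` represents `σ`. -/
structure Rep (cx : Ctx) (s : State) (σ : St) : Prop where
  -- Even registers are variables, registers 1 and 3 hold base and width, register 5 is free, and
  -- the odd registers from 7 on are temporaries.
  v : ∀ x, s.reg (2 * x) = σ.v x
  base : s.reg 1 = cx.base
  width : s.reg 3 = cx.Wd
  a : ∀ j < 20, ∀ r < cx.L, ∀ c < cx.Wd, s.mem (cx.addr r c (2 * j)) = σ.a j r c
  z : ∀ j < 20, ∀ r < cx.L, s.mem (cx.addr r 0 (2 * j + 1)) = σ.z j r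
  inp : ∀ i < cx.base, s.mem i = σ.inp i

/-- The registers below temporary `d` and the memory are unchanged. -/
def Keeps (d : ℕ) (s s' : State) : Prop :=
  s'.mem = s.mem ∧ ∀ r, (∀ m, d ≤ m → r ≠ tr m) → s'.reg r = s.reg r

theorem Keeps.trans {d : ℕ} {s s' s'' : State} (h : Keeps d s s') (h' : Keeps d s' s'') :
    Keeps d s s'' :=
  ⟨h'.1.trans h.1, fun r hr => (h'.2 r hr).trans (h.2 r hr)⟩

theorem Keeps.mono {d e : ℕ} {s s' : State} (h : Keeps d s s') (hd : e ≤ d) : Keeps e s s' :=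
  ⟨h.1, fun r hr => h.2 r fun m hm => hr m (hd.trans hm)⟩

theorem keeps_setReg {d m : ℕ} {s : State} (x : ℤ) (h : d ≤ m) : Keeps d s (s.setReg (tr m) x) :=
  ⟨rfl, fun r hr => by simp [State.setReg, Function.update, hr m h]⟩

theorem Keeps.tr {d m : ℕ} {s s' : State} (h : Keeps d s s') (hm : m < d) :
    s'.reg (tr m) = s.reg (tr m) :=
  h.2 _ fun k hk => by unfold HIA.tr; omega

/-- Temporaries are odd registers from 7 on, and `Rep` mentions none of these. -/
theorem Keeps.rep {cx : Ctx} {d : ℕ} {s s' : State} {σ : St} (h : Keeps d s s')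
    (hs : Rep cx s σ) : Rep cx s' σ := by
  refine ⟨fun x => ?_, ?_, ?_, ?_, ?_, ?_⟩
  · rw [h.2 _ fun m _ => by unfold HIA.tr; omega, hs.v]
  · rw [h.2 _ fun m _ => by unfold HIA.tr; omega, hs.base]
  · rw [h.2 _ fun m _ => by unfold HIA.tr; omega, hs.width]
  · rw [h.1]; exact hs.a
  · rw [h.1]; exact hs.z
  · rw [h.1]; exact hs.inp

/-! ### Words, addresses and binary operations. -/

theorem Ctx.Valid.isWord {cx : Ctx} (h : cx.Valid) {n : ℕ} (hn : n < cx.W) :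
    IsWord cx.w (n : ℤ) := by
  have h1 := h.word
  have h2 : (2 * cx.W : ℤ) ≤ 2 ^ cx.w := by exact_mod_cast h1
  constructor
  · have : (0 : ℤ) ≤ 2 ^ cx.w := by positivity
    omega
  · omega

theorem Ctx.addr_lt {cx : Ctx} (h : cx.Valid) {r c sl : ℕ} (hr : r < cx.L) (hc : c < cx.Wd)
    (hsl : sl < 40) : cx.addr r c sl < cx.S := by
  have h1 : r * cx.Wd + c + 1 ≤ cx.L * cx.Wd := by
    have := Nat.mul_le_mul_right cx.Wd hr
    rw [Nat.succ_mul] at this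
    omega
  have := h.space
  unfold Ctx.addr
  omega

/-- An address is a mixed-radix numeral with digits row, column and slot, shifted by the base. -/
theorem Ctx.addr_inj {cx : Ctx} {r c sl r' c' sl' : ℕ} (hc : c < cx.Wd)
    (hsl : sl < 40) (hc' : c' < cx.Wd) (hsl' : sl' < 40)
    (h : cx.addr r c sl = cx.addr r' c' sl') : r = r' ∧ c = c' ∧ sl = sl' := by
  unfold Ctx.addr at h
  have h1 : sl = sl' := by omega
  have h2 : r * cx.Wd + c = r' * cx.Wd + c' := by omega
  have h3 : r = r' := by
    have e1 := congrArg (· / cx.Wd) h2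
    have hp : 0 < cx.Wd := by omega
    simpa [Nat.add_comm, Nat.add_mul_div_right _ _ hp, Nat.div_eq_of_lt hc,
      Nat.div_eq_of_lt hc'] using e1
  subst h3
  exact ⟨rfl, by omega, h1⟩

theorem setReg_self (s : State) (d : ℕ) (x : ℤ) : (s.setReg d x).reg d = x := by
  simp [State.setReg]

theorem run_arith {cx : Ctx} (h : cx.Valid) (o : ArithOp) {s : State} {d a b n : ℕ}
    (ho : o.eval (s.reg a) (s.reg b) = n) (hn : n < cx.W) :
    Run cx.w cx.S (.arith o d a b) s 1 (s.setReg d n) := by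
  have := Run.arith (w := cx.w) (S := cx.S) s o d a b (by rw [ho]; exact h.isWord hn)
  rwa [ho] at this

theorem run_addrProg {cx : Ctx} (h : cx.Valid) {s : State} {d r c sl : ℕ}
    (hW : s.reg 3 = cx.Wd) (hb : s.reg 1 = cx.base)
    (hr : s.reg (tr d) = r) (hc : s.reg (tr (d + 1)) = c) (hrL : r < cx.L) (hcW : c < cx.Wd)
    (hsl : sl < 40) : ∃ s', Run cx.w cx.S (addrProg d sl) s 7 s' ∧ Keeps d s s' ∧
      s'.reg (tr d) = cx.addr r c sl := by
  have hS := cx.addr_lt h hrL hcW hsl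
  have hSW := h.space_le
  have h40 := h.forty
  unfold Ctx.addr at hS
  have n1 : tr (d + 1) ≠ tr d := by unfold tr; omega
  have n2 : 1 ≠ tr (d + 1) := by unfold tr; omega
  have n3 : 1 ≠ tr d := by unfold tr; omega
  have b1 : r * cx.Wd ≤ (r * cx.Wd + c) * 40 := by omega
  refine ⟨_, .seq (run_arith h .mul (n := r * cx.Wd) ?_ (by omega)) <|
    .seq (run_arith h .add (n := r * cx.Wd + c) ?_ (by omega)) <|
    .seq (.const _ _ (40 : ℕ) (h.isWord h40)) <|
    .seq (run_arith h .mul (n := (r * cx.Wd + c) * 40) ?_ (by omega)) <|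
    .seq (.const _ _ (sl : ℕ) (h.isWord (by omega))) <|
    .seq (run_arith h .add (n := (r * cx.Wd + c) * 40 + sl) ?_ (by omega))
    (run_arith h .add (n := cx.addr r c sl) ?_ (by unfold Ctx.addr; omega)), ?_, ?_⟩
  · simp [ArithOp.eval, hr, hW]
  · simp [ArithOp.eval, State.setReg, Function.update, n1, hc]
  · simp [ArithOp.eval, State.setReg, Function.update, n1.symm]
  · simp [ArithOp.eval, State.setReg, Function.update, n1.symm]
  · simp [ArithOp.eval, State.setReg, Function.update, n2, n3, hb, Ctx.addr]
    ring
  · refine (keeps_setReg _ le_rfl).trans <| (keeps_setReg _ le_rfl).trans <|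
      (keeps_setReg _ (Nat.le_succ d)).trans <| (keeps_setReg _ le_rfl).trans <|
      (keeps_setReg _ (Nat.le_succ d)).trans <| (keeps_setReg _ le_rfl).trans <|
      (keeps_setReg _ le_rfl)
  · exact setReg_self _ _ _

/-- The left value survives in temporary `d` because the right operand uses temporaries from `d + 1`
on. The operand programs are arbitrary functions of `d`, so one lemma serves all operations on
natural numbers. -/
theorem run_binary {cx : Ctx} (h : cx.Valid) {σ : St} {s : State} {d m n k t t' : ℕ}
    {a b : ℕ → Prog} (o : ArithOp) (hs : Rep cx s σ)
    (ha : ∀ s, Rep cx s σ → ∃ s', Run cx.w cx.S (a d) s t s' ∧ Keeps d s s' ∧ s'.reg (tr d) = m)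
    (hb : ∀ s, Rep cx s σ → ∃ s', Run cx.w cx.S (b (d + 1)) s t' s' ∧ Keeps (d + 1) s s' ∧
      s'.reg (tr (d + 1)) = n)
    (ho : o.eval m n = k) (hk : k < cx.W) :
    ∃ s', Run cx.w cx.S (.seq (a d) (.seq (b (d + 1)) (.arith o (tr d) (tr d) (tr (d + 1))))) s
      (t + t' + 1) s' ∧ Keeps d s s' ∧ s'.reg (tr d) = k := by
  obtain ⟨s1, r1, k1, e1⟩ := ha s hs
  obtain ⟨s2, r2, k2, e2⟩ := hb s1 (k1.rep hs)
  refine ⟨s2.setReg (tr d) k, ?_, ?_, setReg_self _ _ _⟩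
  · rw [add_assoc]
    refine .seq r1 (.seq r2 (run_arith h o (n := k) ?_ hk))
    rw [e2, k2.tr (Nat.lt_succ_self d), e1, ho]
  · exact (k1.trans (k2.mono (Nat.le_succ d))).trans (keeps_setReg _ le_rfl)

/-! ### Correctness and cost of compiled expressions and tests. -/

theorem Exp.run_comp {cx : Ctx} (h : cx.Valid) {σ : St} : ∀ (e : Exp), e.ok cx σ → ∀ (d : ℕ)
    (s : State), Rep cx s σ → ∃ s', Run cx.w cx.S (e.comp d) s e.cost s' ∧ Keeps d s s' ∧
      s'.reg (tr d) = e.eval σ := by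
  intro e
  induction e with
  | var x =>
    intro _ d s hs
    refine ⟨s.setReg (tr d) (s.reg (2 * x)), .move _ _ _, keeps_setReg _ le_rfl, ?_⟩
    rw [setReg_self, hs.v]
    rfl
  | lit n =>
    intro hok d s hs
    exact ⟨s.setReg (tr d) n, .const _ _ _ (h.isWord hok), keeps_setReg _ le_rfl,
      setReg_self _ _ _⟩
  | add a b iha ihb =>
    intro hok d s hs
    exact run_binary (k := (Exp.add a b).eval σ) h .add hs (iha hok.1 d) (ihb hok.2.1 (d + 1))
      (by simp [ArithOp.eval]) hok.2.2
  | sub a b iha ihb =>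
    intro hok d s hs
    exact run_binary (k := (Exp.sub a b).eval σ) h .sub hs (iha hok.1 d) (ihb hok.2.1 (d + 1))
      (by simp [ArithOp.eval, Nat.cast_sub hok.2.2.1]) (lt_of_le_of_lt (Nat.sub_le _ _) hok.2.2.2)
  | mul a b iha ihb =>
    intro hok d s hs
    exact run_binary (k := (Exp.mul a b).eval σ) h .mul hs (iha hok.1 d) (ihb hok.2.1 (d + 1))
      (by simp [ArithOp.eval]) hok.2.2
  | div a b iha ihb =>
    intro hok d s hs
    exact run_binary (k := (Exp.div a b).eval σ) h .div hs (iha hok.1 d) (ihb hok.2.1 (d + 1))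
      (by simp [ArithOp.eval]) (lt_of_le_of_lt (Nat.div_le_self _ _) hok.2.2)
  | mod a b iha ihb =>
    intro hok d s hs
    obtain ⟨s1, r1, k1, e1⟩ := iha hok.1 d s hs
    obtain ⟨s2, r2, k2, e2⟩ := ihb hok.2.1 (d + 1) s1 (k1.rep hs)
    have e3 : s2.reg (tr d) = a.eval σ := by rw [k2.tr (Nat.lt_succ_self d), e1]
    have hA : a.eval σ < cx.W := hok.2.2
    have hm : a.eval σ / b.eval σ * b.eval σ ≤ a.eval σ := Nat.div_mul_le_self _ _
    have n1 : tr (d + 1) ≠ tr (d + 2) := by unfold tr; omega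
    have n2 : tr d ≠ tr (d + 2) := by unfold tr; omega
    -- The machine has no remainder; `a - a / b * b` also agrees with `a % b` when `b = 0`, as both
    -- divisions by `0` return `0`.
    have hmod : (a.eval σ : ℤ) - (a.eval σ / b.eval σ * b.eval σ : ℕ) =
        ((a.eval σ % b.eval σ : ℕ) : ℤ) := by
      have := Nat.div_add_mod' (a.eval σ) (b.eval σ)
      omega
    have R1 := run_arith h .div (s := s2) (d := tr (d + 2)) (a := tr d) (b := tr (d + 1))
      (n := a.eval σ / b.eval σ) (by simp [ArithOp.eval, e2, e3])
      (lt_of_le_of_lt (Nat.div_le_self _ _) hA)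
    have R2 := run_arith h .mul (s := s2.setReg (tr (d + 2)) (a.eval σ / b.eval σ : ℕ))
      (d := tr (d + 2)) (a := tr (d + 2)) (b := tr (d + 1)) (n := a.eval σ / b.eval σ * b.eval σ)
      (by simp [ArithOp.eval, State.setReg, Function.update, n1, e2]) (lt_of_le_of_lt hm hA)
    have R3 := run_arith h .sub (s := (s2.setReg (tr (d + 2)) (a.eval σ / b.eval σ : ℕ)).setReg
        (tr (d + 2)) (a.eval σ / b.eval σ * b.eval σ : ℕ))
      (d := tr d) (a := tr d) (b := tr (d + 2)) (n := a.eval σ % b.eval σ)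
      (by simp only [ArithOp.eval, State.setReg, Function.update_self, ne_eq, n2,
        not_false_eq_true, Function.update_of_ne, e3, hmod]) (lt_of_le_of_lt (Nat.mod_le _ _) hA)
    have hc : (Exp.mod a b).cost = a.cost + (b.cost + (1 + (1 + 1))) := by simp; ring
    rw [hc]
    refine ⟨_, .seq r1 (.seq r2 (.seq R1 (.seq R2 R3))), ?_, setReg_self _ _ _⟩
    exact (k1.trans (k2.mono (Nat.le_succ d))).trans <| (keeps_setReg _ (by omega)).trans <|
      (keeps_setReg _ (by omega)).trans (keeps_setReg _ le_rfl)
  | rd j r c ihr ihc =>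
    intro hok d s hs
    obtain ⟨hr, hc, hj, hrL, hcW⟩ := hok
    obtain ⟨s1, r1, k1, e1⟩ := ihr hr d s hs
    obtain ⟨s2, r2, k2, e2⟩ := ihc hc (d + 1) s1 (k1.rep hs)
    have hs2 := k2.rep (k1.rep hs)
    obtain ⟨s3, r3, k3, e3⟩ := run_addrProg h hs2.width hs2.base
      ((k2.tr (Nat.lt_succ_self d)).trans e1) e2 hrL hcW (sl := 2 * j) (by omega)
    refine ⟨s3.setReg (tr d) (s3.mem (cx.addr (r.eval σ) (c.eval σ) (2 * j))), ?_, (k1.trans (k2.mono (Nat.le_succ d))).trans <|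
      k3.trans (keeps_setReg _ le_rfl), ?_⟩
    · have : (Exp.rd j r c).cost = r.cost + (c.cost + (7 + 1)) := by simp; ring
      rw [this]
      exact .seq r1 <| .seq r2 <| .seq r3 <| .load _ _ _ _ (cx.addr_lt h hrL hcW (by omega)) e3
    · rw [setReg_self, (k3.rep hs2).a j hj _ hrL _ hcW]; rfl
  | inp e ih =>
    intro hok d s hs
    obtain ⟨he, hb, h0⟩ := hok
    obtain ⟨s1, r1, k1, e1⟩ := ih he d s hs
    refine ⟨_, .seq r1 (.load _ _ _ _ ?_ e1), k1.trans (keeps_setReg _ le_rfl), ?_⟩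
    · have := h.space; omega
    · rw [setReg_self, (k1.rep hs).inp _ hb]
      exact (Int.toNat_of_nonneg h0).symm

theorem ZExp.run_comp {cx : Ctx} (h : cx.Valid) {σ : St} : ∀ (e : ZExp), e.ok cx σ → ∀ (d : ℕ)
    (s : State), Rep cx s σ → ∃ s', Run cx.w cx.S (e.comp d) s e.cost s' ∧ Keeps d s s' ∧
      s'.reg (tr d) = e.eval σ := by
  intro e
  induction e with
  | rd j r =>
    intro hok d s hs
    obtain ⟨hr, hj, hrL⟩ := hok
    obtain ⟨s1, r1, k1, e1⟩ := r.run_comp h hr d s hs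
    have k2 : Keeps (d + 1) s1 (s1.setReg (tr (d + 1)) ((0 : ℕ) : ℤ)) := keeps_setReg _ le_rfl
    have hs2 := k2.rep (k1.rep hs)
    have hW : 0 < cx.Wd := h.width (by omega)
    obtain ⟨s3, r3, k3, e3⟩ := run_addrProg h hs2.width hs2.base
      ((k2.tr (Nat.lt_succ_self d)).trans e1) (setReg_self _ _ _) hrL hW (sl := 2 * j + 1)
      (by omega)
    refine ⟨s3.setReg (tr d) (s3.mem (cx.addr (r.eval σ) 0 (2 * j + 1))), ?_, (k1.trans (k2.mono (Nat.le_succ d))).trans <|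
      k3.trans (keeps_setReg _ le_rfl), ?_⟩
    · have : (ZExp.rd j r).cost = r.cost + (1 + (7 + 1)) := by simp
      rw [this]
      exact .seq r1 <|
        .seq (.const _ _ ((0 : ℕ) : ℤ) (h.isWord (by have := h.forty; omega))) <| .seq r3 <|
        .load _ _ _ _ (cx.addr_lt h hrL hW (by omega)) e3
    · rw [setReg_self, (k3.rep hs2).z j hj _ hrL]; rfl
  | inp e =>
    intro hok d s hs
    obtain ⟨he, hb⟩ := hok
    obtain ⟨s1, r1, k1, e1⟩ := e.run_comp h he d s hs
    refine ⟨_, .seq r1 (.load _ _ _ _ ?_ e1), k1.trans (keeps_setReg _ le_rfl), ?_⟩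
    · have := h.space; omega
    · rw [setReg_self, (k1.rep hs).inp _ hb]; rfl
  | add a b iha ihb =>
    intro hok d s hs
    obtain ⟨s1, r1, k1, e1⟩ := iha hok.1 d s hs
    obtain ⟨s2, r2, k2, e2⟩ := ihb hok.2.1 (d + 1) s1 (k1.rep hs)
    have e3 : s2.reg (tr d) = a.eval σ := by rw [k2.tr (Nat.lt_succ_self d), e1]
    refine ⟨s2.setReg (tr d) (ArithOp.add.eval (s2.reg (tr d)) (s2.reg (tr (d + 1)))), ?_, ?_, ?_⟩
    · rw [ZExp.cost, add_assoc]
      refine .seq r1 (.seq r2 (.arith _ _ _ _ _ ?_))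
      rw [e2, e3]
      exact hok.2.2
    · exact (k1.trans (k2.mono (Nat.le_succ d))).trans (keeps_setReg _ le_rfl)
    · rw [setReg_self, e2, e3]; rfl

theorem Tst.run_comp {cx : Ctx} (h : cx.Valid) {σ : St} (t : Tst) (hok : t.ok cx σ) {s : State}
    (hs : Rep cx s σ) : ∃ s', Run cx.w cx.S t.comp s t.cost s' ∧ Rep cx s' σ ∧
      (t.toTest.Holds s' ↔ t.holds σ) := by
  cases t with
  | lt a b | le a b | eq a b =>
    obtain ⟨s1, r1, k1, e1⟩ := a.run_comp h hok.1 0 s hs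
    obtain ⟨s2, r2, k2, e2⟩ := b.run_comp h hok.2 1 s1 (k1.rep hs)
    refine ⟨_, .seq r1 r2, k2.rep (k1.rep hs), ?_⟩
    simp [Tst.toTest, Test.Holds, e2, k2.tr zero_lt_one, e1]
  | zlt a b | zeq a b =>
    obtain ⟨s1, r1, k1, e1⟩ := a.run_comp h hok.1 0 s hs
    obtain ⟨s2, r2, k2, e2⟩ := b.run_comp h hok.2 1 s1 (k1.rep hs)
    refine ⟨_, .seq r1 r2, k2.rep (k1.rep hs), ?_⟩
    simp [Tst.toTest, Test.Holds, e2, k2.tr zero_lt_one, e1]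

/-! ### Assignments and loops. -/

theorem Rep.setv {cx : Ctx} {s : State} {σ : St} (hs : Rep cx s σ) (x n : ℕ) :
    Rep cx (s.setReg (2 * x) n) (σ.setv x n) := by
  refine ⟨fun y => ?_, ?_, ?_, hs.a, hs.z, hs.inp⟩
  · by_cases hy : y = x
    · simp [hy, State.setReg]
    · simp [hy, State.setReg, Function.update, hs.v]
  · have : 1 ≠ 2 * x := by omega
    simp [State.setReg, Function.update, this, hs.base]
  · have : 3 ≠ 2 * x := by omega
    simp [State.setReg, Function.update, this, hs.width]

/-- Addresses are injective, the parity of the slot separates natural-number arrays from integer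
arrays, and the input lies below the base. -/
theorem Rep.seta {cx : Ctx} {s : State} {σ : St} (hs : Rep cx s σ) (n : ℕ) {j r c : ℕ}
    (hj : j < 20) (hc : c < cx.Wd) :
    Rep cx (s.setMem (cx.addr r c (2 * j)) n) (σ.seta j r c n) := by
  refine ⟨hs.v, hs.base, hs.width, fun j' hj' r' hr' c' hc' => ?_, fun j' hj' r' hr' => ?_,
    fun i hi => ?_⟩
  · by_cases he : j' = j ∧ r' = r ∧ c' = c
    · obtain ⟨rfl, rfl, rfl⟩ := he
      simp [State.setMem]
    · have : cx.addr r' c' (2 * j') ≠ cx.addr r c (2 * j) := fun e => he (by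
        obtain ⟨h1, h2, h3⟩ := Ctx.addr_inj hc' (by omega) hc (by omega) e
        exact ⟨by omega, h1, h2⟩)
      simp [State.setMem, Function.update, this, he, hs.a j' hj' r' hr' c' hc']
  · have : cx.addr r' 0 (2 * j' + 1) ≠ cx.addr r c (2 * j) := fun e => by
      have := (Ctx.addr_inj (by omega) (by omega) hc (by omega) e).2.2
      omega
    simp [State.setMem, Function.update, this, hs.z j' hj' r' hr']
  · have : i ≠ cx.addr r c (2 * j) := by unfold Ctx.addr; omega
    simp [State.setMem, Function.update, this, hs.inp i hi]

theorem Rep.setz {cx : Ctx} {s : State} {σ : St} (hs : Rep cx s σ) (n : ℤ) {j r : ℕ}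
    (hj : j < 20) (hW : 0 < cx.Wd) :
    Rep cx (s.setMem (cx.addr r 0 (2 * j + 1)) n) (σ.setz j r n) := by
  refine ⟨hs.v, hs.base, hs.width, fun j' hj' r' hr' c' hc' => ?_, fun j' hj' r' hr' => ?_,
    fun i hi => ?_⟩
  · have : cx.addr r' c' (2 * j') ≠ cx.addr r 0 (2 * j + 1) := fun e => by
      have := (Ctx.addr_inj hc' (by omega) hW (by omega) e).2.2
      omega
    simp [State.setMem, Function.update, this, hs.a j' hj' r' hr' c' hc']
  · by_cases he : j' = j ∧ r' = r
    · obtain ⟨rfl, rfl⟩ := he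
      simp [State.setMem]
    · have : cx.addr r' 0 (2 * j' + 1) ≠ cx.addr r 0 (2 * j + 1) := fun e => he (by
        obtain ⟨h1, h2, h3⟩ := Ctx.addr_inj hW (by omega) hW (by omega) e
        exact ⟨by omega, h1⟩)
      simp [State.setMem, Function.update, this, he, hs.z j' hj' r' hr']
  · have : i ≠ cx.addr r 0 (2 * j + 1) := by unfold Ctx.addr; omega
    simp [State.setMem, Function.update, this, hs.inp i hi]

/-- Induction on the number `k` of remaining iterations. The correctness of the body is a
hypothesis, so that the lemma can be used inside the induction over commands. -/
theorem Cmd.run_for {cx : Ctx} (h : cx.Valid) {x n : ℕ} {p : Cmd} {σ : St} {I : ℕ → St → Prop}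
    (hn : σ.v n = cx.rho n) (hnW : cx.rho n < cx.W) (hx : x ∉ p.mv) (hnm : n ∉ x :: p.mv)
    (hp : ∀ i < cx.rho n, ∀ τ, Agree (for_ x n p) σ τ → τ.v x = i → I i τ → ∀ s, Rep cx s τ →
      ∃ s' τ' t, Run cx.w cx.S p.comp s t s' ∧ t ≤ p.tm cx.rho ∧ Rep cx s' τ' ∧ Agree p τ τ' ∧
        I (i + 1) (τ'.setv x (i + 1))) :
    ∀ k i, i + k = cx.rho n → ∀ τ, Agree (for_ x n p) σ τ → τ.v x = i → I i τ →
      ∀ s, Rep cx s τ → ∃ s' τ' t, Run cx.w cx.S (.loop (.lt (2 * x) (2 * n)) <|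
        .seq p.comp <| .seq (.const (tr 0) 1) (.arith .add (2 * x) (2 * x) (tr 0))) s t s' ∧
        t ≤ k * (p.tm cx.rho + 3) + 1 ∧ Rep cx s' τ' ∧ Agree (for_ x n p) σ τ' ∧
        I (cx.rho n) τ' := by
  intro k
  induction k with
  | zero =>
    intro i hi τ hA hxi hI s hs
    refine ⟨s, τ, 1, .loop_false ?_, by omega, hs, hA, ?_⟩
    · simp only [Test.Holds, hs.v, hxi, hA.v n (by simpa using hnm), hn]
      omega
    · rwa [← hi]
  | succ k ih =>
    intro i hi τ hA hxi hI s hs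
    obtain ⟨s1, τ1, t1, r1, ht1, hs1, hA1, hI1⟩ := hp i (by omega) τ hA hxi hI s hs
    have hA2 : Agree (for_ x n p) σ (τ1.setv x (i + 1)) :=
      (hA.trans (hA1.mono (by simp) (by simp) (by simp))).setv_for
    have k2 : Keeps 0 s1 (s1.setReg (tr 0) ((1 : ℕ) : ℤ)) := keeps_setReg _ le_rfl
    have hs2 := k2.rep hs1
    have hx1 : τ1.v x = i := by rw [hA1.v x hx, hxi]
    obtain ⟨s', τ', t', r', ht', hs', hA', hI'⟩ := ih (i + 1) (by omega) _ hA2 (by simp) hI1 _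
      (hs2.setv x (i + 1))
    refine ⟨s', τ', t1 + (1 + 1) + t' + 1, .loop_true ?_ (.seq r1 (.seq
      (.const _ _ ((1 : ℕ) : ℤ) (h.isWord (by have := h.forty; omega)))
      (run_arith h .add (n := i + 1) ?_ (by omega)))) r', ?_, hs', hA', hI'⟩
    · simp only [Test.Holds, hs.v, hxi, hA.v n (by simpa using hnm), hn]
      omega
    · have : s1.reg (2 * x) = i := by rw [hs1.v, hx1]
      have n1 : 2 * x ≠ tr 0 := by unfold tr; omega
      simp [ArithOp.eval, State.setReg, Function.update, n1, this]
    · rw [Nat.succ_mul]; omega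

/-- Soundness of the weakest preconditions for the compiled program. -/
theorem Cmd.run_of_wp {cx : Ctx} (h : cx.Valid) (p : Cmd) : ∀ {Q : St → Prop} {σ : St},
    p.wp cx Q σ → ∀ s, Rep cx s σ → ∃ s' τ t, Run cx.w cx.S p.comp s t s' ∧ t ≤ p.tm cx.rho ∧
      Rep cx s' τ ∧ Agree p σ τ ∧ Q τ := by
  -- Strengthening the postcondition by `Agree` with `wp_conseq` supplies the frame condition, so
  -- each case may ignore it.
  have frame : ∀ p : Cmd, (∀ (Q : St → Prop) (σ : St), p.wp cx Q σ → ∀ s, Rep cx s σ →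
      ∃ s' τ t, Run cx.w cx.S p.comp s t s' ∧ t ≤ p.tm cx.rho ∧ Rep cx s' τ ∧ Q τ) →
      ∀ {Q : St → Prop} {σ : St}, p.wp cx Q σ → ∀ s, Rep cx s σ → ∃ s' τ t,
        Run cx.w cx.S p.comp s t s' ∧ t ≤ p.tm cx.rho ∧ Rep cx s' τ ∧ Agree p σ τ ∧ Q τ := by
    intro p hp Q σ hw s hs
    exact hp _ _ (p.wp_conseq (Q' := fun τ => Agree p σ τ ∧ Q τ) hw fun τ h1 h2 => ⟨h1, h2⟩) s hs
  induction p with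
  | skip =>
    intro Q σ
    exact frame .skip (fun Q σ hw s hs => ⟨s, σ, 1, .skip s, le_rfl, hs, hw⟩)
  | asg x e =>
    intro Q σ
    refine frame (.asg x e) (fun Q σ hw s hs => ?_)
    obtain ⟨s1, r1, k1, e1⟩ := e.run_comp h hw.1 0 s hs
    refine ⟨_, _, _, .seq r1 (.move _ _ _), le_rfl, ?_, hw.2⟩
    rw [e1]
    exact (k1.rep hs).setv _ _
  | wr j r c e =>
    intro Q σ
    refine frame (.wr j r c e) (fun Q σ hw s hs => ?_)
    obtain ⟨⟨hr, hc, he, hj, hrL, hcW⟩, hQ⟩ := hw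
    obtain ⟨s1, r1, k1, e1⟩ := e.run_comp h he 0 s hs
    obtain ⟨s2, r2, k2, e2⟩ := r.run_comp h hr 1 s1 (k1.rep hs)
    obtain ⟨s3, r3, k3, e3⟩ := c.run_comp h hc 2 s2 (k2.rep (k1.rep hs))
    have hs3 := k3.rep (k2.rep (k1.rep hs))
    obtain ⟨s4, r4, k4, e4⟩ := run_addrProg h hs3.width hs3.base
      ((k3.tr (by omega)).trans e2) e3 hrL hcW (sl := 2 * j) (by omega)
    refine ⟨_, _, _, .seq r1 <| .seq r2 <| .seq r3 <| .seq r4 <|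
      .store _ _ _ _ (cx.addr_lt h hrL hcW (by omega)) e4, ?_, ?_, hQ⟩
    · simp only [tm]; omega
    · rw [k4.tr zero_lt_one, k3.tr (by omega), k2.tr zero_lt_one, e1]
      exact (k4.rep hs3).seta _ hj hcW
  | wz j r e =>
    intro Q σ
    refine frame (.wz j r e) (fun Q σ hw s hs => ?_)
    obtain ⟨⟨hr, he, hj, hrL⟩, hQ⟩ := hw
    have hW : 0 < cx.Wd := h.width (by omega)
    obtain ⟨s1, r1, k1, e1⟩ := e.run_comp h he 0 s hs
    obtain ⟨s2, r2, k2, e2⟩ := r.run_comp h hr 1 s1 (k1.rep hs)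
    have k3 : Keeps 2 s2 (s2.setReg (tr 2) ((0 : ℕ) : ℤ)) := keeps_setReg _ le_rfl
    have hs3 := k3.rep (k2.rep (k1.rep hs))
    obtain ⟨s4, r4, k4, e4⟩ := run_addrProg h hs3.width hs3.base
      ((k3.tr (by omega)).trans e2) (setReg_self _ _ _) hrL hW (sl := 2 * j + 1) (by omega)
    refine ⟨_, _, _, .seq r1 <| .seq r2 <|
      .seq (.const _ _ ((0 : ℕ) : ℤ) (h.isWord (by have := h.forty; omega))) <| .seq r4 <|
      .store _ _ _ _ (cx.addr_lt h hrL hW (by omega)) e4, ?_, ?_, hQ⟩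
    · simp only [tm]; omega
    · rw [k4.tr zero_lt_one, k3.tr (by omega), k2.tr zero_lt_one, e1]
      exact (k4.rep hs3).setz _ hj hW
  | seq p q ihp ihq =>
    intro Q σ
    refine frame (.seq p q) (fun Q σ hw s hs => ?_)
    obtain ⟨s1, τ1, t1, r1, ht1, hs1, -, hQ1⟩ := ihp hw s hs
    obtain ⟨s2, τ2, t2, r2, ht2, hs2, -, hQ2⟩ := ihq hQ1 s1 hs1
    exact ⟨s2, τ2, _, .seq r1 r2, Nat.add_le_add ht1 ht2, hs2, hQ2⟩
  | ite t p q ihp ihq =>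
    intro Q σ
    refine frame (.ite t p q) (fun Q σ hw s hs => ?_)
    obtain ⟨s0, r0, hs0, ht⟩ := t.run_comp h hw.1 hs
    by_cases hc : t.holds σ
    · obtain ⟨s1, τ1, t1, r1, ht1, hs1, -, hQ1⟩ := ihp (hw.2.1 hc) s0 hs0
      exact ⟨s1, τ1, _, .seq r0 (.branch_true (ht.2 hc) r1), by simp only [tm]; omega, hs1, hQ1⟩
    · obtain ⟨s1, τ1, t1, r1, ht1, hs1, -, hQ1⟩ := ihq (hw.2.2 hc) s0 hs0
      exact ⟨s1, τ1, _, .seq r0 (.branch_false (fun h' => hc (ht.1 h')) r1),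
        by simp only [tm]; omega, hs1, hQ1⟩
  | for_ x n p ih =>
    intro Q σ
    refine frame (.for_ x n p) (fun Q σ hw s hs => ?_)
    obtain ⟨⟨hn, hnW, hx, hnm⟩, I, hI0, hI, hQ⟩ := hw
    obtain ⟨s', τ', t, r, ht, hs', hA', hI'⟩ := Cmd.run_for h (I := I) hn hnW hx hnm
      (fun i hi τ hA hxi hIi s hs => ih (hI i hi τ hA hxi hIi) s hs) (cx.rho n) 0 (by omega) _
      (Agree.refl _ σ).setv_for (by simp) hI0 _ (hs.setv x 0)
    exact ⟨s', τ', _, .seq (.const _ _ _ (h.isWord (n := 0) (by have := h.forty; omega))) r,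
      by simp only [tm]; omega, hs', hQ τ' hA' hI'⟩

/-- Programs without stores. -/
def Prog.StoreFree : Prog → Prop
  | .store _ _ => False
  | .seq p q => p.StoreFree ∧ q.StoreFree
  | .branch _ p q => p.StoreFree ∧ q.StoreFree
  | .loop _ p => p.StoreFree
  | _ => True

/-- Used twice: a query leaves the data structure unchanged, and the computation of the constants
does not touch the input. -/
theorem Run.mem_eq {w S : ℕ} {p : Prog} {s s' : State} {t : ℕ} (h : Run w S p s t s')
    (hp : p.StoreFree) : s'.mem = s.mem := by
  induction h with
  | skip | const | move | arith | load => rfl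
  | store => exact hp.elim
  | seq _ _ ih1 ih2 => rw [ih2 hp.2, ih1 hp.1]
  | branch_true _ _ ih => exact ih hp.1
  | branch_false _ _ ih => exact ih hp.2
  | loop_true _ _ _ ih1 ih2 => rw [ih2 hp, ih1 hp]
  | loop_false => rfl

theorem Exp.storeFree_comp (e : Exp) : ∀ d, (e.comp d).StoreFree := by
  induction e <;> simp_all [Exp.comp, Prog.StoreFree, addrProg]

theorem ZExp.storeFree_comp (e : ZExp) : ∀ d, (e.comp d).StoreFree := by
  induction e <;> simp_all [ZExp.comp, Prog.StoreFree, addrProg, Exp.storeFree_comp]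

theorem Cmd.storeFree_comp (p : Cmd) (ha : p.ma = []) (hz : p.mz = []) : p.comp.StoreFree := by
  induction p with
  | ite t p q ihp ihq =>
    cases t <;> simp_all [Cmd.comp, Prog.StoreFree, Tst.comp, Exp.storeFree_comp,
      ZExp.storeFree_comp]
  | _ => simp_all [Cmd.comp, Prog.StoreFree, Exp.storeFree_comp]

end HIA

namespace HIA

/-! ### Trees on an initial segment of the natural numbers in preorder -/

/-- `a` is an ancestor of `t` for the parent function `par`. -/
def Anc (par : ℕ → ℕ) (a t : ℕ) : Prop := ∃ k : ℕ, par^[k] t = a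

theorem Anc.refl (par : ℕ → ℕ) (t : ℕ) : Anc par t t := ⟨0, rfl⟩

theorem Anc.trans {par : ℕ → ℕ} {a b c : ℕ} (h : Anc par a b) (h' : Anc par b c) :
    Anc par a c := by
  obtain ⟨i, rfl⟩ := h
  obtain ⟨j, rfl⟩ := h'
  exact ⟨i + j, by rw [Function.iterate_add_apply]⟩

theorem anc_par (par : ℕ → ℕ) (t : ℕ) : Anc par (par t) t := ⟨1, rfl⟩

theorem Anc.of_ne {par : ℕ → ℕ} {a t : ℕ} (h : Anc par a t) (hne : a ≠ t) : Anc par a (par t) := by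
  obtain ⟨k, hk⟩ := h
  cases k with
  | zero => exact absurd hk.symm hne
  | succ k => exact ⟨k, by rw [← hk, Function.iterate_succ_apply]⟩

/-- `par` is the parent function of a tree with root `0` whose nodes are numbered in preorder. -/
structure Preorderly (par : ℕ → ℕ) : Prop where
  zero : par 0 = 0
  -- In preorder the next node is a child of the current node or of one of its ancestors.
  succ : ∀ t, Anc par (par (t + 1)) t

namespace Preorderly

theorem par_le {par : ℕ → ℕ} (h : Preorderly par) (t : ℕ) : par t ≤ t := by
  induction t using Nat.strong_induction_on with
  | _ t ih =>
    cases t with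
    | zero => exact h.zero.le
    | succ t =>
      obtain ⟨k, hk⟩ := h.succ t
      have key : ∀ k, par^[k] t ≤ t := by
        intro k
        induction k with
        | zero => exact le_rfl
        | succ k ihk =>
          rw [Function.iterate_succ_apply']
          exact (ih _ (by omega)).trans ihk
      exact (hk ▸ key k).trans (Nat.le_succ t)

theorem anc_le {par : ℕ → ℕ} (h : Preorderly par) {a t : ℕ} (ha : Anc par a t) : a ≤ t := by
  obtain ⟨k, rfl⟩ := ha
  induction k with
  | zero => exact le_rfl
  | succ k ih =>
    rw [Function.iterate_succ_apply']
    exact (h.par_le _).trans ih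

theorem par_succ_le {par : ℕ → ℕ} (h : Preorderly par) (t : ℕ) : par (t + 1) ≤ t :=
  h.anc_le (h.succ t)

/-- The ancestors of `t` are iterates of `par` and form a chain; `par` never increases numbers, so
the smaller of two is the higher. -/
theorem anc_of_le {par : ℕ → ℕ} (h : Preorderly par) {a b t : ℕ} (ha : Anc par a t)
    (hb : Anc par b t) (hab : a ≤ b) : Anc par a b := by
  obtain ⟨i, rfl⟩ := ha
  obtain ⟨j, rfl⟩ := hb
  rcases le_total j i with hij | hij
  · exact ⟨i - j, by rw [← Function.iterate_add_apply, Nat.sub_add_cancel hij]⟩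
  · have h1 : Anc par (par^[j] t) (par^[i] t) :=
      ⟨j - i, by rw [← Function.iterate_add_apply, Nat.sub_add_cancel hij]⟩
    rw [le_antisymm hab (h.anc_le h1)]
    exact .refl _ _

/-- The descendants of a node form an interval. -/
theorem anc_of_between {par : ℕ → ℕ} (h : Preorderly par) {a p q : ℕ} (ha : Anc par a q)
    (hap : a ≤ p) (hpq : p ≤ q) : Anc par a p := by
  induction q, hpq using Nat.le_induction with
  | base => exact ha
  -- A proper ancestor of `q + 1` is an ancestor of its parent, which is an ancestor of `q`.
  | succ q hq ih => exact ih ((ha.of_ne (by omega)).trans (h.succ q))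

end Preorderly

/-- Minimum of the parents of `p + 1, …, p + d` (and of `p`). -/
def minPar (par : ℕ → ℕ) (p : ℕ) : ℕ → ℕ
  | 0 => p
  | d + 1 => min (minPar par p d) (par (p + d + 1))

/-- The lowest common ancestor of two nodes numbered in preorder. -/
def lc (par : ℕ → ℕ) (p q : ℕ) : ℕ := if p ≤ q then minPar par p (q - p) else minPar par q (p - q)

theorem lc_self (par : ℕ → ℕ) (p : ℕ) : lc par p p = p := by simp [lc, minPar]

theorem lc_comm (par : ℕ → ℕ) (p q : ℕ) : lc par p q = lc par q p := by
  unfold lc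
  rcases lt_trichotomy p q with h | rfl | h
  · rw [if_pos h.le, if_neg (by omega)]
  · rfl
  · rw [if_neg (by omega), if_pos h.le]

theorem lc_succ (par : ℕ → ℕ) {p q : ℕ} (h : p ≤ q) :
    lc par p (q + 1) = min (lc par p q) (par (q + 1)) := by
  unfold lc
  rw [if_pos (by omega), if_pos h, show q + 1 - p = (q - p) + 1 by omega, minPar,
    show p + (q - p) + 1 = q + 1 by omega]

namespace Preorderly

/-- The recursion of `lc_succ` from the other end. The initial term `p` of the minimum does no harm
because `par (p + 1) ≤ p`. It serves to fill a table in descending order. -/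
theorem lc_pred {par : ℕ → ℕ} (h : Preorderly par) {p q : ℕ} (hpq : p < q) :
    lc par p q = min (lc par (p + 1) q) (par (p + 1)) := by
  induction q, hpq using Nat.le_induction with
  | base =>
    rw [lc_succ _ le_rfl, lc_self, lc_self]
    have := h.par_succ_le p
    omega
  | succ q hq ih =>
    rw [lc_succ _ (by omega), lc_succ _ hq, ih, min_right_comm]

/-- The minimum so far and the parent of `q + 1` are both ancestors of `q`, hence comparable; the
smaller is an ancestor of the other. -/
theorem lc_anc_aux {par : ℕ → ℕ} (h : Preorderly par) {p q : ℕ} (hpq : p ≤ q) :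
    Anc par (lc par p q) p ∧ Anc par (lc par p q) q := by
  induction q, hpq using Nat.le_induction with
  | base => rw [lc_self]; exact ⟨.refl _ _, .refl _ _⟩
  | succ q hq ih =>
    rw [lc_succ _ hq]
    rcases le_total (lc par p q) (par (q + 1)) with hle | hle
    · rw [min_eq_left hle]
      exact ⟨ih.1, (h.anc_of_le ih.2 (h.succ q) hle).trans (anc_par _ _)⟩
    · rw [min_eq_right hle]
      exact ⟨(h.anc_of_le (h.succ q) ih.2 hle).trans ih.1, anc_par _ _⟩

theorem lc_anc_left {par : ℕ → ℕ} (h : Preorderly par) (p q : ℕ) : Anc par (lc par p q) p := by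
  rcases le_total p q with hpq | hpq
  · exact (h.lc_anc_aux hpq).1
  · rw [lc_comm]; exact (h.lc_anc_aux hpq).2

theorem lc_anc_right {par : ℕ → ℕ} (h : Preorderly par) (p q : ℕ) : Anc par (lc par p q) q := by
  rw [lc_comm]; exact h.lc_anc_left q p

/-- A common ancestor `g` of the two ends is an ancestor of all nodes between them, and of the
parents of all those after the first, so it is below every term of the minimum. -/
theorem le_lc {par : ℕ → ℕ} (h : Preorderly par) {g p q : ℕ} (hp : Anc par g p)
    (hq : Anc par g q) : g ≤ lc par p q := by
  have key : ∀ p q, p ≤ q → Anc par g p → Anc par g q → g ≤ lc par p q := by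
    intro p q hpq
    induction q, hpq using Nat.le_induction with
    | base => intro h1 _; rw [lc_self]; exact h.anc_le h1
    | succ q hq ih =>
      intro h1 h2
      have hg := h.anc_le h1
      rw [lc_succ _ hq]
      exact le_min (ih h1 (h.anc_of_between h2 (by omega) (by omega)))
        (h.anc_le (h2.of_ne (by omega)))
  rcases le_total p q with hpq | hpq
  · exact key p q hpq hp hq
  · rw [lc_comm]; exact key q p hpq hq hp

/-- The higher of `lc u c` and `lc x c` is a common ancestor of `u` and `x`. -/
theorem anc_of_lc_le {par : ℕ → ℕ} (h : Preorderly par) {u x c : ℕ}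
    (hle : lc par u c ≤ lc par x c) : Anc par (lc par u c) u ∧ Anc par (lc par u c) x :=
  ⟨h.lc_anc_left u c,
    (h.anc_of_le (h.lc_anc_right u c) (h.lc_anc_right x c) hle).trans (h.lc_anc_left x c)⟩

/-- A common ancestor of `u` and `x` is an ancestor of every `c` between them, since descendants
form an interval. Conversely `anc_of_lc_le` makes the smaller term a common ancestor. -/
theorem lc_between {par : ℕ → ℕ} (h : Preorderly par) {u x c : ℕ}
    (hc : u ≤ c ∧ c ≤ x ∨ x ≤ c ∧ c ≤ u) : lc par u x = min (lc par u c) (lc par x c) := by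
  apply le_antisymm
  · have h1 := h.lc_anc_left u x
    have h2 := h.lc_anc_right u x
    have hac : Anc par (lc par u x) c := by
      rcases hc with hc | hc
      · exact h.anc_of_between h2 ((h.anc_le h1).trans hc.1) hc.2
      · exact h.anc_of_between h1 ((h.anc_le h2).trans hc.1) hc.2
    exact le_min (h.le_lc h1 hac) (h.le_lc h2 hac)
  · rcases le_total (lc par u c) (lc par x c) with hle | hle
    · rw [min_eq_left hle]
      exact h.le_lc (h.anc_of_lc_le hle).1 (h.anc_of_lc_le hle).2
    · rw [min_eq_right hle]
      exact h.le_lc (h.anc_of_lc_le hle).2 (h.anc_of_lc_le hle).1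

end Preorderly

/-! ### Keys -/

/-- The separator with index `j` of node `u`: the multiple `(j % B) * B ^ e` of `B ^ e`,
`e = j / B`, counted from the start of the block of length `B ^ (e + 1)` that contains `u`. -/
def sepr (B u j : ℕ) : ℕ := u / B ^ (j / B + 1) * B ^ (j / B + 1) + j % B * B ^ (j / B)

/-- A key: separator, type, level and a number at that level. -/
def packKey (k B c typ f m : ℕ) : ℕ := ((c * 3 + typ) * k + f) * B ^ (k + 1) + m

/-- The number at level `j2 / B` of the insertion entry for the ancestor `a`. -/
def insNum (B a j2 : ℕ) : ℕ := a / B ^ (j2 / B + 1) * B + j2 % B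

/-- The position of `a` relative to the block of length `P = B ^ (j2 / B)` with number `m = insNum B
a j2`: type 1 if `a` is at most all of its elements, type 0 if `a` lies after it, type 2 if `a` lies
inside but past the start. Type 2 is never asked for. -/
def insTyp (B a j2 : ℕ) : ℕ :=
  if a ≤ insNum B a j2 * B ^ (j2 / B) then 1
  else if (insNum B a j2 + 1) * B ^ (j2 / B) ≤ a then 0 else 2

/-- Key of the entry `j` that is inserted for the node `x`. -/
def insKey (k B : ℕ) (par : ℕ → ℕ) (x j : ℕ) : ℕ :=
  packKey k B (sepr B x (j / (k * B)))
    (insTyp B (lc par x (sepr B x (j / (k * B)))) (j % (k * B))) (j % (k * B) / B)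
    (insNum B (lc par x (sepr B x (j / (k * B)))) (j % (k * B)))

/-- Node of the entry `j` that is inserted for the node `x`. -/
def insNode (k B : ℕ) (par : ℕ → ℕ) (x j : ℕ) : ℕ :=
  if insTyp B (lc par x (sepr B x (j / (k * B)))) (j % (k * B)) = 1 then
    lc par x (sepr B x (j / (k * B))) else 0

/-- Index of the separator that is used by the query entries with index `j1` of `u`. -/
def qrySep (B u j1 : ℕ) : ℕ :=
  -- Two separators for the level `j1 / 2`: the start of the block of `u`, and the start of the next
  -- block if that belongs to the same block of the level above. Otherwise the first one is
  -- repeated.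
  j1 / 2 * B + (if j1 % 2 = 1 ∧ u / B ^ (j1 / 2) % B + 1 < B then u / B ^ (j1 / 2) % B + 1
    else u / B ^ (j1 / 2) % B)

/-- The index encodes the separator in `j / (2 * k)` and level and type in quotient and remainder of
`j % (2 * k)` by 2. The number is that of the block containing the query's own ancestor. -/
def qryKey (k B : ℕ) (par : ℕ → ℕ) (u j : ℕ) : ℕ :=
  packKey k B (sepr B u (qrySep B u (j / (2 * k)))) (j % (2 * k) % 2) (j % (2 * k) / 2)
    (lc par u (sepr B u (qrySep B u (j / (2 * k)))) / B ^ (j % (2 * k) / 2))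

/-- For type 0 the query's own ancestor is the higher one, for type 1 the stored one is. The side
that does not supply the node contributes `0`, so the common ancestor is always the sum of `insNode`
and `qryNode`. -/
def qryNode (k B : ℕ) (par : ℕ → ℕ) (u j : ℕ) : ℕ :=
  if j % (2 * k) % 2 = 0 then lc par u (sepr B u (qrySep B u (j / (2 * k)))) else 0

/-! ### Injectivity and size of keys; existence of separators and separating digits. -/

theorem pair_inj {M a b a' b' : ℕ} (hb : b < M) (hb' : b' < M) (h : a * M + b = a' * M + b') :
    a = a' ∧ b = b' := by
  have hM : 0 < M := by omega
  have h1 : a = a' := by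
    have e1 := congrArg (· / M) h
    simpa [Nat.add_comm, Nat.add_mul_div_right _ _ hM, Nat.div_eq_of_lt hb,
      Nat.div_eq_of_lt hb'] using e1
  subst h1
  exact ⟨rfl, by omega⟩

theorem packKey_inj {k B c typ f m c' typ' f' m' : ℕ} (ht : typ < 3) (ht' : typ' < 3)
    (hf : f < k) (hf' : f' < k) (hm : m < B ^ (k + 1)) (hm' : m' < B ^ (k + 1))
    (h : packKey k B c typ f m = packKey k B c' typ' f' m') :
    c = c' ∧ typ = typ' ∧ f = f' ∧ m = m' := by
  obtain ⟨h1, h2⟩ := pair_inj hm hm' h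
  obtain ⟨h3, h4⟩ := pair_inj hf hf' h1
  exact ⟨by omega, by omega, h4, h2⟩

theorem insTyp_lt (B a j2 : ℕ) : insTyp B a j2 < 3 := by
  unfold insTyp; split_ifs <;> omega

theorem two_mul_pow_le {k B : ℕ} (hB : 2 ≤ B) : 2 * B ^ k ≤ B ^ (k + 1) := by
  rw [pow_succ, mul_comm]; exact Nat.mul_le_mul_left _ hB

theorem le_pow_of_pos {k B : ℕ} (hk : 0 < k) : B ≤ B ^ k :=
  Nat.le_self_pow hk.ne' B

theorem insNum_lt {k B a j2 : ℕ} (hk : 0 < k) (hB : 2 ≤ B) (ha : a < B ^ k) :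
    insNum B a j2 < B ^ (k + 1) := by
  have h1 : a / B ^ (j2 / B + 1) * B ≤ a :=
    (Nat.mul_le_mul_left _ (le_pow_of_pos (Nat.succ_pos _))).trans (Nat.div_mul_le_self _ _)
  have h2 : j2 % B < B := Nat.mod_lt _ (by omega)
  have h3 := two_mul_pow_le (k := k) hB
  have h4 := le_pow_of_pos (B := B) hk
  unfold insNum
  omega

theorem sepr_le {k B u j : ℕ} (hB : 2 ≤ B) (hu : u < B ^ k) (hj : j < k * B) :
    sepr B u j < 2 * B ^ k := by
  have h1 : u / B ^ (j / B + 1) * B ^ (j / B + 1) ≤ u := Nat.div_mul_le_self _ _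
  have h2 : j % B * B ^ (j / B) ≤ B ^ (j / B + 1) := by
    rw [pow_succ, mul_comm]
    exact Nat.mul_le_mul_left _ (Nat.mod_lt _ (by omega)).le
  have h3 : B ^ (j / B + 1) ≤ B ^ k :=
    Nat.pow_le_pow_right (by omega) (Nat.div_lt_of_lt_mul (by rwa [mul_comm]))
  unfold sepr
  omega

theorem packKey_lt {k B c typ f m : ℕ} (hB : 2 ≤ B) (hc : c < 2 * B ^ k) (ht : typ < 3)
    (hf : f < k) (hm : m < B ^ (k + 1)) :
    packKey k B c typ f m < 16 * k * B ^ k * B ^ (k + 1) := by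
  have hp : 0 < B ^ k := Nat.pow_pos (by omega)
  have h1 : (c * 3 + typ) * k + f + 1 ≤ (c * 3 + 3) * k := by
    have : (c * 3 + typ + 1) * k ≤ (c * 3 + 3) * k := Nat.mul_le_mul_right _ (by omega)
    rw [Nat.succ_mul] at this
    omega
  -- The factor 16 is generous, 6 would do; it is slack for the overflow checks and a power of two
  -- for the depth of the trie.
  have h2 : (c * 3 + 3) * k ≤ 16 * k * B ^ k := by
    have : (c * 3 + 3) * k ≤ (16 * B ^ k) * k := Nat.mul_le_mul_right _ (by omega)
    linarith
  have h3 : ((c * 3 + typ) * k + f + 1) * B ^ (k + 1) ≤ 16 * k * B ^ k * B ^ (k + 1) :=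
    Nat.mul_le_mul_right _ (h1.trans h2)
  rw [Nat.succ_mul] at h3
  unfold packKey
  omega

theorem qrySep_lt {k B u j1 : ℕ} (hB : 2 ≤ B) (hj : j1 < 2 * k) : qrySep B u j1 < k * B := by
  have h1 : (j1 / 2 + 1) * B ≤ k * B := Nat.mul_le_mul_right _ (by omega)
  rw [Nat.succ_mul] at h1
  have h2 := Nat.mod_lt (u / B ^ (j1 / 2)) (show 0 < B by omega)
  unfold qrySep
  split_ifs <;> omega

/-- The first level at which the blocks of two different numbers differ. -/
theorem exists_level {k B a b : ℕ} (ha : a < B ^ k) (hb : b < B ^ k) (hab : a < b) :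
    ∃ e < k, a / B ^ (e + 1) = b / B ^ (e + 1) ∧ a / B ^ e < b / B ^ e := by
  have hex : ∃ e, a / B ^ e = b / B ^ e := ⟨k, by rw [Nat.div_eq_of_lt ha, Nat.div_eq_of_lt hb]⟩
  classical
  -- Blocks of level 0 are single numbers, so equality at level 0 would mean `a = b`.
  have h0 : Nat.find hex ≠ 0 := fun h => by
    have := Nat.find_spec hex
    rw [h] at this
    simp at this
    omega
  obtain ⟨e, he⟩ := Nat.exists_eq_succ_of_ne_zero h0
  have h1 := Nat.find_spec hex
  have h2 : ¬ a / B ^ e = b / B ^ e := Nat.find_min hex (by omega)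
  have h3 : Nat.find hex ≤ k := Nat.find_min' hex
    (by rw [Nat.div_eq_of_lt ha, Nat.div_eq_of_lt hb])
  refine ⟨e, by omega, by rw [he] at h1; exact h1, ?_⟩
  have := Nat.div_le_div_right (c := B ^ e) hab.le
  omega

theorem div_pow_succ (B a e : ℕ) : a / B ^ (e + 1) = a / B ^ e / B := by
  rw [pow_succ, Nat.div_div_eq_div_mul]

theorem div_pow_eq (B a e : ℕ) : a / B ^ e = a / B ^ (e + 1) * B + a / B ^ e % B := by
  rw [div_pow_succ]; exact (Nat.div_add_mod' _ _).symm

theorem encode_div {B e i : ℕ} (hi : i < B) : (e * B + i) / B = e ∧ (e * B + i) % B = i := by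
  have hB : 0 < B := by omega
  constructor
  · rw [Nat.add_comm, Nat.add_mul_div_right _ _ hB, Nat.div_eq_of_lt hi, Nat.zero_add]
  · rw [Nat.add_comm, Nat.add_mul_mod_self_right, Nat.mod_eq_of_lt hi]

theorem encode_lt {B k e i : ℕ} (he : e < k) (hi : i < B) : e * B + i < k * B := by
  have : (e + 1) * B ≤ k * B := Nat.mul_le_mul_right _ he
  rw [Nat.succ_mul] at this
  omega

/-- There is a common separator between any two nodes. -/
theorem exists_sepr {k B u x : ℕ} (hk : 0 < k) (hB : 2 ≤ B) (hu : u < B ^ k) (hx : x < B ^ k) :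
    ∃ j1 < 2 * k, ∃ j < k * B, sepr B x j = sepr B u (qrySep B u j1) ∧
      (u ≤ sepr B x j ∧ sepr B x j ≤ x ∨ x ≤ sepr B x j ∧ sepr B x j ≤ u) := by
  have hBpos : 0 < B := by omega
  have hmod : ∀ n, n % B < B := fun n => Nat.mod_lt n hBpos
  rcases lt_trichotomy u x with h | rfl | h
  -- At this level the start of the block following that of `u` lies after `u` and at or before `x`.
  -- As `u` and `x` share the enclosing block, the separator has the same index for both.
  · obtain ⟨e, he, h1, h2⟩ := exists_level hu hx h
    have h3 : u / B ^ e % B + 1 ≤ x / B ^ e % B := by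
      have e1 := div_pow_eq B u e
      have e2 := div_pow_eq B x e
      rw [h1] at e1
      omega
    have h4 : u / B ^ e % B + 1 < B := lt_of_le_of_lt h3 (hmod _)
    have hd := encode_div (e := e) h4
    have hq : qrySep B u (e * 2 + 1) = e * B + (u / B ^ e % B + 1) := by
      have e1 : (e * 2 + 1) / 2 = e := by omega
      have e2 : (e * 2 + 1) % 2 = 1 := by omega
      unfold qrySep
      rw [e1, e2, if_pos ⟨rfl, h4⟩]
    have hs : sepr B x (e * B + (u / B ^ e % B + 1)) = (u / B ^ e + 1) * B ^ e := by
      unfold sepr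
      rw [hd.1, hd.2, ← h1]
      conv_rhs => rw [div_pow_eq B u e]
      rw [pow_succ]
      ring
    have hs' : sepr B u (e * B + (u / B ^ e % B + 1)) = (u / B ^ e + 1) * B ^ e := by
      rw [← hs]
      unfold sepr
      rw [hd.1, h1]
    refine ⟨e * 2 + 1, by omega, _, encode_lt he h4, by rw [hq, hs, hs'], .inl ?_⟩
    rw [hs]
    constructor
    · have := Nat.lt_div_mul_add (a := u) (Nat.pow_pos (n := e) hBpos)
      rw [Nat.succ_mul]
      omega
    · exact (Nat.mul_le_mul_right _ h2).trans (Nat.div_mul_le_self _ _)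
  -- For equal nodes the separator of level 0 at the last digit is the node itself.
  · have hd := encode_div (e := 0) (hmod u)
    have hs : sepr B u (0 * B + u % B) = u := by
      unfold sepr
      rw [hd.1, hd.2]
      simpa using Nat.div_add_mod' u B
    refine ⟨0, by omega, _, encode_lt hk (hmod u), by simp [qrySep], .inl ?_⟩
    rw [hs]
    exact ⟨le_rfl, le_rfl⟩
  -- Here the start of the block of `u` itself lies after `x` and at or before `u`.
  · obtain ⟨e, he, h1, h2⟩ := exists_level hx hu h
    have hd := encode_div (e := e) (hmod (u / B ^ e))
    have hq : qrySep B u (e * 2) = e * B + u / B ^ e % B := by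
      have e1 : (e * 2) / 2 = e := by omega
      have e2 : (e * 2) % 2 = 0 := by omega
      unfold qrySep
      rw [e1, e2, if_neg (by omega)]
    have hs : sepr B u (e * B + u / B ^ e % B) = u / B ^ e * B ^ e := by
      unfold sepr
      rw [hd.1, hd.2]
      conv_rhs => rw [div_pow_eq B u e]
      rw [pow_succ]
      ring
    have hs' : sepr B x (e * B + u / B ^ e % B) = u / B ^ e * B ^ e := by
      rw [← hs]
      unfold sepr
      rw [hd.1, h1]
    refine ⟨e * 2, by omega, _, encode_lt he (hmod _), by rw [hq, hs, hs'], .inr ?_⟩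
    rw [hs']
    constructor
    · have h3 := Nat.lt_div_mul_add (a := x) (Nat.pow_pos (n := e) hBpos)
      have h4 := Nat.mul_le_mul_right (B ^ e) h2
      rw [Nat.succ_mul] at h4
      omega
    · exact Nat.div_mul_le_self _ _

/-- Some level and digit separate `a` from `al`, with the right type. -/
theorem exists_digit {k B a al : ℕ} (hk : 0 < k) (hB : 2 ≤ B) (ha : a < B ^ k)
    (hal : al < B ^ k) : ∃ j2 < k * B, insNum B a j2 = al / B ^ (j2 / B) ∧
      (a ≤ al ∧ insTyp B a j2 = 1 ∨ al ≤ a ∧ insTyp B a j2 = 0) := by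
  have hBpos : 0 < B := by omega
  have hmod : ∀ n, n % B < B := fun n => Nat.mod_lt n hBpos
  -- If `a` and `al` share the block of level `e + 1`, then the digit of `al` turns `insNum` into
  -- the number of the block of `al` at level `e`.
  have key : ∀ e < k, a / B ^ (e + 1) = al / B ^ (e + 1) →
      ∃ j2 < k * B, j2 / B = e ∧ insNum B a j2 = al / B ^ e := by
    intro e he h1
    have hd := encode_div (e := e) (hmod (al / B ^ e))
    refine ⟨_, encode_lt he (hmod (al / B ^ e)), hd.1, ?_⟩
    unfold insNum
    rw [hd.1, hd.2, h1]
    exact (div_pow_eq B al e).symm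
  rcases lt_trichotomy a al with h | rfl | h
  · obtain ⟨e, he, h1, h2⟩ := exists_level ha hal h
    obtain ⟨j2, hj2, rfl, hn⟩ := key e he h1
    refine ⟨j2, hj2, hn, .inl ⟨h.le, ?_⟩⟩
    unfold insTyp
    rw [hn, if_pos]
    have h3 := Nat.lt_div_mul_add (a := a) (Nat.pow_pos (n := j2 / B) hBpos)
    have h4 := Nat.mul_le_mul_right (B ^ (j2 / B)) h2
    rw [Nat.succ_mul] at h4
    omega
  -- Equality is counted as type 1: at level 0 the block is `{a}` and starts at `a`.
  · obtain ⟨j2, hj2, he, hn⟩ := key 0 hk rfl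
    refine ⟨j2, hj2, by rw [he, hn], .inl ⟨le_rfl, ?_⟩⟩
    unfold insTyp
    rw [hn, he]
    simp
  · obtain ⟨e, he, h1, h2⟩ := exists_level hal ha h
    obtain ⟨j2, hj2, rfl, hn⟩ := key e he h1.symm
    refine ⟨j2, hj2, hn, .inr ⟨h.le, ?_⟩⟩
    have h3 : (al / B ^ (j2 / B) + 1) * B ^ (j2 / B) ≤ a :=
      (Nat.mul_le_mul_right _ h2).trans (Nat.div_mul_le_self _ _)
    have h4 : 0 < B ^ (j2 / B) := Nat.pow_pos hBpos
    unfold insTyp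
    rw [hn, if_neg, if_pos h3]
    rw [Nat.succ_mul] at h3
    omega

/-! ### Matching keys: soundness, completeness, uniformity. -/

namespace Preorderly

theorem lc_lt {par : ℕ → ℕ} (h : Preorderly par) {x c b : ℕ} (hx : x < b) : lc par x c < b :=
  lt_of_le_of_lt (h.anc_le (h.lc_anc_left x c)) hx

theorem insKey_lt {par : ℕ → ℕ} (h : Preorderly par) {k B x j : ℕ} (hk : 0 < k) (hB : 2 ≤ B)
    (hx : x < B ^ k) (hj : j < (k * B) * (k * B)) :
    insKey k B par x j < 16 * k * B ^ k * B ^ (k + 1) :=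
  packKey_lt hB (sepr_le hB hx (Nat.div_lt_of_lt_mul hj)) (insTyp_lt _ _ _)
    (Nat.div_lt_of_lt_mul (by rw [mul_comm]; exact Nat.mod_lt _ (by positivity)))
    (insNum_lt hk hB (h.lc_lt hx))

theorem qryKey_lt {par : ℕ → ℕ} (h : Preorderly par) {k B u j : ℕ} (hB : 2 ≤ B)
    (hu : u < B ^ k) (hj : j < (2 * k) * (2 * k)) :
    qryKey k B par u j < 16 * k * B ^ k * B ^ (k + 1) := by
  have hk : 0 < 2 * k := by
    rcases Nat.eq_zero_or_pos (2 * k) with h0 | h0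
    · rw [h0] at hj; omega
    · exact h0
  have h1 := Nat.mod_lt j hk
  refine packKey_lt hB (sepr_le hB hu (qrySep_lt hB (Nat.div_lt_of_lt_mul hj))) (by omega)
    (by omega) (lt_of_le_of_lt (Nat.div_le_self _ _) (lt_of_lt_of_le (h.lc_lt hu) ?_))
  exact Nat.pow_le_pow_right (by omega) (Nat.le_succ k)

/-- Every component of both keys is below its radix, so `packKey_inj` applies. -/
theorem key_eq {par : ℕ → ℕ} (h : Preorderly par) {k B x u i j : ℕ} (hk : 0 < k) (hB : 2 ≤ B)
    (hx : x < B ^ k) (hu : u < B ^ k) (he : insKey k B par x i = qryKey k B par u j) :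
    sepr B x (i / (k * B)) = sepr B u (qrySep B u (j / (2 * k))) ∧
    insTyp B (lc par x (sepr B x (i / (k * B)))) (i % (k * B)) = j % (2 * k) % 2 ∧
    i % (k * B) / B = j % (2 * k) / 2 ∧
    insNum B (lc par x (sepr B x (i / (k * B)))) (i % (k * B)) =
      lc par u (sepr B u (qrySep B u (j / (2 * k)))) / B ^ (j % (2 * k) / 2) := by
  have h1 := Nat.mod_lt j (show 0 < 2 * k by omega)
  refine packKey_inj (insTyp_lt _ _ _) (by omega)
    (Nat.div_lt_of_lt_mul (by rw [mul_comm]; exact Nat.mod_lt _ (by positivity))) (by omega)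
    (insNum_lt hk hB (h.lc_lt hx))
    (lt_of_le_of_lt (Nat.div_le_self _ _) (lt_of_lt_of_le (h.lc_lt hu) ?_)) he
  exact Nat.pow_le_pow_right (by omega) (Nat.le_succ k)

/-- The node determined by matching entries of `x` and `u` is a common ancestor. -/
theorem key_sound {par : ℕ → ℕ} (h : Preorderly par) {k B x u i j : ℕ} (hk : 0 < k) (hB : 2 ≤ B)
    (hx : x < B ^ k) (hu : u < B ^ k) (he : insKey k B par x i = qryKey k B par u j) :
    Anc par (insNode k B par x i + qryNode k B par u j) x ∧
    Anc par (insNode k B par x i + qryNode k B par u j) u := by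
  obtain ⟨h1, h2, h3, h4⟩ := h.key_eq hk hB hx hu he
  unfold insNode qryNode
  set c := sepr B u (qrySep B u (j / (2 * k)))
  rw [h2]
  rw [h1] at h2 h4 ⊢
  have hB0 : 0 < B ^ (j % (2 * k) / 2) := Nat.pow_pos (by omega)
  unfold insTyp at h2
  rw [h3, h4] at h2
  -- Equal keys place the ancestor of `x` at or after the end of the block of the ancestor of `u`
  -- (type 0), or at or before its start (type 1). Either way it is known which one is higher, and
  -- `anc_of_lc_le` applies even if the separator is not between `u` and `x`.
  rcases Nat.mod_two_eq_zero_or_one (j % (2 * k)) with ht | ht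
  · rw [if_neg (by omega), if_pos ht, Nat.zero_add]
    rw [ht] at h2
    split_ifs at h2 with h5 h6
    have h7 := Nat.lt_div_mul_add (a := lc par u c) hB0
    rw [Nat.succ_mul] at h6
    exact (h.anc_of_lc_le (u := u) (x := x) (c := c) (by omega)).symm
  · rw [if_pos ht, if_neg (by omega), Nat.add_zero]
    rw [ht] at h2
    have h5 : lc par x c ≤ lc par u c / B ^ (j % (2 * k) / 2) * B ^ (j % (2 * k) / 2) := by
      by_contra h5
      rw [if_neg h5] at h2
      split_ifs at h2
      omega
    exact h.anc_of_lc_le (h5.trans (Nat.div_mul_le_self _ _))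

/-- Some entries of `x` and `u` match and determine the lowest common ancestor. -/
theorem key_complete {par : ℕ → ℕ} (h : Preorderly par) {k B x u : ℕ} (hk : 0 < k) (hB : 2 ≤ B)
    (hx : x < B ^ k) (hu : u < B ^ k) : ∃ i < (k * B) * (k * B), ∃ j < (2 * k) * (2 * k),
      insKey k B par x i = qryKey k B par u j ∧
      insNode k B par x i + qryNode k B par u j = lc par u x := by
  obtain ⟨j1, hj1, i1, hi1, hs, hbet⟩ := exists_sepr hk hB hu hx
  obtain ⟨i2, hi2, hn, ht⟩ := exists_digit hk hB (h.lc_lt (c := sepr B x i1) hx)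
    (h.lc_lt (c := sepr B x i1) hu)
  have hf : i2 / B < k := Nat.div_lt_of_lt_mul (by rwa [mul_comm])
  have hT : insTyp B (lc par x (sepr B x i1)) i2 < 2 := by omega
  have hi := encode_div (e := i1) hi2
  have hj2 : i2 / B * 2 + insTyp B (lc par x (sepr B x i1)) i2 < 2 * k := by omega
  have hj := encode_div (e := j1) hj2
  have e1 : (i2 / B * 2 + insTyp B (lc par x (sepr B x i1)) i2) % 2 =
    insTyp B (lc par x (sepr B x i1)) i2 := by omega
  have e2 : (i2 / B * 2 + insTyp B (lc par x (sepr B x i1)) i2) / 2 = i2 / B := by omega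
  refine ⟨_, encode_lt hi1 hi2, _, encode_lt hj1 hj2, ?_, ?_⟩
  · unfold insKey qryKey
    rw [hi.1, hi.2, hj.1, hj.2, e1, e2, ← hs, hn]
  · unfold insNode qryNode
    rw [hi.1, hi.2, hj.1, hj.2, e1, ← hs, h.lc_between hbet]
    rcases ht with ht | ht
    · rw [ht.2, if_pos rfl, if_neg one_ne_zero, min_eq_right ht.1, Nat.add_zero]
    · rw [ht.2, if_neg zero_ne_one, if_pos rfl, min_eq_left ht.1, Nat.zero_add]

/-- Entries with the same key store comparable nodes. -/
theorem key_uniform {par : ℕ → ℕ} (h : Preorderly par) {k B x x' u i i' j r : ℕ} (hk : 0 < k)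
    (hB : 2 ≤ B) (hx : x < B ^ k) (hx' : x' < B ^ k) (hu : u < B ^ k)
    (he : insKey k B par x i = qryKey k B par u j) (he' : insKey k B par x' i' = qryKey k B par u j)
    (hr : r ≠ 0) (hrx' : Anc par r x')
    (hr' : ∀ a, a ≠ 0 → Anc par a x → Anc par r a) :
    (insNode k B par x i = 0 ∧ insNode k B par x' i' = 0) ∨
    (qryNode k B par u j = 0 ∧ (insNode k B par x i ≠ 0 → insNode k B par x' i' ≠ 0)) := by
  obtain ⟨h1, h2, -, -⟩ := h.key_eq hk hB hx hu he
  obtain ⟨h1', h2', -, -⟩ := h.key_eq hk hB hx' hu he'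
  unfold insNode qryNode
  rw [h2, h2', h1, h1']
  -- The dictionary keeps only one pair per key, so an entry `0`, of weight 0, must not displace a
  -- node of negative weight. Type 0 entries all store `0`. For type 1, a nonzero node of `x` forces
  -- the common separator below `r`, and then the node of `x'` is at least `r`.
  rcases Nat.mod_two_eq_zero_or_one (j % (2 * k)) with ht | ht
  · left
    constructor <;> rw [if_neg (by omega)]
  · right
    rw [if_neg (by omega), if_pos ht, if_pos ht]
    refine ⟨rfl, fun hne => ?_⟩
    have h3 := hr' _ hne (h.lc_anc_left _ _)
    have := h.le_lc hrx' (h3.trans (h.lc_anc_right x _))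
    omega

end Preorderly

end HIA

namespace HIA

open Cmd Exp

/-! ### The environment of the main programs

Variables `0`, …, `15` hold constants: `N₁`, `N₂`, `N = N₁ + N₂`, `k`, `B`, `N + 1`, `k + 1`, `k B`,
`(k B) ^ 2`, `4 k ^ 2`, the depth of the trie, a bound for keys, `B ^ (k + 1)`, `2 k`, the width of
the rows. -/

/-- Depth of the trie. -/
def trieDepth (k : ℕ) : ℕ := 6 * k + 10

/-- Bound for keys. -/
def keyBound (k B : ℕ) : ℕ := 16 * k * B ^ k * B ^ (k + 1)

structure Env (cx : Ctx) (N1 N2 k B : ℕ) : Prop where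
  r0 : cx.rho 0 = N1
  r1 : cx.rho 1 = N2
  r2 : cx.rho 2 = N1 + N2
  r3 : cx.rho 3 = k
  r4 : cx.rho 4 = B
  r5 : cx.rho 5 = N1 + N2 + 1
  r6 : cx.rho 6 = k + 1
  r7 : cx.rho 7 = k * B
  r8 : cx.rho 8 = (k * B) * (k * B)
  r9 : cx.rho 9 = (2 * k) * (2 * k)
  r10 : cx.rho 10 = trieDepth k
  r11 : cx.rho 11 = keyBound k B
  r12 : cx.rho 12 = B ^ (k + 1)
  r13 : cx.rho 13 = 2 * k
  hk : 0 < k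
  hB : 2 ≤ B
  hP : N1 + N2 < B ^ k
  hL : N1 + N2 + B + 5 ≤ cx.L
  -- Room for the trie: at most `N1 + N2` matches with `(k * B) ^ 4` keys each, and every key
  -- creates at most `trieDepth k` nodes.
  hLt : (N1 + N2) * ((k * B) * (k * B) * ((k * B) * (k * B))) * trieDepth k + 5 ≤ cx.L
  hWd : (k * B) * (k * B) + (2 * k) * (2 * k) + k + B + 5 ≤ cx.Wd
  hLW : cx.L ≤ cx.W
  hWdW : cx.Wd ≤ cx.W
  hMW : keyBound k B * keyBound k B ≤ cx.W
  hbase : cx.base = 3 * (N1 + N2)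

/-- The constants have their values. -/
def Consts (cx : Ctx) (σ : St) : Prop := ∀ x < 16, σ.v x = cx.rho x

theorem Consts.of_agree {cx : Ctx} {σ τ : St} {p : Cmd} (h : Consts cx σ) (hA : Agree p σ τ)
    (hp : ∀ x < 16, x ∉ p.mv) : Consts cx τ :=
  fun x hx => (hA.v x (hp x hx)).trans (h x hx)

/-! ### Sorting with a tournament tree -/

/-- `m` is an element of `S` with smallest key, or `0` if there is none. -/
def Best (key : ℕ → ℤ) (S : ℕ → Prop) (m : ℕ) : Prop :=
  (m = 0 ∧ ∀ i, ¬ S i) ∨ (S m ∧ ∀ i, S i → key m ≤ key i)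

theorem Best.congr {key : ℕ → ℤ} {S S' : ℕ → Prop} {m : ℕ} (h : Best key S m)
    (hS : ∀ i, S' i ↔ S i) : Best key S' m := by
  rwa [show S' = S from funext fun i => propext (hS i)]

/-- Every node of the tournament tree holds the best element of its block. -/
def TreeOK (key : ℕ → ℤ) (A : Finset ℕ) (B : ℕ) (T : ℕ → ℕ → ℕ) (e : ℕ) : Prop :=
  ∀ j, Best key (fun i => i ∈ A ∧ i / B ^ e = j) (T j e)

/-- Writes `v` (variable 22) at the leaf `x` (variable 21) and recomputes the path to the root. -/
def updCmd (zk tj : ℕ) : Cmd :=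
  wr tj (var 21) (lit 0) (var 22) ;; asg 23 (var 21) ;;
  for_ 24 3 (
    asg 23 (.div (var 23) (var 4)) ;; asg 25 (lit 0) ;;
    for_ 26 4 (
      asg 27 (.rd tj (.add (.mul (var 23) (var 4)) (var 26)) (var 24)) ;;
      ite (.eq (var 27) (lit 0)) skip (
      ite (.eq (var 25) (lit 0)) (asg 25 (var 27)) (
      ite (.zlt (.rd zk (var 27)) (.rd zk (var 25))) (asg 25 (var 27)) skip))) ;;
    wr tj (var 23) (.add (var 24) (lit 1)) (var 25))

/-- Only the blocks containing `x` are affected, one on each level. Recomputing a block inspects its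
`B` children, so an update takes a constant times `k * B` steps. -/
theorem updCmd_wp {cx : Ctx} {N1 N2 k B : ℕ} (hE : Env cx N1 N2 k B) {zk tj : ℕ} (hzk : zk < 20)
    (htj : tj < 20) {σ : St} (hc : Consts cx σ) {A A' : Finset ℕ} {x : ℕ} (hx : σ.v 21 = x)
    (hxN : x ≤ N1 + N2)
    (hA' : ∀ i ∈ A', 1 ≤ i ∧ i ≤ N1 + N2) (hAA : ∀ i, i ≠ x → (i ∈ A' ↔ i ∈ A))
    (hv : σ.v 22 = if x ∈ A' then x else 0)
    (hT : ∀ e ≤ k, TreeOK (σ.z zk) A B (σ.a tj) e) :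
    (updCmd zk tj).wp cx (fun τ => ∀ e ≤ k, TreeOK (σ.z zk) A' B (τ.a tj) e) σ := by
  have hB := hE.hB
  have hL := hE.hL
  have hLW := hE.hLW
  have hWd := hE.hWd
  have hWdW := hE.hWdW
  unfold updCmd
  simp only [wp, Exp.ok, Exp.eval, St.setv_v, St.seta_v]
  refine ⟨⟨trivial, by omega, trivial, htj, by omega, by omega⟩, trivial, ⟨?_, ?_, ?_, ?_⟩, ?_⟩
  · simp [hc 3]
  · rw [hE.r3]; omega
  · simp
  · simp
  -- Halfway up, the levels up to `e` are correct for the new set and the levels above still for the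
  -- old one.
  refine ⟨fun e τ => τ.v 23 = x / B ^ e ∧ (∀ e' ≤ e, TreeOK (σ.z zk) A' B (τ.a tj) e') ∧
    ∀ e', e < e' → e' ≤ k → TreeOK (σ.z zk) A B (τ.a tj) e', ?_, ?_, ?_⟩
  · refine ⟨by simp [hx], fun e' he' j => ?_, fun e' h1 h2 j => ?_⟩
    · obtain rfl : e' = 0 := by omega
      simp only [St.setv_a, St.seta_a, pow_zero, Nat.div_one, hx, true_and, and_true]
      by_cases hj : j = x
      · subst hj
        rw [if_pos rfl, hv]
        split_ifs with hm
        · exact .inr ⟨⟨hm, rfl⟩, fun i hi => by rw [hi.2]⟩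
        · exact .inl ⟨rfl, fun i hi => hm (hi.2 ▸ hi.1)⟩
      · rw [if_neg hj]
        refine (hT 0 (by omega) j).congr fun i => ?_
        simp only [pow_zero, Nat.div_one]
        constructor <;> rintro ⟨h1, rfl⟩
        · exact ⟨(hAA i hj).1 h1, rfl⟩
        · exact ⟨(hAA i hj).2 h1, rfl⟩
    · have : ¬ (e' = 0) := by omega
      simp only [St.setv_a, St.seta_a, this, and_false, if_false]
      exact hT e' h2 j
  · rw [hE.r3]
    rintro e he τ hA hτe ⟨h23, hT1, hT2⟩
    have h4 : τ.v 4 = B := by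
      rw [hA.v 4 (by simp), St.setv_v, if_neg (by decide), St.seta_v, hc 4 (by omega), hE.r4]
    have hz : τ.z = σ.z := by
      funext j
      rw [hA.z j (by simp)]
      rfl
    have hdiv : x / B ^ e / B = x / B ^ (e + 1) := (div_pow_succ B x e).symm
    have hxe : x / B ^ (e + 1) ≤ x := Nat.div_le_self _ _
    have hxB : x / B ^ (e + 1) * B ≤ x := by
      rw [← hdiv]
      exact (Nat.div_mul_le_self _ _).trans (Nat.div_le_self _ _)
    have hxe' : x / B ^ e ≤ x := Nat.div_le_self _ _
    simp only [h23, h4, Nat.reduceEqDiff, if_false, if_true]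
    refine ⟨⟨trivial, trivial, by omega⟩, by omega, ⟨by rw [hE.r4], by rw [hE.r4]; omega,
      by simp, by simp⟩, ?_⟩
    refine ⟨fun t υ => Best (σ.z zk) (fun i => i ∈ A' ∧ x / B ^ (e + 1) * B ≤ i / B ^ e ∧
      i / B ^ e < x / B ^ (e + 1) * B + t) (υ.v 25), ?_, ?_, ?_⟩
    · exact .inl ⟨by simp, fun i hi => by omega⟩
    · rw [hE.r4]
      intro t ht υ hυ hυt hI
      have u23 : υ.v 23 = x / B ^ (e + 1) := by
        rw [hυ.v 23 (by simp)]; simp [hdiv]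
      have u4 : υ.v 4 = B := by rw [hυ.v 4 (by simp)]; simp [h4]
      have u24 : υ.v 24 = e := by rw [hυ.v 24 (by simp)]; simp [hτe]
      have ua : υ.a = τ.a := by
        funext j; rw [hυ.a j (by simp)]; rfl
      have uz : υ.z = σ.z := by
        funext j; rw [hυ.z j (by simp)]; simp [hz]
      have hc' : Best (σ.z zk) (fun i => i ∈ A' ∧ i / B ^ e = x / B ^ (e + 1) * B + t)
          (υ.a tj (x / B ^ (e + 1) * B + t) e) := by
        rw [ua]; exact hT1 e le_rfl _
      have hmem : ∀ S : ℕ → Prop, ∀ m, Best (σ.z zk) (fun i => i ∈ A' ∧ S i) m → m ≤ N1 + N2 := by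
        rintro S m (⟨h, -⟩ | ⟨h, -⟩)
        · omega
        · exact (hA' m h.1).2
      have hcN := hmem _ _ hc'
      have hbN := hmem _ _ hI
      have h0 : 0 ∉ A' := fun h => by have := (hA' 0 h).1; omega
      simp only [u23, u4, u24, hυt, Nat.reduceEqDiff, if_false, if_true, uz, Tst.ok, Tst.holds,
        Exp.eval, Exp.ok, ZExp.ok, ZExp.eval, St.setv_v, St.setv_z]
      generalize υ.a tj (x / B ^ (e + 1) * B + t) e = c at hc' hcN ⊢
      generalize υ.v 25 = b at hI hbN ⊢
      have hsplit : ∀ i, (i ∈ A' ∧ x / B ^ (e + 1) * B ≤ i / B ^ e ∧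
          i / B ^ e < x / B ^ (e + 1) * B + (t + 1)) ↔
          (i ∈ A' ∧ x / B ^ (e + 1) * B ≤ i / B ^ e ∧ i / B ^ e < x / B ^ (e + 1) * B + t) ∨
          (i ∈ A' ∧ i / B ^ e = x / B ^ (e + 1) * B + t) := fun i => by
        constructor
        · rintro ⟨h1, h2, h3⟩
          rcases lt_or_ge (i / B ^ e) (x / B ^ (e + 1) * B + t) with h | h
          · exact .inl ⟨h1, h2, h⟩
          · exact .inr ⟨h1, by omega⟩
        · rintro (⟨h1, h2, h3⟩ | ⟨h1, h2⟩)
          · exact ⟨h1, h2, by omega⟩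
          · exact ⟨h1, by omega, by omega⟩
      refine ⟨⟨⟨⟨trivial, trivial, by omega⟩, trivial, by omega⟩, trivial, htj, by omega,
        by omega⟩, ⟨trivial, by omega⟩, fun hc0 => ?_, fun hc0 =>
        ⟨⟨trivial, by omega⟩, fun hb0 => ⟨trivial, ?_⟩, fun hb0 =>
        ⟨⟨⟨trivial, hzk, by omega⟩, trivial, hzk, by omega⟩, fun hlt => ⟨trivial, ?_⟩, fun hlt => ?_⟩⟩⟩
      · rcases hc' with ⟨-, hc'⟩ | ⟨hc', -⟩
        · refine hI.congr fun i => (hsplit i).trans ⟨fun h => ?_, .inl⟩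
          exact h.resolve_right (hc' i)
        · exact absurd (hc0 ▸ hc'.1) h0
      · rcases hI with ⟨-, hI⟩ | ⟨hI, -⟩
        · refine hc'.congr fun i => (hsplit i).trans ⟨fun h => ?_, .inr⟩
          exact h.resolve_left (hI i)
        · exact absurd (hb0 ▸ hI.1) h0
      · rcases hI with ⟨hI, -⟩ | ⟨hI, hI'⟩
        · exact absurd hI hb0
        rcases hc' with ⟨hc', -⟩ | ⟨hc', hc''⟩
        · exact absurd hc' hc0
        refine .inr ⟨(hsplit _).2 (.inr hc'), fun i hi => ?_⟩
        rcases (hsplit i).1 hi with hi | hi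
        · exact hlt.le.trans (hI' i hi)
        · exact hc'' i hi
      · rcases hI with ⟨hI, -⟩ | ⟨hI, hI'⟩
        · exact absurd hI hb0
        rcases hc' with ⟨hc', -⟩ | ⟨hc', hc''⟩
        · exact absurd hc' hc0
        refine .inr ⟨(hsplit _).2 (.inl hI), fun i hi => ?_⟩
        rcases (hsplit i).1 hi with hi | hi
        · exact hI' i hi
        · exact (not_lt.1 hlt).trans (hc'' i hi)
    · rw [hE.r4]
      intro υ hυ hI
      have u23 : υ.v 23 = x / B ^ (e + 1) := by
        rw [hυ.v 23 (by simp)]; simp [hdiv]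
      have u24 : υ.v 24 = e := by rw [hυ.v 24 (by simp)]; simp [hτe]
      have ua : υ.a = τ.a := by
        funext j; rw [hυ.a j (by simp)]; rfl
      simp only [u23, u24, Nat.reduceEqDiff, if_false, St.setv_v, St.setv_a]
      refine ⟨⟨trivial, ⟨trivial, by omega, by omega⟩, trivial, htj, by omega, by omega⟩, ?_,
        fun e' he' j => ?_, fun e' h1 h2 j => ?_⟩
      · simp [u23]
      · simp only [St.seta_a, true_and, ua]
        rcases Nat.lt_or_ge e e' with h | h
        · obtain rfl : e' = e + 1 := by omega
          by_cases hj : j = x / B ^ (e + 1)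
          · rw [if_pos ⟨hj, rfl⟩]
            refine hI.congr fun i => ?_
            rw [hj, div_pow_succ B i e]
            have hBp : 0 < B := by omega
            constructor
            · rintro ⟨h1, h2⟩
              rw [← h2]
              exact ⟨h1, Nat.div_mul_le_self _ _, Nat.lt_div_mul_add hBp⟩
            · rintro ⟨h1, h2, h3⟩
              refine ⟨h1, le_antisymm ?_ ((Nat.le_div_iff_mul_le hBp).2 h2)⟩
              rw [← Nat.lt_succ_iff, Nat.div_lt_iff_lt_mul hBp, Nat.succ_mul]
              exact h3
          · rw [if_neg (fun h => hj h.1)]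
            refine (hT2 (e + 1) (by omega) (by omega) j).congr fun i => ?_
            constructor <;> rintro ⟨h1, rfl⟩
            · exact ⟨(hAA i fun h => hj (by rw [h])).1 h1, rfl⟩
            · exact ⟨(hAA i fun h => hj (by rw [h])).2 h1, rfl⟩
        · rw [if_neg (by omega)]
          exact hT1 e' h j
      · simp only [St.seta_a, true_and, ua]
        rw [if_neg (by omega)]
        exact hT2 e' (by omega) h2 j
  · rw [hE.r3]
    rintro τ - ⟨-, hT1, -⟩
    exact hT1

/-- Sorts the numbers `1`, …, `N` by the integer array `zk` into the array `oj`, with the help of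
the array `tj`. -/
def sortCmd (zk tj oj : ℕ) : Cmd :=
  for_ 20 2 (asg 21 (.add (var 20) (lit 1)) ;; asg 22 (var 21) ;; updCmd zk tj) ;;
  for_ 20 2 (asg 21 (.rd tj (lit 0) (var 3)) ;; wr oj (var 20) (lit 0) (var 21) ;;
    asg 22 (lit 0) ;; updCmd zk tj)

/-- `out 0, …, out (N - 1)` are the numbers `1, …, N` in the order of their keys. -/
structure Sorted (key : ℕ → ℤ) (N : ℕ) (out : ℕ → ℕ) : Prop where
  range : ∀ o < N, 1 ≤ out o ∧ out o ≤ N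
  ne : ∀ o o', o < o' → o' < N → out o ≠ out o'
  le : ∀ o o', o < o' → o' < N → key (out o) ≤ key (out o')
  surj : ∀ i, 1 ≤ i → i ≤ N → ∃ o < N, out o = i

theorem sortCmd_mv (zk tj oj x : ℕ) (hx : x < 20) : x ∉ (sortCmd zk tj oj).mv := by
  simp [sortCmd, updCmd]
  omega

/-- All numbers are inserted, then a minimum is extracted `N1 + N2` times. Ties are broken
arbitrarily. -/
theorem sortCmd_wp {cx : Ctx} {N1 N2 k B : ℕ} (hE : Env cx N1 N2 k B) {zk tj oj : ℕ}
    (hzk : zk < 20) (htj : tj < 20) (hoj : oj < 20) (hto : tj ≠ oj) {σ : St} (hc : Consts cx σ)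
    (hT0 : ∀ j e, σ.a tj j e = 0) :
    (sortCmd zk tj oj).wp cx (fun τ => Sorted (σ.z zk) (N1 + N2) fun o => τ.a oj o 0) σ := by
  have hB := hE.hB
  have hL := hE.hL
  have hLW := hE.hLW
  have hWd := hE.hWd
  have hWdW := hE.hWdW
  have hk := hE.hk
  unfold sortCmd
  rw [wp, wp]
  refine ⟨⟨hc 2 (by omega), by rw [hE.r2]; omega, by simp [updCmd], by simp [updCmd]⟩,
    fun n τ => ∀ e ≤ k, TreeOK (σ.z zk) (Finset.Icc 1 n) B (τ.a tj) e, ?_, ?_, ?_⟩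
  · exact fun e _ j => .inl ⟨by simp [hT0], fun i hi => by simp at hi⟩
  · rw [hE.r2]
    intro i hi τ hA hτi hI
    have hcτ : Consts cx τ := hc.of_agree hA fun x hx => by
      simp [updCmd]
      omega
    have hz : τ.z = σ.z := by
      funext j; rw [hA.z j (by simp [updCmd])]
    simp only [wp, Exp.ok, Exp.eval, St.setv_v, hτi, if_true]
    refine ⟨⟨trivial, by omega, by omega⟩, trivial, ?_⟩
    have h := updCmd_wp hE hzk htj (σ := (τ.setv 21 (i + 1)).setv 22 (i + 1))
      (A := Finset.Icc 1 i) (A' := Finset.Icc 1 (i + 1)) (x := i + 1)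
      (fun x hx => by
        simp only [St.setv_v]; rw [if_neg (by omega), if_neg (by omega)]; exact hcτ x hx)
      (by simp) (by omega)
      (fun i' hi' => by simp only [Finset.mem_Icc] at hi'; omega)
      (fun i' hi' => by simp only [Finset.mem_Icc]; omega) (by simp)
      (by simpa [hz] using hI)
    exact wp_conseq _ h fun υ _ hυ => by simpa [hz] using hυ
  rw [hE.r2]
  intro σ₁ hA₁ hI₁
  have hc₁ : Consts cx σ₁ := hc.of_agree hA₁ fun x hx => by
    simp [updCmd]
    omega
  have hz₁ : σ₁.z = σ.z := by
    funext j; rw [hA₁.z j (by simp [updCmd])]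
  rw [wp]
  refine ⟨⟨hc₁ 2 (by omega), by rw [hE.r2]; omega, by simp [updCmd], by simp [updCmd]⟩,
    -- `A` is the set of numbers that are not yet output.
    fun o τ => ∃ A : Finset ℕ, A.card = N1 + N2 - o ∧ A ⊆ Finset.Icc 1 (N1 + N2) ∧
      (∀ e ≤ k, TreeOK (σ.z zk) A B (τ.a tj) e) ∧
      (∀ i ∈ Finset.Icc 1 (N1 + N2), i ∈ A ∨ ∃ o' < o, τ.a oj o' 0 = i) ∧
      (∀ o' < o, τ.a oj o' 0 ∈ Finset.Icc 1 (N1 + N2) ∧ τ.a oj o' 0 ∉ A ∧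
        ∀ i ∈ A, σ.z zk (τ.a oj o' 0) ≤ σ.z zk i) ∧
      ∀ o₁ o₂, o₁ < o₂ → o₂ < o → τ.a oj o₁ 0 ≠ τ.a oj o₂ 0 ∧
        σ.z zk (τ.a oj o₁ 0) ≤ σ.z zk (τ.a oj o₂ 0), ?_, ?_, ?_⟩
  · exact ⟨Finset.Icc 1 (N1 + N2), by simp, subset_rfl, hI₁, fun i hi => .inl hi,
      fun o' ho' => by omega, fun o₁ o₂ _ ho₂ => by omega⟩
  · rw [hE.r2]
    rintro o ho τ hA hτo ⟨A, hcard, hsub, hT, hcov, hout, hord⟩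
    have hcτ : Consts cx τ := hc₁.of_agree hA fun x hx => by
      simp [updCmd]
      omega
    have hz : τ.z = σ.z := by
      funext j; rw [hA.z j (by simp [updCmd]), hz₁]
    have h3 : τ.v 3 = k := by rw [hcτ 3 (by omega), hE.r3]
    have hP := hE.hP
    -- As `N1 + N2 < B ^ k`, all numbers lie in block 0 of level `k`, so row 0 in column `k` is the
    -- root of the tournament.
    have hroot : τ.a tj 0 k ∈ A ∧ ∀ i ∈ A, σ.z zk (τ.a tj 0 k) ≤ σ.z zk i := by
      have hdiv : ∀ i ∈ A, i / B ^ k = 0 := fun i hi => Nat.div_eq_of_lt (by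
        have := Finset.mem_Icc.1 (hsub hi); omega)
      rcases hT k le_rfl 0 with ⟨-, h⟩ | ⟨h, h'⟩
      · obtain ⟨i, hi⟩ := Finset.card_pos.1 (show 0 < A.card by omega)
        exact absurd ⟨hi, hdiv i hi⟩ (h i)
      · exact ⟨h.1, fun i hi => h' i ⟨hi, hdiv i hi⟩⟩
    obtain ⟨hm, hmle⟩ := hroot
    simp only [wp, Exp.ok, Exp.eval, St.setv_v, hτo, h3, Nat.reduceEqDiff, if_false, if_true]
    generalize τ.a tj 0 k = m at hm hmle ⊢
    have hmN := Finset.mem_Icc.1 (hsub hm)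
    refine ⟨⟨by omega, trivial, htj, by omega, by omega⟩, ⟨trivial, by omega, trivial, hoj,
      by omega, by omega⟩, by omega, ?_⟩
    have h := updCmd_wp hE hzk htj (σ := ((τ.setv 21 m).seta oj o 0 m).setv 22 0)
      (A := A) (A' := A.erase m) (x := m)
      (fun x hx => by
        simp only [St.setv_v, St.seta_v]; rw [if_neg (by omega), if_neg (by omega)]
        exact hcτ x hx)
      (by simp) hmN.2
      (fun i hi => Finset.mem_Icc.1 (hsub (Finset.mem_of_mem_erase hi)))
      (fun i hi => by simp [hi]) (by simp)
      (by
        intro e he j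
        have := hT e he j
        simpa [hz, hto] using this)
    refine wp_conseq _ h fun υ hυ hυT => ?_
    have ho : ∀ o', υ.a oj o' 0 = if o' = o then m else τ.a oj o' 0 := fun o' => by
      rw [hυ.a oj (by simp [updCmd, hto.symm])]; simp
    simp only [St.setv_a, ho]
    refine ⟨A.erase m, by rw [Finset.card_erase_of_mem hm]; omega,
      (Finset.erase_subset _ _).trans hsub, by simpa [hz] using hυT, fun i hi => ?_,
      fun o' ho' => ?_, fun o₁ o₂ h12 h2 => ?_⟩
    · by_cases him : i = m
      · exact .inr ⟨o, by omega, by simp [him]⟩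
      · rcases hcov i hi with h | ⟨o', ho', h⟩
        · exact .inl (Finset.mem_erase.2 ⟨him, h⟩)
        · exact .inr ⟨o', by omega, by rw [if_neg (by omega), h]⟩
    · by_cases hoo : o' = o
      · rw [if_pos hoo]
        exact ⟨hsub hm, Finset.notMem_erase _ _, fun i hi => hmle i (Finset.mem_of_mem_erase hi)⟩
      · rw [if_neg hoo]
        obtain ⟨h1, h2, h3⟩ := hout o' (by omega)
        exact ⟨h1, fun h => h2 (Finset.mem_of_mem_erase h),
          fun i hi => h3 i (Finset.mem_of_mem_erase hi)⟩
    · rw [if_neg (show ¬ o₁ = o by omega)]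
      by_cases hoo : o₂ = o
      · rw [if_pos hoo]
        obtain ⟨-, h2, h3⟩ := hout o₁ (by omega)
        exact ⟨fun h => h2 (h ▸ hm), h3 m hm⟩
      · rw [if_neg hoo]
        exact hord o₁ o₂ h12 (by omega)
  · rw [hE.r2]
    rintro τ - ⟨A, hcard, -, -, hcov, hout, hord⟩
    have hA0 : A = ∅ := Finset.card_eq_zero.1 (by omega)
    refine ⟨fun o ho => Finset.mem_Icc.1 (hout o ho).1, fun o o' h h' => (hord o o' h h').1,
      fun o o' h h' => (hord o o' h h').2, fun i h1 h2 => ?_⟩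
    rcases hcov i (Finset.mem_Icc.2 ⟨h1, h2⟩) with h | h
    · simp [hA0] at h
    · exact h

end HIA

namespace HIA

open Cmd Exp

/-! ### Reading the input -/

/-- The input cells. -/
def inputCells (T₁ T₂ : WLTree) (i : ℕ) : ℤ := (T₁.encode ++ T₂.encode).getD i 0

theorem WLTree.length_encode (T : WLTree) : T.encode.length = 3 * T.size := by
  simp [WLTree.encode]; ring

theorem WLTree.encode_parent (T : WLTree) (v : Fin T.size) :
    T.encode.getD v 0 = ((T.parent v).val : ℤ) := by
  have := v.2
  simp [WLTree.encode, List.getD, List.getElem?_append]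

theorem WLTree.encode_weight (T : WLTree) (v : Fin T.size) :
    T.encode.getD (T.size + v) 0 = T.weight v := by
  have := v.2
  simp [WLTree.encode, List.getD, List.getElem?_append]

theorem WLTree.encode_label (T : WLTree) (v : Fin T.size) :
    T.encode.getD (T.size + T.size + v) 0 = T.label v := by
  have := v.2
  rw [WLTree.encode, List.getD_append_right _ _ _ _ (by simp)]
  simp [List.getD]

theorem inputCells_left (T₁ T₂ : WLTree) {i : ℕ} (hi : i < 3 * T₁.size) :
    inputCells T₁ T₂ i = T₁.encode.getD i 0 := by
  rw [inputCells, List.getD_append _ _ _ _ (by rwa [WLTree.length_encode])]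

theorem inputCells_right (T₁ T₂ : WLTree) (i : ℕ) :
    inputCells T₁ T₂ (3 * T₁.size + i) = T₂.encode.getD i 0 := by
  rw [inputCells, List.getD_append_right _ _ _ _ (by rw [WLTree.length_encode]; omega),
    WLTree.length_encode, Nat.add_sub_cancel_left]

/-- The two trees as one tree on `0`, …, `N₁ + N₂` with the additional root `0`: node `v` of the
first tree is `v + 1`, node `v` of the second tree is `N₁ + v + 1`. -/
structure Joined (T₁ T₂ : WLTree) (par : ℕ → ℕ) (wt lb : ℕ → ℤ) : Prop where
  par1 : ∀ v : Fin T₁.size, par (v + 1) = if v = T₁.root then 0 else (T₁.parent v : ℕ) + 1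
  par2 : ∀ v : Fin T₂.size, par (T₁.size + v + 1) =
    if v = T₂.root then 0 else T₁.size + (T₂.parent v : ℕ) + 1
  par0 : par 0 = 0
  wt1 : ∀ v : Fin T₁.size, wt (v + 1) = T₁.weight v
  wt2 : ∀ v : Fin T₂.size, wt (T₁.size + v + 1) = T₂.weight v
  wt0 : wt 0 = 0
  lb1 : ∀ v : Fin T₁.size, lb (v + 1) = T₁.label v
  lb2 : ∀ v : Fin T₂.size, lb (T₁.size + v + 1) = T₂.label v

/-- The input does not name the root; it is recognised by its self-loop, and strict monotonicity of
the weights excludes other self-loops. -/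
theorem WLTree.parent_eq_self (T : WLTree) (v : Fin T.size) : T.parent v = v ↔ v = T.root := by
  constructor
  · intro h
    by_contra hv
    have := T.weight_parent_lt v hv
    rw [h] at this
    exact lt_irrefl _ this
  · rintro rfl
    exact T.parent_root

/-- Nothing is written for the root of a tree: its parent keeps the initial value `0`, which is the
additional root. -/
def inputCmd : Cmd :=
  for_ 20 0 (asg 21 (.inp (var 20)) ;;
    ite (.eq (var 21) (var 20)) skip
      (wr 0 (.add (var 20) (lit 1)) (lit 0) (.add (var 21) (lit 1))) ;;
    wz 0 (.add (var 20) (lit 1)) (.inp (.add (var 0) (var 20))) ;;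
    wz 1 (.add (var 20) (lit 1)) (.inp (.add (.add (var 0) (var 0)) (var 20)))) ;;
  for_ 20 1 (asg 22 (.add (.add (.add (var 0) (var 0)) (var 0)) (var 20)) ;;
    asg 21 (.inp (var 22)) ;;
    asg 23 (.add (.add (var 0) (var 20)) (lit 1)) ;;
    ite (.eq (var 21) (var 20)) skip
      (wr 0 (var 23) (lit 0) (.add (.add (var 0) (var 21)) (lit 1))) ;;
    wz 0 (var 23) (.inp (.add (var 22) (var 1))) ;;
    wz 1 (var 23) (.inp (.add (.add (var 22) (var 1)) (var 1))))

theorem inputCmd_wp {cx : Ctx} {T₁ T₂ : WLTree} {k B : ℕ} (hE : Env cx T₁.size T₂.size k B)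
    {σ : St} (hc : Consts cx σ) (hinp : σ.inp = inputCells T₁ T₂)
    (ha : ∀ r, σ.a 0 r 0 = 0) (hz : ∀ r, σ.z 0 r = 0) :
    inputCmd.wp cx (fun τ => Joined T₁ T₂ (fun i => τ.a 0 i 0) (τ.z 0) (τ.z 1)) σ := by
  have hB := hE.hB
  have hL := hE.hL
  have hLW := hE.hLW
  have hWd := hE.hWd
  have hWdW := hE.hWdW
  have hMW := hE.hMW
  have hP := hE.hP
  have hbase := hE.hbase
  have h3W : 3 * (T₁.size + T₂.size) < cx.W := by
    have h1 : 3 * B ^ k ≤ keyBound k B := by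
      have : 3 * B ^ k * 1 ≤ 16 * k * B ^ k * B ^ (k + 1) :=
        Nat.mul_le_mul (Nat.mul_le_mul_right _ (by have := hE.hk; omega)) (Nat.pow_pos (by omega))
      simpa [keyBound] using this
    have h2 : keyBound k B ≤ keyBound k B * keyBound k B := Nat.le_mul_self _
    omega
  unfold inputCmd
  rw [wp, wp]
  refine ⟨⟨hc 0 (by omega), by rw [hE.r0]; omega, by simp, by simp⟩, fun i τ =>
    (∀ v : Fin T₁.size, v < i →
      τ.a 0 (v + 1) 0 = (if v = T₁.root then 0 else (T₁.parent v : ℕ) + 1) ∧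
      τ.z 0 (v + 1) = T₁.weight v ∧ τ.z 1 (v + 1) = T₁.label v) ∧
    ∀ r, (r = 0 ∨ i < r) → τ.a 0 r 0 = 0 ∧ τ.z 0 r = 0, ?_, ?_, ?_⟩
  · exact ⟨fun v hv => by omega, fun r _ => ⟨ha r, hz r⟩⟩
  · rw [hE.r0]
    rintro i hi τ hA hτi ⟨hI1, hI2⟩
    have hcτ := hc.of_agree hA fun x hx => by simp; omega
    have h0 : τ.v 0 = T₁.size := by rw [hcτ 0 (by omega), hE.r0]
    have hin : τ.inp = inputCells T₁ T₂ := by rw [hA.inp, hinp]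
    have e1 := T₁.encode_parent ⟨i, hi⟩
    have e2 := T₁.encode_weight ⟨i, hi⟩
    have e3 := T₁.encode_label ⟨i, hi⟩
    simp only at e1 e2 e3
    rw [← inputCells_left T₁ T₂ (by omega)] at e1 e2 e3
    have hpar := (T₁.parent ⟨i, hi⟩).2
    have hroot := T₁.parent_eq_self ⟨i, hi⟩
    rw [Fin.ext_iff] at hroot
    simp only [wp, Exp.ok, Exp.eval, Tst.ok, Tst.holds, ZExp.ok, ZExp.eval, St.setv_v, St.setv_inp,
      St.seta_v, St.seta_inp, St.setz_v, St.setz_inp, hτi, h0, hin, e1, e2, e3, Int.toNat_natCast,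
      Nat.reduceEqDiff, if_false, if_true, true_and, and_true]
    -- Bookkeeping common to both outcomes of the root test: only row `i + 1` has changed.
    have key : ∀ υ : St, (∀ r, r ≠ i + 1 → υ.a 0 r 0 = τ.a 0 r 0 ∧ υ.z 0 r = τ.z 0 r ∧
        υ.z 1 r = τ.z 1 r) →
        υ.a 0 (i + 1) 0 = (if (⟨i, hi⟩ : Fin T₁.size) = T₁.root then 0
          else (T₁.parent ⟨i, hi⟩ : ℕ) + 1) →
        υ.z 0 (i + 1) = T₁.weight ⟨i, hi⟩ → υ.z 1 (i + 1) = T₁.label ⟨i, hi⟩ →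
        (∀ v : Fin T₁.size, v < i + 1 →
          υ.a 0 (v + 1) 0 = (if v = T₁.root then 0 else (T₁.parent v : ℕ) + 1) ∧
          υ.z 0 (v + 1) = T₁.weight v ∧ υ.z 1 (v + 1) = T₁.label v) ∧
        ∀ r, (r = 0 ∨ i + 1 < r) → υ.a 0 r 0 = 0 ∧ υ.z 0 r = 0 := by
      intro υ h1 h2 h3 h4
      refine ⟨fun v hv => ?_, fun r hr => ?_⟩
      · by_cases hvi : v = ⟨i, hi⟩
        · subst hvi
          exact ⟨h2, h3, h4⟩
        · have hvi' : (v : ℕ) ≠ i := fun h => hvi (Fin.ext h)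
          obtain ⟨g1, g2, g3⟩ := h1 (v + 1) (by omega)
          rw [g1, g2, g3]
          exact hI1 v (by omega)
      · obtain ⟨g1, g2, -⟩ := h1 r (by omega)
        rw [g1, g2]
        exact hI2 r (by omega)
    refine ⟨by omega, fun hr => ?_, fun hr => ?_⟩
    · refine ⟨by omega, by omega, ?_⟩
      apply key
      · intro r hr
        simp [hr]
      · have := (hI2 (i + 1) (by omega)).1
        simp [this, hroot.1 hr]
      · simp
      · simp
    · refine ⟨by omega, by omega, by omega, ?_⟩
      apply key
      · intro r hr
        simp [hr]
      · have : ¬ (⟨i, hi⟩ : Fin T₁.size) = T₁.root := fun h => hr (hroot.2 h)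
        simp [this]
      · simp
      · simp
  rw [hE.r0]
  rintro σ₁ hA₁ ⟨hI1, hI2⟩
  have hc₁ := hc.of_agree hA₁ fun x hx => by simp; omega
  rw [wp]
  refine ⟨⟨hc₁ 1 (by omega), by rw [hE.r1]; omega, by simp, by simp⟩, fun i τ =>
    (∀ r ≤ T₁.size, τ.a 0 r 0 = σ₁.a 0 r 0 ∧ τ.z 0 r = σ₁.z 0 r ∧ τ.z 1 r = σ₁.z 1 r) ∧
    (∀ v : Fin T₂.size, v < i → τ.a 0 (T₁.size + v + 1) 0 =
      (if v = T₂.root then 0 else T₁.size + (T₂.parent v : ℕ) + 1) ∧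
      τ.z 0 (T₁.size + v + 1) = T₂.weight v ∧ τ.z 1 (T₁.size + v + 1) = T₂.label v) ∧
    ∀ r, T₁.size + i < r → τ.a 0 r 0 = 0, ?_, ?_, ?_⟩
  · exact ⟨fun r _ => ⟨rfl, rfl, rfl⟩, fun v hv => by omega, fun r hr => (hI2 r (by omega)).1⟩
  · rw [hE.r1]
    rintro i hi τ hA hτi ⟨hJ0, hJ1, hJ2⟩
    have hcτ := hc₁.of_agree hA fun x hx => by simp; omega
    have h0 : τ.v 0 = T₁.size := by rw [hcτ 0 (by omega), hE.r0]
    have h1 : τ.v 1 = T₂.size := by rw [hcτ 1 (by omega), hE.r1]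
    have hin : τ.inp = inputCells T₁ T₂ := by rw [hA.inp, hA₁.inp, hinp]
    have e1 := T₂.encode_parent ⟨i, hi⟩
    have e2 := T₂.encode_weight ⟨i, hi⟩
    have e3 := T₂.encode_label ⟨i, hi⟩
    simp only at e1 e2 e3
    rw [← inputCells_right T₁ T₂] at e1 e2 e3
    rw [show 3 * T₁.size + i = T₁.size + T₁.size + T₁.size + i by ring] at e1
    rw [show 3 * T₁.size + (T₂.size + i) = T₁.size + T₁.size + T₁.size + i + T₂.size by ring] at e2
    rw [show 3 * T₁.size + (T₂.size + T₂.size + i) =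
      T₁.size + T₁.size + T₁.size + i + T₂.size + T₂.size by ring] at e3
    have hpar := (T₂.parent ⟨i, hi⟩).2
    have hroot := T₂.parent_eq_self ⟨i, hi⟩
    rw [Fin.ext_iff] at hroot
    simp only [wp, Exp.ok, Exp.eval, Tst.ok, Tst.holds, ZExp.ok, ZExp.eval, St.setv_v, St.setv_inp,
      St.seta_v, St.seta_inp, St.setz_v, St.setz_inp, hτi, h0, h1, hin, e1, e2, e3,
      Int.toNat_natCast, Nat.reduceEqDiff, if_false, if_true, OfNat.zero_ne_ofNat,
      OfNat.one_ne_ofNat, true_and, and_true]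
    have key : ∀ υ : St, (∀ r, r ≠ T₁.size + i + 1 → υ.a 0 r 0 = τ.a 0 r 0 ∧
        υ.z 0 r = τ.z 0 r ∧ υ.z 1 r = τ.z 1 r) →
        υ.a 0 (T₁.size + i + 1) 0 = (if (⟨i, hi⟩ : Fin T₂.size) = T₂.root then 0
          else T₁.size + (T₂.parent ⟨i, hi⟩ : ℕ) + 1) →
        υ.z 0 (T₁.size + i + 1) = T₂.weight ⟨i, hi⟩ →
        υ.z 1 (T₁.size + i + 1) = T₂.label ⟨i, hi⟩ →
        (∀ r ≤ T₁.size, υ.a 0 r 0 = σ₁.a 0 r 0 ∧ υ.z 0 r = σ₁.z 0 r ∧ υ.z 1 r = σ₁.z 1 r) ∧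
        (∀ v : Fin T₂.size, v < i + 1 → υ.a 0 (T₁.size + v + 1) 0 =
          (if v = T₂.root then 0 else T₁.size + (T₂.parent v : ℕ) + 1) ∧
          υ.z 0 (T₁.size + v + 1) = T₂.weight v ∧ υ.z 1 (T₁.size + v + 1) = T₂.label v) ∧
        ∀ r, T₁.size + (i + 1) < r → υ.a 0 r 0 = 0 := by
      intro υ h1 h2 h3 h4
      refine ⟨fun r hr => ?_, fun v hv => ?_, fun r hr => ?_⟩
      · obtain ⟨g1, g2, g3⟩ := h1 r (by omega)
        rw [g1, g2, g3]
        exact hJ0 r hr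
      · by_cases hvi : v = ⟨i, hi⟩
        · subst hvi
          exact ⟨h2, h3, h4⟩
        · have hvi' : (v : ℕ) ≠ i := fun h => hvi (Fin.ext h)
          obtain ⟨g1, g2, g3⟩ := h1 (T₁.size + v + 1) (by omega)
          rw [g1, g2, g3]
          exact hJ1 v (by omega)
      · rw [(h1 r (by omega)).1]
        exact hJ2 r (by omega)
    refine ⟨by omega, by omega, by omega, fun hr => ?_, fun hr => ?_⟩
    · refine ⟨by omega, by omega, ?_⟩
      apply key
      · intro r hr
        simp [hr]
      · have := hJ2 (T₁.size + i + 1) (by omega)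
        simp [this, hroot.1 hr]
      · simp
      · simp
    · refine ⟨by omega, by omega, by omega, ?_⟩
      apply key
      · intro r hr
        simp [hr]
      · have : ¬ (⟨i, hi⟩ : Fin T₂.size) = T₂.root := fun h => hr (hroot.2 h)
        simp [this]
      · simp
      · simp
  · rw [hE.r1]
    rintro τ - ⟨hJ0, hJ1, -⟩
    refine ⟨fun v => ?_, fun v => (hJ1 v v.2).1, ?_, fun v => ?_, fun v => (hJ1 v v.2).2.1, ?_,
      fun v => ?_, fun v => (hJ1 v v.2).2.2⟩
    · exact (hJ0 _ (by omega)).1.trans (hI1 v v.2).1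
    · exact (hJ0 0 (by omega)).1.trans (hI2 0 (.inl rfl)).1
    · exact (hJ0 _ (by omega)).2.1.trans (hI1 v v.2).2.1
    · exact (hJ0 0 (by omega)).2.1.trans (hI2 0 (.inl rfl)).2
    · exact (hJ0 _ (by omega)).2.2.trans (hI1 v v.2).2.2

end HIA

namespace HIA

open Cmd Exp

/-! ### Numbering the nodes in preorder -/

/-- Marks the nodes with children. -/
def leafCmd : Cmd :=
  for_ 20 2 (wr 1 (.rd 0 (.add (var 20) (lit 1)) (lit 0)) (lit 0) (lit 1))

theorem leafCmd_wp {cx : Ctx} {N1 N2 k B : ℕ} (hE : Env cx N1 N2 k B) {σ : St}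
    (hc : Consts cx σ) (h0 : ∀ r, σ.a 1 r 0 = 0) (hpar : ∀ i ≤ N1 + N2, σ.a 0 i 0 ≤ N1 + N2) :
    leafCmd.wp cx (fun τ => ∀ p, τ.a 1 p 0 = 0 ↔ ∀ i, 1 ≤ i → i ≤ N1 + N2 → σ.a 0 i 0 ≠ p) σ := by
  have hB := hE.hB
  have hL := hE.hL
  have hLW := hE.hLW
  have hWd := hE.hWd
  unfold leafCmd
  rw [wp]
  refine ⟨⟨hc 2 (by omega), by rw [hE.r2]; omega, by simp, by simp⟩, fun i τ =>
    ∀ p, τ.a 1 p 0 = 0 ↔ ∀ j < i, σ.a 0 (j + 1) 0 ≠ p, ?_, ?_, ?_⟩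
  · exact fun p => ⟨fun _ j hj => by omega, fun _ => h0 p⟩
  · rw [hE.r2]
    intro i hi τ hA hτi hI
    have ha : τ.a 0 = σ.a 0 := hA.a 0 (by simp)
    have hp := hpar (i + 1) (by omega)
    simp only [wp, Exp.ok, Exp.eval, hτi, ha, true_and, St.seta_a, St.setv_a]
    refine ⟨by omega, fun p => ?_⟩
    by_cases hpi : p = σ.a 0 (i + 1) 0
    · subst hpi
      simp only [true_and, if_true]
      exact ⟨fun h => absurd h one_ne_zero, fun h => absurd rfl (h i (by omega))⟩
    · rw [if_neg (by simpa using hpi), hI p]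
      constructor
      · intro h j hj
        by_cases hji : j = i
        · subst hji; exact fun h => hpi h.symm
        · exact h j (by omega)
      · exact fun h j hj => h j (by omega)
  · rw [hE.r2]
    intro τ _ hI p
    rw [hI p]
    constructor
    · intro h i h1 h2
      have := h (i - 1) (by omega)
      rwa [Nat.sub_add_cancel h1] at this
    · exact fun h j hj => h (j + 1) (by omega) (by omega)

theorem isChain_of_mem {R R' : ℕ → ℕ → Prop} : ∀ l : List ℕ, (∀ s ∈ l, ∀ t, R s t → R' s t) →
    l.IsChain R → l.IsChain R'
  | [], _, _ => .nil
  | [a], _, _ => .singleton a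
  | a :: b :: l, h, hl => by
    rw [List.isChain_cons_cons] at hl ⊢
    exact ⟨h a (by simp) b hl.1,
      isChain_of_mem (b :: l) (fun s hs => h s (List.mem_cons_of_mem _ hs)) hl.2⟩

/-- Insertion into a linked list. -/
theorem isChain_insert {R R' : ℕ → ℕ → Prop} {p x : ℕ} (h1 : R' p x) (h2 : ∀ t, R p t → R' x t) :
    ∀ l₁ l₂ : List ℕ, (∀ s ∈ l₁ ++ p :: l₂, s ≠ p → ∀ t, R s t → R' s t) →
      (l₁ ++ p :: l₂).Nodup → (l₁ ++ p :: l₂).IsChain R → (l₁ ++ p :: x :: l₂).IsChain R'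
  | [], l₂, h, hnd, hl => by
    simp only [List.nil_append] at *
    rw [List.isChain_cons_cons]
    refine ⟨h1, ?_⟩
    cases l₂ with
    | nil => exact .singleton x
    | cons t l =>
      rw [List.isChain_cons_cons] at hl ⊢
      have hp : p ∉ t :: l := (List.nodup_cons.1 hnd).1
      exact ⟨h2 t hl.1, isChain_of_mem _ (fun s hs => h s (List.mem_cons_of_mem _ hs)
        fun e => hp (e ▸ hs)) hl.2⟩
  | a :: l₁, l₂, h, hnd, hl => by
    simp only [List.cons_append] at *
    have hnd' := List.nodup_cons.1 hnd
    have ih := isChain_insert h1 h2 l₁ l₂ (fun s hs => h s (List.mem_cons_of_mem _ hs)) hnd'.2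
      hl.of_cons
    have hap : a ≠ p := fun e => hnd'.1 (by simp [e])
    cases l₁ with
    | nil =>
      simp only [List.nil_append, List.isChain_cons_cons] at hl ih ⊢
      exact ⟨h a (by simp) hap _ hl.1, ih⟩
    | cons b l₁ =>
      simp only [List.cons_append, List.isChain_cons_cons] at hl ih ⊢
      exact ⟨h a (by simp) hap _ hl.1, ih⟩

/-- Inserts every node after its parent into a linked list. -/
def listCmd : Cmd :=
  for_ 20 2 (asg 21 (.rd 4 (var 20) (lit 0)) ;; asg 22 (.rd 0 (var 21) (lit 0)) ;;
    wr 6 (var 21) (lit 0) (.rd 6 (var 22) (lit 0)) ;; wr 6 (var 22) (lit 0) (var 21))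

/-- In the order of the weights a parent is inserted before its children. Placing `x` directly
behind its parent preserves the successor condition: `par x` precedes `x`, and for the old successor
`t` of `par x` the node `par t` is an ancestor of `par x`, hence of `x`. -/
theorem listCmd_wp {cx : Ctx} {N1 N2 k B : ℕ} (hE : Env cx N1 N2 k B) {σ : St}
    (hc : Consts cx σ) {par : ℕ → ℕ} (hpar : ∀ i, σ.a 0 i 0 = par i)
    {key : ℕ → ℤ} (hs : Sorted key (N1 + N2) fun o => σ.a 4 o 0)
    (hkey : ∀ i, 1 ≤ i → i ≤ N1 + N2 → par i = 0 ∨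
      1 ≤ par i ∧ par i ≤ N1 + N2 ∧ key (par i) < key i) :
    listCmd.wp cx (fun τ => ∃ l : List ℕ, l.head? = some 0 ∧ l.Nodup ∧
      l.length = N1 + N2 + 1 ∧ (∀ i, i ∈ l ↔ i ≤ N1 + N2) ∧
      l.IsChain fun s t => τ.a 6 s 0 = t ∧ Anc par (par t) s) σ := by
  have hB := hE.hB
  have hL := hE.hL
  have hLW := hE.hLW
  have hWd := hE.hWd
  unfold listCmd
  rw [wp]
  refine ⟨⟨hc 2 (by omega), by rw [hE.r2]; omega, by simp, by simp⟩, fun o τ =>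
    ∃ l : List ℕ, l.head? = some 0 ∧ l.Nodup ∧ l.length = o + 1 ∧
      (∀ i, i ∈ l ↔ i = 0 ∨ ∃ o' < o, σ.a 4 o' 0 = i) ∧
      l.IsChain fun s t => τ.a 6 s 0 = t ∧ Anc par (par t) s, ?_, ?_, ?_⟩
  · exact ⟨[0], rfl, by simp, rfl, by simp, .singleton 0⟩
  · rw [hE.r2]
    rintro o ho τ hA hτo ⟨l, hhead, hnd, hlen, hmem, hch⟩
    have h4 : τ.a 4 = σ.a 4 := hA.a 4 (by simp)
    have h0 : τ.a 0 = σ.a 0 := hA.a 0 (by simp)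
    obtain ⟨hx1, hxN⟩ := hs.range o ho
    have hne := hs.ne
    have hle := hs.le
    have hsurj := hs.surj
    simp only [wp, Exp.ok, Exp.eval, hτo, h4, h0, hpar, true_and, and_true, St.setv_v, St.setv_a,
      St.seta_v, St.seta_a, Nat.reduceEqDiff, if_false, if_true]
    generalize hx : σ.a 4 o 0 = x at hx1 hxN
    have hpx : par x ≤ N1 + N2 := by rcases hkey x hx1 hxN with h | h <;> omega
    have hpl : par x ∈ l := by
      rw [hmem]
      rcases hkey x hx1 hxN with h | ⟨h1, h2, h3⟩
      · exact .inl h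
      · obtain ⟨o', ho', he⟩ := hsurj _ h1 h2
        refine .inr ⟨o', ?_, he⟩
        by_contra hoo
        rcases Nat.lt_or_ge o o' with h | h
        · have := hle o o' h ho'
          rw [he, hx] at this
          omega
        · obtain rfl : o' = o := by omega
          rw [← he, hx] at h3
          omega
    have hxl : x ∉ l := by
      rw [hmem]
      rintro (h | ⟨o', ho', h⟩)
      · omega
      · exact hne o' o ho' ho (h.trans hx.symm)
    refine ⟨by omega, by omega, by omega, by omega, ?_⟩
    obtain ⟨l₁, l₂, rfl⟩ := List.append_of_mem hpl
    have hperm : (l₁ ++ par x :: x :: l₂).Perm (x :: (l₁ ++ par x :: l₂)) := by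
      have := List.perm_middle (a := x) (l₁ := l₁ ++ [par x]) (l₂ := l₂)
      simpa using this
    refine ⟨l₁ ++ par x :: x :: l₂, ?_, ?_, ?_, fun i => ?_, ?_⟩
    · cases l₁ <;> simpa using hhead
    · rw [hperm.nodup_iff, List.nodup_cons]
      exact ⟨hxl, hnd⟩
    · rw [hperm.length_eq, List.length_cons, hlen]
    · rw [hperm.mem_iff, List.mem_cons, hmem]
      constructor
      · rintro (h | h | ⟨o', ho', h⟩)
        · exact .inr ⟨o, by omega, by rw [hx, h]⟩
        · exact .inl h
        · exact .inr ⟨o', by omega, h⟩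
      · rintro (h | ⟨o', ho', h⟩)
        · exact .inr (.inl h)
        · by_cases hoo : o' = o
          · subst hoo; exact .inl (by rw [← h, hx])
          · exact .inr (.inr ⟨o', by omega, h⟩)
    · have hxp : x ≠ par x := fun h => hxl (h ▸ hpl)
      refine isChain_insert (R := fun s t => τ.a 6 s 0 = t ∧ Anc par (par t) s) ?_ ?_ l₁ l₂ ?_
        hnd hch
      · exact ⟨by simp, .refl _ _⟩
      · rintro t ⟨h1, h2⟩
        exact ⟨by simp [hxp, h1], h2.trans (anc_par _ _)⟩
      · rintro s hs hsp t ⟨h1, h2⟩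
        have hsx : s ≠ x := fun h => hxl (h ▸ hs)
        exact ⟨by simp [hsp, hsx, h1], h2⟩
  · rw [hE.r2]
    rintro τ - ⟨l, hhead, hnd, hlen, hmem, hch⟩
    refine ⟨l, hhead, hnd, hlen, fun i => ?_, hch⟩
    rw [hmem]
    constructor
    · rintro (h | ⟨o, ho, h⟩)
      · omega
      · have : σ.a 4 o 0 ≤ N1 + N2 := (hs.range o ho).2
        omega
    · intro h
      rcases Nat.eq_zero_or_pos i with h0 | h0
      · exact .inl h0
      · exact .inr (hs.surj i h0 h)

/-- Numbers the nodes in the order of the list. -/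
def posCmd : Cmd :=
  asg 21 (lit 0) ;;
  for_ 20 5 (wr 7 (var 21) (lit 0) (var 20) ;; wr 8 (var 20) (lit 0) (var 21) ;;
    asg 21 (.rd 6 (var 21) (lit 0)))

/-- The list enumerates all nodes without repetition, so walking along it makes arrays 7 (node to
position) and 8 (position to node) inverse to each other. The relation `R` between list neighbours
becomes one between consecutive positions. -/
theorem posCmd_wp {cx : Ctx} {N1 N2 k B : ℕ} (hE : Env cx N1 N2 k B) {σ : St}
    (hc : Consts cx σ) {R : ℕ → ℕ → Prop} {l : List ℕ} (hhead : l.head? = some 0) (hnd : l.Nodup)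
    (hlen : l.length = N1 + N2 + 1) (hmem : ∀ i, i ∈ l ↔ i ≤ N1 + N2)
    (hch : l.IsChain fun s t => σ.a 6 s 0 = t ∧ R s t) :
    posCmd.wp cx (fun τ => (∀ t ≤ N1 + N2, τ.a 8 t 0 ≤ N1 + N2 ∧ τ.a 7 (τ.a 8 t 0) 0 = t) ∧
      (∀ i ≤ N1 + N2, τ.a 7 i 0 ≤ N1 + N2 ∧ τ.a 8 (τ.a 7 i 0) 0 = i) ∧ τ.a 7 0 0 = 0 ∧
      ∀ t < N1 + N2, R (τ.a 8 t 0) (τ.a 8 (t + 1) 0)) σ := by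
  have hB := hE.hB
  have hL := hE.hL
  have hLW := hE.hLW
  have hWd := hE.hWd
  have hg : ∀ t (ht : t < l.length), l[t] ≤ N1 + N2 := fun t ht => (hmem _).1 (List.getElem_mem ht)
  have hstep : ∀ t (ht : t + 1 < l.length), σ.a 6 l[t] 0 = l[t + 1] ∧ R l[t] l[t + 1] :=
    fun t ht => List.isChain_iff_getElem.1 hch t ht
  have hl0 : ∀ h : 0 < l.length, l[0] = 0 := fun h => by
    rw [List.head?_eq_getElem?, List.getElem?_eq_getElem h] at hhead
    exact Option.some.inj hhead
  unfold posCmd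
  rw [wp, wp, wp]
  refine ⟨by simp only [Exp.ok]; omega, ⟨hc 5 (by omega), by rw [hE.r5]; omega, by simp, by simp⟩,
    fun t τ => (∀ h : t < l.length, τ.v 21 = l[t]) ∧
      ∀ t' < t, ∀ h : t' < l.length, τ.a 8 t' 0 = l[t'] ∧ τ.a 7 l[t'] 0 = t', ?_, ?_, ?_⟩
  · exact ⟨fun h => by simp [hl0], fun t' h => by omega⟩
  · rw [hE.r5]
    rintro t ht τ hA hτt ⟨hI1, hI2⟩
    have h6 : τ.a 6 = σ.a 6 := hA.a 6 (by simp)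
    have htl : t < l.length := by omega
    have hgt := hg t htl
    simp only [wp, Exp.ok, Exp.eval, hτt, hI1 htl, h6, true_and, and_true, St.setv_v, St.setv_a,
      St.seta_v, St.seta_a, Nat.reduceEqDiff, if_false, if_true, false_and]
    refine ⟨by omega, by omega, by omega, fun h => (hstep t h).1, fun t' ht' h => ?_⟩
    by_cases htt : t' = t
    · subst htt; simp
    · have hne : l[t'] ≠ l[t] := fun e => htt ((hnd.getElem_inj_iff).1 e)
      rw [if_neg htt, if_neg hne]
      exact hI2 t' (by omega) h
  · rw [hE.r5]
    rintro τ - ⟨-, hI⟩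
    have hI' : ∀ t (h : t < l.length), τ.a 8 t 0 = l[t] ∧ τ.a 7 l[t] 0 = t :=
      fun t h => hI t (by omega) h
    refine ⟨fun t ht => ?_, fun i hi => ?_, ?_, fun t ht => ?_⟩
    · have h := hI' t (by omega)
      rw [h.1]
      exact ⟨hg t _, h.2⟩
    · obtain ⟨t, ht, rfl⟩ := List.getElem_of_mem ((hmem i).2 hi)
      rw [(hI' t ht).2]
      exact ⟨by omega, (hI' t ht).1⟩
    · have := (hI' 0 (by omega)).2
      rwa [hl0] at this
    · rw [(hI' t (by omega)).1, (hI' (t + 1) (by omega)).1]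
      exact (hstep t (by omega)).2

/-- Computes parents and weights of the positions. -/
def parCmd : Cmd :=
  for_ 20 5 (asg 21 (.rd 8 (var 20) (lit 0)) ;;
    wr 9 (var 20) (lit 0) (.rd 7 (.rd 0 (var 21) (lit 0)) (lit 0)) ;; wz 2 (var 20) (.rd 0 (var 21)))

theorem parCmd_wp {cx : Ctx} {N1 N2 k B : ℕ} (hE : Env cx N1 N2 k B) {σ : St}
    (hc : Consts cx σ) (h8 : ∀ t ≤ N1 + N2, σ.a 8 t 0 ≤ N1 + N2)
    (h0 : ∀ i ≤ N1 + N2, σ.a 0 i 0 ≤ N1 + N2) (h9 : ∀ t, σ.a 9 t 0 = 0) :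
    parCmd.wp cx (fun τ =>
      (∀ t ≤ N1 + N2, τ.a 9 t 0 = σ.a 7 (σ.a 0 (σ.a 8 t 0) 0) 0 ∧ τ.z 2 t = σ.z 0 (σ.a 8 t 0)) ∧
      ∀ t, N1 + N2 < t → τ.a 9 t 0 = 0) σ := by
  have hB := hE.hB
  have hL := hE.hL
  have hLW := hE.hLW
  have hWd := hE.hWd
  unfold parCmd
  rw [wp]
  refine ⟨⟨hc 5 (by omega), by rw [hE.r5]; omega, by simp, by simp⟩, fun i τ =>
    (∀ t < i, τ.a 9 t 0 = σ.a 7 (σ.a 0 (σ.a 8 t 0) 0) 0 ∧ τ.z 2 t = σ.z 0 (σ.a 8 t 0)) ∧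
    ∀ t, i ≤ t → τ.a 9 t 0 = 0, ?_, ?_, ?_⟩
  · exact ⟨fun t ht => by omega, fun t _ => h9 t⟩
  · rw [hE.r5]
    rintro i hi τ hA hτi ⟨hI1, hI2⟩
    have a0 : τ.a 0 = σ.a 0 := hA.a 0 (by simp)
    have a7 : τ.a 7 = σ.a 7 := hA.a 7 (by simp)
    have a8 : τ.a 8 = σ.a 8 := hA.a 8 (by simp)
    have z0 : τ.z 0 = σ.z 0 := hA.z 0 (by simp)
    have b8 := h8 i (by omega)
    have b0 := h0 _ b8
    simp only [wp, Exp.ok, Exp.eval, ZExp.ok, ZExp.eval, hτi, a0, a7, a8, z0, true_and, and_true,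
      St.setv_v, St.setv_a, St.seta_v, St.seta_a, Nat.reduceEqDiff, if_false, if_true, St.setz_a, St.setz_z, St.setv_z, St.seta_z]
    refine ⟨by omega, by omega, by omega, fun t ht => ?_, fun t ht => ?_⟩
    · by_cases hti : t = i
      · subst hti; simp
      · rw [if_neg hti, if_neg hti]
        exact hI1 t (by omega)
    · rw [if_neg (by omega)]
      exact hI2 t (by omega)
  · rw [hE.r5]
    rintro τ - ⟨hI1, hI2⟩
    exact ⟨fun t ht => hI1 t (by omega), fun t ht => hI2 t (by omega)⟩

end HIA

namespace HIA

open Cmd Exp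

/-! ### Tables -/

/-- The rows `g 0, …, g (i - 1)` and the first `j` entries of row `g i` are filled, and nothing
else has changed. -/
structure FilledTo (n m : ℕ) (g : ℕ → ℕ) (F : ℕ → ℕ → ℕ) (old new : ℕ → ℕ → ℕ) (i j : ℕ) :
    Prop where
  done : ∀ i' < i, ∀ c < m, new (g i') c = F (g i') c
  cur : i < n → ∀ c < j, new (g i) c = F (g i) c
  rest : ∀ r c, m ≤ c ∨ (∀ i' < i, g i' ≠ r) ∧ (i < n → g i = r → j ≤ c) → new r c = old r c

/-- Injectivity of `g` ensures that a finished row is not written again. -/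
theorem FilledTo.next {n m : ℕ} {g : ℕ → ℕ} (hg : ∀ i < n, ∀ i' < n, g i = g i' → i = i')
    {F old new new' : ℕ → ℕ → ℕ} {i j : ℕ} (hi : i < n) (hj : j < m)
    (h : FilledTo n m g F old new i j)
    (hnew : ∀ r c, new' r c = if r = g i ∧ c = j then F r c else new r c) :
    FilledTo n m g F old new' i (j + 1) := by
  refine ⟨fun i' hi' c hc => ?_, fun _ c hc => ?_, fun r c hrc => ?_⟩
  · rw [hnew, if_neg fun e => ?_, h.done i' hi' c hc]
    have := hg _ (by omega) _ hi e.1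
    omega
  · rw [hnew]
    split_ifs with e
    · rfl
    · exact h.cur hi c (by have : c ≠ j := fun e' => e ⟨rfl, e'⟩; omega)
  · rw [hnew, if_neg, h.rest r c (hrc.imp_right fun h' => ⟨h'.1, fun h1 h2 => by
      have := h'.2 h1 h2; omega⟩)]
    rintro ⟨rfl, rfl⟩
    rcases hrc with h' | h'
    · omega
    · have := h'.2 hi rfl
      omega

theorem FilledTo.row {n m : ℕ} {g : ℕ → ℕ}
    {F old new : ℕ → ℕ → ℕ} {i : ℕ} (hi : i < n) (h : FilledTo n m g F old new i m) :
    FilledTo n m g F old new (i + 1) 0 := by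
  refine ⟨fun i' hi' c hc => ?_, fun _ c hc => by omega, fun r c hrc => ?_⟩
  · rcases Nat.lt_succ_iff_lt_or_eq.1 hi' with h' | rfl
    · exact h.done i' h' c hc
    · exact h.cur hi c hc
  · refine h.rest r c ?_
    rcases hrc with h' | h'
    · exact .inl h'
    · exact .inr ⟨fun i' hi' => h'.1 i' (by omega), fun _ e => absurd e (h'.1 i (by omega))⟩

/-- Two nested loops that fill the rows `g 0, …, g (n - 1)` of the arrays in `AS`. -/
theorem fill_wp {cx : Ctx} {x n y m : ℕ} {p : Cmd} {σ : St} (g : ℕ → ℕ) (AS : List ℕ)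
    (F : ℕ → ℕ → ℕ → ℕ) (hg : ∀ i < cx.rho n, ∀ i' < cx.rho n, g i = g i' → i = i')
    (hn : σ.v n = cx.rho n) (hnW : cx.rho n < cx.W) (hm : σ.v m = cx.rho m)
    (hmW : cx.rho m < cx.W) (hx : x ∉ y :: p.mv) (hn' : n ∉ x :: y :: p.mv) (hy : y ∉ p.mv)
    (hm' : m ∉ x :: y :: p.mv)
    (hb : ∀ i < cx.rho n, ∀ j < cx.rho m, ∀ τ, Agree (for_ x n (for_ y m p)) σ τ → τ.v x = i →
      τ.v y = j → (∀ A ∈ AS, FilledTo (cx.rho n) (cx.rho m) g (F A) (σ.a A) (τ.a A) i j) →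
      p.wp cx (fun τ' => ∀ A ∈ AS, ∀ r c, τ'.a A r c =
        if r = g i ∧ c = j then F A r c else τ.a A r c) τ) :
    (for_ x n (for_ y m p)).wp cx (fun τ => ∀ A ∈ AS,
      (∀ i < cx.rho n, ∀ c < cx.rho m, τ.a A (g i) c = F A (g i) c) ∧
      ∀ r c, cx.rho m ≤ c ∨ (∀ i < cx.rho n, g i ≠ r) → τ.a A r c = σ.a A r c) σ := by
  rw [wp]
  refine ⟨⟨hn, hnW, by simpa using hx, by simpa using hn'⟩, fun i τ => ∀ A ∈ AS,
    FilledTo (cx.rho n) (cx.rho m) g (F A) (σ.a A) (τ.a A) i 0, ?_, ?_, ?_⟩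
  · exact fun A _ => ⟨fun _ h => by omega, fun _ _ h => by omega, fun _ _ _ => rfl⟩
  · intro i hi τ hA hτi hI
    have hmv : m ∉ (for_ x n (for_ y m p)).mv := by simpa using hm'
    rw [wp]
    refine ⟨⟨(hA.v m hmv).trans hm, hmW, hy, fun h => hm' (List.mem_cons_of_mem _ h)⟩,
      fun j υ => ∀ A ∈ AS, FilledTo (cx.rho n) (cx.rho m) g (F A) (σ.a A) (υ.a A) i j, hI, ?_, ?_⟩
    · intro j hj υ hB hυj hJ
      have hAυ : Agree (for_ x n (for_ y m p)) σ υ :=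
        hA.trans (hB.mono (by simp) (by simp) (by simp))
      refine wp_conseq _ (hb i hi j hj υ hAυ ((hB.v x (by simpa using hx)).trans hτi) hυj hJ) ?_
      exact fun υ' _ h A hAS => (hJ A hAS).next hg hi hj (h A hAS)
    · exact fun υ _ hJ A hAS => (hJ A hAS).row hi
  · intro τ _ hI A hAS
    refine ⟨(hI A hAS).done, fun r c hrc => (hI A hAS).rest r c (hrc.imp_right fun h => ⟨h, ?_⟩)⟩
    exact fun h' => absurd h' (lt_irrefl _)

/-- `keyBound k B` has the factor `16 * k`, so it strictly exceeds `8 * B ^ k * B ^ (k + 1)`; the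
overflow checks of the table programs reduce to such monomials. -/
theorem Env.lt_of_le_keyBound {cx : Ctx} {N1 N2 k B : ℕ} (hE : Env cx N1 N2 k B) {a : ℕ}
    (ha : a ≤ 8 * B ^ k * B ^ (k + 1)) : a < cx.W := by
  have hk := hE.hk
  have hB := hE.hB
  have hMW := hE.hMW
  have h1 : 0 < B ^ k * B ^ (k + 1) := by positivity
  have h2 : 8 * B ^ k * B ^ (k + 1) < keyBound k B := by
    unfold keyBound
    nlinarith
  have h3 := Nat.le_mul_self (keyBound k B)
  omega

/-- Powers of `B`. -/
def powCmd : Cmd :=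
  asg 21 (lit 1) ;; for_ 20 6 (wr 10 (lit 0) (var 20) (var 21) ;; asg 21 (.mul (var 21) (var 4)))

theorem powCmd_wp {cx : Ctx} {N1 N2 k B : ℕ} (hE : Env cx N1 N2 k B) {σ : St}
    (hc : Consts cx σ) : powCmd.wp cx (fun τ => ∀ e ≤ k, τ.a 10 0 e = B ^ e) σ := by
  have hB := hE.hB
  have hL := hE.hL
  have hLW := hE.hLW
  have hWd := hE.hWd
  have hWdW := hE.hWdW
  unfold powCmd
  rw [wp, wp, wp]
  refine ⟨by simp only [Exp.ok]; omega, ⟨hc 6 (by omega), by rw [hE.r6]; omega, by simp, by simp⟩,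
    fun e τ => τ.v 21 = B ^ e ∧ ∀ e' < e, τ.a 10 0 e' = B ^ e', ?_, ?_, ?_⟩
  · exact ⟨by simp, fun _ h => by omega⟩
  · rw [hE.r6]
    rintro e he τ hA hτe ⟨hI1, hI2⟩
    have h4 : τ.v 4 = B := by rw [hA.v 4 (by simp), St.setv_v, if_neg (by decide), hc 4 (by omega), hE.r4]
    have hW : B ^ (e + 1) < cx.W := hE.lt_of_le_keyBound (by
      have h1 : B ^ (e + 1) ≤ B ^ (k + 1) := Nat.pow_le_pow_right (by omega) (by omega)
      have h2 : B ^ (k + 1) ≤ 8 * B ^ k * B ^ (k + 1) :=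
        Nat.le_mul_of_pos_left _ (by have : 0 < B ^ k := Nat.pow_pos (by omega)
                                     omega)
      omega)
    simp only [wp, Exp.ok, Exp.eval, hτe, hI1, h4, true_and, St.setv_v, St.setv_a,
      St.seta_v, St.seta_a, Nat.reduceEqDiff, if_false, if_true]
    rw [← pow_succ]
    refine ⟨by omega, hW, rfl, fun e' he' => ?_⟩
    split_ifs with h
    · rw [h]
    · exact hI2 e' (by omega)
  · rw [hE.r6]
    exact fun τ _ hI e he => hI.2 e (by omega)

/-- The separator with index `j` of `u`. -/
def sepExp (u j : Exp) : Exp :=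
  .add (.mul (.div u (.rd 10 (lit 0) (.add (.div j (var 4)) (lit 1))))
    (.rd 10 (lit 0) (.add (.div j (var 4)) (lit 1))))
    (.mul (.mod j (var 4)) (.rd 10 (lit 0) (.div j (var 4))))

theorem sepExp_ok {cx : Ctx} {N1 N2 k B : ℕ} (hE : Env cx N1 N2 k B) {σ : St}
    (h4 : σ.v 4 = B) (hPW : ∀ e ≤ k, σ.a 10 0 e = B ^ e) {u j : Exp} (hu : u.ok cx σ)
    (hj : j.ok cx σ) (huB : u.eval σ < B ^ k) (hjB : j.eval σ < k * B) :
    (sepExp u j).ok cx σ ∧ (sepExp u j).eval σ = sepr B (u.eval σ) (j.eval σ) := by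
  have hB := hE.hB
  have hL := hE.hL
  have hLW := hE.hLW
  have hWd := hE.hWd
  have hWdW := hE.hWdW
  have he : j.eval σ / B < k := Nat.div_lt_of_lt_mul (by rwa [mul_comm])
  have hs := sepr_le hB huB hjB
  have hkB : k * B ≤ k * B * (k * B) := Nat.le_mul_self _
  have hpow : B ^ k ≤ B ^ k * B ^ (k + 1) := Nat.le_mul_of_pos_right _ (Nat.pow_pos (by omega))
  have hW : 2 * B ^ k < cx.W := hE.lt_of_le_keyBound (by nlinarith)
  unfold sepr at hs
  simp only [sepExp, Exp.ok, Exp.eval, h4, hPW _ he.le, hPW _ (show j.eval σ / B + 1 ≤ k from he), hu, hj,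
    true_and]
  refine ⟨by omega, rfl⟩

/-- A separator is never before the start of the enclosing block of `u`. If it is smaller than `u`,
then `u` is not that start and `u - 1` lies in the same block. -/
theorem sepr_pred {B u j : ℕ} (h : sepr B u j < u) : sepr B (u - 1) j = sepr B u j := by
  unfold sepr at h ⊢
  set P := B ^ (j / B + 1)
  have : (u - 1) / P = u / P := by
    rcases Nat.eq_zero_or_pos P with h0 | h0
    · simp [h0]
    apply le_antisymm (Nat.div_le_div_right (by omega))
    rw [Nat.le_div_iff_mul_le h0]
    omega
  rw [this]

/-- The digit is less than `B`, so the separator lies inside the enclosing block of `u`; if it is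
larger than `u`, then `u + 1` is still in that block. -/
theorem sepr_succ {B u j : ℕ} (hB : 2 ≤ B) (h : u < sepr B u j) :
    sepr B (u + 1) j = sepr B u j := by
  unfold sepr at h ⊢
  have h2 : j % B * B ^ (j / B) < B ^ (j / B + 1) := by
    rw [pow_succ, mul_comm]
    exact Nat.mul_lt_mul_of_pos_left (Nat.mod_lt _ (by omega)) (Nat.pow_pos (by omega))
  set P := B ^ (j / B + 1)
  have : (u + 1) / P = u / P := by
    apply le_antisymm _ (Nat.div_le_div_right (by omega))
    rw [← Nat.lt_succ_iff, Nat.div_lt_iff_lt_mul (by omega), Nat.succ_mul]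
    omega
  rw [this]

/-- Lowest common ancestors of the nodes and their separators, for separators `c ≤ u`. -/
def tabUpCmd : Cmd :=
  for_ 20 5 (for_ 21 7 (asg 22 (sepExp (var 20) (var 21)) ;;
    ite (.lt (var 20) (var 22)) skip (
    ite (.eq (var 20) (var 22)) (wr 11 (var 20) (var 21) (var 20)) (
      asg 23 (.rd 11 (.sub (var 20) (lit 1)) (var 21)) ;; asg 24 (.rd 9 (var 20) (lit 0)) ;;
      ite (.lt (var 23) (var 24)) (wr 11 (var 20) (var 21) (var 23))
        (wr 11 (var 20) (var 21) (var 24))))))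

/-- The same for separators `u < c`. -/
def tabDownCmd : Cmd :=
  for_ 20 5 (for_ 21 7 (asg 25 (.sub (var 2) (var 20)) ;; asg 22 (sepExp (var 25) (var 21)) ;;
    ite (.lt (var 25) (var 22)) (
      asg 23 (.rd 11 (.add (var 25) (lit 1)) (var 21)) ;;
      asg 24 (.rd 9 (.add (var 25) (lit 1)) (lit 0)) ;;
      ite (.lt (var 23) (var 24)) (wr 11 (var 25) (var 21) (var 23))
        (wr 11 (var 25) (var 21) (var 24))) skip))

/-- The positions `0, …, N` with their parents in array 9 are numbered in preorder. -/
structure Positions (N : ℕ) (σ : St) : Prop where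
  pre : Preorderly fun t => σ.a 9 t 0
  beyond : ∀ t, N < t → σ.a 9 t 0 = 0

/-- For a separator below `u` the entry of `u - 1` with the same index belongs to the same
separator, so `lc_succ` gives each entry in constant time from the row before. -/
theorem tabUpCmd_wp {cx : Ctx} {N1 N2 k B : ℕ} (hE : Env cx N1 N2 k B) {σ : St}
    (hc : Consts cx σ) (hPW : ∀ e ≤ k, σ.a 10 0 e = B ^ e)
    (h11 : ∀ r c, σ.a 11 r c = 0) :
    tabUpCmd.wp cx (fun τ => (∀ u ≤ N1 + N2, ∀ j < k * B, sepr B u j ≤ u →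
      τ.a 11 u j = lc (fun t => σ.a 9 t 0) u (sepr B u j)) ∧
      ∀ u j, N1 + N2 < u → τ.a 11 u j = 0) σ := by
  have hB := hE.hB
  have hL := hE.hL
  have hLW := hE.hLW
  have hWd := hE.hWd
  have hWdW := hE.hWdW
  have hP := hE.hP
  have hkB : k * B ≤ k * B * (k * B) := Nat.le_mul_self _
  unfold tabUpCmd
  refine wp_conseq _ (fill_wp id [11] (fun _ u j => if sepr B u j ≤ u then
      lc (fun t => σ.a 9 t 0) u (sepr B u j) else 0) (fun _ _ _ _ h => h) (hc 5 (by omega))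
      (by rw [hE.r5]; omega) (hc 7 (by omega)) (by rw [hE.r7]; omega) (by simp) (by simp)
      (by simp) (by simp) ?_) ?_
  · rw [hE.r5, hE.r7]
    intro i hi j hj τ hA hτi hτj hF
    replace hF := hF 11 (by simp)
    have h9 : τ.a 9 = σ.a 9 := hA.a 9 (by simp)
    have h10 : τ.a 10 = σ.a 10 := hA.a 10 (by simp)
    have h4 : τ.v 4 = B := by rw [hA.v 4 (by simp), hc 4 (by omega), hE.r4]
    obtain ⟨s1, s2⟩ := sepExp_ok hE h4 (by rwa [h10]) (u := var 20) (j := var 21) trivial trivial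
      (by rw [Exp.eval, hτi]; omega) (by rwa [Exp.eval, hτj])
    rw [Exp.eval, Exp.eval, hτi, hτj] at s2
    have hold : τ.a 11 i j = 0 :=
      (hF.rest i j (.inr ⟨fun i' hi' => by simp; omega, fun _ _ => le_rfl⟩)).trans (h11 _ _)
    simp only [wp, Tst.ok, Tst.holds, Exp.ok, Exp.eval, s1, s2, hτi, hτj, h9, true_and, and_true,
      St.setv_v, St.setv_a, St.seta_a, Nat.reduceEqDiff, if_false, if_true,
      List.mem_singleton, forall_eq, id]
    refine ⟨fun h r c => ?_, fun h => ⟨fun h' => ⟨by omega, fun r c => ?_⟩, fun h' => ?_⟩⟩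
    · split_ifs with e
      · obtain ⟨rfl, rfl⟩ := e
        omega
      · obtain ⟨rfl, rfl⟩ := e
        exact hold
      · rfl
    · split_ifs with e
      · obtain ⟨rfl, rfl⟩ := e
        rw [← h', lc_self]
      · obtain ⟨rfl, rfl⟩ := e
        omega
      · rfl
    · have hsu : sepr B i j < i := by omega
      have hpred := sepr_pred hsu
      have hprev : τ.a 11 (i - 1) j = lc (fun t => σ.a 9 t 0) (i - 1) (sepr B i j) := by
        have := hF.done (i - 1) (by omega) j hj
        simp only [id] at this
        rw [this, hpred, if_pos (by omega)]
      have hlc : lc (fun t => σ.a 9 t 0) i (sepr B i j) =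
          min (τ.a 11 (i - 1) j) (σ.a 9 i 0) := by
        rw [hprev, lc_comm, lc_comm _ (i - 1)]
        have := lc_succ (fun t => σ.a 9 t 0) (p := sepr B i j) (q := i - 1) (by omega)
        rwa [show i - 1 + 1 = i by omega] at this
      refine ⟨by omega, by omega, fun h'' => ⟨by omega, fun r c => ?_⟩,
        fun h'' => ⟨by omega, fun r c => ?_⟩⟩
      all_goals
        split_ifs with e
        · obtain ⟨rfl, rfl⟩ := e
          rw [hlc]
          omega
        · obtain ⟨rfl, rfl⟩ := e
          omega
        · rfl
  · rw [hE.r5, hE.r7]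
    intro τ _ h
    obtain ⟨h1, h2⟩ := h 11 (by simp)
    refine ⟨fun u hu j hj hs => ?_, fun u j hu => ?_⟩
    · have := h1 u (by omega) j hj
      simp only [id] at this
      rw [this, if_pos hs]
    · rw [h2 u j (.inr fun i hi => by simp; omega), h11]

/-- The mirror image with `lc_pred`, in descending order of `u`. Separators may lie beyond the last
node; there the parents are `0` and the row behind the last one is `0`, which agrees with the value
of `lc` across the end. -/
theorem tabDownCmd_wp {cx : Ctx} {N1 N2 k B : ℕ} (hE : Env cx N1 N2 k B) {σ : St}
    (hc : Consts cx σ) (hPW : ∀ e ≤ k, σ.a 10 0 e = B ^ e) (hp : Positions (N1 + N2) σ)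
    (h11 : ∀ u ≤ N1 + N2, ∀ j < k * B, sepr B u j ≤ u →
      σ.a 11 u j = lc (fun t => σ.a 9 t 0) u (sepr B u j))
    (h11' : ∀ u j, N1 + N2 < u → σ.a 11 u j = 0) :
    tabDownCmd.wp cx (fun τ => ∀ u ≤ N1 + N2, ∀ j < k * B,
      τ.a 11 u j = lc (fun t => σ.a 9 t 0) u (sepr B u j)) σ := by
  have hB := hE.hB
  have hL := hE.hL
  have hLW := hE.hLW
  have hWd := hE.hWd
  have hWdW := hE.hWdW
  have hP := hE.hP
  have hkB : k * B ≤ k * B * (k * B) := Nat.le_mul_self _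
  unfold tabDownCmd
  refine wp_conseq _ (fill_wp (fun i => N1 + N2 - i) [11] (fun _ u j =>
      lc (fun t => σ.a 9 t 0) u (sepr B u j)) ?_ (hc 5 (by omega))
      (by rw [hE.r5]; omega) (hc 7 (by omega)) (by rw [hE.r7]; omega) (by simp) (by simp)
      (by simp) (by simp) ?_) ?_
  · rw [hE.r5]
    intro i hi i' hi' h
    omega
  · rw [hE.r5, hE.r7]
    intro i hi j hj τ hA hτi hτj hF
    replace hF := hF 11 (by simp)
    have h9 : τ.a 9 = σ.a 9 := hA.a 9 (by simp)
    have h10 : τ.a 10 = σ.a 10 := hA.a 10 (by simp)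
    have h4 : τ.v 4 = B := by rw [hA.v 4 (by simp), hc 4 (by omega), hE.r4]
    have h2 : τ.v 2 = N1 + N2 := by rw [hA.v 2 (by simp), hc 2 (by omega), hE.r2]
    have hue : ∃ u, u = N1 + N2 - i := ⟨_, rfl⟩
    obtain ⟨u, hu⟩ := hue
    obtain ⟨s1, s2⟩ := sepExp_ok hE (σ := τ.setv 25 u) (by simp [h4]) (by simpa [h10] using hPW)
      (u := var 25) (j := var 21) trivial trivial
      (by simp; omega) (by simpa [hτj] using hj)
    simp only [Exp.eval, St.setv_v, hτj, Nat.reduceEqDiff, if_false, if_true] at s2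
    have hold : τ.a 11 u j = σ.a 11 u j :=
      hF.rest u j (.inr ⟨fun i' hi' => by omega, fun _ _ => le_rfl⟩)
    simp only [wp, Tst.ok, Tst.holds, Exp.ok, Exp.eval, hτi, h2, ← hu, s1, s2, hτj, h9, true_and,
      and_true, St.setv_v, St.setv_a, St.seta_a, Nat.reduceEqDiff, if_false, if_true,
      List.mem_singleton, forall_eq]
    refine ⟨by omega, fun h => ?_, fun h r c => ?_⟩
    · have hnext : τ.a 11 (u + 1) j = if u < N1 + N2 then
          lc (fun t => σ.a 9 t 0) (u + 1) (sepr B u j) else 0 := by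
        split_ifs with h'
        · have := hF.done (i - 1) (by omega) j hj
          rw [show N1 + N2 - (i - 1) = u + 1 by omega] at this
          rw [this, sepr_succ hB h]
        · rw [hF.rest (u + 1) j (.inr ⟨fun i' hi' => by omega, fun _ h => by omega⟩)]
          exact h11' _ _ (by omega)
      have hlc : lc (fun t => σ.a 9 t 0) u (sepr B u j) =
          min (τ.a 11 (u + 1) j) (σ.a 9 (u + 1) 0) := by
        rw [hp.pre.lc_pred h, hnext]
        split_ifs with h'
        · rfl
        · rw [hp.beyond (u + 1) (by omega)]
          simp
      refine ⟨by omega, by omega, fun h'' => ⟨by omega, fun r c => ?_⟩,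
        fun h'' => ⟨by omega, fun r c => ?_⟩⟩
      all_goals
        split_ifs with e
        · obtain ⟨rfl, rfl⟩ := e
          rw [hlc]
          omega
        · rfl
    · split_ifs with e
      · obtain ⟨rfl, rfl⟩ := e
        rw [hold]
        exact h11 _ (by omega) _ hj (by omega)
      · rfl
  · rw [hE.r5, hE.r7]
    intro τ _ h u hu j hj
    have := (h 11 (by simp)).1 (N1 + N2 - u) (by omega) j hj
    rwa [show N1 + N2 - (N1 + N2 - u) = u by omega] at this

end HIA

namespace HIA

open Cmd Exp

/-! ### Entries of the nodes -/

theorem Env.pow_lt {cx : Ctx} {N1 N2 k B : ℕ} (hE : Env cx N1 N2 k B) : B ^ (k + 1) < cx.W := by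
  have hB := hE.hB
  refine hE.lt_of_le_keyBound (Nat.le_mul_of_pos_left _ ?_)
  have : 0 < B ^ k := Nat.pow_pos (by omega)
  omega

/-- Computes the type (variable 28) and the node (variable 29) of an insertion entry for the
ancestor in variable 24, with block size in variable 26 and number in variable 27. -/
def insTypCmd : Cmd :=
  ite (.le (var 24) (.mul (var 27) (var 26))) (asg 28 (lit 1) ;; asg 29 (var 24)) (asg 29 (lit 0) ;;
    ite (.le (.mul (.add (var 27) (lit 1)) (var 26)) (var 24)) (asg 28 (lit 0)) (asg 28 (lit 2)))

theorem insTypCmd_wp {cx : Ctx} {N1 N2 k B : ℕ} (hE : Env cx N1 N2 k B) {σ : St} {a j2 : ℕ}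
    (ha : a < B ^ k) (hj : j2 < k * B)
    (h24 : σ.v 24 = a) (h26 : σ.v 26 = B ^ (j2 / B)) (h27 : σ.v 27 = insNum B a j2) :
    insTypCmd.wp cx (fun τ => τ.v 28 = insTyp B a j2 ∧
      τ.v 29 = if insTyp B a j2 = 1 then a else 0) σ := by
  have hB := hE.hB
  have hL := hE.hL
  have hLW := hE.hLW
  have hlt := insNum_lt (j2 := j2) hE.hk hB ha
  have h2 : B ^ (j2 / B) ≤ B ^ k := Nat.pow_le_pow_right (by omega)
    (Nat.div_lt_of_lt_mul (by rwa [mul_comm])).le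
  have h3 : (insNum B a j2 + 1) * B ^ (j2 / B) ≤ B ^ (k + 1) * B ^ k := Nat.mul_le_mul hlt h2
  have h4 : insNum B a j2 * B ^ (j2 / B) ≤ (insNum B a j2 + 1) * B ^ (j2 / B) :=
    Nat.mul_le_mul_right _ (Nat.le_succ _)
  have h5 : B ^ (k + 1) ≤ B ^ (k + 1) * B ^ k := Nat.le_mul_of_pos_right _ (Nat.pow_pos (by omega))
  have h6 : B ^ (k + 1) * B ^ k < cx.W := hE.lt_of_le_keyBound (by nlinarith)
  unfold insTypCmd
  simp only [wp, Tst.ok, Tst.holds, Exp.ok, Exp.eval, h24, h26, h27, true_and, and_true, St.setv_v,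
    Nat.reduceEqDiff, if_false, if_true]
  refine ⟨by omega, fun h => ⟨by omega, ?_⟩, fun h => ⟨by omega, by omega, fun h' => ⟨by omega, ?_⟩,
    fun h' => ⟨by omega, ?_⟩⟩⟩
  · unfold insTyp
    rw [if_pos h]
    simp
  · unfold insTyp
    rw [if_neg h, if_pos h']
    simp
  · unfold insTyp
    rw [if_neg h, if_neg h']
    simp

/-- The key of separator `c`, type `t`, level `f` and number `m`. -/
def keyExp (c t f m : Exp) : Exp :=
  .add (.mul (.add (.mul (.add (.mul c (lit 3)) t) (var 3)) f) (var 12)) m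

/-- The multipliers `3`, `k` and `B ^ (k + 1)` are positive, so all intermediate results are at most
the key itself, which does not overflow. -/
theorem keyExp_ok {cx : Ctx} {N1 N2 k B : ℕ} (hE : Env cx N1 N2 k B) {σ : St}
    (h3 : σ.v 3 = k) (h12 : σ.v 12 = B ^ (k + 1)) {c t f m : Exp} (hc : c.ok cx σ) (ht : t.ok cx σ)
    (hf : f.ok cx σ) (hm : m.ok cx σ) (hc' : c.eval σ < 2 * B ^ k) (ht' : t.eval σ < 3)
    (hf' : f.eval σ < k) (hm' : m.eval σ < B ^ (k + 1)) :
    (keyExp c t f m).ok cx σ ∧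
      (keyExp c t f m).eval σ = packKey k B (c.eval σ) (t.eval σ) (f.eval σ) (m.eval σ) := by
  have hMW := hE.hMW
  have hB := hE.hB
  have hk := hE.hk
  have hlt := packKey_lt hB hc' ht' hf' hm'
  have h1 := Nat.le_mul_self (keyBound k B)
  have hW : packKey k B (c.eval σ) (t.eval σ) (f.eval σ) (m.eval σ) < cx.W := by
    unfold keyBound at h1 hMW
    omega
  unfold packKey at hW
  have h2 : (c.eval σ * 3 + t.eval σ) * k + f.eval σ ≤
      ((c.eval σ * 3 + t.eval σ) * k + f.eval σ) * B ^ (k + 1) :=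
    Nat.le_mul_of_pos_right _ (Nat.pow_pos (by omega))
  have h3' : c.eval σ * 3 + t.eval σ ≤ (c.eval σ * 3 + t.eval σ) * k :=
    Nat.le_mul_of_pos_right _ hk
  have hL := hE.hL
  have hLW := hE.hLW
  simp only [keyExp, Exp.ok, Exp.eval, h3, h12, hc, ht, hf, hm, true_and]
  exact ⟨by omega, rfl⟩

/-- The entries for insertion. -/
def insTabCmd : Cmd :=
  for_ 20 5 (for_ 21 8 (asg 22 (.div (var 21) (var 7)) ;; asg 23 (.mod (var 21) (var 7)) ;;
    asg 33 (sepExp (var 20) (var 22)) ;; asg 24 (.rd 11 (var 20) (var 22)) ;;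
    asg 25 (.div (var 23) (var 4)) ;; asg 26 (.rd 10 (lit 0) (var 25)) ;;
    asg 27 (.add (.mul (.div (var 24) (.rd 10 (lit 0) (.add (var 25) (lit 1)))) (var 4))
      (.mod (var 23) (var 4))) ;;
    insTypCmd ;; wr 12 (var 20) (var 21) (keyExp (var 33) (var 28) (var 25) (var 27)) ;;
    wr 13 (var 20) (var 21) (var 29)))

/-- The lowest common ancestor with the separator is a table entry, so each of the `(k * B) ^ 2`
entries of a node costs constant time. -/
theorem insTabCmd_wp {cx : Ctx} {N1 N2 k B : ℕ} (hE : Env cx N1 N2 k B) {σ : St}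
    (hc : Consts cx σ) (hPW : ∀ e ≤ k, σ.a 10 0 e = B ^ e) {par : ℕ → ℕ} (hp : Preorderly par)
    (h11 : ∀ u ≤ N1 + N2, ∀ j < k * B, σ.a 11 u j = lc par u (sepr B u j)) :
    insTabCmd.wp cx (fun τ => ∀ u ≤ N1 + N2, ∀ j < (k * B) * (k * B),
      τ.a 12 u j = insKey k B par u j ∧ τ.a 13 u j = insNode k B par u j) σ := by
  have hB := hE.hB
  have hk := hE.hk
  have hL := hE.hL
  have hLW := hE.hLW
  have hWd := hE.hWd
  have hWdW := hE.hWdW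
  have hP := hE.hP
  have hkB : k * B ≤ k * B * (k * B) := Nat.le_mul_self _
  have hkB0 : 0 < k * B := Nat.mul_pos hk (by omega)
  unfold insTabCmd
  refine wp_conseq _ (fill_wp id [12, 13] (fun A u j => if A = 12 then insKey k B par u j else
      insNode k B par u j) (fun _ _ _ _ h => h) (hc 5 (by omega))
      (by rw [hE.r5]; omega) (hc 8 (by omega)) (by rw [hE.r8]; omega) (by simp [insTypCmd])
      (by simp [insTypCmd]) (by simp [insTypCmd]) (by simp [insTypCmd]) ?_) ?_
  · rw [hE.r5, hE.r8]
    intro i hi j hj τ hA hτi hτj _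
    have hτv : ∀ x < 16, τ.v x = cx.rho x := fun x hx => by
      rw [hA.v x (by simp [insTypCmd]; omega), hc x hx]
    have h10 : τ.a 10 = σ.a 10 := hA.a 10 (by simp [insTypCmd])
    have h11t : τ.a 11 = σ.a 11 := hA.a 11 (by simp [insTypCmd])
    have h4 : τ.v 4 = B := by rw [hτv 4 (by omega), hE.r4]
    have h7 : τ.v 7 = k * B := by rw [hτv 7 (by omega), hE.r7]
    have hj1 : j / (k * B) < k * B := Nat.div_lt_of_lt_mul hj
    have hj2 : j % (k * B) < k * B := Nat.mod_lt _ hkB0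
    have hf : j % (k * B) / B < k := Nat.div_lt_of_lt_mul (by rw [mul_comm B]; exact hj2)
    obtain ⟨s1, s2⟩ := sepExp_ok hE (σ := (τ.setv 22 (j / (k * B))).setv 23 (j % (k * B)))
      (by simp [h4]) (by simpa [h10] using hPW) (u := var 20) (j := var 22) trivial trivial
      (by simp [hτi]; omega) (by simpa using hj1)
    simp only [Exp.eval, St.setv_v, hτi, Nat.reduceEqDiff, if_false, if_true] at s2
    have hlt := hp.lc_lt (c := sepr B i (j / (k * B))) (show i < B ^ k by omega)
    have hnum := insNum_lt (j2 := j % (k * B)) hk hB hlt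
    have hnumW : B ^ (k + 1) < cx.W := hE.pow_lt
    have hpk : B ^ k ≤ B ^ (k + 1) := Nat.pow_le_pow_right (by omega) (by omega)
    simp only [wp, Exp.ok, Exp.eval, hτi, h7, s1, s2, hτj, h4, h10, h11t,
      h11 i (by omega) _ hj1, hPW _ hf.le, hPW _ (show j % (k * B) / B + 1 ≤ k from hf), true_and,
      St.setv_v, St.setv_a, Nat.reduceEqDiff, if_false, if_true]
    generalize hae : lc par i (sepr B i (j / (k * B))) = a at hlt hnum ⊢
    unfold insNum at hnum
    refine ⟨by omega, by omega, by omega, by omega, by omega, by omega, ?_⟩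
    refine wp_conseq _ (insTypCmd_wp hE (a := a) (j2 := j % (k * B)) hlt hj2 (by simp) (by simp)
      (by simp [insNum])) ?_
    rintro υ hυ ⟨h28, h29⟩
    have u33 : υ.v 33 = sepr B i (j / (k * B)) := by rw [hυ.v 33 (by simp [insTypCmd])]; simp
    have u25 : υ.v 25 = j % (k * B) / B := by rw [hυ.v 25 (by simp [insTypCmd])]; simp
    have u27 : υ.v 27 = insNum B a (j % (k * B)) := by
      rw [hυ.v 27 (by simp [insTypCmd])]; simp [insNum]
    have u20 : υ.v 20 = i := by rw [hυ.v 20 (by simp [insTypCmd])]; simp [hτi]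
    have u21 : υ.v 21 = j := by rw [hυ.v 21 (by simp [insTypCmd])]; simp [hτj]
    have u3 : υ.v 3 = k := by
      rw [hυ.v 3 (by simp [insTypCmd])]; simp [hτv 3, hE.r3]
    have u12 : υ.v 12 = B ^ (k + 1) := by
      rw [hυ.v 12 (by simp [insTypCmd])]; simp [hτv 12, hE.r12]
    have ua : ∀ A, υ.a A = τ.a A := fun A => by rw [hυ.a A (by simp [insTypCmd])]; rfl
    obtain ⟨k1, k2⟩ := keyExp_ok hE (σ := υ) u3 u12 (c := var 33) (t := var 28) (f := var 25)
      (m := var 27) trivial trivial trivial trivial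
      (by rw [Exp.eval, u33]; exact sepr_le hB (by omega) hj1)
      (by rw [Exp.eval, h28]; exact insTyp_lt _ _ _) (by rwa [Exp.eval, u25])
      (by rw [Exp.eval, u27]; unfold insNum; exact hnum)
    simp only [Exp.eval, u33, h28, u25, u27] at k2
    simp only [k1, k2, u20, u21, h29, true_and, St.seta_v, St.seta_a, List.mem_cons,
      List.not_mem_nil, or_false, forall_eq_or_imp, forall_eq, Nat.reduceEqDiff, false_and,
      if_false, if_true, id, ua]
    refine ⟨by omega, by omega, fun r c => ?_, fun r c => ?_⟩
    · split_ifs with e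
      · obtain ⟨rfl, rfl⟩ := e
        rw [insKey, hae]
      · rfl
    · by_cases e : r = i ∧ c = j
      · rw [if_pos e, if_pos e]
        obtain ⟨rfl, rfl⟩ := e
        rw [insNode, hae]
      · rw [if_neg e, if_neg e]
  · rw [hE.r5, hE.r8]
    intro τ _ h u hu j hj
    have h1 := (h 12 (by simp)).1 u (by omega) j hj
    have h2 := (h 13 (by simp)).1 u (by omega) j hj
    exact ⟨by simpa using h1, by simpa using h2⟩

/-- Computes the index (variable 26) of the separator of a query entry. -/
def qrySepCmd : Cmd :=
  asg 24 (.div (var 22) (lit 2)) ;; asg 25 (.mod (.div (var 20) (.rd 10 (lit 0) (var 24))) (var 4)) ;;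
  ite (.eq (.mod (var 22) (lit 2)) (lit 1))
    (ite (.lt (.add (var 25) (lit 1)) (var 4)) (asg 25 (.add (var 25) (lit 1))) skip) skip ;;
  asg 26 (.add (.mul (var 24) (var 4)) (var 25))

theorem qrySepCmd_wp {cx : Ctx} {N1 N2 k B : ℕ} (hE : Env cx N1 N2 k B) {σ : St}
    (hPW : ∀ e ≤ k, σ.a 10 0 e = B ^ e) {u j1 : ℕ} (h4 : σ.v 4 = B) (hu : u < B ^ k)
    (hj : j1 < 2 * k) (h20 : σ.v 20 = u) (h22 : σ.v 22 = j1) :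
    qrySepCmd.wp cx (fun τ => τ.v 26 = qrySep B u j1) σ := by
  have hB := hE.hB
  have hL := hE.hL
  have hLW := hE.hLW
  have hWd := hE.hWd
  have hWdW := hE.hWdW
  have hkB : k * B ≤ k * B * (k * B) := Nat.le_mul_self _
  have hk2 : 2 * k ≤ 2 * k * (2 * k) := Nat.le_mul_self _
  have hf : j1 / 2 < k := by omega
  have hlt := Nat.mod_lt (u / B ^ (j1 / 2)) (show 0 < B by omega)
  have hdiv : u / B ^ (j1 / 2) ≤ u := Nat.div_le_self _ _
  have hs := encode_lt (k := k) (B := B) hf (show B - 1 < B by omega)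
  have hpk : B ^ k < B ^ (k + 1) := Nat.pow_lt_pow_right (by omega) (by omega)
  have hpW := hE.pow_lt
  unfold qrySepCmd
  simp only [wp, Tst.ok, Tst.holds, Exp.ok, Exp.eval, h20, h22, h4, hPW _ hf.le, true_and,
    and_true, St.setv_v, St.setv_a, Nat.reduceEqDiff, if_false, if_true, Nat.reduceLT]
  unfold qrySep
  refine ⟨by omega, by omega, by omega, fun h => ⟨by omega, fun h' => ⟨by omega, by omega, ?_⟩,
    fun h' => ⟨by omega, ?_⟩⟩, fun h => ⟨by omega, ?_⟩⟩
  · rw [if_pos ⟨h, h'⟩]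
  · rw [if_neg (fun e => h' e.2)]
  · rw [if_neg (fun e => h e.1)]

/-- The entries for queries. -/
def qryTabCmd : Cmd :=
  for_ 20 5 (for_ 21 9 (asg 22 (.div (var 21) (var 13)) ;; asg 23 (.mod (var 21) (var 13)) ;;
    qrySepCmd ;; asg 33 (sepExp (var 20) (var 26)) ;; asg 27 (.rd 11 (var 20) (var 26)) ;;
    asg 28 (.mod (var 23) (lit 2)) ;; asg 29 (.div (var 23) (lit 2)) ;;
    wr 14 (var 20) (var 21) (keyExp (var 33) (var 28) (var 29)
      (.div (var 27) (.rd 10 (lit 0) (var 29)))) ;;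
    ite (.eq (var 28) (lit 0)) (wr 15 (var 20) (var 21) (var 27))
      (wr 15 (var 20) (var 21) (lit 0))))

set_option maxHeartbeats 400000 in
theorem qryTabCmd_wp {cx : Ctx} {N1 N2 k B : ℕ} (hE : Env cx N1 N2 k B) {σ : St}
    (hc : Consts cx σ) (hPW : ∀ e ≤ k, σ.a 10 0 e = B ^ e) {par : ℕ → ℕ} (hp : Preorderly par)
    (h11 : ∀ u ≤ N1 + N2, ∀ j < k * B, σ.a 11 u j = lc par u (sepr B u j)) :
    qryTabCmd.wp cx (fun τ => ∀ u ≤ N1 + N2, ∀ j < (2 * k) * (2 * k),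
      τ.a 14 u j = qryKey k B par u j ∧ τ.a 15 u j = qryNode k B par u j) σ := by
  have hB := hE.hB
  have hk := hE.hk
  have hL := hE.hL
  have hLW := hE.hLW
  have hWd := hE.hWd
  have hWdW := hE.hWdW
  have hP := hE.hP
  have hkB : k * B ≤ k * B * (k * B) := Nat.le_mul_self _
  have hk2 : 2 * k ≤ 2 * k * (2 * k) := Nat.le_mul_self _
  unfold qryTabCmd
  refine wp_conseq _ (fill_wp id [14, 15] (fun A u j => if A = 14 then qryKey k B par u j else
      qryNode k B par u j) (fun _ _ _ _ h => h) (hc 5 (by omega))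
      (by rw [hE.r5]; omega) (hc 9 (by omega)) (by rw [hE.r9]; omega) (by simp [qrySepCmd])
      (by simp [qrySepCmd]) (by simp [qrySepCmd]) (by simp [qrySepCmd]) ?_) ?_
  · rw [hE.r5, hE.r9]
    intro i hi j hj τ hA hτi hτj _
    have hτv : ∀ x < 16, τ.v x = cx.rho x := fun x hx => by
      rw [hA.v x (by simp [qrySepCmd]; omega), hc x hx]
    have h10 : τ.a 10 = σ.a 10 := hA.a 10 (by simp [qrySepCmd])
    have h11t : τ.a 11 = σ.a 11 := hA.a 11 (by simp [qrySepCmd])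
    have h4 : τ.v 4 = B := by rw [hτv 4 (by omega), hE.r4]
    have h13 : τ.v 13 = 2 * k := by rw [hτv 13 (by omega), hE.r13]
    have hj1 : j / (2 * k) < 2 * k := Nat.div_lt_of_lt_mul hj
    have hj2 : j % (2 * k) < 2 * k := Nat.mod_lt _ (by omega)
    have hf : j % (2 * k) / 2 < k := by omega
    rw [wp, wp, wp, wp]
    simp only [Exp.ok, Exp.eval, hτj, h13, St.setv_v, Nat.reduceEqDiff, if_false, true_and]
    rw [wp]
    refine ⟨by omega, by omega, wp_conseq _ (qrySepCmd_wp hE (u := i) (j1 := j / (2 * k))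
      (by simpa [h10] using hPW) (by simp [h4]) (by omega) hj1 (by simp [hτi]) (by simp)) ?_⟩
    intro υ hυ h26
    have u20 : υ.v 20 = i := by rw [hυ.v 20 (by simp [qrySepCmd])]; simp [hτi]
    have u21 : υ.v 21 = j := by rw [hυ.v 21 (by simp [qrySepCmd])]; simp [hτj]
    have u23 : υ.v 23 = j % (2 * k) := by rw [hυ.v 23 (by simp [qrySepCmd])]; simp
    have u3 : υ.v 3 = k := by
      rw [hυ.v 3 (by simp [qrySepCmd])]; simp [hτv 3, hE.r3]
    have u4 : υ.v 4 = B := by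
      rw [hυ.v 4 (by simp [qrySepCmd])]; simp [h4]
    have u12 : υ.v 12 = B ^ (k + 1) := by
      rw [hυ.v 12 (by simp [qrySepCmd])]; simp [hτv 12, hE.r12]
    have ua : ∀ A, υ.a A = τ.a A := fun A => by rw [hυ.a A (by simp [qrySepCmd])]; rfl
    have hs := qrySep_lt (u := i) hB hj1
    obtain ⟨s1, s2⟩ := sepExp_ok hE (σ := υ) u4 (by rw [ua, h10]; exact hPW) (u := var 20)
      (j := var 26) trivial trivial (by rw [Exp.eval, u20]; omega) (by rwa [Exp.eval, h26])
    simp only [Exp.eval, u20, h26] at s2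
    have hlt := hp.lc_lt (c := sepr B i (qrySep B i (j / (2 * k)))) (show i < B ^ k by omega)
    generalize hq : qrySep B i (j / (2 * k)) = q at hs s1 s2 h26 hlt
    generalize hal : lc par i (sepr B i q) = al at hlt
    have hpk : B ^ k < B ^ (k + 1) := Nat.pow_lt_pow_right (by omega) (by omega)
    have hpW := hE.pow_lt
    have hdl : al / B ^ (j % (2 * k) / 2) ≤ al := Nat.div_le_self _ _
    have ha : σ.a 11 i q = al := by rw [h11 i (by omega) q hs, hal]
    obtain ⟨k1, k2⟩ := keyExp_ok hE (σ := ((((υ.setv 33 (sepr B i q)).setv 27 al).setv 28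
      (j % (2 * k) % 2)).setv 29 (j % (2 * k) / 2))) (by simp [u3]) (by simp [u12]) (c := var 33)
      (t := var 28) (f := var 29) (m := .div (var 27) (.rd 10 (lit 0) (var 29)))
      trivial trivial trivial (by simp; omega) (by simpa using sepr_le hB (by omega) hs)
      (by simp; omega) (by simpa using hf)
      (by simp [ua, h10, hPW _ hf.le]; omega)
    simp only [Exp.eval, St.setv_v, St.setv_a, Nat.reduceEqDiff, if_false, if_true, ua, h10,
      hPW _ hf.le] at k2
    simp only [wp, Tst.ok, Tst.holds, Exp.ok, Exp.eval, s1, s2, u20, u21, u23, h26, ua, h11t, ha,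
      k1, k2, true_and, St.setv_v, St.setv_a, St.seta_v, St.seta_a, Nat.reduceEqDiff,
      if_false, if_true, List.mem_cons, List.not_mem_nil, or_false, forall_eq_or_imp, forall_eq,
      false_and, id, Nat.reduceLT]
    refine ⟨by omega, by omega, by omega, by omega, by omega, fun h => ⟨by omega, fun r c => ?_,
      fun r c => ?_⟩, fun h => ⟨by omega, fun r c => ?_, fun r c => ?_⟩⟩
    all_goals
      by_cases e : r = i ∧ c = j
      · rw [if_pos e, if_pos e]
        obtain ⟨rfl, rfl⟩ := e
        simp only [qryKey, qryNode, hq, hal, h, if_true, if_false]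
      · rw [if_neg e, if_neg e]
  · rw [hE.r5, hE.r9]
    intro τ _ h u hu j hj
    have h1 := (h 14 (by simp)).1 u (by omega) j hj
    have h2 := (h 15 (by simp)).1 u (by omega) j hj
    exact ⟨by simpa using h1, by simpa using h2⟩

end HIA

namespace HIA

open Cmd Exp

/-! ### A trie on the digits of the keys -/

/-- The node that is reached from node `1` by the last `d` digits of `K`; node `0` stands for a
missing node. -/
def trieAt (B : ℕ) (ch : ℕ → ℕ → ℕ) (K : ℕ) : ℕ → ℕ
  | 0 => 1
  | d + 1 => ch (trieAt B ch K d) (K / B ^ d % B)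

/-- `ch` holds the children of the nodes of a trie with nodes `1, …, cnt`. -/
structure Trie (ch : ℕ → ℕ → ℕ) (cnt : ℕ) : Prop where
  pos : 1 ≤ cnt
  le : ∀ v g, ch v g ≤ cnt
  zero : ∀ g, ch 0 g = 0
  -- A node has at most one incoming edge. Nothing is required of the root `1`, because paths are
  -- compared only at equal depth.
  inj : ∀ v g v' g', ch v g = ch v' g' → ch v g ≠ 0 → v = v' ∧ g = g'

namespace Trie

variable {B cnt : ℕ} {ch : ℕ → ℕ → ℕ}

theorem trieAt_le (h : Trie ch cnt) (K d : ℕ) : trieAt B ch K d ≤ cnt := by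
  cases d with
  | zero => exact h.pos
  | succ d => exact h.le _ _

theorem trieAt_ne (h : Trie ch cnt) {K d : ℕ} (hd : trieAt B ch K (d + 1) ≠ 0) :
    trieAt B ch K d ≠ 0 := fun h0 => hd (by rw [trieAt, h0, h.zero])

/-- Walking back along the unique incoming edges recovers the digits. -/
theorem trieAt_inj (h : Trie ch cnt) {K K' : ℕ} {d : ℕ} (he : trieAt B ch K d = trieAt B ch K' d)
    (h0 : trieAt B ch K d ≠ 0) : K % B ^ d = K' % B ^ d := by
  induction d with
  | zero => simp [Nat.mod_one]
  | succ d ih =>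
    obtain ⟨h1, h2⟩ := h.inj _ _ _ _ he h0
    rw [Nat.mod_pow_succ, Nat.mod_pow_succ, h2, ih h1 (h.trieAt_ne h0)]

/-- Existing edges are kept, and a nonzero end means that every node on the path existed. -/
theorem trieAt_ext (h : Trie ch cnt) {ch' : ℕ → ℕ → ℕ} (he : ∀ v g, ch v g ≠ 0 → ch' v g = ch v g)
    {K d : ℕ} (h0 : trieAt B ch K d ≠ 0) : trieAt B ch' K d = trieAt B ch K d := by
  induction d with
  | zero => rfl
  | succ d ih => rw [trieAt, ih (h.trieAt_ne h0), he _ _ h0, trieAt]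

theorem insert (h : Trie ch cnt) {ch' : ℕ → ℕ → ℕ} {v g : ℕ} (hv : v ≠ 0)
    (hch' : ∀ v' g', ch' v' g' = if v' = v ∧ g' = g then cnt + 1 else ch v' g') :
    Trie ch' (cnt + 1) := by
  refine ⟨by omega, fun v' g' => ?_, fun g' => ?_, fun v₁ g₁ v₂ g₂ => ?_⟩
  · have := h.le v' g'
    rw [hch']
    split_ifs <;> omega
  · rw [hch', if_neg (fun e => hv e.1.symm), h.zero]
  · have h1 := h.le v₁ g₁
    have h2 := h.le v₂ g₂
    rw [hch', hch']
    split_ifs with e1 e2 e2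
    · exact fun _ _ => ⟨e1.1.trans e2.1.symm, e1.2.trans e2.2.symm⟩
    · intro e; omega
    · intro e; omega
    · exact h.inj _ _ _ _

end Trie

/-- The trie of depth `D` with the values `val` is a dictionary of the pairs that are related to a
key by `I`: it holds a heaviest pair for each key. -/
structure Dict (B D : ℕ) (pw : ℕ → ℤ) (ch val : ℕ → ℕ → ℕ) (I : ℕ → ℕ → ℕ → Prop) : Prop where
  -- Nodes with a value are ends of full-length paths. This keeps values from being seen by foreign
  -- keys when the trie grows, and makes node `0` empty.
  used : ∀ v, val v 0 ≠ 0 → v ≠ 0 ∧ ∃ K < B ^ D, trieAt B ch K D = v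
  none : ∀ K < B ^ D, val (trieAt B ch K D) 0 = 0 → ∀ s₁ s₂, ¬ I K s₁ s₂
  mem : ∀ K < B ^ D, val (trieAt B ch K D) 0 ≠ 0 →
    I K (val (trieAt B ch K D) 1) (val (trieAt B ch K D) 2)
  le : ∀ K < B ^ D, val (trieAt B ch K D) 0 ≠ 0 → ∀ s₁ s₂, I K s₁ s₂ →
    pw s₁ + pw s₂ ≤ pw (val (trieAt B ch K D) 1) + pw (val (trieAt B ch K D) 2)

namespace Dict

variable {B D cnt cnt' : ℕ} {pw : ℕ → ℤ} {ch ch' val val' : ℕ → ℕ → ℕ} {I : ℕ → ℕ → ℕ → Prop}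

/-- If a path in the larger trie ends in a node with a value, then by `used` some old path ends
there, and injectivity of paths makes the two keys equal. -/
theorem extend (h : Dict B D pw ch val I) (ht : Trie ch cnt) (ht' : Trie ch' cnt')
    (he : ∀ v g, ch v g ≠ 0 → ch' v g = ch v g) : Dict B D pw ch' val I := by
  have key : ∀ K < B ^ D, val (trieAt B ch' K D) 0 ≠ 0 → trieAt B ch' K D = trieAt B ch K D := by
    intro K hK h0
    obtain ⟨hv, K', hK', hv'⟩ := h.used _ h0
    have h1 : trieAt B ch K' D ≠ 0 := by rwa [hv']
    have h2 := ht'.trieAt_inj ((ht.trieAt_ext he h1).trans hv') (by rwa [ht.trieAt_ext he h1])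
    rw [Nat.mod_eq_of_lt hK', Nat.mod_eq_of_lt hK] at h2
    rw [← h2, ht.trieAt_ext he h1]
  refine ⟨fun v hv => ?_, fun K hK h0 => ?_, fun K hK h0 => ?_, fun K hK h0 => ?_⟩
  · obtain ⟨hv, K', hK', rfl⟩ := h.used v hv
    exact ⟨hv, K', hK', ht.trieAt_ext he hv⟩
  · refine h.none K hK ?_
    by_contra h1
    exact h1 (by rwa [ht.trieAt_ext he (h.used _ h1).1] at h0)
  · have e := key K hK h0
    rw [e] at h0 ⊢
    exact h.mem K hK h0
  · have e := key K hK h0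
    rw [e] at h0 ⊢
    exact h.le K hK h0

theorem congr (h : Dict B D pw ch val I) {I' : ℕ → ℕ → ℕ → Prop}
    (hI : ∀ K s₁ s₂, I' K s₁ s₂ ↔ I K s₁ s₂) : Dict B D pw ch val I' := by
  rwa [show I' = I from funext fun K => funext fun s₁ => funext fun s₂ => propext (hI K s₁ s₂)]

/-- The new pair is not heavier than the one already stored, so nothing needs to change. -/
theorem keep (h : Dict B D pw ch val I) {K₀ s₁ s₂ : ℕ} (hK₀ : K₀ < B ^ D)
    (h0 : val (trieAt B ch K₀ D) 0 ≠ 0)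
    (hle : pw s₁ + pw s₂ ≤ pw (val (trieAt B ch K₀ D) 1) + pw (val (trieAt B ch K₀ D) 2)) :
    Dict B D pw ch val fun K t₁ t₂ => I K t₁ t₂ ∨ K = K₀ ∧ t₁ = s₁ ∧ t₂ = s₂ := by
  refine ⟨h.used, fun K hK h1 t₁ t₂ => ?_, fun K hK h1 => .inl (h.mem K hK h1),
    fun K hK h1 t₁ t₂ => ?_⟩
  · rintro (h2 | ⟨rfl, rfl, rfl⟩)
    · exact h.none K hK h1 _ _ h2
    · exact h0 h1
  · rintro (h2 | ⟨rfl, rfl, rfl⟩)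
    · exact h.le K hK h1 _ _ h2
    · exact hle

/-- Distinct keys below `B ^ D` have distinct ends unless these are missing, so only the value at
`K₀` is affected. -/
theorem update (h : Dict B D pw ch val I) (ht : Trie ch cnt) {K₀ s₁ s₂ : ℕ} (hK₀ : K₀ < B ^ D)
    (hne : trieAt B ch K₀ D ≠ 0)
    (hle : val (trieAt B ch K₀ D) 0 ≠ 0 →
      pw (val (trieAt B ch K₀ D) 1) + pw (val (trieAt B ch K₀ D) 2) ≤ pw s₁ + pw s₂)
    (h0 : val' (trieAt B ch K₀ D) 0 ≠ 0) (h1 : val' (trieAt B ch K₀ D) 1 = s₁)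
    (h2 : val' (trieAt B ch K₀ D) 2 = s₂)
    (hval : ∀ v, v ≠ trieAt B ch K₀ D → val' v = val v) :
    Dict B D pw ch val' fun K t₁ t₂ => I K t₁ t₂ ∨ K = K₀ ∧ t₁ = s₁ ∧ t₂ = s₂ := by
  have key : ∀ K < B ^ D, K ≠ K₀ → val' (trieAt B ch K D) = val (trieAt B ch K D) := by
    intro K hK hKK
    refine hval _ fun h3 => hKK ?_
    have := ht.trieAt_inj h3.symm hne
    rwa [Nat.mod_eq_of_lt hK, Nat.mod_eq_of_lt hK₀, eq_comm] at this
  refine ⟨fun v hv => ?_, fun K hK h3 t₁ t₂ => ?_, fun K hK h3 => ?_, fun K hK h3 t₁ t₂ => ?_⟩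
  · by_cases hvv : v = trieAt B ch K₀ D
    · exact ⟨hvv ▸ hne, K₀, hK₀, hvv.symm⟩
    · rw [hval v hvv] at hv
      exact h.used v hv
  · by_cases hKK : K = K₀
    · exact absurd (hKK ▸ h3) h0
    · rw [key K hK hKK] at h3
      rintro (h4 | h4)
      · exact h.none K hK h3 _ _ h4
      · exact hKK h4.1
  · by_cases hKK : K = K₀
    · exact .inr ⟨hKK, hKK ▸ h1, hKK ▸ h2⟩
    · rw [key K hK hKK] at h3 ⊢
      exact .inl (h.mem K hK h3)
  · by_cases hKK : K = K₀
    · rw [hKK, h1, h2]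
      rintro (h4 | ⟨-, rfl, rfl⟩)
      · by_cases h5 : val (trieAt B ch K₀ D) 0 = 0
        · exact absurd h4 (h.none K₀ hK₀ h5 _ _)
        · exact (h.le K₀ hK₀ h5 _ _ h4).trans (hle h5)
      · exact le_rfl
    · rw [key K hK hKK] at h3 ⊢
      rintro (h4 | h4)
      · exact h.le K hK h3 _ _ h4
      · exact absurd h4.1 hKK

end Dict

theorem St.seta_a_of_ne (σ : St) {j j' : ℕ} (r c n : ℕ) (h : j' ≠ j) :
    (σ.seta j r c n).a j' = σ.a j' := by
  funext r' c'
  simp [h]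

/-- From `16 ≤ B ^ 4` and `k ≤ B ^ k` one key has at most `4 + k + k + (k + 1) = 3 * k + 5` digits;
a pair of keys has twice as many. -/
theorem keyBound_sq_le {k B : ℕ} (hB : 2 ≤ B) : keyBound k B * keyBound k B ≤ B ^ trieDepth k := by
  have h1 : k ≤ B ^ k := (Nat.lt_pow_self (by omega)).le
  have h2 : 16 ≤ B ^ 4 := by
    calc 16 = 2 ^ 4 := by norm_num
      _ ≤ B ^ 4 := Nat.pow_le_pow_left hB 4
  have h3 : keyBound k B ≤ B ^ (3 * k + 5) := by
    calc keyBound k B ≤ B ^ 4 * B ^ k * B ^ k * B ^ (k + 1) :=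
          Nat.mul_le_mul_right _ (Nat.mul_le_mul_right _ (Nat.mul_le_mul h2 h1))
      _ = B ^ (3 * k + 5) := by ring
  calc keyBound k B * keyBound k B ≤ B ^ (3 * k + 5) * B ^ (3 * k + 5) := Nat.mul_le_mul h3 h3
    _ = B ^ trieDepth k := by unfold trieDepth; ring

/-- Inserts the pair in variables 41, 42 with the key in variable 40; variable 44 holds the number
of nodes. -/
def insertCmd : Cmd :=
  asg 43 (lit 1) ;;
  for_ 45 10 (asg 46 (.mod (var 40) (var 4)) ;; asg 40 (.div (var 40) (var 4)) ;;
    ite (.eq (.rd 16 (var 43) (var 46)) (lit 0))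
      (asg 44 (.add (var 44) (lit 1)) ;; wr 16 (var 43) (var 46) (var 44)) skip ;;
    asg 43 (.rd 16 (var 43) (var 46))) ;;
  ite (.eq (.rd 17 (var 43) (lit 0)) (lit 0))
    (wr 17 (var 43) (lit 0) (lit 1) ;; wr 17 (var 43) (lit 1) (var 41) ;;
      wr 17 (var 43) (lit 2) (var 42))
    (ite (.zlt (.add (.rd 2 (.rd 17 (var 43) (lit 1))) (.rd 2 (.rd 17 (var 43) (lit 2))))
        (.add (.rd 2 (var 41)) (.rd 2 (var 42))))
      (wr 17 (var 43) (lit 1) (var 41) ;; wr 17 (var 43) (lit 2) (var 42)) skip)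

/-- `hI` is needed because the comparison adds up the weights of the pair stored earlier, and this
sum has to be a word. -/
theorem insertCmd_wp {cx : Ctx} {N1 N2 k B : ℕ} (hE : Env cx N1 N2 k B) {σ : St} {K s₁ s₂ cnt : ℕ}
    {I : ℕ → ℕ → ℕ → Prop} (hc : Consts cx σ) (hK : K < keyBound k B * keyBound k B)
    (h40 : σ.v 40 = K) (h41 : σ.v 41 = s₁) (h42 : σ.v 42 = s₂) (h44 : σ.v 44 = cnt)
    (hcnt : cnt + trieDepth k < cx.L) (ht : Trie (σ.a 16) cnt)
    (hd : Dict B (trieDepth k) (σ.z 2) (σ.a 16) (σ.a 17) I)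
    (hs₁ : s₁ < cx.L) (hs₂ : s₂ < cx.L) (hs : IsWord cx.w (σ.z 2 s₁ + σ.z 2 s₂))
    (hI : ∀ K t₁ t₂, I K t₁ t₂ → t₁ < cx.L ∧ t₂ < cx.L ∧ IsWord cx.w (σ.z 2 t₁ + σ.z 2 t₂)) :
    insertCmd.wp cx (fun τ => ∃ cnt' ≤ cnt + trieDepth k, τ.v 44 = cnt' ∧ Trie (τ.a 16) cnt' ∧
      Dict B (trieDepth k) (σ.z 2) (τ.a 16) (τ.a 17)
        fun K' t₁ t₂ => I K' t₁ t₂ ∨ K' = K ∧ t₁ = s₁ ∧ t₂ = s₂) σ := by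
  have hB := hE.hB
  have hL := hE.hL
  have hLW := hE.hLW
  have hWd := hE.hWd
  have hMW := hE.hMW
  have hKD : K < B ^ trieDepth k := hK.trans_le (keyBound_sq_le hB)
  unfold insertCmd
  rw [wp, wp, wp, wp]
  refine ⟨by simp only [Exp.ok]; omega, ⟨by simp [hc 10], by rw [hE.r10]; omega, by simp, by simp⟩,
    -- After `d` digits the path of `K` exists up to depth `d`, at most `d` nodes are new, and no
    -- old edge has changed.
    fun d τ => τ.v 40 = K / B ^ d ∧ ∃ cnt' ≤ cnt + d, τ.v 44 = cnt' ∧ Trie (τ.a 16) cnt' ∧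
      (∀ v g, σ.a 16 v g ≠ 0 → τ.a 16 v g = σ.a 16 v g) ∧ τ.v 43 = trieAt B (τ.a 16) K d ∧
      τ.v 43 ≠ 0, ?_, ?_, ?_⟩
  · exact ⟨by simp [h40], cnt, le_rfl, by simp [h44], by simpa using ht, by simp, by simp [trieAt],
      by simp⟩
  · rw [hE.r10]
    rintro d hdD τ hA hτd ⟨h40, cnt', hcnt', h44, hT, hext, h43, hne⟩
    have h4 : τ.v 4 = B := by
      rw [hA.v 4 (by simp), St.setv_v, if_neg (by decide), hc 4 (by omega), hE.r4]
    have hle := hT.trieAt_le (B := B) K d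
    have hle' := hT.le (trieAt B (τ.a 16) K d) (K / B ^ d % B)
    have hKd : K / B ^ d ≤ K := Nat.div_le_self _ _
    have hdig : K / B ^ d % B < B := Nat.mod_lt _ (by omega)
    rw [h43] at hne
    simp only [wp, Tst.ok, Tst.holds, Exp.ok, Exp.eval, h40, h43, h44, h4, true_and, and_true,
      St.setv_v, St.setv_a, St.seta_v, St.seta_a, Nat.reduceEqDiff, if_false, if_true,
      Nat.reduceLT]
    refine ⟨by omega, by omega, by omega, fun h0 => ⟨by omega, by omega, by omega, ?_⟩,
      fun h0 => ⟨by omega, ?_⟩⟩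
    · refine ⟨by rw [div_pow_succ], cnt' + 1, by omega, rfl, hT.insert (v := trieAt B (τ.a 16) K d)
        (g := K / B ^ d % B) hne fun v g => by simp,
        fun v g hvg => ?_, ?_, by omega⟩
      · rw [if_neg, hext v g hvg]
        rintro ⟨rfl, rfl⟩
        rw [hext _ _ hvg] at h0
        exact hvg h0
      · have hat : ∀ ch' : ℕ → ℕ → ℕ, (∀ v g, ch' v g = if v = trieAt B (τ.a 16) K d ∧
            g = K / B ^ d % B then cnt' + 1 else τ.a 16 v g) →
            cnt' + 1 = trieAt B ch' K (d + 1) := by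
          intro ch' hch'
          rw [trieAt, hT.trieAt_ext (ch' := ch') (fun v g hvg => ?_) hne, hch', if_pos ⟨rfl, rfl⟩]
          rw [hch', if_neg]
          rintro ⟨rfl, rfl⟩
          exact hvg h0
        exact hat _ fun v g => by simp
    · exact ⟨by rw [div_pow_succ], cnt', by omega, rfl, hT, hext, by rw [trieAt], h0⟩
  · rw [hE.r10]
    rintro τ hA ⟨h40, cnt', hcnt', h44, hT, hext, h43, hne⟩
    have h17 : τ.a 17 = σ.a 17 := by rw [hA.a 17 (by simp)]; rfl
    have hz : τ.z 2 = σ.z 2 := by rw [hA.z 2 (by simp)]; rfl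
    have h41' : τ.v 41 = s₁ := by rw [hA.v 41 (by simp)]; simp [h41]
    have h42' : τ.v 42 = s₂ := by rw [hA.v 42 (by simp)]; simp [h42]
    have hle := hT.trieAt_le (B := B) K (trieDepth k)
    have hd' := hd.extend ht hT hext
    rw [h43] at hne
    simp only [wp, Tst.ok, Tst.holds, Exp.ok, Exp.eval, ZExp.ok, ZExp.eval, h41', h42', h43, h17,
      hz, true_and, St.seta_v, Nat.reduceLT]
    refine ⟨by omega, fun h0 => ⟨by omega, by omega, by omega, cnt', hcnt', h44, ?_, ?_⟩, fun h0 => ?_⟩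
    · simpa [St.seta_a_of_ne] using hT
    · rw [St.seta_a_of_ne _ _ _ _ (by decide), St.seta_a_of_ne _ _ _ _ (by decide),
        St.seta_a_of_ne _ _ _ _ (by decide)]
      refine hd'.update hT hKD hne (fun h => absurd h0 h) (by simp) (by simp) (by simp)
        fun v hv => ?_
      funext c
      simp [hv, h17]
    · have hm := hI _ _ _ (hd'.mem K hKD h0)
      refine ⟨by simp only [hm, hs, and_true]; omega, fun hlt => ⟨by omega, by omega, cnt', hcnt', h44,
        ?_, ?_⟩, fun hlt => ⟨cnt', hcnt', h44, hT, ?_⟩⟩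
      · simpa [St.seta_a_of_ne] using hT
      · rw [St.seta_a_of_ne _ _ _ _ (by decide), St.seta_a_of_ne _ _ _ _ (by decide)]
        refine hd'.update hT hKD hne (fun _ => hlt.le) (by simpa [h17] using h0) (by simp)
          (by simp) fun v hv => ?_
        funext c
        simp [hv, h17]
      · exact hd'.keep hKD h0 (not_lt.1 hlt)

/-- Follows the digits of the key in variable 40. -/
def lookupCmd : Cmd :=
  asg 43 (lit 1) ;;
  for_ 45 10 (asg 43 (.rd 16 (var 43) (.mod (var 40) (var 4))) ;; asg 40 (.div (var 40) (var 4)))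

/-- Missing nodes need no special treatment: all children of node `0` are `0`, and node `0` carries
no value. Only the constants that a query restores are assumed. -/
theorem lookupCmd_wp {cx : Ctx} {N1 N2 k B : ℕ} (hE : Env cx N1 N2 k B) {σ : St} {K cnt : ℕ}
    (h4 : σ.v 4 = B) (h10 : σ.v 10 = trieDepth k) (hK : K < keyBound k B * keyBound k B)
    (h40 : σ.v 40 = K) (hD : trieDepth k < cx.W) (hcnt : cnt < cx.L)
    (ht : Trie (σ.a 16) cnt) :
    lookupCmd.wp cx (fun τ => τ.v 43 = trieAt B (σ.a 16) K (trieDepth k)) σ := by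
  have hB := hE.hB
  have hL := hE.hL
  have hLW := hE.hLW
  have hWd := hE.hWd
  have hMW := hE.hMW
  unfold lookupCmd
  rw [wp, wp, wp]
  refine ⟨by simp only [Exp.ok]; omega, ⟨by simp [h10, hE.r10], by rwa [hE.r10], by simp, by simp⟩,
    fun d τ => τ.v 40 = K / B ^ d ∧ τ.v 43 = trieAt B (σ.a 16) K d, ?_, ?_, ?_⟩
  · exact ⟨by simp [h40], by simp [trieAt]⟩
  · rw [hE.r10]
    rintro d hdD τ hA hτd ⟨h40, h43⟩
    have h4 : τ.v 4 = B := by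
      rw [hA.v 4 (by simp), St.setv_v, if_neg (by decide), h4]
    have h16 : τ.a 16 = σ.a 16 := by rw [hA.a 16 (by simp)]; rfl
    have hle := ht.trieAt_le (B := B) K d
    have hKd : K / B ^ d ≤ K := Nat.div_le_self _ _
    have hdig : K / B ^ d % B < B := Nat.mod_lt _ (by omega)
    simp only [wp, Exp.ok, Exp.eval, h40, h43, h4, h16, true_and,
      St.setv_v, Nat.reduceEqDiff, if_false, if_true, Nat.reduceLT]
    exact ⟨by omega, by omega, by rw [div_pow_succ], by rw [trieAt]⟩
  · rw [hE.r10]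
    exact fun τ _ h => h.2

end HIA

namespace HIA

open Cmd Exp

/-! ### Inserting all pairs of leaves with a common label -/

/-- The pair of entries for the nodes `p` and `q`. -/
def PairEntry (k B : ℕ) (par : ℕ → ℕ) (p q K s₁ s₂ : ℕ) : Prop :=
  ∃ i < (k * B) * (k * B), ∃ j < (k * B) * (k * B),
    K = insKey k B par p i * keyBound k B + insKey k B par q j ∧
    s₁ = insNode k B par p i ∧ s₂ = insNode k B par q j

/-- Inserts all pairs of entries of the positions in variables 33 and 34. -/
def pairCmd : Cmd :=
  for_ 35 8 (for_ 36 8 (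
    asg 40 (.add (.mul (.rd 12 (var 33) (var 35)) (var 11)) (.rd 12 (var 34) (var 36))) ;;
    asg 41 (.rd 13 (var 33) (var 35)) ;; asg 42 (.rd 13 (var 34) (var 36)) ;; insertCmd))

/-- The trie holds the pairs in `I`, with at most `c` nodes. -/
def Holds (k B : ℕ) (pw : ℕ → ℤ) (c : ℕ) (I : ℕ → ℕ → ℕ → Prop) (τ : St) : Prop :=
  ∃ cnt ≤ c, τ.v 44 = cnt ∧ Trie (τ.a 16) cnt ∧ Dict B (trieDepth k) pw (τ.a 16) (τ.a 17) I

/-- Every pair of entries is one insertion, and each insertion adds at most `trieDepth k` nodes,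
whence the growth of the node bound. -/
theorem pairCmd_wp {cx : Ctx} {N1 N2 k B : ℕ} (hE : Env cx N1 N2 k B) {σ : St}
    {c p q : ℕ} {I : ℕ → ℕ → ℕ → Prop} (hc : Consts cx σ) {par : ℕ → ℕ} (hp : Preorderly par)
    (h12 : ∀ u ≤ N1 + N2, ∀ j < (k * B) * (k * B),
      σ.a 12 u j = insKey k B par u j ∧ σ.a 13 u j = insNode k B par u j)
    (h33 : σ.v 33 = p) (h34 : σ.v 34 = q) (hpN : p ≤ N1 + N2) (hqN : q ≤ N1 + N2)
    (hcL : c + (k * B) * (k * B) * ((k * B) * (k * B)) * trieDepth k < cx.L)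
    (hH : Holds k B (σ.z 2) c I σ)
    (hI : ∀ K t₁ t₂, I K t₁ t₂ ∨ PairEntry k B par p q K t₁ t₂ →
      t₁ < cx.L ∧ t₂ < cx.L ∧ IsWord cx.w (σ.z 2 t₁ + σ.z 2 t₂)) :
    pairCmd.wp cx (fun τ => Holds k B (σ.z 2)
      (c + (k * B) * (k * B) * ((k * B) * (k * B)) * trieDepth k)
      (fun K t₁ t₂ => I K t₁ t₂ ∨ PairEntry k B par p q K t₁ t₂) τ) σ := by
  have hB := hE.hB
  have hL := hE.hL
  have hLW := hE.hLW
  have hWd := hE.hWd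
  have hWdW := hE.hWdW
  have hMW := hE.hMW
  have hP := hE.hP
  have hk := hE.hk
  have hJ0 : (k * B) * (k * B) < cx.W := by omega
  unfold pairCmd
  set J := (k * B) * (k * B) with hJ
  set D := trieDepth k with hD
  rw [wp]
  refine ⟨⟨hc 8 (by omega), by rwa [hE.r8], by simp [insertCmd], by simp [insertCmd]⟩,
    fun i τ => Holds k B (σ.z 2) (c + i * J * D) (fun K t₁ t₂ => I K t₁ t₂ ∨ ∃ i' < i, ∃ j < J,
      K = insKey k B par p i' * keyBound k B + insKey k B par q j ∧
      t₁ = insNode k B par p i' ∧ t₂ = insNode k B par q j) τ, ?_, ?_, ?_⟩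
  · obtain ⟨cnt, h1, h2, h3, h4⟩ := hH
    exact ⟨cnt, by omega, by simpa using h2, h3, h4.congr fun K s₁ s₂ => by simp⟩
  · rw [hE.r8]
    intro i hi τ hA hτi hτ
    have hcτ : Consts cx τ := hc.of_agree hA fun x hx => by
      simp [insertCmd]
      omega
    rw [wp]
    refine ⟨⟨hcτ 8 (by omega), by rwa [hE.r8], by simp [insertCmd], by simp [insertCmd]⟩,
      fun j τ => Holds k B (σ.z 2) (c + i * J * D + j * D) (fun K t₁ t₂ => I K t₁ t₂ ∨
        -- The current row `i` is complete only up to column `j`.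
        ∃ i' ≤ i, ∃ j' < J, (i' = i → j' < j) ∧
        K = insKey k B par p i' * keyBound k B + insKey k B par q j' ∧
        t₁ = insNode k B par p i' ∧ t₂ = insNode k B par q j') τ, ?_, ?_, ?_⟩
    · obtain ⟨cnt, h1, h2, h3, h4⟩ := hτ
      refine ⟨cnt, by omega, by simpa using h2, h3, h4.congr fun K s₁ s₂ => or_congr_right ?_⟩
      constructor
      · rintro ⟨i', hi', j', hj', h5, h6⟩
        exact ⟨i', by by_contra; have := h5 (by omega); omega, j', hj', h6⟩
      · rintro ⟨i', hi', j', hj', h6⟩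
        exact ⟨i', by omega, j', hj', fun h => by omega, h6⟩
    · rw [hE.r8]
      intro j hj υ hAυ hυj hυ
      obtain ⟨cnt, h1, h2, h3, h4⟩ := hυ
      have hcυ : Consts cx υ := hcτ.of_agree hAυ fun x hx => by
        simp [insertCmd]
        omega
      have u35 : υ.v 35 = i := by rw [hAυ.v 35 (by simp [insertCmd]), hτi]
      have u33 : υ.v 33 = p := by
        rw [hAυ.v 33 (by simp [insertCmd]), hA.v 33 (by simp [insertCmd]), h33]
      have u34 : υ.v 34 = q := by
        rw [hAυ.v 34 (by simp [insertCmd]), hA.v 34 (by simp [insertCmd]), h34]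
      have u11 : υ.v 11 = keyBound k B := by rw [hcυ 11 (by omega), hE.r11]
      have ua : ∀ A, A ≠ 16 → A ≠ 17 → υ.a A = σ.a A := fun A hA1 hA2 => by
        rw [hAυ.a A (by simp [insertCmd, hA1, hA2]), hA.a A (by simp [insertCmd, hA1, hA2])]
      have uz : υ.z = σ.z := by
        funext A
        rw [hAυ.z A (by simp [insertCmd]), hA.z A (by simp [insertCmd])]
      obtain ⟨e1, e2⟩ := h12 p hpN i hi
      obtain ⟨e3, e4⟩ := h12 q hqN j hj
      have k1 : insKey k B par p i < keyBound k B := hp.insKey_lt hk hB (by omega) hi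
      have k2 : insKey k B par q j < keyBound k B := hp.insKey_lt hk hB (by omega) hj
      have hKlt := encode_lt k1 k2
      have hcnt : c + i * J * D + j * D + D ≤ c + J * J * D := by
        have h5 : (i * J + j + 1) * D ≤ J * J * D := Nat.mul_le_mul_right _ (encode_lt hi hj)
        have h6 : (i * J + j + 1) * D = i * J * D + j * D + D := by ring
        omega
      have hnew := hI _ _ _ (.inr ⟨i, hi, j, hj, rfl, rfl, rfl⟩)
      simp only [wp, Exp.ok, Exp.eval, u33, u34, u35, u11, hυj, St.setv_v, St.setv_a,
        Nat.reduceEqDiff, if_false, ua 12 (by decide) (by decide), ua 13 (by decide) (by decide),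
        e1, e2, e3, e4, true_and, Nat.reduceLT]
      refine ⟨by omega, by omega, by omega, ?_⟩
      refine wp_conseq _ (insertCmd_wp hE (σ := ((υ.setv 40 _).setv 41 _).setv 42 _) (cnt := cnt)
        (hcυ.of_agree (p := asg 40 (lit 0) ;; asg 41 (lit 0) ;; asg 42 (lit 0))
          ⟨fun y hy => ?_, fun _ _ => rfl, fun _ _ => rfl, rfl⟩ fun x hx => ?_) hKlt (by simp)
        (by simp) (by simp)
        (by simpa using h2) (by omega) h3 (by simp only [St.setv_z, uz]; exact h4)
        hnew.1 hnew.2.1 ?_ ?_) ?_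
      · simp only [mv, List.cons_append, List.nil_append, List.mem_cons,
          List.not_mem_nil, or_false, not_or] at hy
        simp [hy]
      · simp
        omega
      · simp only [St.setv_z, uz]; exact hnew.2.2
      · simp only [St.setv_z, uz]
        rintro K t₁ t₂ (h | ⟨i', hi', j', hj', -, h⟩)
        · exact hI K t₁ t₂ (.inl h)
        · exact hI K t₁ t₂ (.inr ⟨i', by omega, j', hj', h⟩)
      · rintro υ' - ⟨cnt', g1, g2, g3, g4⟩
        have e : (j + 1) * D = j * D + D := Nat.succ_mul _ _
        refine ⟨cnt', by omega, by simpa using g2, g3, ?_⟩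
        simp only [St.setv_z, uz] at g4
        refine g4.congr fun K t₁ t₂ => ?_
        constructor
        · rintro (h | ⟨i', hi', j', hj', h5, h⟩)
          · exact .inl (.inl h)
          · by_cases hij : i' = i ∧ j' = j
            · obtain ⟨rfl, rfl⟩ := hij
              exact .inr h
            · exact .inl (.inr ⟨i', hi', j', hj', fun h6 => by
                have := h5 h6
                have : j' ≠ j := fun h7 => hij ⟨h6, h7⟩
                omega, h⟩)
        · rintro ((h | ⟨i', hi', j', hj', h5, h⟩) | h)
          · exact .inl h
          · exact .inr ⟨i', hi', j', hj', fun h6 => by have := h5 h6; omega, h⟩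
          · exact .inr ⟨i, le_rfl, j, hj, fun _ => by omega, h⟩
    · rw [hE.r8]
      rintro υ - ⟨cnt, h1, h2, h3, h4⟩
      have e : (i + 1) * J * D = i * J * D + J * D := by ring
      rw [← hJ] at h1
      refine ⟨cnt, by omega, by simpa using h2, h3, h4.congr fun K s₁ s₂ => or_congr_right ?_⟩
      constructor
      · rintro ⟨i', hi', j', hj', h6⟩
        exact ⟨i', by omega, j', hj', fun _ => hj', h6⟩
      · rintro ⟨i', hi', j', hj', -, h6⟩
        exact ⟨i', by omega, j', hj', h6⟩
  · rw [hE.r8]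
    exact fun τ _ h => h

/-- The leaves `x` of the first and `y` of the second tree have the same label. -/
structure Match (N1 N2 : ℕ) (leaf : ℕ → Prop) (lb : ℕ → ℤ) (x y : ℕ) : Prop where
  x_pos : 1 ≤ x
  x_le : x ≤ N1
  lt_y : N1 < y
  y_le : y ≤ N1 + N2
  leaf_x : leaf x
  leaf_y : leaf y
  eq : lb x = lb y

def joinCmd : Cmd :=
  asg 44 (lit 1) ;; asg 30 (lit 0) ;;
  for_ 31 2 (asg 32 (.rd 5 (var 31) (lit 0)) ;;
    ite (.eq (.rd 1 (var 32) (lit 0)) (lit 0)) (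
      ite (.eq (var 30) (lit 0)) skip (
      ite (.zeq (.rd 1 (var 30)) (.rd 1 (var 32))) (
        ite (.le (var 30) (var 0)) (asg 33 (var 30) ;; asg 34 (var 32))
          (asg 33 (var 32) ;; asg 34 (var 30)) ;;
        asg 33 (.rd 7 (var 33) (lit 0)) ;; asg 34 (.rd 7 (var 34) (lit 0)) ;; pairCmd) skip) ;;
      asg 30 (var 32)) skip)

/-- Within one tree the labels of leaves are distinct, so at most two leaves share a label, and
these are consecutive among the leaves in label order. Comparing each leaf with the previous one
finds every match exactly once. Inner nodes are skipped, as their labels are meaningless. -/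
theorem joinCmd_wp {cx : Ctx} {N1 N2 k B : ℕ} (hE : Env cx N1 N2 k B) {σ : St}
    (hc : Consts cx σ) {par : ℕ → ℕ} (hp : Preorderly par)
    (h12 : ∀ u ≤ N1 + N2, ∀ j < (k * B) * (k * B),
      σ.a 12 u j = insKey k B par u j ∧ σ.a 13 u j = insNode k B par u j)
    (h7 : ∀ i ≤ N1 + N2, σ.a 7 i 0 ≤ N1 + N2)
    (hs : Sorted (σ.z 1) (N1 + N2) fun o => σ.a 5 o 0)
    (h1 : ∀ x y, σ.a 1 x 0 = 0 → σ.a 1 y 0 = 0 → 1 ≤ x → x ≤ N1 → 1 ≤ y → y ≤ N1 →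
      σ.z 1 x = σ.z 1 y → x = y)
    (h2 : ∀ x y, σ.a 1 x 0 = 0 → σ.a 1 y 0 = 0 → N1 < x → x ≤ N1 + N2 → N1 < y → y ≤ N1 + N2 →
      σ.z 1 x = σ.z 1 y → x = y)
    (h16 : ∀ v g, σ.a 16 v g = 0) (h17 : ∀ v g, σ.a 17 v g = 0)
    (hI : ∀ x y, Match N1 N2 (fun i => σ.a 1 i 0 = 0) (σ.z 1) x y → ∀ K t₁ t₂,
      PairEntry k B par (σ.a 7 x 0) (σ.a 7 y 0) K t₁ t₂ →
      t₁ < cx.L ∧ t₂ < cx.L ∧ IsWord cx.w (σ.z 2 t₁ + σ.z 2 t₂)) :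
    joinCmd.wp cx (fun τ => ∃ cnt < cx.L, Trie (τ.a 16) cnt ∧
      Dict B (trieDepth k) (σ.z 2) (τ.a 16) (τ.a 17) fun K t₁ t₂ => ∃ x y,
        Match N1 N2 (fun i => σ.a 1 i 0 = 0) (σ.z 1) x y ∧
        PairEntry k B par (σ.a 7 x 0) (σ.a 7 y 0) K t₁ t₂) σ := by
  have hB := hE.hB
  have hL := hE.hL
  have hLW := hE.hLW
  have hWd := hE.hWd
  have hLt := hE.hLt
  unfold joinCmd
  rw [wp, wp, wp, wp, wp]
  set U := (k * B) * (k * B) * ((k * B) * (k * B)) * trieDepth k with hU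
  have hLt' : (N1 + N2) * U + 5 ≤ cx.L := by rw [hU, ← mul_assoc]; exact hLt
  set M := Match N1 N2 (fun i => σ.a 1 i 0 = 0) (σ.z 1) with hM
  refine ⟨by simp only [Exp.ok]; omega, by simp only [Exp.ok]; omega,
    ⟨by simp [hc 2], by rw [hE.r2]; omega, by simp [pairCmd, insertCmd],
      by simp [pairCmd, insertCmd]⟩,
    -- Variable 30 is the last leaf met so far, or `0` if there is none.
    fun o τ => (τ.v 30 = 0 ∧ (∀ o' < o, σ.a 1 (σ.a 5 o' 0) 0 ≠ 0) ∨
      ∃ o' < o, τ.v 30 = σ.a 5 o' 0 ∧ σ.a 1 (σ.a 5 o' 0) 0 = 0 ∧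
        ∀ o'' < o, o' < o'' → σ.a 1 (σ.a 5 o'' 0) 0 ≠ 0) ∧
      Holds k B (σ.z 2) (1 + o * U) (fun K t₁ t₂ => ∃ x y, M x y ∧
        (∃ o' < o, σ.a 5 o' 0 = x) ∧ (∃ o' < o, σ.a 5 o' 0 = y) ∧
        PairEntry k B par (σ.a 7 x 0) (σ.a 7 y 0) K t₁ t₂) τ, ?_, ?_, ?_⟩
  · refine ⟨.inl ⟨by simp, fun o' h => by omega⟩, 1, by omega, by simp, ?_, ?_⟩
    · exact ⟨le_rfl, fun v g => by simp [h16], fun g => by simp [h16],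
        fun v g v' g' _ h => absurd (h16 v g) (by simpa using h)⟩
    · exact ⟨fun v hv => absurd (h17 v 0) (by simpa using hv), fun K _ _ s₁ s₂ h => by
        obtain ⟨x, y, -, ⟨o', ho', -⟩, -⟩ := h
        omega, fun K _ hv => absurd (h17 _ 0) (by simpa using hv),
        fun K _ hv => absurd (h17 _ 0) (by simpa using hv)⟩
  · rw [hE.r2]
    rintro o ho τ hA hτo ⟨hprev, hH⟩
    have hcσ : Consts cx ((σ.setv 44 (eval σ (lit 1))).setv 30
        (eval (σ.setv 44 (eval σ (lit 1))) (lit 0))) := fun x hx => by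
      simp only [St.setv_v]
      rw [if_neg (by omega), if_neg (by omega), hc x hx]
    have hcτ : Consts cx τ := hcσ.of_agree hA fun x hx => by
      simp [pairCmd, insertCmd]
      omega
    have ua : ∀ A, A ≠ 16 → A ≠ 17 → τ.a A = σ.a A := fun A hA1 hA2 => by
      rw [hA.a A (by simp [pairCmd, insertCmd, hA1, hA2])]; rfl
    have uz : τ.z = σ.z := by
      funext A
      rw [hA.z A (by simp [pairCmd, insertCmd])]; rfl
    have h0 : τ.v 0 = N1 := by rw [hcτ 0 (by omega), hE.r0]
    obtain ⟨x, hx⟩ : ∃ x, x = σ.a 5 o 0 := ⟨_, rfl⟩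
    have hxr : 1 ≤ x ∧ x ≤ N1 + N2 := by rw [hx]; exact hs.range o ho
    have hsucc : (o + 1) * U = o * U + U := Nat.succ_mul _ _
    have hU' : 1 + o * U + U < cx.L := by
      have : (o + 1) * U ≤ (N1 + N2) * U := Nat.mul_le_mul_right _ ho
      omega
    have hlt : ∀ {o' : ℕ} {y : ℕ}, σ.a 5 o' 0 = y → y ≠ x → o' < o + 1 → o' < o := by
      intro o' y h3 h4 h5
      rcases Nat.lt_succ_iff_lt_or_eq.1 h5 with h | rfl
      · exact h
      · exact absurd (h3.symm.trans hx.symm) h4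
    -- no new match
    have hsame : (∀ z, (∃ o' < o, σ.a 5 o' 0 = z) → ¬ M x z ∧ ¬ M z x) → ∀ K t₁ t₂,
        (∃ x y, M x y ∧ (∃ o' < o + 1, σ.a 5 o' 0 = x) ∧ (∃ o' < o + 1, σ.a 5 o' 0 = y) ∧
          PairEntry k B par (σ.a 7 x 0) (σ.a 7 y 0) K t₁ t₂) ↔
        (∃ x y, M x y ∧ (∃ o' < o, σ.a 5 o' 0 = x) ∧ (∃ o' < o, σ.a 5 o' 0 = y) ∧
          PairEntry k B par (σ.a 7 x 0) (σ.a 7 y 0) K t₁ t₂) := by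
      intro hno K t₁ t₂
      constructor
      · rintro ⟨a, b, hab, ⟨o₁, ho₁, e₁⟩, ⟨o₂, ho₂, e₂⟩, he⟩
        have hne : a ≠ b := fun h => by have := hab.x_le; have := hab.lt_y; omega
        have hax : a ≠ x := by
          rintro rfl
          exact (hno b ⟨o₂, hlt e₂ hne.symm ho₂, e₂⟩).1 hab
        have hbx : b ≠ x := by
          rintro rfl
          exact (hno a ⟨o₁, hlt e₁ hne ho₁, e₁⟩).2 hab
        exact ⟨a, b, hab, ⟨o₁, hlt e₁ hax ho₁, e₁⟩, ⟨o₂, hlt e₂ hbx ho₂, e₂⟩, he⟩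
      · rintro ⟨a, b, hab, ⟨o₁, ho₁, e₁⟩, ⟨o₂, ho₂, e₂⟩, he⟩
        exact ⟨a, b, hab, ⟨o₁, by omega, e₁⟩, ⟨o₂, by omega, e₂⟩, he⟩
    have hmono : ∀ (υ : St) (I : ℕ → ℕ → ℕ → Prop), Holds k B (σ.z 2) (1 + o * U) I υ →
        Holds k B (σ.z 2) (1 + (o + 1) * U) I υ := by
      rintro υ I ⟨cnt, g1, g⟩
      exact ⟨cnt, by omega, g⟩
    rw [wp]
    refine ⟨by simp only [Exp.ok, Exp.eval, hτo, true_and]; omega, ?_⟩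
    simp only [Exp.eval, hτo, ua 5 (by decide) (by decide), ← hx]
    rw [wp]
    refine ⟨by simp only [Tst.ok, Exp.ok, Exp.eval, St.setv_v, if_true, true_and]; omega,
      fun hleaf => ?_, fun hleaf => ?_⟩
    swap
    · simp only [Tst.holds, Exp.eval, St.setv_v, if_true, St.setv_a,
        ua 1 (by decide) (by decide)] at hleaf
      simp only [wp, St.setv_v, Nat.reduceEqDiff, if_false]
      refine ⟨?_, ?_⟩
      · rcases hprev with ⟨g1, g2⟩ | ⟨o', g0, g1, g2, g3⟩
        · refine .inl ⟨g1, fun o' ho' => ?_⟩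
          rcases Nat.lt_succ_iff_lt_or_eq.1 ho' with h | rfl
          · exact g2 o' h
          · rwa [← hx]
        · refine .inr ⟨o', by omega, g1, g2, fun o'' ho'' hlt' => ?_⟩
          rcases Nat.lt_succ_iff_lt_or_eq.1 ho'' with h | rfl
          · exact g3 o'' h hlt'
          · rwa [← hx]
      · obtain ⟨cnt, g1, g2, g3, g4⟩ := hmono _ _ hH
        exact ⟨cnt, g1, by simpa using g2, by simpa using g3, g4.congr (hsame fun z _ =>
          ⟨fun h => hleaf h.leaf_x, fun h => hleaf h.leaf_y⟩)⟩
    simp only [Tst.holds, Exp.eval, St.setv_v, if_true, St.setv_a,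
      ua 1 (by decide) (by decide)] at hleaf
    rw [wp]
    -- the new last leaf
    have hfin : ∀ υ : St, υ.v 32 = x → Holds k B (σ.z 2) (1 + (o + 1) * U) (fun K t₁ t₂ =>
        ∃ x y, M x y ∧ (∃ o' < o + 1, σ.a 5 o' 0 = x) ∧ (∃ o' < o + 1, σ.a 5 o' 0 = y) ∧
          PairEntry k B par (σ.a 7 x 0) (σ.a 7 y 0) K t₁ t₂) υ →
        wp cx (asg 30 (var 32)) (fun τ' => (((τ'.setv 31 (o + 1)).v 30 = 0 ∧
          (∀ o' < o + 1, σ.a 1 (σ.a 5 o' 0) 0 ≠ 0) ∨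
          ∃ o' < o + 1, (τ'.setv 31 (o + 1)).v 30 = σ.a 5 o' 0 ∧ σ.a 1 (σ.a 5 o' 0) 0 = 0 ∧
            ∀ o'' < o + 1, o' < o'' → σ.a 1 (σ.a 5 o'' 0) 0 ≠ 0) ∧
          Holds k B (σ.z 2) (1 + (o + 1) * U) (fun K t₁ t₂ => ∃ x y, M x y ∧
            (∃ o' < o + 1, σ.a 5 o' 0 = x) ∧ (∃ o' < o + 1, σ.a 5 o' 0 = y) ∧
            PairEntry k B par (σ.a 7 x 0) (σ.a 7 y 0) K t₁ t₂) (τ'.setv 31 (o + 1)))) υ := by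
      rintro υ h32 ⟨cnt, g1, g2, g3, g4⟩
      rw [wp]
      refine ⟨trivial, .inr ⟨o, by omega, by simp [h32, hx], by rwa [← hx], fun o'' _ _ => by omega⟩,
        cnt, g1, by simpa using g2, g3, g4⟩
    have hτH : Holds k B (σ.z 2) (1 + o * U) (fun K t₁ t₂ => ∃ x y, M x y ∧
        (∃ o' < o, σ.a 5 o' 0 = x) ∧ (∃ o' < o, σ.a 5 o' 0 = y) ∧
        PairEntry k B par (σ.a 7 x 0) (σ.a 7 y 0) K t₁ t₂) (τ.setv 32 x) := hH
    rcases hprev with ⟨g1, g2⟩ | ⟨o', g0, g1, g2, g3⟩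
    · have hskip : wp cx skip (fun υ => υ.v 32 = x ∧ Holds k B (σ.z 2) (1 + (o + 1) * U)
          (fun K t₁ t₂ => ∃ x y, M x y ∧ (∃ o' < o + 1, σ.a 5 o' 0 = x) ∧
            (∃ o' < o + 1, σ.a 5 o' 0 = y) ∧
            PairEntry k B par (σ.a 7 x 0) (σ.a 7 y 0) K t₁ t₂) υ) (τ.setv 32 x) := by
        refine ⟨by simp, ?_⟩
        obtain ⟨cnt, f1, f2, f3, f4⟩ := hmono _ _ hτH
        refine ⟨cnt, f1, f2, f3, f4.congr (hsame ?_)⟩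
        rintro z ⟨o₁, ho₁, rfl⟩
        exact ⟨fun h => g2 o₁ ho₁ h.leaf_y, fun h => g2 o₁ ho₁ h.leaf_x⟩
      rw [wp]
      refine ⟨by simp only [Tst.ok, Exp.ok, true_and]; omega, fun _ => hfin _ hskip.1 hskip.2, fun h => ?_⟩
      exact absurd (by simpa using g1) h
    · obtain ⟨y, hy⟩ : ∃ y, y = σ.a 5 o' 0 := ⟨_, rfl⟩
      rw [← hy] at g1 g2
      have hyr : 1 ≤ y ∧ y ≤ N1 + N2 := by rw [hy]; exact hs.range o' (by omega)
      have hyx : y ≠ x := by rw [hx, hy]; exact hs.ne o' o g0 ho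
      have hyle : σ.z 1 y ≤ σ.z 1 x := by rw [hx, hy]; exact hs.le o' o g0 ho
      -- a leaf with the same label as `x` is the previous leaf
      have huniq : ∀ z, (∃ o₁ < o, σ.a 5 o₁ 0 = z) → σ.a 1 z 0 = 0 → σ.z 1 z = σ.z 1 x →
          (z ≤ N1 ∧ N1 < x ∨ x ≤ N1 ∧ N1 < z) → z = y := by
        rintro z ⟨o₁, ho₁, hz⟩ hzl hzx hside
        -- Otherwise `z`, `y`, `x` would be three leaves with the same label, since `y` lies between
        -- the other two in the order; two of them would be in the same tree.
        by_contra hzy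
        have hzr : 1 ≤ z ∧ z ≤ N1 + N2 := by rw [← hz]; exact hs.range o₁ (by omega)
        have ho₁o' : o₁ < o' := by
          rcases lt_trichotomy o₁ o' with h | rfl | h
          · exact h
          · exact absurd (hz.symm.trans hy.symm) hzy
          · exact absurd (hz ▸ hzl) (g3 o₁ ho₁ h)
        have hzle : σ.z 1 z ≤ σ.z 1 y := by
          rw [← hz, hy]; exact hs.le o₁ o' ho₁o' (by omega)
        have hyx' : σ.z 1 y = σ.z 1 x := le_antisymm hyle (hzx ▸ hzle)
        rcases Nat.lt_or_ge N1 y with h | h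
        · rcases hside with h' | h'
          · exact hyx (h2 y x g2 hleaf h hyr.2 h'.2 hxr.2 hyx')
          · exact hzy (h2 z y hzl g2 h'.2 hzr.2 h hyr.2 (hzx.trans hyx'.symm))
        · rcases hside with h' | h'
          · exact hzy (h1 z y hzl g2 hzr.1 h'.1 hyr.1 h (hzx.trans hyx'.symm))
          · exact hyx (h1 y x g2 hleaf hyr.1 h hxr.1 h'.1 hyx')
      rw [wp]
      refine ⟨by simp only [Tst.ok, Exp.ok, true_and]; omega, fun h => ?_, fun _ => ?_⟩
      · simp [g1] at h
        omega
      rw [wp]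
      refine ⟨by simp only [Tst.ok, ZExp.ok, Exp.ok, Exp.eval, St.setv_v, g1, if_true,
        Nat.reduceEqDiff, if_false, true_and]; omega, fun hlab => ?_, fun hlab => ?_⟩
      swap
      · simp only [Tst.holds, ZExp.eval, Exp.eval, St.setv_v, g1, if_true, Nat.reduceEqDiff,
          if_false, St.setv_z, uz] at hlab
        refine hfin _ (by simp) ?_
        obtain ⟨cnt, f1, f2, f3, f4⟩ := hmono _ _ hτH
        refine ⟨cnt, f1, f2, f3, f4.congr (hsame ?_)⟩
        intro z hz
        refine ⟨fun h => hlab ?_, fun h => hlab ?_⟩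
        · rw [← huniq z hz h.leaf_y h.eq.symm (.inr ⟨h.x_le, h.lt_y⟩), h.eq]
        · rw [← huniq z hz h.leaf_x h.eq (.inl ⟨h.x_le, h.lt_y⟩), h.eq]
      simp only [Tst.holds, ZExp.eval, Exp.eval, St.setv_v, g1, if_true, Nat.reduceEqDiff,
        if_false, St.setv_z, uz] at hlab
      have hside : y ≤ N1 ∧ N1 < x ∨ x ≤ N1 ∧ N1 < y := by
        rcases Nat.lt_or_ge N1 y with h | h
        · refine .inr ⟨?_, h⟩
          by_contra h'
          exact hyx (h2 y x g2 hleaf h hyr.2 (by omega) hxr.2 hlab)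
        · refine .inl ⟨h, ?_⟩
          by_contra h'
          exact hyx (h1 y x g2 hleaf hyr.1 h hxr.1 (by omega) hlab)
      -- the new match
      have hmain : ∀ (a b : ℕ), M a b → (a = x ∧ b = y ∨ a = y ∧ b = x) → ∀ υ : St, υ.v 33 = a →
          υ.v 34 = b → Agree (asg 33 (lit 0) ;; asg 34 (lit 0)) (τ.setv 32 x) υ →
          wp cx (asg 33 (.rd 7 (var 33) (lit 0)) ;; asg 34 (.rd 7 (var 34) (lit 0)) ;; pairCmd)
            (fun υ => υ.v 32 = x ∧ Holds k B (σ.z 2) (1 + (o + 1) * U)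
          (fun K t₁ t₂ => ∃ x y, M x y ∧ (∃ o' < o + 1, σ.a 5 o' 0 = x) ∧
            (∃ o' < o + 1, σ.a 5 o' 0 = y) ∧
            PairEntry k B par (σ.a 7 x 0) (σ.a 7 y 0) K t₁ t₂) υ) υ := by
        intro a b hab habxy υ h33 h34 hυ
        have va : ∀ A, A ≠ 16 → A ≠ 17 → υ.a A = σ.a A := fun A hA1 hA2 => by
          rw [hυ.a A (by simp), St.setv_a, ua A hA1 hA2]
        have vz : υ.z = σ.z := by
          funext A
          rw [hυ.z A (by simp), St.setv_z, uz]
        have hcυ : ∀ z < 16, υ.v z = cx.rho z := fun z hz => by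
          rw [hυ.v z (by simp; omega), St.setv_v, if_neg (by omega), hcτ z hz]
        have haN : a ≤ N1 + N2 := by have := hab.x_le; omega
        have hbN := hab.y_le
        have ha7 := h7 a haN
        have hb7 := h7 b hbN
        simp only [wp, Exp.ok, Exp.eval, h33, h34, va 7 (by decide) (by decide), St.setv_v,
          St.setv_a, Nat.reduceEqDiff, if_false, true_and]
        refine ⟨by omega, by omega, ?_⟩
        obtain ⟨cnt, f1, f2, f3, f4⟩ := hτH
        refine wp_conseq _ (pairCmd_wp hE (c := 1 + o * U) (p := σ.a 7 a 0) (q := σ.a 7 b 0)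
          (I := fun K t₁ t₂ => ∃ x y, M x y ∧
            (∃ o' < o, σ.a 5 o' 0 = x) ∧ (∃ o' < o, σ.a 5 o' 0 = y) ∧
            PairEntry k B par (σ.a 7 x 0) (σ.a 7 y 0) K t₁ t₂) (fun z hz => ?_) hp ?_ (by simp)
          (by simp) ha7 hb7 hU' ⟨cnt, f1, ?_, ?_, ?_⟩ ?_) ?_
        · simp only [St.setv_v]
          rw [if_neg (by omega), if_neg (by omega), hcυ z hz]
        · simpa [va 12 (by decide) (by decide), va 13 (by decide) (by decide)] using h12
        · simp only [St.setv_v, Nat.reduceEqDiff, if_false]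
          rw [hυ.v 44 (by simp), f2]
        · rw [St.setv_a, St.setv_a, hυ.a 16 (by simp)]
          exact f3
        · rw [St.setv_a, St.setv_a, hυ.a 16 (by simp), hυ.a 17 (by simp), St.setv_z, St.setv_z, vz]
          exact f4
        · simp only [St.setv_z, vz]
          rintro K t₁ t₂ (⟨a', b', h', -, -, h''⟩ | h)
          · exact hI a' b' h' K t₁ t₂ h''
          · exact hI a b hab K t₁ t₂ h
        · rintro υ' hυ' ⟨cnt, f1, f2, f3, f4⟩
          refine ⟨?_, cnt, by omega, f2, f3, ?_⟩
          · rw [hυ'.v 32 (by simp [pairCmd, insertCmd])]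
            simp [hυ.v 32]
          simp only [St.setv_z, vz] at f4
          refine f4.congr fun K t₁ t₂ => ?_
          constructor
          · rintro ⟨a', b', hab', ⟨o₁, ho₁, e₁⟩, ⟨o₂, ho₂, e₂⟩, he⟩
            have hne : a' ≠ b' := fun h => by have := hab'.x_le; have := hab'.lt_y; omega
            by_cases hax : a' = x
            · right
              subst hax
              obtain rfl := huniq b' ⟨o₂, hlt e₂ hne.symm ho₂, e₂⟩ hab'.leaf_y hab'.eq.symm
                (.inr ⟨hab'.x_le, hab'.lt_y⟩)
              rcases habxy with ⟨rfl, rfl⟩ | ⟨rfl, rfl⟩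
              · exact he
              · have := hab.x_le; have := hab'.lt_y; omega
            by_cases hbx : b' = x
            · right
              subst hbx
              obtain rfl := huniq a' ⟨o₁, hlt e₁ hne ho₁, e₁⟩ hab'.leaf_x hab'.eq
                (.inl ⟨hab'.x_le, hab'.lt_y⟩)
              rcases habxy with ⟨rfl, rfl⟩ | ⟨rfl, rfl⟩
              · have := hab.x_le; have := hab'.lt_y; omega
              · exact he
            · exact .inl ⟨a', b', hab', ⟨o₁, hlt e₁ hax ho₁, e₁⟩, ⟨o₂, hlt e₂ hbx ho₂, e₂⟩, he⟩
          · rintro (⟨a', b', hab', ⟨o₁, ho₁, e₁⟩, ⟨o₂, ho₂, e₂⟩, he⟩ | he)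
            · exact ⟨a', b', hab', ⟨o₁, by omega, e₁⟩, ⟨o₂, by omega, e₂⟩, he⟩
            · refine ⟨a, b, hab, ?_, ?_, he⟩
              all_goals
                rcases habxy with ⟨rfl, rfl⟩ | ⟨rfl, rfl⟩
                · first
                  | exact ⟨o, by omega, hx.symm⟩
                  | exact ⟨o', by omega, hy.symm⟩
                · first
                  | exact ⟨o, by omega, hx.symm⟩
                  | exact ⟨o', by omega, hy.symm⟩
      rw [wp]
      have hτ0 : (τ.setv 32 x).v 0 = N1 := by simp [h0]
      have hτ30 : (τ.setv 32 x).v 30 = y := by simp [g1]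
      have hτ32 : (τ.setv 32 x).v 32 = x := by simp
      rw [wp]
      refine ⟨by simp [Tst.ok], fun hyN => ?_, fun hyN => ?_⟩
      · simp only [Tst.holds, Exp.eval, hτ0, hτ30] at hyN
        have hm : M y x := ⟨hyr.1, hyN, by omega, hxr.2, g2, hleaf, hlab⟩
        rw [wp, wp, wp]
        refine ⟨trivial, trivial, wp_conseq _ (hmain y x hm (.inr ⟨rfl, rfl⟩) _ ?_ ?_ ?_)
          fun υ _ h => hfin υ h.1 h.2⟩
        · simp [g1]
        · simp
        · exact ⟨fun z hz => by
            simp only [mv, List.cons_append, List.nil_append, List.mem_cons,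
              List.not_mem_nil, or_false, not_or] at hz
            simp [hz], fun _ _ => rfl, fun _ _ => rfl, rfl⟩
      · simp only [Tst.holds, Exp.eval, hτ0, hτ30] at hyN
        have hm : M x y := ⟨hxr.1, by omega, by omega, hyr.2, hleaf, g2, hlab.symm⟩
        rw [wp, wp, wp]
        refine ⟨trivial, trivial, wp_conseq _ (hmain x y hm (.inl ⟨rfl, rfl⟩) _ ?_ ?_ ?_)
          fun υ _ h => hfin υ h.1 h.2⟩
        · simp
        · simp [g1]
        · exact ⟨fun z hz => by
            simp only [mv, List.cons_append, List.nil_append, List.mem_cons,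
              List.not_mem_nil, or_false, not_or] at hz
            simp [hz], fun _ _ => rfl, fun _ _ => rfl, rfl⟩
  · rw [hE.r2]
    rintro τ - ⟨-, cnt, f1, -, f3, f4⟩
    refine ⟨cnt, by omega, f3, f4.congr fun K t₁ t₂ => ?_⟩
    constructor
    · rintro ⟨x, y, hxy, he⟩
      have hx := hxy.x_le
      have hy := hxy.lt_y
      exact ⟨x, y, hxy, hs.surj x hxy.x_pos (by omega), hs.surj y (by omega) hxy.y_le, he⟩
    · rintro ⟨x, y, hxy, -, -, he⟩
      exact ⟨x, y, hxy, he⟩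

end HIA

namespace HIA

/-! ### Correctness of the answers -/

/-- `e` embeds the tree `T` into the tree with root `0` and parent function `par`. -/
structure Embeds (T : WLTree) (par : ℕ → ℕ) (pw : ℕ → ℤ) (e : Fin T.size → ℕ) : Prop where
  zero : par 0 = 0
  ne : ∀ v, e v ≠ 0
  inj : ∀ v v', e v = e v' → v = v'
  par : ∀ v, par (e v) = if v = T.root then 0 else e (T.parent v)
  weight : ∀ v, pw (e v) = T.weight v

theorem WLTree.weight_mono (T : WLTree) {a v : Fin T.size} (h : T.IsAncestor a v) :
    T.weight a ≤ T.weight v := by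
  obtain ⟨k, rfl⟩ := h
  induction k with
  | zero => exact le_rfl
  | succ k ih =>
    rw [Function.iterate_succ_apply']
    by_cases hr : T.parent^[k] v = T.root
    · rw [hr, T.parent_root, ← hr]
      exact ih
    · exact (T.weight_parent_lt _ hr).le.trans ih

namespace Embeds

variable {T : WLTree} {par : ℕ → ℕ} {pw : ℕ → ℤ} {e : Fin T.size → ℕ}

theorem anc (h : Embeds T par pw e) {a v : Fin T.size} (ha : T.IsAncestor a v) :
    Anc par (e a) (e v) := by
  obtain ⟨k, hk⟩ := ha
  induction k generalizing v with
  | zero => rw [← hk]; exact .refl _ _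
  | succ k ih =>
    rw [Function.iterate_succ_apply] at hk
    by_cases hv : v = T.root
    · rw [hv, T.parent_root, ← hv] at hk
      exact ih hk
    · have h1 := anc_par par (e v)
      rw [h.par, if_neg hv] at h1
      exact (ih hk).trans h1

/-- Above the image of the root there is only `0`, so a nonzero ancestor of an image is an image. -/
theorem exists_of_anc (h : Embeds T par pw e) {g : ℕ} {v : Fin T.size} (hg : g ≠ 0)
    (ha : Anc par g (e v)) : ∃ a, g = e a ∧ T.IsAncestor a v := by
  obtain ⟨k, hk⟩ := ha
  induction k generalizing v with
  | zero => exact ⟨v, hk.symm, 0, rfl⟩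
  | succ k ih =>
    rw [Function.iterate_succ_apply, h.par] at hk
    by_cases hv : v = T.root
    · rw [if_pos hv, Function.iterate_fixed h.zero] at hk
      exact absurd hk.symm hg
    · rw [if_neg hv] at hk
      obtain ⟨a, h1, j, h2⟩ := ih hk
      exact ⟨a, h1, j + 1, by rw [Function.iterate_succ_apply, h2]⟩

theorem root_anc (h : Embeds T par pw e) (v : Fin T.size) : Anc par (e T.root) (e v) :=
  h.anc (T.reaches_root v)

end Embeds

theorem Preorderly.insNode_le {par : ℕ → ℕ} (h : Preorderly par) (k B x j : ℕ) :
    insNode k B par x j ≤ x := by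
  unfold insNode
  split_ifs
  · exact h.anc_le (h.lc_anc_left _ _)
  · exact Nat.zero_le _

theorem Preorderly.qryNode_le {par : ℕ → ℕ} (h : Preorderly par) (k B x j : ℕ) :
    qryNode k B par x j ≤ x := by
  unfold qryNode
  split_ifs
  · exact h.anc_le (h.lc_anc_left _ _)
  · exact Nat.zero_le _

/-- The pairs of entries of all pairs of leaves with the same label. -/
def LeafEntry (T₁ T₂ : WLTree) (k B : ℕ) (par : ℕ → ℕ) (e₁ : Fin T₁.size → ℕ)
    (e₂ : Fin T₂.size → ℕ) (K s₁ s₂ : ℕ) : Prop :=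
  ∃ x y, T₁.IsLeaf x ∧ T₂.IsLeaf y ∧ T₁.label x = T₂.label y ∧
    PairEntry k B par (e₁ x) (e₂ y) K s₁ s₂

/-- The trie node that is found with the entries `j₁`, `j₂`. -/
def found (k B : ℕ) (par : ℕ → ℕ) (ch : ℕ → ℕ → ℕ) (p q j₁ j₂ : ℕ) : ℕ :=
  trieAt B ch (qryKey k B par p j₁ * keyBound k B + qryKey k B par q j₂) (trieDepth k)

section Answers

variable {T₁ T₂ : WLTree} {k B : ℕ} {par : ℕ → ℕ} {pw : ℕ → ℤ} {e₁ : Fin T₁.size → ℕ}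
  {e₂ : Fin T₂.size → ℕ} {ch val : ℕ → ℕ → ℕ}

theorem qryKey_pair_lt (hp : Preorderly par) (hB : 2 ≤ B) {p q : ℕ} (hpB : p < B ^ k)
    (hqB : q < B ^ k) {j₁ j₂ : ℕ} (hj₁ : j₁ < (2 * k) * (2 * k)) (hj₂ : j₂ < (2 * k) * (2 * k)) :
    qryKey k B par p j₁ * keyBound k B + qryKey k B par q j₂ < keyBound k B * keyBound k B :=
  encode_lt (hp.qryKey_lt hB hpB hj₁) (hp.qryKey_lt hB hqB hj₂)

/-- The stored pair may come from any matched leaves whose keys agree with those of the query. The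
combined key determines both keys because the second is below `keyBound k B`. -/
theorem found_spec (hk : 0 < k) (hB : 2 ≤ B) (hp : Preorderly par)
    (h₂ : ∀ v, e₂ v < B ^ k)
    (hd : Dict B (trieDepth k) pw ch val (LeafEntry T₁ T₂ k B par e₁ e₂))
    {p q : ℕ} (hpB : p < B ^ k) (hqB : q < B ^ k) {j₁ j₂ : ℕ}
    (hj₁ : j₁ < (2 * k) * (2 * k)) (hj₂ : j₂ < (2 * k) * (2 * k))
    (hval : val (found k B par ch p q j₁ j₂) 0 ≠ 0) :
    ∃ x y i₁ i₂, T₁.IsLeaf x ∧ T₂.IsLeaf y ∧ T₁.label x = T₂.label y ∧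
      insKey k B par (e₁ x) i₁ = qryKey k B par p j₁ ∧
      insKey k B par (e₂ y) i₂ = qryKey k B par q j₂ ∧
      val (found k B par ch p q j₁ j₂) 1 = insNode k B par (e₁ x) i₁ ∧
      val (found k B par ch p q j₁ j₂) 2 = insNode k B par (e₂ y) i₂ := by
  have hKB := qryKey_pair_lt hp hB hpB hqB hj₁ hj₂
  obtain ⟨x, y, hx, hy, hl, i₁, hi₁, i₂, hi₂, hK, h3, h4⟩ :=
    hd.mem _ (hKB.trans_le (keyBound_sq_le hB)) hval
  obtain ⟨h5, h6⟩ := pair_inj (hp.qryKey_lt hB hqB hj₂) (hp.insKey_lt hk hB (h₂ y) hi₂) hK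
  exact ⟨x, y, i₁, i₂, hx, hy, hl, h5.symm, h6.symm, h3, h4⟩

/-- By `key_sound` in both trees each sum is a common ancestor of a queried node and a matched leaf.
Being nonzero, it is a node of the tree and not the additional root. -/
theorem found_sound (hk : 0 < k) (hB : 2 ≤ B) (hp : Preorderly par) (hE₁ : Embeds T₁ par pw e₁)
    (hE₂ : Embeds T₂ par pw e₂) (h₁ : ∀ v, e₁ v < B ^ k) (h₂ : ∀ v, e₂ v < B ^ k)
    (hd : Dict B (trieDepth k) pw ch val (LeafEntry T₁ T₂ k B par e₁ e₂))
    {u : Fin T₁.size} {v : Fin T₂.size} {j₁ j₂ : ℕ}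
    (hj₁ : j₁ < (2 * k) * (2 * k)) (hj₂ : j₂ < (2 * k) * (2 * k))
    (hval : val (found k B par ch (e₁ u) (e₂ v) j₁ j₂) 0 ≠ 0)
    (hg₁ : val (found k B par ch (e₁ u) (e₂ v) j₁ j₂) 1 + qryNode k B par (e₁ u) j₁ ≠ 0)
    (hg₂ : val (found k B par ch (e₁ u) (e₂ v) j₁ j₂) 2 + qryNode k B par (e₂ v) j₂ ≠ 0) :
    ∃ a b, val (found k B par ch (e₁ u) (e₂ v) j₁ j₂) 1 + qryNode k B par (e₁ u) j₁ = e₁ a ∧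
      val (found k B par ch (e₁ u) (e₂ v) j₁ j₂) 2 + qryNode k B par (e₂ v) j₂ = e₂ b ∧
      InducedAncestors T₁ T₂ u v a b := by
  obtain ⟨x, y, i₁, i₂, hx, hy, hl, h5, h6, h3, h4⟩ :=
    found_spec hk hB hp h₂ hd (h₁ u) (h₂ v) hj₁ hj₂ hval
  rw [h3] at hg₁ ⊢
  rw [h4] at hg₂ ⊢
  obtain ⟨s1, s2⟩ := hp.key_sound hk hB (h₁ x) (h₁ u) h5
  obtain ⟨s3, s4⟩ := hp.key_sound hk hB (h₂ y) (h₂ v) h6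
  obtain ⟨a, ha, ha1⟩ := hE₁.exists_of_anc hg₁ s2
  obtain ⟨b, hb, hb1⟩ := hE₂.exists_of_anc hg₂ s4
  obtain ⟨a', ha', ha2⟩ := hE₁.exists_of_anc hg₁ s1
  obtain ⟨b', hb', hb2⟩ := hE₂.exists_of_anc hg₂ s3
  obtain rfl := hE₁.inj _ _ (ha.symm.trans ha')
  obtain rfl := hE₂.inj _ _ (hb.symm.trans hb')
  exact ⟨a, b, ha, hb, ha1, hb1, x, y, hx, hy, hl, ha2, hb2⟩

/-- The nodes found with the entries of a leaf `x` and with those of another leaf `x'` at the same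
key differ in weight as the stored nodes do. -/
theorem found_weight {T : WLTree} {e : Fin T.size → ℕ} (hk : 0 < k) (hB : 2 ≤ B)
    (hp : Preorderly par) (hE : Embeds T par pw e) (h : ∀ v, e v < B ^ k) {u a x x' : Fin T.size}
    {i i' j : ℕ} (hau : T.IsAncestor a u) (hax : T.IsAncestor a x)
    (he : insKey k B par (e x) i = qryKey k B par (e u) j)
    (hlc : insNode k B par (e x) i + qryNode k B par (e u) j = lc par (e u) (e x))
    (he' : insKey k B par (e x') i' = qryKey k B par (e u) j) :
    insNode k B par (e x') i' + qryNode k B par (e u) j ≠ 0 ∧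
    T.weight a + pw (insNode k B par (e x') i') ≤
      pw (insNode k B par (e x') i' + qryNode k B par (e u) j) + pw (insNode k B par (e x) i) := by
  have h1 := hp.le_lc (hE.anc hau) (hE.anc hax)
  have h2 := hE.ne a
  -- The lowest common ancestor is a descendant of the common ancestor `a`, and weights grow
  -- downwards.
  have h3 : T.weight a ≤ pw (lc par (e u) (e x)) := by
    obtain ⟨b, hb, hb'⟩ := hE.exists_of_anc (g := lc par (e u) (e x)) (by omega)
      (hp.lc_anc_left _ _)
    have h4 := hp.anc_of_le (hE.anc hau) (hp.lc_anc_left _ _) h1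
    rw [hb] at h4
    obtain ⟨a', ha, ha'⟩ := hE.exists_of_anc h2 h4
    rw [hb, hE.weight, ← hE.weight, ha, hE.weight]
    exact T.weight_mono ha'
  rcases hp.key_uniform hk hB (h x) (h x') (h u) he he' (hE.ne T.root) (hE.root_anc x')
    (fun b hb hbx => by
      obtain ⟨b', rfl, -⟩ := hE.exists_of_anc hb hbx
      exact hE.root_anc b') with ⟨g1, g2⟩ | ⟨g1, g2⟩
  -- Both stored nodes are `0`, and the query itself supplies the lowest common ancestor.
  · rw [g1, Nat.zero_add] at hlc
    rw [g1, g2, Nat.zero_add, hlc]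
    exact ⟨by omega, by omega⟩
  -- The query contributes `0`, and the entry of `x` stores the lowest common ancestor.
  · rw [g1, Nat.add_zero] at hlc
    rw [g1, Nat.add_zero, hlc]
    exact ⟨g2 (by omega), by omega⟩

/-- Let leaves `x`, `y` witness that `(a, b)` is induced. By `key_complete` their entries meet the
query at keys that yield the two lowest common ancestors, which are at least as heavy as `a` and
`b`. The dictionary may hold another pair there, with at least the same stored weight;
`found_weight` turns this into a comparison of the resulting nodes. -/
theorem found_complete (hk : 0 < k) (hB : 2 ≤ B) (hp : Preorderly par) (hE₁ : Embeds T₁ par pw e₁)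
    (hE₂ : Embeds T₂ par pw e₂) (h₁ : ∀ v, e₁ v < B ^ k) (h₂ : ∀ v, e₂ v < B ^ k)
    (hd : Dict B (trieDepth k) pw ch val (LeafEntry T₁ T₂ k B par e₁ e₂))
    {u a : Fin T₁.size} {v b : Fin T₂.size} (hab : InducedAncestors T₁ T₂ u v a b) :
    ∃ j₁ < (2 * k) * (2 * k), ∃ j₂ < (2 * k) * (2 * k),
      val (found k B par ch (e₁ u) (e₂ v) j₁ j₂) 0 ≠ 0 ∧
      val (found k B par ch (e₁ u) (e₂ v) j₁ j₂) 1 + qryNode k B par (e₁ u) j₁ ≠ 0 ∧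
      val (found k B par ch (e₁ u) (e₂ v) j₁ j₂) 2 + qryNode k B par (e₂ v) j₂ ≠ 0 ∧
      T₁.weight a + T₂.weight b ≤
        pw (val (found k B par ch (e₁ u) (e₂ v) j₁ j₂) 1 + qryNode k B par (e₁ u) j₁) +
        pw (val (found k B par ch (e₁ u) (e₂ v) j₁ j₂) 2 + qryNode k B par (e₂ v) j₂) := by
  obtain ⟨hau, hbv, x, y, hx, hy, hl, hax, hby⟩ := hab
  obtain ⟨i₁, hi₁, j₁, hj₁, he₁, hn₁⟩ := hp.key_complete hk hB (h₁ x) (h₁ u)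
  obtain ⟨i₂, hi₂, j₂, hj₂, he₂, hn₂⟩ := hp.key_complete hk hB (h₂ y) (h₂ v)
  have hKB := (qryKey_pair_lt hp hB (h₁ u) (h₂ v) hj₁ hj₂).trans_le (keyBound_sq_le hB)
  have hI : LeafEntry T₁ T₂ k B par e₁ e₂ (qryKey k B par (e₁ u) j₁ * keyBound k B +
      qryKey k B par (e₂ v) j₂) (insNode k B par (e₁ x) i₁) (insNode k B par (e₂ y) i₂) :=
    ⟨x, y, hx, hy, hl, i₁, hi₁, i₂, hi₂, by rw [he₁, he₂], rfl, rfl⟩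
  have hval : val (found k B par ch (e₁ u) (e₂ v) j₁ j₂) 0 ≠ 0 :=
    fun h => hd.none _ hKB h _ _ hI
  have hle := hd.le _ hKB hval _ _ hI
  obtain ⟨x', y', i₁', i₂', -, -, -, h5, h6, h3, h4⟩ :=
    found_spec hk hB hp h₂ hd (h₁ u) (h₂ v) hj₁ hj₂ hval
  obtain ⟨w1, w2⟩ := found_weight hk hB hp hE₁ h₁ hau hax he₁ hn₁ h5
  obtain ⟨w3, w4⟩ := found_weight hk hB hp hE₂ h₂ hbv hby he₂ hn₂ h6
  refine ⟨j₁, hj₁, j₂, hj₂, hval, ?_⟩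
  unfold found at h3 h4 ⊢
  rw [h3, h4] at hle ⊢
  exact ⟨w1, w3, by linarith⟩

end Answers

end HIA

namespace HIA

open Cmd Exp

/-! ### Preprocessing -/

namespace Joined

variable {T₁ T₂ : WLTree} {par : ℕ → ℕ} {wt lb : ℕ → ℤ}

theorem embeds₁ (h : Joined T₁ T₂ par wt lb) : Embeds T₁ par wt fun v => v + 1 :=
  ⟨h.par0, fun _ => by omega, fun _ _ e => Fin.ext (by omega), h.par1, h.wt1⟩

theorem embeds₂ (h : Joined T₁ T₂ par wt lb) : Embeds T₂ par wt fun v => T₁.size + v + 1 :=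
  ⟨h.par0, fun _ => by omega, fun _ _ e => Fin.ext (by omega), h.par2, h.wt2⟩

theorem cases {i : ℕ} (h1 : 1 ≤ i) (h2 : i ≤ T₁.size + T₂.size) :
    (∃ v : Fin T₁.size, i = v + 1) ∨ ∃ v : Fin T₂.size, i = T₁.size + v + 1 := by
  by_cases h : i ≤ T₁.size
  · exact .inl ⟨⟨i - 1, by omega⟩, by simp; omega⟩
  · exact .inr ⟨⟨i - T₁.size - 1, by omega⟩, by simp; omega⟩

theorem par_spec (h : Joined T₁ T₂ par wt lb) {i : ℕ} (h1 : 1 ≤ i)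
    (h2 : i ≤ T₁.size + T₂.size) : par i = 0 ∨
      1 ≤ par i ∧ par i ≤ T₁.size + T₂.size ∧ wt (par i) < wt i := by
  rcases cases h1 h2 with ⟨v, rfl⟩ | ⟨v, rfl⟩
  · rw [h.par1]
    split_ifs with hv
    · exact .inl rfl
    · right
      rw [h.wt1, h.wt1]
      exact ⟨by omega, by omega, T₁.weight_parent_lt v hv⟩
  · rw [h.par2]
    split_ifs with hv
    · exact .inl rfl
    · right
      rw [h.wt2, h.wt2]
      exact ⟨by omega, by omega, T₂.weight_parent_lt v hv⟩

theorem par_le (h : Joined T₁ T₂ par wt lb) {i : ℕ} (h2 : i ≤ T₁.size + T₂.size) :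
    par i ≤ T₁.size + T₂.size := by
  rcases Nat.eq_zero_or_pos i with rfl | h1
  · rw [h.par0]; omega
  · rcases h.par_spec h1 h2 with h3 | h3 <;> omega

theorem zero_anc (h : Joined T₁ T₂ par wt lb) {i : ℕ} (h2 : i ≤ T₁.size + T₂.size) :
    Anc par 0 i := by
  rcases Nat.eq_zero_or_pos i with rfl | h1
  · exact .refl _ _
  · rcases cases h1 h2 with ⟨v, rfl⟩ | ⟨v, rfl⟩
    · have := h.par1 T₁.root
      rw [if_pos rfl] at this
      exact Anc.trans ⟨1, this⟩ (h.embeds₁.root_anc v)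
    · have := h.par2 T₂.root
      rw [if_pos rfl] at this
      exact Anc.trans ⟨1, this⟩ (h.embeds₂.root_anc v)

/-- The self-loop of the root has been replaced by the parent `0`, so it does not make the root its
own child, and parents never cross from one tree to the other. -/
theorem isLeaf₁ (h : Joined T₁ T₂ par wt lb) (v : Fin T₁.size) :
    (∀ i, 1 ≤ i → i ≤ T₁.size + T₂.size → par i ≠ v + 1) ↔ T₁.IsLeaf v := by
  constructor
  · intro h1 c hc hcv
    have := h1 (c + 1) (by omega) (by omega)
    rw [h.par1, if_neg hc, hcv] at this
    exact this rfl
  · intro h1 i hi1 hi2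
    rcases cases hi1 hi2 with ⟨c, rfl⟩ | ⟨c, rfl⟩
    · rw [h.par1]
      split_ifs with hc
      · omega
      · exact fun e => h1 c hc (Fin.ext (by omega))
    · rw [h.par2]
      split_ifs with hc <;> omega

theorem isLeaf₂ (h : Joined T₁ T₂ par wt lb) (v : Fin T₂.size) :
    (∀ i, 1 ≤ i → i ≤ T₁.size + T₂.size → par i ≠ T₁.size + v + 1) ↔ T₂.IsLeaf v := by
  constructor
  · intro h1 c hc hcv
    have := h1 (T₁.size + c + 1) (by omega) (by omega)
    rw [h.par2, if_neg hc, hcv] at this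
    exact this rfl
  · intro h1 i hi1 hi2
    rcases cases hi1 hi2 with ⟨c, rfl⟩ | ⟨c, rfl⟩
    · rw [h.par1]
      split_ifs with hc <;> omega
    · rw [h.par2]
      split_ifs with hc
      · omega
      · exact fun e => h1 c hc (Fin.ext (by omega))

end Joined

/-- The nodes `0, …, N` of the joined tree are numbered in preorder: `pos` and `org` are inverse to
each other, `pp` is the parent function and `pw` the weight function on positions. -/
structure Numbered (N : ℕ) (par : ℕ → ℕ) (wt : ℕ → ℤ) (pos org pp : ℕ → ℕ) (pw : ℕ → ℤ) :
    Prop where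
  pre : Preorderly pp
  beyond : ∀ t, N < t → pp t = 0
  pos_le : ∀ i ≤ N, pos i ≤ N
  org_pos : ∀ i ≤ N, org (pos i) = i
  pos_zero : pos 0 = 0
  pp_pos : ∀ i ≤ N, pp (pos i) = pos (par i)
  pw_pos : ∀ i ≤ N, pw (pos i) = wt i

/-- `pos` commutes with the parent functions, hence preserves ancestors; the condition `hR` on
neighbours in the list thus becomes `Preorderly.succ`. Behind the last position the parent is `0`,
an ancestor of everything. -/
theorem Joined.numbered {T₁ T₂ : WLTree} {par : ℕ → ℕ} {wt lb : ℕ → ℤ}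
    (h : Joined T₁ T₂ par wt lb) {pos org pp : ℕ → ℕ} {pw : ℕ → ℤ}
    (hpos : ∀ i ≤ T₁.size + T₂.size, pos i ≤ T₁.size + T₂.size ∧ org (pos i) = i)
    (horg : ∀ t ≤ T₁.size + T₂.size, org t ≤ T₁.size + T₂.size ∧ pos (org t) = t)
    (h0 : pos 0 = 0) (hR : ∀ t < T₁.size + T₂.size, Anc par (par (org (t + 1))) (org t))
    (hpp : ∀ t ≤ T₁.size + T₂.size, pp t = pos (par (org t)) ∧ pw t = wt (org t))
    (hpp' : ∀ t, T₁.size + T₂.size < t → pp t = 0) :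
    Numbered (T₁.size + T₂.size) par wt pos org pp pw := by
  have hp : ∀ i ≤ T₁.size + T₂.size, pp (pos i) = pos (par i) := fun i hi => by
    rw [(hpp _ (hpos i hi).1).1, (hpos i hi).2]
  have hanc : ∀ a b, b ≤ T₁.size + T₂.size → Anc par a b → Anc pp (pos a) (pos b) := by
    rintro a b hb ⟨n, rfl⟩
    refine ⟨n, ?_⟩
    induction n generalizing b with
    | zero => rfl
    | succ n ih =>
      rw [Function.iterate_succ_apply, Function.iterate_succ_apply, hp b hb, ih _ (h.par_le hb)]
  refine ⟨⟨?_, fun t => ?_⟩, hpp', fun i hi => (hpos i hi).1, fun i hi => (hpos i hi).2, h0, hp,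
    fun i hi => ?_⟩
  · have := hp 0 (by omega)
    rwa [h0, h.par0, h0] at this
  · by_cases ht : t < T₁.size + T₂.size
    · have h1 := horg t ht.le
      have h2 := hanc _ _ h1.1 (hR t ht)
      rwa [h1.2, ← (hpp (t + 1) ht).1] at h2
    · rw [hpp' _ (by omega)]
      by_cases ht' : t ≤ T₁.size + T₂.size
      · have h1 := horg t ht'
        have h2 := hanc _ _ h1.1 (h.zero_anc h1.1)
        rwa [h1.2, h0] at h2
      · exact ⟨1, hpp' t (by omega)⟩
  · rw [(hpp _ (hpos i hi).1).2, (hpos i hi).2]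

theorem Numbered.embeds {N : ℕ} {par pos org pp : ℕ → ℕ} {wt pw : ℕ → ℤ}
    (h : Numbered N par wt pos org pp pw) {T : WLTree} {e : Fin T.size → ℕ}
    (he : Embeds T par wt e) (heN : ∀ v, e v ≤ N) : Embeds T pp pw fun v => pos (e v) := by
  refine ⟨h.pre.zero, fun v hv => he.ne v ?_, fun v v' hv => he.inj v v' ?_, fun v => ?_,
    fun v => ?_⟩
  · have h1 := h.org_pos _ (heN v)
    have h2 := h.org_pos 0 (Nat.zero_le _)
    rw [h.pos_zero] at h2
    rw [← h1, hv, h2]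
  · rw [← h.org_pos _ (heN v), hv, h.org_pos _ (heN v')]
  · rw [h.pp_pos _ (heN v), he.par]
    split_ifs
    · exact h.pos_zero
    · rfl
  · rw [h.pw_pos _ (heN v), he.weight]

/-- What the preprocessing has computed. -/
structure Built (cx : Ctx) (T₁ T₂ : WLTree) (k B : ℕ) (τ : St) : Prop where
  pre : Preorderly fun t => τ.a 9 t 0
  emb₁ : Embeds T₁ (fun t => τ.a 9 t 0) (τ.z 2) fun v => τ.a 7 (v + 1) 0
  emb₂ : Embeds T₂ (fun t => τ.a 9 t 0) (τ.z 2) fun v => τ.a 7 (T₁.size + v + 1) 0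
  pos_le : ∀ i ≤ T₁.size + T₂.size, τ.a 7 i 0 ≤ T₁.size + T₂.size
  org_pos : ∀ i ≤ T₁.size + T₂.size, τ.a 8 (τ.a 7 i 0) 0 = i
  qry : ∀ u ≤ T₁.size + T₂.size, ∀ j < (2 * k) * (2 * k),
    τ.a 14 u j = qryKey k B (fun t => τ.a 9 t 0) u j ∧
    τ.a 15 u j = qryNode k B (fun t => τ.a 9 t 0) u j
  trie : ∃ cnt < cx.L, Trie (τ.a 16) cnt
  dict : Dict B (trieDepth k) (τ.z 2) (τ.a 16) (τ.a 17)
    (LeafEntry T₁ T₂ k B (fun t => τ.a 9 t 0) (fun v => τ.a 7 (v + 1) 0)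
      fun v => τ.a 7 (T₁.size + v + 1) 0)
  prm₀ : τ.a 18 0 0 = B
  prm₁ : τ.a 18 0 1 = keyBound k B
  prm₂ : τ.a 18 0 2 = T₁.size

/-- Numbering of the nodes. -/
def numberCmd : Cmd :=
  inputCmd ;; leafCmd ;; sortCmd 0 2 4 ;; sortCmd 1 3 5 ;; listCmd ;; posCmd ;; parCmd

/-- The first sort is by weight and feeds the linked list, the second is by label and is kept for
the matching of leaves. The rest is the transport of each result through later commands that do not
write its arrays. -/
theorem numberCmd_wp {cx : Ctx} {T₁ T₂ : WLTree} {k B : ℕ} (hE : Env cx T₁.size T₂.size k B)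
    {σ : St} (hc : Consts cx σ) (hinp : σ.inp = inputCells T₁ T₂)
    (ha : ∀ j r c, σ.a j r c = 0) (hz : ∀ j r, σ.z j r = 0) :
    numberCmd.wp cx (fun τ => Joined T₁ T₂ (fun i => τ.a 0 i 0) (τ.z 0) (τ.z 1) ∧
      (∀ p, τ.a 1 p 0 = 0 ↔ ∀ i, 1 ≤ i → i ≤ T₁.size + T₂.size → τ.a 0 i 0 ≠ p) ∧
      Sorted (τ.z 1) (T₁.size + T₂.size) (fun o => τ.a 5 o 0) ∧
      Numbered (T₁.size + T₂.size) (fun i => τ.a 0 i 0) (τ.z 0) (fun i => τ.a 7 i 0)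
        (fun i => τ.a 8 i 0) (fun i => τ.a 9 i 0) (τ.z 2)) σ := by
  unfold numberCmd
  rw [wp]
  refine wp_conseq _ (inputCmd_wp hE hc hinp (fun r => ha _ _ _) fun r => hz _ _) fun σ₁ A₁ J => ?_
  have c₁ := hc.of_agree A₁ fun x hx => by simp [inputCmd]; omega
  have J' : ∀ i ≤ T₁.size + T₂.size, σ₁.a 0 i 0 ≤ T₁.size + T₂.size := fun i hi => J.par_le hi
  rw [wp]
  refine wp_conseq _ (leafCmd_wp hE c₁ (fun r => by rw [A₁.a 1 (by simp [inputCmd]), ha]) J')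
    fun σ₂ A₂ h1 => ?_
  have c₂ := c₁.of_agree A₂ fun x hx => by simp [leafCmd]; omega
  have e0 : σ₂.a 0 = σ₁.a 0 := A₂.a 0 (by simp [leafCmd])
  have z0 : σ₂.z = σ₁.z := funext fun j => A₂.z j (by simp [leafCmd])
  rw [← e0] at h1 J'
  rw [← e0, ← z0] at J
  rw [wp]
  refine wp_conseq _ (sortCmd_wp (zk := 0) (tj := 2) (oj := 4) hE (by omega) (by omega) (by omega)
    (by omega) c₂ fun j e => by
      rw [A₂.a 2 (by simp [leafCmd]), A₁.a 2 (by simp [inputCmd]), ha]) fun σ₃ A₃ h4 => ?_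
  have c₃ := c₂.of_agree A₃ fun x hx => sortCmd_mv _ _ _ _ (by omega)
  have f3 : ∀ j, j ≠ 2 → j ≠ 4 → σ₃.a j = σ₂.a j := fun j h1 h2 =>
    A₃.a j (by simp [sortCmd, updCmd]; omega)
  have z3 : σ₃.z = σ₂.z := funext fun j => A₃.z j (by simp [sortCmd, updCmd])
  rw [← f3 0 (by omega) (by omega)] at h1 J' J
  rw [← f3 1 (by omega) (by omega)] at h1
  rw [← z3] at J h4
  rw [wp]
  refine wp_conseq _ (sortCmd_wp (zk := 1) (tj := 3) (oj := 5) hE (by omega) (by omega) (by omega)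
    (by omega) c₃ fun j e => by
      rw [f3 3 (by omega) (by omega), A₂.a 3 (by simp [leafCmd]), A₁.a 3 (by simp [inputCmd]), ha])
    fun σ₄ A₄ h5 => ?_
  have c₄ := c₃.of_agree A₄ fun x hx => sortCmd_mv _ _ _ _ (by omega)
  have f4 : ∀ j, j ≠ 3 → j ≠ 5 → σ₄.a j = σ₃.a j := fun j h1 h2 =>
    A₄.a j (by simp [sortCmd, updCmd]; omega)
  have z4 : σ₄.z = σ₃.z := funext fun j => A₄.z j (by simp [sortCmd, updCmd])
  rw [← f4 0 (by omega) (by omega)] at h1 J' J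
  rw [← f4 1 (by omega) (by omega)] at h1
  rw [← f4 4 (by omega) (by omega)] at h4
  rw [← z4] at J h4 h5
  rw [wp]
  refine wp_conseq _ (listCmd_wp hE c₄ (fun i => rfl) h4 (fun i h1 h2 => J.par_spec h1 h2))
    fun σ₅ A₅ ⟨l, l1, l2, l3, l4, l5⟩ => ?_
  have c₅ := c₄.of_agree A₅ fun x hx => by simp [listCmd]; omega
  have f5 : ∀ j, j ≠ 6 → σ₅.a j = σ₄.a j := fun j h1 => A₅.a j (by simp [listCmd]; omega)
  have z5 : σ₅.z = σ₄.z := funext fun j => A₅.z j (by simp [listCmd])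
  rw [← f5 0 (by omega)] at h1 J' J l5
  rw [← f5 1 (by omega)] at h1
  rw [← f5 5 (by omega)] at h5
  rw [← z5] at J h5
  rw [wp]
  refine wp_conseq _ (posCmd_wp hE c₅ (R := fun s t => Anc (fun i => σ₅.a 0 i 0) (σ₅.a 0 t 0) s)
    l1 l2 l3 l4 l5) fun σ₆ A₆ ⟨p1, p2, p3, p4⟩ => ?_
  have c₆ := c₅.of_agree A₆ fun x hx => by simp [posCmd]; omega
  have f6 : ∀ j, j ≠ 7 → j ≠ 8 → σ₆.a j = σ₅.a j := fun j h1 h2 => A₆.a j (by simp [posCmd]; omega)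
  have z6 : σ₆.z = σ₅.z := funext fun j => A₆.z j (by simp [posCmd])
  rw [← f6 0 (by omega) (by omega)] at h1 J' J p4
  rw [← f6 1 (by omega) (by omega)] at h1
  rw [← f6 5 (by omega) (by omega)] at h5
  rw [← z6] at J h5
  refine wp_conseq _ (parCmd_wp hE c₆ (fun t ht => (p1 t ht).1) J' fun t => by
    rw [f6 9 (by omega) (by omega), f5 9 (by omega), f4 9 (by omega) (by omega),
      f3 9 (by omega) (by omega), A₂.a 9 (by simp [leafCmd]), A₁.a 9 (by simp [inputCmd]), ha])
    fun σ₇ A₇ ⟨q1, q2⟩ => ?_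
  have f7 : ∀ j, j ≠ 9 → σ₇.a j = σ₆.a j := fun j h1 => A₇.a j (by simp [parCmd]; omega)
  have z7 : ∀ j, j ≠ 2 → σ₇.z j = σ₆.z j := fun j h1 => A₇.z j (by simp [parCmd]; omega)
  rw [f7 0 (by omega), f7 1 (by omega), f7 5 (by omega), f7 7 (by omega), f7 8 (by omega),
    z7 0 (by omega), z7 1 (by omega)]
  exact ⟨J, h1, h5, J.numbered p2 p1 p3 p4 q1 q2⟩

/-- The tables, the trie and the parameters. -/
def tableCmd : Cmd :=
  powCmd ;; tabUpCmd ;; tabDownCmd ;; insTabCmd ;; qryTabCmd ;; joinCmd ;;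
  wr 18 (lit 0) (lit 0) (var 4) ;; wr 18 (lit 0) (lit 1) (var 11) ;; wr 18 (lit 0) (lit 2) (var 0)

theorem insNode_eq_zero_or (k B : ℕ) {par : ℕ → ℕ} (hp : Preorderly par) (x j : ℕ) :
    insNode k B par x j = 0 ∨ Anc par (insNode k B par x j) x := by
  unfold insNode
  split_ifs
  · exact .inr (hp.lc_anc_left _ _)
  · exact .inl rfl

/-- Besides sums of two weights the dictionary compares sums in which one or both nodes are `0`, of
weight 0; such a sum is a single weight or `0`. -/
theorem FitsInWords.sum {w : ℕ} {T₁ T₂ : WLTree} (hf : FitsInWords w T₁ T₂) {par : ℕ → ℕ}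
    {pw : ℕ → ℤ} {e₁ : Fin T₁.size → ℕ} {e₂ : Fin T₂.size → ℕ} (h₁ : Embeds T₁ par pw e₁)
    (h₂ : Embeds T₂ par pw e₂) (h0 : pw 0 = 0) {s₁ s₂ : ℕ} {x : Fin T₁.size} {y : Fin T₂.size}
    (hs₁ : s₁ = 0 ∨ Anc par s₁ (e₁ x)) (hs₂ : s₂ = 0 ∨ Anc par s₂ (e₂ y)) :
    IsWord w (pw s₁ + pw s₂) := by
  have k₁ : s₁ = 0 ∨ ∃ a, s₁ = e₁ a := by
    rcases Nat.eq_zero_or_pos s₁ with h | h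
    · exact .inl h
    · obtain ⟨a, ha, -⟩ := h₁.exists_of_anc h.ne' (hs₁.resolve_left h.ne')
      exact .inr ⟨a, ha⟩
  have k₂ : s₂ = 0 ∨ ∃ b, s₂ = e₂ b := by
    rcases Nat.eq_zero_or_pos s₂ with h | h
    · exact .inl h
    · obtain ⟨b, hb, -⟩ := h₂.exists_of_anc h.ne' (hs₂.resolve_left h.ne')
      exact .inr ⟨b, hb⟩
  rcases k₁ with rfl | ⟨a, rfl⟩ <;> rcases k₂ with rfl | ⟨b, rfl⟩
  · rw [h0]
    have : (0 : ℤ) < 2 ^ w := by positivity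
    exact ⟨by omega, by omega⟩
  · rw [h0, zero_add, h₂.weight]
    exact (hf.2.1 b).1
  · rw [h0, add_zero, h₁.weight]
    exact (hf.1 a).1
  · rw [h₁.weight, h₂.weight]
    exact hf.2.2 a b

theorem tableCmd_wp {cx : Ctx} {T₁ T₂ : WLTree} {k B : ℕ} (hE : Env cx T₁.size T₂.size k B)
    {σ : St} (hc : Consts cx σ) (hf : FitsInWords cx.w T₁ T₂)
    (ha : ∀ j, 9 < j → ∀ r c, σ.a j r c = 0)
    (J : Joined T₁ T₂ (fun i => σ.a 0 i 0) (σ.z 0) (σ.z 1))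
    (hl : ∀ p, σ.a 1 p 0 = 0 ↔ ∀ i, 1 ≤ i → i ≤ T₁.size + T₂.size → σ.a 0 i 0 ≠ p)
    (hs : Sorted (σ.z 1) (T₁.size + T₂.size) fun o => σ.a 5 o 0)
    (hN : Numbered (T₁.size + T₂.size) (fun i => σ.a 0 i 0) (σ.z 0) (fun i => σ.a 7 i 0)
        (fun i => σ.a 8 i 0) (fun i => σ.a 9 i 0) (σ.z 2)) :
    tableCmd.wp cx (Built cx T₁ T₂ k B) σ := by
  have hL := hE.hL
  have hWd := hE.hWd
  have hLW := hE.hLW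
  have hB := hE.hB
  have emb₁ := hN.embeds J.embeds₁ fun v => by omega
  have emb₂ := hN.embeds J.embeds₂ fun v => by omega
  have pw0 : σ.z 2 0 = 0 := by
    have := hN.pw_pos 0 (by omega)
    rwa [hN.pos_zero, J.wt0] at this
  unfold tableCmd
  rw [wp]
  refine wp_conseq _ (powCmd_wp hE hc) fun σ₁ A₁ hP₁ => ?_
  have c₁ := hc.of_agree A₁ fun x hx => by simp [powCmd]; omega
  have f1 : ∀ j, j ≠ 10 → σ₁.a j = σ.a j := fun j h1 => A₁.a j (by simp [powCmd]; omega)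
  have p₁ : Positions (T₁.size + T₂.size) σ₁ := by
    constructor
    · rw [f1 9 (by omega)]; exact hN.pre
    · rw [f1 9 (by omega)]; exact hN.beyond
  rw [wp]
  refine wp_conseq _ (tabUpCmd_wp hE c₁ hP₁ fun r c => by
    rw [f1 11 (by omega), ha 11 (by omega)]) fun σ₂ A₂ ⟨t1, t2⟩ => ?_
  have c₂ := c₁.of_agree A₂ fun x hx => by simp [tabUpCmd]; omega
  have f2 : ∀ j, j ≠ 11 → σ₂.a j = σ₁.a j := fun j h1 => A₂.a j (by simp [tabUpCmd]; omega)
  rw [← f2 9 (by omega)] at t1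
  rw [← f2 10 (by omega)] at hP₁
  have p₂ : Positions (T₁.size + T₂.size) σ₂ := by
    constructor
    · rw [f2 9 (by omega)]; exact p₁.pre
    · rw [f2 9 (by omega)]; exact p₁.beyond
  rw [wp]
  refine wp_conseq _ (tabDownCmd_wp hE c₂ hP₁ p₂ t1 t2) fun σ₃ A₃ t3 => ?_
  have c₃ := c₂.of_agree A₃ fun x hx => by simp [tabDownCmd]; omega
  have f3 : ∀ j, j ≠ 11 → σ₃.a j = σ₂.a j := fun j h1 => A₃.a j (by simp [tabDownCmd]; omega)
  rw [f2 9 (by omega), f1 9 (by omega)] at t3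
  rw [← f3 10 (by omega)] at hP₁
  rw [wp]
  refine wp_conseq _ (insTabCmd_wp hE c₃ hP₁ hN.pre t3) fun σ₄ A₄ t4 => ?_
  have c₄ := c₃.of_agree A₄ fun x hx => by simp [insTabCmd, insTypCmd]; omega
  have f4 : ∀ j, j ≠ 12 → j ≠ 13 → σ₄.a j = σ₃.a j := fun j h1 h2 =>
    A₄.a j (by simp [insTabCmd, insTypCmd]; omega)
  rw [← f4 10 (by omega) (by omega)] at hP₁
  rw [← f4 11 (by omega) (by omega)] at t3
  rw [wp]
  refine wp_conseq _ (qryTabCmd_wp hE c₄ hP₁ hN.pre t3) fun σ₅ A₅ t5 => ?_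
  have c₅ := c₄.of_agree A₅ fun x hx => by simp [qryTabCmd, qrySepCmd]; omega
  have f5 : ∀ j, j ≠ 14 → j ≠ 15 → σ₅.a j = σ₄.a j := fun j h1 h2 =>
    A₅.a j (by simp [qryTabCmd, qrySepCmd]; omega)
  rw [← f5 12 (by omega) (by omega), ← f5 13 (by omega) (by omega)] at t4
  have f : ∀ j, j < 10 ∨ 15 < j → σ₅.a j = σ.a j := fun j hj => by
    rw [f5 j (by omega) (by omega), f4 j (by omega) (by omega), f3 j (by omega), f2 j (by omega),
      f1 j (by omega)]
  have fz : σ₅.z = σ.z := funext fun j => by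
    rw [A₅.z j (by simp [qryTabCmd, qrySepCmd]), A₄.z j (by simp [insTabCmd, insTypCmd]),
      A₃.z j (by simp [tabDownCmd]), A₂.z j (by simp [tabUpCmd]), A₁.z j (by simp [powCmd])]
  have leaf₁ : ∀ v : Fin T₁.size, σ.a 1 (v + 1) 0 = 0 ↔ T₁.IsLeaf v := fun v => by
    rw [hl, J.isLeaf₁]
  have leaf₂ : ∀ v : Fin T₂.size, σ.a 1 (T₁.size + v + 1) 0 = 0 ↔ T₂.IsLeaf v := fun v => by
    rw [hl, J.isLeaf₂]
  rw [wp]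
  refine wp_conseq _ (joinCmd_wp hE c₅ hN.pre t4 ?_ ?_ ?_ ?_ ?_ ?_ ?_)
    fun σ₆ A₆ ⟨cnt, g1, g2, g3⟩ => ?_
  · rw [f 7 (by omega)]; exact hN.pos_le
  · rw [f 5 (by omega), fz]; exact hs
  · rw [f 1 (by omega), fz]
    intro x y hx hy x1 x2 y1 y2 he
    rcases Joined.cases (T₁ := T₁) (T₂ := T₂) x1 (by omega) with ⟨v, rfl⟩ | ⟨v, rfl⟩
    · rcases Joined.cases (T₁ := T₁) (T₂ := T₂) y1 (by omega) with ⟨v', rfl⟩ | ⟨v', rfl⟩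
      · rw [J.lb1, J.lb1] at he
        rw [T₁.label_injective v v' ((leaf₁ v).1 hx) ((leaf₁ v').1 hy) he]
      · omega
    · omega
  · rw [f 1 (by omega), fz]
    intro x y hx hy x1 x2 y1 y2 he
    rcases Joined.cases (T₁ := T₁) (T₂ := T₂) (i := x) (by omega) x2 with ⟨v, rfl⟩ | ⟨v, rfl⟩
    · omega
    · rcases Joined.cases (T₁ := T₁) (T₂ := T₂) (i := y) (by omega) y2 with ⟨v', rfl⟩ | ⟨v', rfl⟩
      · omega
      · rw [J.lb2, J.lb2] at he
        rw [T₂.label_injective v v' ((leaf₂ v).1 hx) ((leaf₂ v').1 hy) he]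
  · rw [f 16 (by omega)]; exact ha 16 (by omega)
  · rw [f 17 (by omega)]; exact ha 17 (by omega)
  · rw [f 1 (by omega), f 7 (by omega), fz]
    rintro x y hm K t₁ t₂ ⟨i, -, j, -, -, rfl, rfl⟩
    have hx := hN.pos_le x (by have := hm.x_le; omega)
    have hy := hN.pos_le y hm.y_le
    have l1 := hN.pre.insNode_le k B (σ.a 7 x 0) i
    have l2 := hN.pre.insNode_le k B (σ.a 7 y 0) j
    refine ⟨by omega, by omega, ?_⟩
    rcases Joined.cases (T₁ := T₁) (T₂ := T₂) (i := x) hm.x_pos (by have := hm.x_le; omega) with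
      ⟨v, rfl⟩ | ⟨v, rfl⟩
    · rcases Joined.cases (T₁ := T₁) (T₂ := T₂) (i := y) (by have := hm.lt_y; omega) hm.y_le with
        ⟨v', rfl⟩ | ⟨v', rfl⟩
      · have := hm.lt_y; omega
      · exact hf.sum emb₁ emb₂ pw0 (insNode_eq_zero_or k B hN.pre _ i)
          (insNode_eq_zero_or k B hN.pre _ j)
    · have := hm.x_le; omega
  · have c₆ := c₅.of_agree A₆ fun x hx => by simp [joinCmd, pairCmd, insertCmd]; omega
    have f6 : ∀ j, j ≠ 16 → j ≠ 17 → σ₆.a j = σ₅.a j := fun j h1 h2 =>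
      A₆.a j (by simp [joinCmd, pairCmd, insertCmd]; omega)
    have z6 : σ₆.z = σ.z := (funext fun j => A₆.z j (by simp [joinCmd, pairCmd, insertCmd])).trans fz
    have b0 : σ₆.v 0 = T₁.size := by rw [c₆ 0 (by omega), hE.r0]
    have b4 : σ₆.v 4 = B := by rw [c₆ 4 (by omega), hE.r4]
    have b11 : σ₆.v 11 = keyBound k B := by rw [c₆ 11 (by omega), hE.r11]
    simp only [wp, Exp.ok, Exp.eval, St.seta_v, b0, b4, b11, true_and]
    refine ⟨by omega, by omega, by omega, ?_⟩
    set υ := ((σ₆.seta 18 0 0 B).seta 18 0 1 (keyBound k B)).seta 18 0 2 T₁.size with hυ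
    have fυ : ∀ j, j ≠ 18 → υ.a j = σ₆.a j := fun j hj => by
      rw [hυ, St.seta_a_of_ne _ _ _ _ hj, St.seta_a_of_ne _ _ _ _ hj, St.seta_a_of_ne _ _ _ _ hj]
    have zυ : υ.z = σ.z := z6
    have e7 : υ.a 7 = σ.a 7 := by rw [fυ 7 (by omega), f6 7 (by omega) (by omega), f 7 (by omega)]
    have e8 : υ.a 8 = σ.a 8 := by rw [fυ 8 (by omega), f6 8 (by omega) (by omega), f 8 (by omega)]
    have e9 : υ.a 9 = σ.a 9 := by rw [fυ 9 (by omega), f6 9 (by omega) (by omega), f 9 (by omega)]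
    constructor
    · rw [e9]; exact hN.pre
    · rw [e9, e7, zυ]; exact emb₁
    · rw [e9, e7, zυ]; exact emb₂
    · rw [e7]; exact hN.pos_le
    · rw [e7, e8]; exact hN.org_pos
    · rw [e9, fυ 14 (by omega), fυ 15 (by omega), f6 14 (by omega) (by omega),
        f6 15 (by omega) (by omega)]
      exact t5
    · rw [fυ 16 (by omega)]; exact ⟨cnt, g1, g2⟩
    · rw [e9, e7, zυ, fυ 16 (by omega), fυ 17 (by omega)]
      rw [f 1 (by omega), f 7 (by omega), fz] at g3
      refine g3.congr fun K s₁ s₂ => ?_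
      constructor
      · rintro ⟨x, y, hx, hy, hxy, he⟩
        exact ⟨x + 1, T₁.size + y + 1, ⟨by omega, by omega, by omega, by omega, (leaf₁ x).2 hx,
          (leaf₂ y).2 hy, by rw [J.lb1, J.lb2, hxy]⟩, he⟩
      · rintro ⟨x, y, hm, he⟩
        rcases Joined.cases (T₁ := T₁) (T₂ := T₂) (i := x) hm.x_pos (by have := hm.x_le; omega) with
          ⟨v, rfl⟩ | ⟨v, rfl⟩
        · rcases Joined.cases (T₁ := T₁) (T₂ := T₂) (i := y) (by have := hm.lt_y; omega)
            hm.y_le with ⟨v', rfl⟩ | ⟨v', rfl⟩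
          · have := hm.lt_y; omega
          · exact ⟨v, v', (leaf₁ v).1 hm.leaf_x, (leaf₂ v').1 hm.leaf_y,
              by rw [← J.lb1, ← J.lb2, hm.eq], he⟩
        · have := hm.x_le; omega
    · simp [hυ]
    · simp [hυ]
    · simp [hυ]

theorem build_wp {cx : Ctx} {T₁ T₂ : WLTree} {k B : ℕ} (hE : Env cx T₁.size T₂.size k B)
    {σ : St} (hc : Consts cx σ) (hf : FitsInWords cx.w T₁ T₂) (hinp : σ.inp = inputCells T₁ T₂)
    (ha : ∀ j r c, σ.a j r c = 0) (hz : ∀ j r, σ.z j r = 0) :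
    (numberCmd ;; tableCmd).wp cx (Built cx T₁ T₂ k B) σ := by
  rw [wp]
  refine wp_conseq _ (numberCmd_wp hE hc hinp ha hz) fun τ A ⟨h1, h2, h3, h4⟩ => ?_
  refine tableCmd_wp hE (hc.of_agree A fun x hx => ?_) hf (fun j hj r c => ?_) h1 h2 h3 h4
  · simp [numberCmd, inputCmd, leafCmd, sortCmd, updCmd, listCmd, posCmd, parCmd]
    omega
  · rw [A.a j, ha]
    simp [numberCmd, inputCmd, leafCmd, sortCmd, updCmd, listCmd, posCmd, parCmd]
    omega

end HIA

namespace HIA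

open Cmd Exp

/-! ### Queries -/

/-- Replaces the best pair (variables 56, 57; variable 55 tells whether there is one) by the pair
in variables 60, 61 if that is heavier. -/
def improveCmd : Cmd :=
  ite (.eq (var 60) (lit 0)) skip (ite (.eq (var 61) (lit 0)) skip (
    ite (.eq (var 55) (lit 0)) (asg 55 (lit 1) ;; asg 56 (var 60) ;; asg 57 (var 61)) (
    ite (.zlt (.add (.rd 2 (var 56)) (.rd 2 (var 57))) (.add (.rd 2 (var 60)) (.rd 2 (var 61))))
      (asg 56 (var 60) ;; asg 57 (var 61)) skip)))

/-- Looks up all pairs of entries of the positions in variables 53 and 54. -/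
def searchCmd : Cmd :=
  for_ 58 9 (for_ 59 9 (
    asg 40 (.add (.mul (.rd 14 (var 53) (var 58)) (var 11)) (.rd 14 (var 54) (var 59))) ;;
    lookupCmd ;;
    ite (.eq (.rd 17 (var 43) (lit 0)) (lit 0)) skip (
      asg 60 (.add (.rd 17 (var 43) (lit 1)) (.rd 15 (var 53) (var 58))) ;;
      asg 61 (.add (.rd 17 (var 43) (lit 2)) (.rd 15 (var 54) (var 59))) ;; improveCmd)))

def queryCmd (k : ℕ) : Cmd :=
  asg 4 (.rd 18 (lit 0) (lit 0)) ;; asg 11 (.rd 18 (lit 0) (lit 1)) ;;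
  asg 52 (.rd 18 (lit 0) (lit 2)) ;; asg 9 (lit ((2 * k) * (2 * k))) ;; asg 10 (lit (trieDepth k)) ;;
  asg 53 (.rd 7 (.add (var 0) (lit 1)) (lit 0)) ;;
  asg 54 (.rd 7 (.add (.add (var 52) (var 1)) (lit 1)) (lit 0)) ;; asg 55 (lit 0) ;; searchCmd ;;
  ite (.eq (var 55) (lit 0)) (asg 62 (lit 0) ;; asg 63 (lit 0))
    (asg 62 (.rd 8 (var 56) (lit 0)) ;; asg 63 (.sub (.rd 8 (var 57) (lit 0)) (var 52)))

/-- The best pair is a heaviest one of the pairs in `C`. -/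
def BestPair (pw : ℕ → ℤ) (C : ℕ → ℕ → Prop) (τ : St) : Prop :=
  (τ.v 55 = 0 ∧ ∀ g₁ g₂, ¬ C g₁ g₂) ∨
  (τ.v 55 ≠ 0 ∧ C (τ.v 56) (τ.v 57) ∧ ∀ g₁ g₂, C g₁ g₂ → pw g₁ + pw g₂ ≤ pw (τ.v 56) + pw (τ.v 57))

theorem BestPair.congr {pw : ℕ → ℤ} {C C' : ℕ → ℕ → Prop} {τ : St} (h : BestPair pw C τ)
    (hC : ∀ g₁ g₂, C' g₁ g₂ ↔ C g₁ g₂) : BestPair pw C' τ := by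
  rwa [show C' = C from funext fun g₁ => funext fun g₂ => propext (hC g₁ g₂)]

/-- A component `0` stands for the additional root, which belongs to neither tree; such pairs are
discarded. -/
theorem improveCmd_wp {cx : Ctx} {σ : St} {C : ℕ → ℕ → Prop} {g₁ g₂ : ℕ} (h60 : σ.v 60 = g₁)
    (h61 : σ.v 61 = g₂) (hW : 1 < cx.W) (h : BestPair (σ.z 2) C σ)
    (hC : ∀ t₁ t₂, C t₁ t₂ ∨ (g₁ ≠ 0 ∧ g₂ ≠ 0 ∧ t₁ = g₁ ∧ t₂ = g₂) →
      t₁ < cx.L ∧ t₂ < cx.L ∧ IsWord cx.w (σ.z 2 t₁ + σ.z 2 t₂)) :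
    improveCmd.wp cx (BestPair (σ.z 2) fun t₁ t₂ => C t₁ t₂ ∨
      (g₁ ≠ 0 ∧ g₂ ≠ 0 ∧ t₁ = g₁ ∧ t₂ = g₂)) σ := by
  unfold improveCmd
  simp only [wp, Tst.ok, Tst.holds, Exp.ok, Exp.eval, ZExp.ok, ZExp.eval, h60, h61, true_and,
    St.setv_v, Nat.reduceEqDiff, if_false, Nat.reduceLT]
  refine ⟨by omega, fun h0 => ?_, fun h1 => ⟨by omega, fun h0 => ?_, fun h2 => ⟨by omega,
    fun h3 => ⟨by omega, ?_⟩, fun h3 => ?_⟩⟩⟩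
  · exact h.congr fun t₁ t₂ => ⟨fun h' => h'.resolve_right fun h'' => h''.1 h0, .inl⟩
  · exact h.congr fun t₁ t₂ => ⟨fun h' => h'.resolve_right fun h'' => h''.2.1 h0, .inl⟩
  · rcases h with ⟨-, h⟩ | ⟨h, -⟩
    · refine .inr ⟨by simp, .inr ⟨h1, h2, by simp, by simp⟩, ?_⟩
      rintro t₁ t₂ (h' | ⟨-, -, rfl, rfl⟩)
      · exact absurd h' (h _ _)
      · simp
    · exact absurd h3 h
  · rcases h with ⟨h, -⟩ | ⟨-, h, h'⟩
    · exact absurd h h3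
    obtain ⟨l1, l2, l3⟩ := hC _ _ (.inl h)
    obtain ⟨l4, l5, l6⟩ := hC g₁ g₂ (.inr ⟨h1, h2, rfl, rfl⟩)
    refine ⟨⟨⟨l1, l2, l3⟩, l4, l5, l6⟩, fun hlt => ?_, fun hlt => ?_⟩
    · refine .inr ⟨by simpa using h3, .inr ⟨h1, h2, by simp, by simp⟩, ?_⟩
      simp only [St.setv_v, Nat.reduceEqDiff, if_false, if_true]
      rintro t₁ t₂ (h'' | ⟨-, -, rfl, rfl⟩)
      · exact (h' _ _ h'').trans hlt.le
      · exact le_rfl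
    · refine .inr ⟨h3, .inl h, ?_⟩
      rintro t₁ t₂ (h'' | ⟨-, -, rfl, rfl⟩)
      · exact h' _ _ h''
      · exact not_lt.1 hlt

/-- The pair of positions that is found with the entries `j₁`, `j₂`. -/
def FoundPair (k B : ℕ) (par : ℕ → ℕ) (ch val : ℕ → ℕ → ℕ) (p q j₁ j₂ g₁ g₂ : ℕ) : Prop :=
  val (found k B par ch p q j₁ j₂) 0 ≠ 0 ∧
  g₁ = val (found k B par ch p q j₁ j₂) 1 + qryNode k B par p j₁ ∧
  g₂ = val (found k B par ch p q j₁ j₂) 2 + qryNode k B par q j₂ ∧ g₁ ≠ 0 ∧ g₂ ≠ 0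

/-- `hval` bounds the stored nodes also for candidates with a zero component, which `hword` does not
cover, so that adding the query's nodes cannot overflow. -/
theorem searchCmd_wp {cx : Ctx} {N1 N2 k B : ℕ} (hE : Env cx N1 N2 k B) (hD : trieDepth k < cx.W)
    {σ : St} {p q cnt : ℕ} {par : ℕ → ℕ} (h4 : σ.v 4 = B) (h9 : σ.v 9 = (2 * k) * (2 * k))
    (h10 : σ.v 10 = trieDepth k) (h11 : σ.v 11 = keyBound k B) (h53 : σ.v 53 = p)
    (h54 : σ.v 54 = q) (h55 : σ.v 55 = 0) (hpN : p ≤ N1 + N2) (hqN : q ≤ N1 + N2)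
    (hp : Preorderly par)
    (hqry : ∀ u ≤ N1 + N2, ∀ j < (2 * k) * (2 * k),
      σ.a 14 u j = qryKey k B par u j ∧ σ.a 15 u j = qryNode k B par u j)
    (hcnt : cnt < cx.L) (ht : Trie (σ.a 16) cnt)
    (hval : ∀ j₁ < (2 * k) * (2 * k), ∀ j₂ < (2 * k) * (2 * k),
      σ.a 17 (found k B par (σ.a 16) p q j₁ j₂) 0 ≠ 0 →
      σ.a 17 (found k B par (σ.a 16) p q j₁ j₂) 1 ≤ N1 + N2 ∧
      σ.a 17 (found k B par (σ.a 16) p q j₁ j₂) 2 ≤ N1 + N2)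
    (hword : ∀ j₁ < (2 * k) * (2 * k), ∀ j₂ < (2 * k) * (2 * k), ∀ g₁ g₂,
      FoundPair k B par (σ.a 16) (σ.a 17) p q j₁ j₂ g₁ g₂ →
      g₁ < cx.L ∧ g₂ < cx.L ∧ IsWord cx.w (σ.z 2 g₁ + σ.z 2 g₂)) :
    searchCmd.wp cx (BestPair (σ.z 2) fun g₁ g₂ => ∃ j₁ < (2 * k) * (2 * k),
      ∃ j₂ < (2 * k) * (2 * k), FoundPair k B par (σ.a 16) (σ.a 17) p q j₁ j₂ g₁ g₂) σ := by
  have hL := hE.hL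
  have hWd := hE.hWd
  have hWdW := hE.hWdW
  have hLW := hE.hLW
  have hMW := hE.hMW
  have hB := hE.hB
  have hk := hE.hk
  have hP := hE.hP
  have hNW : N1 + N2 + (N1 + N2) < cx.W := hE.lt_of_le_keyBound (by
    have h1 : 0 < B ^ (k + 1) := Nat.pow_pos (by omega)
    have h2 : 8 * B ^ k * 1 ≤ 8 * B ^ k * B ^ (k + 1) := Nat.mul_le_mul_left _ h1
    omega)
  have hM0 : keyBound k B ≤ keyBound k B * keyBound k B := Nat.le_mul_self _
  unfold searchCmd
  rw [wp]
  refine ⟨⟨by rw [h9, hE.r9], by rw [hE.r9]; omega, by simp [lookupCmd, improveCmd],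
    by simp [lookupCmd, improveCmd]⟩,
    fun i τ => BestPair (σ.z 2) (fun g₁ g₂ => ∃ j₁ < i, ∃ j₂ < (2 * k) * (2 * k),
      FoundPair k B par (σ.a 16) (σ.a 17) p q j₁ j₂ g₁ g₂) τ, ?_, ?_, ?_⟩
  · exact .inl ⟨by simp [h55], fun g₁ g₂ ⟨j, hj, _⟩ => by omega⟩
  swap
  · rw [hE.r9]
    exact fun τ _ h => h
  rw [hE.r9]
  intro i hi τ hA hτi hI
  rw [wp]
  refine ⟨⟨by rw [hA.v 9 (by simp [lookupCmd, improveCmd]), h9, hE.r9], by rw [hE.r9]; omega,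
    by simp [lookupCmd, improveCmd], by simp [lookupCmd, improveCmd]⟩,
    fun j τ => BestPair (σ.z 2) (fun g₁ g₂ => (∃ j₁ < i, ∃ j₂ < (2 * k) * (2 * k),
      FoundPair k B par (σ.a 16) (σ.a 17) p q j₁ j₂ g₁ g₂) ∨ ∃ j₂ < j,
      FoundPair k B par (σ.a 16) (σ.a 17) p q i j₂ g₁ g₂) τ, ?_, ?_, ?_⟩
  · refine BestPair.congr (C := fun g₁ g₂ => ∃ j₁ < i, ∃ j₂ < (2 * k) * (2 * k),
      FoundPair k B par (σ.a 16) (σ.a 17) p q j₁ j₂ g₁ g₂) ?_ fun g₁ g₂ => by simp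
    simpa [BestPair] using hI
  swap
  · rw [hE.r9]
    intro υ _ hυ
    refine BestPair.congr (C := fun g₁ g₂ => (∃ j₁ < i, ∃ j₂ < (2 * k) * (2 * k),
      FoundPair k B par (σ.a 16) (σ.a 17) p q j₁ j₂ g₁ g₂) ∨ ∃ j₂ < (2 * k) * (2 * k),
      FoundPair k B par (σ.a 16) (σ.a 17) p q i j₂ g₁ g₂) ?_ fun g₁ g₂ => ?_
    · simpa [BestPair] using hυ
    · constructor
      · rintro ⟨j₁, hj₁, h⟩
        rcases Nat.lt_succ_iff_lt_or_eq.1 hj₁ with h' | rfl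
        · exact .inl ⟨j₁, h', h⟩
        · exact .inr h
      · rintro (⟨j₁, hj₁, h⟩ | h)
        · exact ⟨j₁, by omega, h⟩
        · exact ⟨i, by omega, h⟩
  rw [hE.r9]
  intro j hj υ hAυ hυj hυ
  have uv : ∀ x, x < 16 ∨ x = 53 ∨ x = 54 → υ.v x = σ.v x := fun x hx => by
    rw [hAυ.v x (by simp [lookupCmd, improveCmd]; omega),
      hA.v x (by simp [lookupCmd, improveCmd]; omega)]
  have u58 : υ.v 58 = i := by rw [hAυ.v 58 (by simp [lookupCmd, improveCmd]), hτi]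
  have ua : υ.a = σ.a := funext fun A => by
    rw [hAυ.a A (by simp [lookupCmd, improveCmd]), hA.a A (by simp [lookupCmd, improveCmd])]
  have uz : υ.z = σ.z := funext fun A => by
    rw [hAυ.z A (by simp [lookupCmd, improveCmd]), hA.z A (by simp [lookupCmd, improveCmd])]
  obtain ⟨q1, q2⟩ := hqry p hpN i hi
  obtain ⟨q3, q4⟩ := hqry q hqN j hj
  have k1 : qryKey k B par p i < keyBound k B := hp.qryKey_lt hB (by omega) hi
  have k2 : qryKey k B par q j < keyBound k B := hp.qryKey_lt hB (by omega) hj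
  have hK := encode_lt k1 k2
  have n1 := hp.qryNode_le k B p i
  have n2 := hp.qryNode_le k B q j
  have hlef : found k B par (σ.a 16) p q i j ≤ cnt := ht.trieAt_le _ _
  rw [wp, wp, wp]
  simp only [Exp.ok, Exp.eval, uv 53 (by omega), uv 54 (by omega), uv 11 (by omega), u58, hυj, h53,
    h54, h11, ua, q1, q3, true_and, Nat.reduceLT]
  refine ⟨by omega, wp_conseq _ (lookupCmd_wp hE (K := qryKey k B par p i * keyBound k B +
    qryKey k B par q j) (cnt := cnt) (by simp [uv 4, h4]) (by simp [uv 10, h10]) hK (by simp) hD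
    hcnt (by simpa [ua] using ht)) ?_⟩
  intro ω hω h43
  rw [St.setv_a, ua] at h43
  change ω.v 43 = found k B par (σ.a 16) p q i j at h43
  have wv : ∀ x, x = 53 ∨ x = 54 ∨ 54 < x → ω.v x = υ.v x := fun x hx => by
    rw [hω.v x (by simp [lookupCmd]; omega), St.setv_v, if_neg (by omega)]
  have wa : ω.a = σ.a := funext fun A => by
    rw [hω.a A (by simp [lookupCmd]), St.setv_a, ua]
  have wz : ω.z = σ.z := funext fun A => by
    rw [hω.z A (by simp [lookupCmd]), St.setv_z, uz]
  have hυ' : BestPair (σ.z 2) (fun g₁ g₂ => (∃ j₁ < i, ∃ j₂ < (2 * k) * (2 * k),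
      FoundPair k B par (σ.a 16) (σ.a 17) p q j₁ j₂ g₁ g₂) ∨ ∃ j₂ < j,
      FoundPair k B par (σ.a 16) (σ.a 17) p q i j₂ g₁ g₂) ω := by
    unfold BestPair at hυ ⊢
    rwa [wv 55 (by omega), wv 56 (by omega), wv 57 (by omega)]
  have hsplit : ∀ g₁ g₂, ((∃ j₁ < i, ∃ j₂ < (2 * k) * (2 * k),
      FoundPair k B par (σ.a 16) (σ.a 17) p q j₁ j₂ g₁ g₂) ∨ ∃ j₂ < j + 1,
      FoundPair k B par (σ.a 16) (σ.a 17) p q i j₂ g₁ g₂) ↔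
      ((∃ j₁ < i, ∃ j₂ < (2 * k) * (2 * k),
      FoundPair k B par (σ.a 16) (σ.a 17) p q j₁ j₂ g₁ g₂) ∨ ∃ j₂ < j,
      FoundPair k B par (σ.a 16) (σ.a 17) p q i j₂ g₁ g₂) ∨
      FoundPair k B par (σ.a 16) (σ.a 17) p q i j g₁ g₂ := by
    intro g₁ g₂
    rw [or_assoc]
    refine or_congr_right ?_
    constructor
    · rintro ⟨j₂, hj₂, h⟩
      rcases Nat.lt_succ_iff_lt_or_eq.1 hj₂ with h' | rfl
      · exact .inl ⟨j₂, h', h⟩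
      · exact .inr h
    · rintro (⟨j₂, hj₂, h⟩ | h)
      · exact ⟨j₂, by omega, h⟩
      · exact ⟨j, by omega, h⟩
  have hset : ∀ (ω' : St) (C : ℕ → ℕ → Prop), BestPair (σ.z 2) C ω' →
      BestPair (σ.z 2) C (ω'.setv 59 (j + 1)) := fun ω' C h => by simpa [BestPair] using h
  rw [wp]
  simp only [Tst.ok, Tst.holds, Exp.ok, Exp.eval, h43, wa, true_and, Nat.reduceLT]
  refine ⟨by omega, fun h0 => ?_, fun h0 => ?_⟩
  · refine hset _ _ (hυ'.congr fun g₁ g₂ => (hsplit g₁ g₂).trans ⟨fun h => ?_, .inl⟩)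
    exact h.resolve_right fun h => h.1 h0
  · obtain ⟨v1, v2⟩ := hval i hi j hj h0
    rw [wp, wp, wp, wp]
    simp only [Exp.ok, Exp.eval, St.setv_v, St.setv_a, h43, wa, wv 53 (by omega), wv 54 (by omega),
      wv 58 (by omega), wv 59 (by omega), uv 53 (by omega), uv 54 (by omega), u58, hυj, h53, h54,
      q2, q4, true_and, Nat.reduceLT, Nat.reduceEqDiff, if_false]
    refine ⟨by omega, by omega, wp_conseq _ (improveCmd_wp
      (g₁ := σ.a 17 (found k B par (σ.a 16) p q i j) 1 + qryNode k B par p i)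
      (g₂ := σ.a 17 (found k B par (σ.a 16) p q i j) 2 + qryNode k B par q j)
      (by simp) (by simp) (by omega)
      (C := fun g₁ g₂ => (∃ j₁ < i, ∃ j₂ < (2 * k) * (2 * k),
      FoundPair k B par (σ.a 16) (σ.a 17) p q j₁ j₂ g₁ g₂) ∨ ∃ j₂ < j,
      FoundPair k B par (σ.a 16) (σ.a 17) p q i j₂ g₁ g₂) ?_ ?_) ?_⟩
    · simpa [BestPair, wz] using hυ'
    · simp only [St.setv_z, wz]
      rintro t₁ t₂ ((⟨j₁, hj₁, j₂, hj₂, h⟩ | ⟨j₂, hj₂, h⟩) | ⟨c1, c2, rfl, rfl⟩)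
      · exact hword j₁ (by omega) j₂ hj₂ _ _ h
      · exact hword i hi j₂ (by omega) _ _ h
      · exact hword i hi j hj _ _ ⟨h0, rfl, rfl, c1, c2⟩
    · intro ω' _ h'
      simp only [St.setv_z, wz] at h'
      refine hset _ _ (h'.congr fun g₁ g₂ => (hsplit g₁ g₂).trans (or_congr_right ?_))
      constructor
      · rintro ⟨-, rfl, rfl, c1, c2⟩
        exact ⟨c1, c2, rfl, rfl⟩
      · rintro ⟨c1, c2, rfl, rfl⟩
        exact ⟨h0, rfl, rfl, c1, c2⟩

/-- Variables 62 and 63 hold the numbers, plus one, of a heaviest induced pair of ancestors, or `0`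
if there is none. -/
def Answered (T₁ T₂ : WLTree) (u : Fin T₁.size) (v : Fin T₂.size) (τ : St) : Prop :=
  (∃ a b, HeaviestInducedAncestors T₁ T₂ u v a b ∧ τ.v 62 = a + 1 ∧ τ.v 63 = b + 1) ∨
  ((¬ ∃ a b, InducedAncestors T₁ T₂ u v a b) ∧ τ.v 62 = 0 ∧ τ.v 63 = 0)

/-- Every candidate is an induced pair of ancestors, and every induced pair of ancestors is matched
by a candidate at least as heavy. So a heaviest candidate is a correct answer, and without
candidates there is no induced pair. -/
theorem queryCmd_wp {cx : Ctx} {T₁ T₂ : WLTree} {k B : ℕ} (hE : Env cx T₁.size T₂.size k B)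
    (hf : FitsInWords cx.w T₁ T₂) {σ : St} (h : Built cx T₁ T₂ k B σ) {u : Fin T₁.size}
    {v : Fin T₂.size} (hu : σ.v 0 = u) (hv : σ.v 1 = v) :
    (queryCmd k).wp cx (Answered T₁ T₂ u v) σ := by
  have hL := hE.hL
  have hLt := hE.hLt
  have hWd := hE.hWd
  have hWdW := hE.hWdW
  have hLW := hE.hLW
  have hMW := hE.hMW
  have hB := hE.hB
  have hk := hE.hk
  have hP := hE.hP
  -- The depth is a factor of the number of rows reserved for the trie.
  have hD : trieDepth k < cx.W := by
    have h1 : 0 < k * B := Nat.mul_pos hk (by omega)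
    have h2 : 0 < (T₁.size + T₂.size) * ((k * B) * (k * B) * ((k * B) * (k * B))) :=
      Nat.mul_pos (by omega) (by positivity)
    have h3 := Nat.le_mul_of_pos_left (trieDepth k) h2
    omega
  obtain ⟨cnt, hcnt, ht⟩ := h.trie
  have hle₁ : ∀ x : Fin T₁.size, σ.a 7 (x + 1) 0 ≤ T₁.size + T₂.size := fun x =>
    h.pos_le _ (by omega)
  have hle₂ : ∀ x : Fin T₂.size, σ.a 7 (T₁.size + x + 1) 0 ≤ T₁.size + T₂.size := fun x =>
    h.pos_le _ (by omega)
  have hlt₁ : ∀ x : Fin T₁.size, σ.a 7 (x + 1) 0 < B ^ k := fun x => (hle₁ x).trans_lt hP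
  have hlt₂ : ∀ x : Fin T₂.size, σ.a 7 (T₁.size + x + 1) 0 < B ^ k := fun x =>
    (hle₂ x).trans_lt hP
  set par := fun t => σ.a 9 t 0 with hpar
  obtain ⟨p, hp⟩ : ∃ p, p = σ.a 7 (u + 1) 0 := ⟨_, rfl⟩
  obtain ⟨q, hq⟩ : ∃ q, q = σ.a 7 (T₁.size + v + 1) 0 := ⟨_, rfl⟩
  have hpN : p ≤ T₁.size + T₂.size := by rw [hp]; exact hle₁ u
  have hqN : q ≤ T₁.size + T₂.size := by rw [hq]; exact hle₂ v
  have hsound : ∀ j₁ < (2 * k) * (2 * k), ∀ j₂ < (2 * k) * (2 * k), ∀ g₁ g₂,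
      FoundPair k B par (σ.a 16) (σ.a 17) p q j₁ j₂ g₁ g₂ →
      ∃ (a : Fin T₁.size) (b : Fin T₂.size), g₁ = σ.a 7 (a + 1) 0 ∧ g₂ = σ.a 7 (T₁.size + b + 1) 0 ∧
        InducedAncestors T₁ T₂ u v a b := by
    rintro j₁ hj₁ j₂ hj₂ g₁ g₂ ⟨f1, rfl, rfl, f2, f3⟩
    rw [hp, hq] at f1 f2 f3 ⊢
    exact found_sound hk hB h.pre h.emb₁ h.emb₂ hlt₁ hlt₂ h.dict hj₁ hj₂ f1 f2 f3
  have hword : ∀ j₁ < (2 * k) * (2 * k), ∀ j₂ < (2 * k) * (2 * k), ∀ g₁ g₂,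
      FoundPair k B par (σ.a 16) (σ.a 17) p q j₁ j₂ g₁ g₂ →
      g₁ < cx.L ∧ g₂ < cx.L ∧ IsWord cx.w (σ.z 2 g₁ + σ.z 2 g₂) := by
    intro j₁ hj₁ j₂ hj₂ g₁ g₂ hg
    obtain ⟨a, b, rfl, rfl, -⟩ := hsound j₁ hj₁ j₂ hj₂ g₁ g₂ hg
    have e1 := hle₁ a
    have e2 := hle₂ b
    refine ⟨by omega, by omega, ?_⟩
    rw [h.emb₁.weight a, h.emb₂.weight b]
    exact hf.2.2 a b
  have hval : ∀ j₁ < (2 * k) * (2 * k), ∀ j₂ < (2 * k) * (2 * k),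
      σ.a 17 (found k B par (σ.a 16) p q j₁ j₂) 0 ≠ 0 →
      σ.a 17 (found k B par (σ.a 16) p q j₁ j₂) 1 ≤ T₁.size + T₂.size ∧
      σ.a 17 (found k B par (σ.a 16) p q j₁ j₂) 2 ≤ T₁.size + T₂.size := by
    intro j₁ hj₁ j₂ hj₂ h0
    obtain ⟨x, y, i₁, i₂, -, -, -, -, -, h3, h4⟩ :=
      found_spec hk hB h.pre hlt₂ h.dict (by omega) (by omega) hj₁ hj₂ h0
    rw [h3, h4]
    exact ⟨(h.pre.insNode_le _ _ _ _).trans (hle₁ x), (h.pre.insNode_le _ _ _ _).trans (hle₂ y)⟩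
  have hWd16 : 2 < cx.Wd := by omega
  unfold queryCmd
  rw [wp, wp, wp, wp, wp, wp, wp, wp, wp, wp, wp, wp, wp, wp, wp, wp, wp]
  simp only [Exp.ok, Exp.eval, St.setv_v, St.setv_a, h.prm₀, h.prm₁, h.prm₂, hu, hv, ← hp, ← hq,
    true_and, Nat.reduceEqDiff, if_false, if_true, Nat.reduceLT]
  refine ⟨by omega, by omega, by omega, by omega, by omega, by omega, by omega, by omega, ?_⟩
  refine wp_conseq _ (searchCmd_wp hE hD (p := p) (q := q) (par := par) (cnt := cnt) (by simp)
    (by simp) (by simp) (by simp) (by simp) (by simp) (by simp) hpN hqN h.pre h.qry hcnt ht hval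
    hword) fun τ hτ hbest => ?_
  have ta : τ.a 8 = σ.a 8 := by rw [hτ.a 8 (by simp [searchCmd, lookupCmd, improveCmd])]; rfl
  have t52 : τ.v 52 = T₁.size := by
    rw [hτ.v 52 (by simp [searchCmd, lookupCmd, improveCmd])]; simp
  simp only [St.setv_z, St.setv_a] at hbest
  simp only [wp, Tst.ok, Tst.holds, Exp.ok, Exp.eval, St.setv_v, St.setv_a, ta, t52, true_and,
    Nat.reduceLT, Nat.reduceEqDiff, if_false]
  rcases hbest with ⟨h0, hno⟩ | ⟨h0, ⟨j₁, hj₁, j₂, hj₂, hg⟩, hbest⟩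
  · refine ⟨by omega, fun _ => ⟨by omega, by omega, .inr ⟨?_, by simp, by simp⟩⟩,
      fun h' => absurd h0 h'⟩
    rintro ⟨a, b, hab⟩
    obtain ⟨j₁, hj₁, j₂, hj₂, f1, f2, f3, -⟩ :=
      found_complete hk hB h.pre h.emb₁ h.emb₂ hlt₁ hlt₂ h.dict hab
    rw [← hp, ← hq] at f1 f2 f3
    exact hno _ _ ⟨j₁, hj₁, j₂, hj₂, f1, rfl, rfl, f2, f3⟩
  · obtain ⟨a, b, ha, hb, hab⟩ := hsound j₁ hj₁ j₂ hj₂ _ _ hg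
    have ea := h.org_pos (a + 1) (by omega)
    have eb := h.org_pos (T₁.size + b + 1) (by omega)
    have e1 := hle₁ a
    have e2 := hle₂ b
    rw [ha, hb, ea, eb]
    refine ⟨by omega, fun h' => absurd h' h0, fun _ => ⟨by omega, by omega, .inl ⟨a, b, ⟨hab, ?_⟩,
      by simp, by simp; omega⟩⟩⟩
    intro a' b' hab'
    obtain ⟨j₁, hj₁, j₂, hj₂, f1, f2, f3, f4⟩ :=
      found_complete hk hB h.pre h.emb₁ h.emb₂ hlt₁ hlt₂ h.dict hab'
    rw [← hp, ← hq] at f1 f2 f3 f4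
    have f5 := hbest _ _ ⟨j₁, hj₁, j₂, hj₂, f1, rfl, rfl, f2, f3⟩
    rw [ha, hb, h.emb₁.weight a, h.emb₂.weight b] at f5
    exact f4.trans f5

end HIA

namespace HIA

open Cmd Exp

/-! ### Running times as monomials -/

/-- The degree of the running time if the numbers of iterations of the loops have degrees `d`. -/
def Cmd.deg (d : ℕ → ℕ) : Cmd → ℕ
  | seq p q => max (p.deg d) (q.deg d)
  | ite _ p q => max (p.deg d) (q.deg d)
  | for_ _ n p => d n + p.deg d
  | skip => 0
  | asg _ _ => 0
  | wr _ _ _ _ => 0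
  | wz _ _ _ => 0

/-- `K` depends on the command and `K₀` only. Sequencing and branching take the larger degree, and a
loop adds the degree of its number of iterations. -/
theorem Cmd.tm_le (d e : ℕ → ℕ) (K₀ : ℕ) (p : Cmd) : ∃ K, ∀ (rho : ℕ → ℕ) (N B : ℕ), 0 < N →
    0 < B → (∀ i, rho i ≤ K₀ * (N ^ d i * B ^ e i)) →
    p.tm rho ≤ K * (N ^ p.deg d * B ^ p.deg e) := by
  have up : ∀ {N B a b a' b' : ℕ}, 0 < N → 0 < B → a ≤ a' → b ≤ b' →
      N ^ a * B ^ b ≤ N ^ a' * B ^ b' := fun hN hB h h' =>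
    Nat.mul_le_mul (Nat.pow_le_pow_right hN h) (Nat.pow_le_pow_right hB h')
  induction p with
  | skip | asg | wr | wz =>
    exact ⟨_, fun rho N B _ _ _ => by
      rw [Cmd.deg, Cmd.deg, pow_zero, pow_zero, mul_one, mul_one, Cmd.tm]⟩
  | seq p q ihp ihq =>
    obtain ⟨K₁, h₁⟩ := ihp
    obtain ⟨K₂, h₂⟩ := ihq
    refine ⟨K₁ + K₂, fun rho N B hN hB h => ?_⟩
    rw [Cmd.tm, add_mul]
    exact add_le_add
      ((h₁ rho N B hN hB h).trans (Nat.mul_le_mul_left _ (up hN hB (le_max_left _ _) (le_max_left _ _))))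
      ((h₂ rho N B hN hB h).trans (Nat.mul_le_mul_left _ (up hN hB (le_max_right _ _) (le_max_right _ _))))
  | ite t p q ihp ihq =>
    obtain ⟨K₁, h₁⟩ := ihp
    obtain ⟨K₂, h₂⟩ := ihq
    refine ⟨t.cost + K₁ + K₂ + 1, fun rho N B hN hB h => ?_⟩
    have h3 := (h₁ rho N B hN hB h).trans
      (Nat.mul_le_mul_left _ (up hN hB (le_max_left _ (q.deg d)) (le_max_left _ (q.deg e))))
    have h4 := (h₂ rho N B hN hB h).trans
      (Nat.mul_le_mul_left _ (up hN hB (le_max_right (p.deg d) _) (le_max_right (p.deg e) _)))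
    have h5 : 0 < N ^ max (p.deg d) (q.deg d) * B ^ max (p.deg e) (q.deg e) := by positivity
    simp only [Cmd.tm, Cmd.deg]
    nlinarith [Nat.zero_le t.cost]
  | for_ x n p ih =>
    obtain ⟨K₁, h₁⟩ := ih
    refine ⟨K₀ * (K₁ + 3) + 2, fun rho N B hN hB h => ?_⟩
    have h5 : 0 < N ^ p.deg d * B ^ p.deg e := by positivity
    have h6 : 0 < N ^ (d n + p.deg d) * B ^ (e n + p.deg e) := by positivity
    have h7 : p.tm rho + 3 ≤ (K₁ + 3) * (N ^ p.deg d * B ^ p.deg e) := by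
      have := h₁ rho N B hN hB h
      nlinarith
    simp only [Cmd.tm, Cmd.deg]
    calc rho n * (p.tm rho + 3) + 2
        ≤ K₀ * (N ^ d n * B ^ e n) * ((K₁ + 3) * (N ^ p.deg d * B ^ p.deg e)) +
          2 * (N ^ (d n + p.deg d) * B ^ (e n + p.deg e)) :=
          add_le_add (Nat.mul_le_mul (h n) h7) (by omega)
      _ = _ := by ring

/-! ### The parameters -/

/-- `B` is the smallest radix for which numbers up to `N` have `k` digits. -/
structure Radix (k N B : ℕ) : Prop where
  two_le : 2 ≤ B
  lt : N < B ^ k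
  le : ∀ b, 2 ≤ b → N < b ^ k → B ≤ b

theorem exists_radix {k : ℕ} (hk : 0 < k) (N : ℕ) : ∃ B, Radix k N B := by
  classical
  have h : ∃ B, 2 ≤ B ∧ N < B ^ k :=
    ⟨N + 2, by omega, (by omega : N < N + 2).trans_le (Nat.le_self_pow hk.ne' _)⟩
  exact ⟨Nat.find h, (Nat.find_spec h).1, (Nat.find_spec h).2, fun b hb hN => Nat.find_min' h ⟨hb, hN⟩⟩

/-- If `B > 2`, minimality gives `(B - 1) ^ k ≤ N`, and `B ≤ 2 * (B - 1)`. -/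
theorem Radix.pow_le {k N B : ℕ} (h : Radix k N B) (hN : 0 < N) : B ^ k ≤ 2 ^ k * N := by
  rcases h.two_le.eq_or_lt with h2 | h2
  · rw [← h2]
    exact Nat.le_mul_of_pos_right _ hN
  · have h1 : (B - 1) ^ k ≤ N := by
      by_contra hlt
      have := h.le (B - 1) (by omega) (by omega)
      omega
    calc B ^ k ≤ (2 * (B - 1)) ^ k := Nat.pow_le_pow_left (by omega) _
      _ = 2 ^ k * (B - 1) ^ k := mul_pow _ _ _
      _ ≤ _ := Nat.mul_le_mul_left _ h1

theorem Radix.le_add_two {k N B : ℕ} (h : Radix k N B) (hk : 0 < k) : B ≤ N + 2 :=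
  h.le _ (by omega) ((by omega : N < N + 2).trans_le (Nat.le_self_pow hk.ne' _))

/-- Number of columns of the arrays. -/
def rowWidth (k B : ℕ) : ℕ := (k * B) * (k * B) + (2 * k) * (2 * k) + k + B + 5

/-- Number of rows of the arrays. -/
def rowCount (k N B : ℕ) : ℕ :=
  N * ((k * B) * (k * B) * ((k * B) * (k * B))) * trieDepth k + N + B + 5

/-- Number of memory cells. -/
def cellCount (k N B : ℕ) : ℕ := 3 * N + rowCount k N B * rowWidth k B * 40

/-- Bound for the numbers that occur in the computation. -/
def numBound (k N B : ℕ) : ℕ :=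
  cellCount k N B + keyBound k B * keyBound k B + 2 ^ k * N + trieDepth k + 16 * k + 41

/-- The values of the constants. -/
def constVal (k N1 N2 B : ℕ) (i : ℕ) : ℕ :=
  if i = 0 then N1 else if i = 1 then N2 else if i = 2 then N1 + N2 else if i = 3 then k else
  if i = 4 then B else if i = 5 then N1 + N2 + 1 else if i = 6 then k + 1 else
  if i = 7 then k * B else if i = 8 then (k * B) * (k * B) else if i = 9 then (2 * k) * (2 * k) else
  if i = 10 then trieDepth k else if i = 11 then keyBound k B else if i = 12 then B ^ (k + 1) else
  if i = 13 then 2 * k else if i = 14 then rowWidth k B else if i = 15 then 3 * (N1 + N2) else 0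

/-- The context of the main programs. -/
def mainCtx (w k N1 N2 B : ℕ) : Ctx where
  w := w
  S := cellCount k (N1 + N2) B
  W := numBound k (N1 + N2) B
  base := 3 * (N1 + N2)
  Wd := rowWidth k B
  L := rowCount k (N1 + N2) B
  rho := constVal k N1 N2 B

/-- The context of the program that computes the constants. -/
def preCtx (w k N1 N2 B : ℕ) : Ctx where
  w := w
  S := cellCount k (N1 + N2) B
  W := numBound k (N1 + N2) B
  -- No arrays and no input: the constants are computed in registers alone, since base and width are
  -- among them.
  base := 0
  Wd := 0
  L := 0
  rho := constVal k N1 N2 B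

theorem rowCount_le_cellCount (k N B : ℕ) : rowCount k N B ≤ cellCount k N B := by
  unfold cellCount
  have h : 0 < rowWidth k B := by unfold rowWidth; omega
  have := Nat.le_mul_of_pos_right (rowCount k N B) h
  omega

theorem rowWidth_le_cellCount (k N B : ℕ) : rowWidth k B ≤ cellCount k N B := by
  unfold cellCount
  have h : 0 < rowCount k N B := by unfold rowCount; omega
  have := Nat.le_mul_of_pos_left (rowWidth k B) h
  omega

theorem mainCtx_valid {w k N1 N2 B : ℕ} (h : 2 * numBound k (N1 + N2) B ≤ 2 ^ w) :
    (mainCtx w k N1 N2 B).Valid := by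
  refine ⟨h, le_rfl, ?_, ?_, fun _ => ?_⟩
  · simp only [mainCtx, numBound]; omega
  · simp only [mainCtx, numBound]; omega
  · simp only [mainCtx, rowWidth]; omega

theorem preCtx_valid {w k N1 N2 B : ℕ} (h : 2 * numBound k (N1 + N2) B ≤ 2 ^ w) :
    (preCtx w k N1 N2 B).Valid := by
  refine ⟨h, by simp [preCtx], ?_, ?_, fun h => ?_⟩
  · simp only [preCtx, numBound]; omega
  · simp only [preCtx, numBound]; omega
  · simp [preCtx] at h

theorem mainCtx_env {w k N1 N2 B : ℕ} (hk : 0 < k) (h : Radix k (N1 + N2) B) :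
    Env (mainCtx w k N1 N2 B) N1 N2 k B := by
  have h1 := rowCount_le_cellCount k (N1 + N2) B
  have h2 := rowWidth_le_cellCount k (N1 + N2) B
  constructor <;> try rfl
  · exact hk
  · exact h.two_le
  · exact h.lt
  · simp only [mainCtx, rowCount]; omega
  · simp only [mainCtx, rowCount]; omega
  · simp only [mainCtx, numBound]; omega
  · simp only [mainCtx, numBound]; omega
  · simp only [mainCtx, numBound]; omega

/-! ### Computing the constants -/

/-- Puts the `k`-th power of variable 4 into variable 17. -/
def radixPowCmd : Cmd := asg 17 (lit 1) ;; for_ 18 3 (asg 17 (.mul (var 17) (var 4)))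

def radixCmd (k : ℕ) : Cmd :=
  asg 2 (.add (var 0) (var 1)) ;; asg 3 (lit k) ;; asg 4 (lit 2) ;;
  for_ 16 2 (radixPowCmd ;; ite (.le (var 17) (var 2)) (asg 4 (.add (var 4) (lit 1))) skip)

def constCmd (k : ℕ) : Cmd :=
  asg 5 (.add (var 2) (lit 1)) ;; asg 6 (.add (var 3) (lit 1)) ;; asg 7 (.mul (var 3) (var 4)) ;;
  asg 8 (.mul (var 7) (var 7)) ;; asg 9 (lit ((2 * k) * (2 * k))) ;; asg 10 (lit (trieDepth k)) ;;
  asg 12 (.mul (var 17) (var 4)) ;; asg 11 (.mul (.mul (lit (16 * k)) (var 17)) (var 12)) ;;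
  asg 13 (lit (2 * k)) ;;
  asg 14 (.add (.add (.add (.add (var 8) (var 9)) (var 3)) (var 4)) (lit 5)) ;;
  asg 15 (.mul (lit 3) (var 2))

theorem radixPowCmd_wp {cx : Ctx} {k b : ℕ} {σ : St} (h3 : σ.v 3 = k) (hr : cx.rho 3 = k)
    (hkW : k < cx.W) (h4 : σ.v 4 = b) (hb : 0 < b) (hW1 : 1 < cx.W) (hW : b ^ k < cx.W) :
    radixPowCmd.wp cx (fun τ => τ.v 17 = b ^ k) σ := by
  unfold radixPowCmd
  rw [wp, wp, wp]
  refine ⟨by simpa using hW1, ⟨by simp [h3, hr], by omega, by simp, by simp⟩,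
    fun i τ => τ.v 17 = b ^ i, by simp, ?_, fun τ _ h => by rwa [hr] at h⟩
  intro i hi τ hA _ hI
  have h4' : τ.v 4 = b := by rw [hA.v 4 (by simp)]; simpa using h4
  simp only [wp, Exp.ok, Exp.eval, hI, h4', true_and, and_true, St.setv_v, Nat.reduceEqDiff,
    if_true, if_false, ← pow_succ]
  exact lt_of_le_of_lt (Nat.pow_le_pow_right hb (by omega)) hW

/-- The candidate starts at 2 and grows while its `k`-th power is at most `N1 + N2`; after `i`
rounds it is `min B (i + 2)`. Since `B ≤ N1 + N2 + 2`, the `N1 + N2` rounds suffice, and no power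
exceeds `B ^ k`. -/
theorem radixCmd_wp {w k N1 N2 B : ℕ} (hk : 0 < k) (hN : 0 < N1 + N2) (h : Radix k (N1 + N2) B)
    {σ : St} (h0 : σ.v 0 = N1) (h1 : σ.v 1 = N2) :
    (radixCmd k).wp (preCtx w k N1 N2 B) (fun τ => τ.v 0 = N1 ∧ τ.v 1 = N2 ∧ τ.v 2 = N1 + N2 ∧
      τ.v 3 = k ∧ τ.v 4 = B) σ := by
  have hle := h.le_add_two hk
  have hp := h.pow_le hN
  have hcell := rowCount_le_cellCount k (N1 + N2) B
  have hrow : N1 + N2 + B + 5 ≤ rowCount k (N1 + N2) B := by unfold rowCount; omega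
  obtain ⟨W, hWeq⟩ : ∃ W, W = (preCtx w k N1 N2 B).W := ⟨_, rfl⟩
  have hW : cellCount k (N1 + N2) B + 2 ^ k * (N1 + N2) + 16 * k + 41 ≤ W := by
    simp only [hWeq, preCtx, numBound]; omega
  have e2 : (preCtx w k N1 N2 B).rho 2 = N1 + N2 := rfl
  have hB2 := h.two_le
  unfold radixCmd
  rw [wp, wp, wp, wp, wp, wp, wp]
  simp only [Exp.ok, Exp.eval, true_and, St.setv_v, Nat.reduceEqDiff, if_true, if_false, h0, h1,
    ← hWeq, e2]
  refine ⟨by omega, by omega, by omega, ⟨by omega, by simp [radixPowCmd], by simp [radixPowCmd]⟩,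
    fun i τ => τ.v 4 = min B (i + 2), by simp [hB2], ?_, ?_⟩
  · intro i hi τ hA _ hI
    have t3 : τ.v 3 = k := by rw [hA.v 3 (by simp [radixPowCmd])]; simp
    have t2 : τ.v 2 = N1 + N2 := by rw [hA.v 2 (by simp [radixPowCmd])]; simp
    have hpow : (min B (i + 2)) ^ k ≤ B ^ k := Nat.pow_le_pow_left (by omega) _
    rw [wp]
    refine wp_conseq _ (radixPowCmd_wp (b := min B (i + 2)) t3 rfl (by omega) hI (by omega)
      (by omega) (by omega)) fun υ hυ h17 => ?_
    have u2 : υ.v 2 = N1 + N2 := by rw [hυ.v 2 (by simp [radixPowCmd]), t2]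
    have u4 : υ.v 4 = min B (i + 2) := by rw [hυ.v 4 (by simp [radixPowCmd]), hI]
    simp only [wp, Tst.ok, Tst.holds, Exp.ok, Exp.eval, h17, u2, u4, true_and, St.setv_v,
      Nat.reduceEqDiff, if_true, if_false, ← hWeq]
    refine ⟨fun hl => ⟨by omega, ?_⟩, fun hl => ?_⟩
    · have : min B (i + 2) ≠ B := fun he => by rw [he] at hl; exact absurd h.lt (by omega)
      omega
    · have := h.le _ (by omega) (not_le.1 hl)
      omega
  · intro τ hA hI
    refine ⟨?_, ?_, ?_, ?_, by omega⟩
    · rw [hA.v 0 (by simp [radixPowCmd])]; simpa using h0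
    · rw [hA.v 1 (by simp [radixPowCmd])]; simpa using h1
    · rw [hA.v 2 (by simp [radixPowCmd])]; simp
    · rw [hA.v 3 (by simp [radixPowCmd])]; simp

/-- All constants. -/
def preCmd (k : ℕ) : Cmd := radixCmd k ;; radixPowCmd ;; constCmd k

theorem preCmd_wp {w k N1 N2 B : ℕ} (hk : 0 < k) (hN : 0 < N1 + N2) (h : Radix k (N1 + N2) B)
    {σ : St} (h0 : σ.v 0 = N1) (h1 : σ.v 1 = N2) :
    (preCmd k).wp (preCtx w k N1 N2 B) (fun τ => ∀ x < 16, τ.v x = constVal k N1 N2 B x) σ := by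
  have hp := h.pow_le hN
  have hcell := rowCount_le_cellCount k (N1 + N2) B
  have hwid := rowWidth_le_cellCount k (N1 + N2) B
  have hrow : N1 + N2 + B + 5 ≤ rowCount k (N1 + N2) B := by unfold rowCount; omega
  have h3N : 3 * (N1 + N2) ≤ cellCount k (N1 + N2) B := by unfold cellCount; omega
  obtain ⟨W, hWeq⟩ : ∃ W, W = (preCtx w k N1 N2 B).W := ⟨_, rfl⟩
  have hW : cellCount k (N1 + N2) B + keyBound k B * keyBound k B + 2 ^ k * (N1 + N2) +
      trieDepth k + 16 * k + 41 = W := by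
    simp only [hWeq, preCtx, numBound]
  have hB2 := h.two_le
  have hrw : (k * B) * (k * B) + (2 * k) * (2 * k) + k + B + 5 = rowWidth k B := rfl
  have hkb : 16 * k * B ^ k * B ^ (k + 1) = keyBound k B := rfl
  have hkk : keyBound k B ≤ keyBound k B * keyBound k B := Nat.le_mul_self _
  have hk1 : 16 * k * B ^ k ≤ keyBound k B :=
    Nat.le_mul_of_pos_right _ (Nat.pow_pos (by omega))
  have hk2 : B ^ (k + 1) ≤ keyBound k B := Nat.le_mul_of_pos_left _
    (Nat.mul_pos (by omega) (Nat.pow_pos (by omega)))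
  have hkB : k * B ≤ (k * B) * (k * B) := Nat.le_mul_self _
  unfold preCmd
  rw [wp]
  refine wp_conseq _ (radixCmd_wp hk hN h h0 h1) fun τ _ ⟨t0, t1, t2, t3, t4⟩ => ?_
  rw [wp]
  refine wp_conseq _ (radixPowCmd_wp t3 rfl (by omega) t4 (by omega) (by omega) (by omega))
    fun υ A u17 => ?_
  have uv : ∀ x < 5, υ.v x = τ.v x := fun x hx => A.v x (by simp [radixPowCmd]; omega)
  have u0 : υ.v 0 = N1 := by rw [uv 0 (by omega), t0]
  have u1 : υ.v 1 = N2 := by rw [uv 1 (by omega), t1]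
  have u2 : υ.v 2 = N1 + N2 := by rw [uv 2 (by omega), t2]
  have u3 : υ.v 3 = k := by rw [uv 3 (by omega), t3]
  have u4 : υ.v 4 = B := by rw [uv 4 (by omega), t4]
  unfold constCmd
  simp only [wp, Exp.ok, Exp.eval, true_and, St.setv_v, Nat.reduceEqDiff, if_true, if_false, u17,
    u2, u3, u4, ← hWeq, ← pow_succ, hkb, hrw]
  refine ⟨by omega, by omega, by omega, by omega, by omega, by omega, by omega, by omega, by omega,
    by omega, by omega, fun x hx => ?_⟩
  interval_cases x <;> simp [constVal, u0, u1, u2, u3, u4]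

end HIA

namespace HIA

open Cmd Exp

/-! ### Bounds for the parameters -/

/-- Degree in `N` of the constants. -/
def degN (i : ℕ) : ℕ :=
  if i = 11 then 2 else
  if i = 0 ∨ i = 1 ∨ i = 2 ∨ i = 5 ∨ i = 12 ∨ i = 15 then 1 else 0

/-- Degree in `B` of the constants. -/
def degB (i : ℕ) : ℕ :=
  if i = 8 ∨ i = 14 then 2 else if i = 4 ∨ i = 7 ∨ i = 11 ∨ i = 12 then 1 else 0

theorem rowWidth_le {k B : ℕ} (hB : 0 < B) : rowWidth k B ≤ (5 * (k * k) + k + 6) * B ^ 2 := by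
  have h1 : 0 < B ^ 2 := by positivity
  have h2 : B ≤ B ^ 2 := Nat.le_self_pow (by omega) _
  unfold rowWidth
  nlinarith [Nat.zero_le (k * k), Nat.zero_le k, Nat.mul_le_mul_left (k * k) h1,
    Nat.mul_le_mul_left k h1]

/-- The trie needs of the order of `N * B ^ 4` rows. All arrays share the width of the table of
entries, of the order of `B ^ 2`; this gives the exponent 6. -/
theorem cellCount_le (k : ℕ) : ∃ K, ∀ N B, 0 < N → 0 < B → cellCount k N B ≤ K * (N * B ^ 6) := by
  refine ⟨3 + ((k * k) * (k * k) * trieDepth k + 7) * (5 * (k * k) + k + 6) * 40,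
    fun N B hN hB => ?_⟩
  have hp : ∀ e, 0 < B ^ e := fun e => Nat.pow_pos hB
  have h4 : B ≤ B ^ 4 := Nat.le_self_pow (by omega) _
  have hr : rowCount k N B ≤ ((k * k) * (k * k) * trieDepth k + 7) * (N * B ^ 4) := by
    have e1 : N ≤ N * B ^ 4 := Nat.le_mul_of_pos_right _ (hp 4)
    have e2 : B ^ 4 ≤ N * B ^ 4 := Nat.le_mul_of_pos_left _ hN
    have e3 : N * ((k * B) * (k * B) * ((k * B) * (k * B))) * trieDepth k =
      (k * k) * (k * k) * trieDepth k * (N * B ^ 4) := by ring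
    unfold rowCount
    rw [e3, add_mul]
    omega
  have e0 : N ≤ N * B ^ 6 := Nat.le_mul_of_pos_right _ (hp 6)
  unfold cellCount
  calc 3 * N + rowCount k N B * rowWidth k B * 40
      ≤ 3 * (N * B ^ 6) + (((k * k) * (k * k) * trieDepth k + 7) * (N * B ^ 4)) *
        ((5 * (k * k) + k + 6) * B ^ 2) * 40 :=
        add_le_add (by omega) (Nat.mul_le_mul_right _ (Nat.mul_le_mul hr (rowWidth_le hB)))
    _ = _ := by ring

/-- The hypothesis on `B ^ k` trades `k` factors `B` for one factor `N1 + N2`, so at most `B ^ 2` is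
left. -/
theorem constVal_le (k : ℕ) : ∃ K, ∀ N1 N2 B i, 0 < N1 + N2 → 0 < B → B ^ k ≤ 2 ^ k * (N1 + N2) →
    constVal k N1 N2 B i ≤ K * ((N1 + N2) ^ degN i * B ^ degB i) := by
  refine ⟨16 * k * (2 ^ k * 2 ^ k) + 2 ^ k + 5 * (k * k) + 6 * k + 10, fun N1 N2 B i hN hB h => ?_⟩
  have hX : 0 < B ^ k := Nat.pow_pos hB
  generalize hN' : N1 + N2 = N at *
  have h2 : 0 < 2 ^ k := by positivity
  generalize hK : 16 * k * (2 ^ k * 2 ^ k) + 2 ^ k + 5 * (k * k) + 6 * k + 10 = K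
  have hK1 : 16 * k * (2 ^ k * 2 ^ k) ≤ K := by omega
  have hK2 : 2 ^ k ≤ K := by omega
  have hK3 : 5 * (k * k) + k + 6 ≤ K := by omega
  have hK4 : trieDepth k ≤ K := by unfold trieDepth; omega
  by_cases hi : i < 16
  · interval_cases i <;> simp only [constVal, degN, degB, hN'] <;> norm_num
    · nlinarith
    · nlinarith
    · nlinarith
    · omega
    · nlinarith
    · nlinarith
    · omega
    · nlinarith
    · calc k * B * (k * B) = (k * k) * B ^ 2 := by ring
        _ ≤ _ := Nat.mul_le_mul_right _ (by omega)
    · nlinarith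
    · exact hK4
    · calc keyBound k B = 16 * k * (B ^ k * B ^ k) * B := by unfold keyBound; ring
        _ ≤ 16 * k * ((2 ^ k * N) * (2 ^ k * N)) * B := by gcongr
        _ = 16 * k * (2 ^ k * 2 ^ k) * (N ^ 2 * B) := by ring
        _ ≤ _ := Nat.mul_le_mul_right _ hK1
    · calc B ^ (k + 1) = B ^ k * B := pow_succ _ _
        _ ≤ 2 ^ k * N * B := Nat.mul_le_mul_right _ h
        _ = 2 ^ k * (N * B) := by ring
        _ ≤ _ := Nat.mul_le_mul_right _ hK2
    · omega
    · exact (rowWidth_le hB).trans (Nat.mul_le_mul_right _ hK3)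
    · nlinarith
  · have : constVal k N1 N2 B i = 0 := by
      simp only [constVal]
      repeat rw [if_neg (by omega)]
    omega

/-- Bounded by a power of the first argument. -/
def PolyBounded (f : ℕ → ℕ → ℕ) : Prop := ∃ c, ∀ N B, 2 ≤ N → B ≤ N + 2 → f N B ≤ N ^ c

namespace PolyBounded

variable {f g : ℕ → ℕ → ℕ}

theorem const (a : ℕ) : PolyBounded fun _ _ => a :=
  ⟨a, fun _ _ hN _ => Nat.lt_two_pow_self.le.trans (Nat.pow_le_pow_left hN _)⟩

theorem left : PolyBounded fun N _ => N := ⟨1, fun N _ _ _ => (pow_one N).ge⟩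

/-- `N + 2 ≤ N ^ 2` for `N ≥ 2`; the size is at least 2 because each tree has a root. -/
theorem right : PolyBounded fun _ B => B := ⟨2, fun N B _ _ => by nlinarith⟩

theorem mul (hf : PolyBounded f) (hg : PolyBounded g) : PolyBounded fun N B => f N B * g N B := by
  obtain ⟨a, ha⟩ := hf
  obtain ⟨b, hb⟩ := hg
  exact ⟨a + b, fun N B hN hB => by
    rw [pow_add]; exact Nat.mul_le_mul (ha N B hN hB) (hb N B hN hB)⟩

theorem add (hf : PolyBounded f) (hg : PolyBounded g) : PolyBounded fun N B => f N B + g N B := by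
  obtain ⟨a, ha⟩ := hf
  obtain ⟨b, hb⟩ := hg
  refine ⟨max a b + 1, fun N B hN hB => ?_⟩
  have h1 := (ha N B hN hB).trans (Nat.pow_le_pow_right (by omega) (le_max_left a b))
  have h2 := (hb N B hN hB).trans (Nat.pow_le_pow_right (by omega) (le_max_right a b))
  rw [pow_succ]
  nlinarith

theorem pow (hf : PolyBounded f) (e : ℕ) : PolyBounded fun N B => f N B ^ e := by
  obtain ⟨a, ha⟩ := hf
  exact ⟨a * e, fun N B hN hB => by rw [pow_mul]; exact Nat.pow_le_pow_left (ha N B hN hB) _⟩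

end PolyBounded

/-- This is why a word length of order `log n` suffices. -/
theorem polyBounded_numBound (k : ℕ) : PolyBounded fun N B => 2 * numBound k N B := by
  have C := PolyBounded.const
  have hB := PolyBounded.right
  have hN := PolyBounded.left
  have hw : PolyBounded fun _ B => rowWidth k B :=
    ((((((C k).mul hB).mul ((C k).mul hB)).add (C _)).add (C _)).add hB).add (C _)
  have hr : PolyBounded fun N B => rowCount k N B :=
    (((((hN.mul ((((C k).mul hB).mul ((C k).mul hB)).mul
      (((C k).mul hB).mul ((C k).mul hB))))).mul (C _)).add hN).add hB).add (C _)
  have hc : PolyBounded fun N B => cellCount k N B :=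
    ((C 3).mul hN).add ((hr.mul hw).mul (C 40))
  have hk : PolyBounded fun _ B => keyBound k B :=
    ((C (16 * k)).mul (hB.pow k)).mul (hB.pow (k + 1))
  exact (C 2).mul (((((hc.add (hk.mul hk)).add ((C (2 ^ k)).mul hN)).add (C _)).add
    (C _)).add (C _))

/-- `B ≤ 2 * n ^ (1 / k)`, and `6 / k ≤ ε` by the choice of `k`; the constant is `2 ^ 6`. -/
theorem Radix.pow_six_le {k n B : ℕ} {ε : ℝ} (hk : 0 < k) (hε : 6 / ε ≤ k) (hε0 : 0 < ε)
    (hn : 0 < n) (h : Radix k n B) : (B : ℝ) ^ 6 ≤ 64 * (n : ℝ) ^ ε := by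
  have hk' : (0 : ℝ) < k := by exact_mod_cast hk
  have hn1 : (1 : ℝ) ≤ n := by exact_mod_cast hn
  have h1 : (B : ℝ) ^ k ≤ 2 ^ k * n := by exact_mod_cast h.pow_le hn
  have h2 : (B : ℝ) ≤ 2 * (n : ℝ) ^ ((1 : ℝ) / k) := by
    refine le_of_pow_le_pow_left₀ hk.ne' (by positivity) (h1.trans_eq ?_)
    rw [mul_pow, ← Real.rpow_natCast ((n : ℝ) ^ ((1 : ℝ) / k)), ← Real.rpow_mul (by positivity),
      one_div_mul_cancel hk'.ne', Real.rpow_one]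
  calc (B : ℝ) ^ 6 ≤ (2 * (n : ℝ) ^ ((1 : ℝ) / k)) ^ 6 := by gcongr
    _ = 64 * (n : ℝ) ^ ((6 : ℝ) / k) := by
      rw [mul_pow, ← Real.rpow_natCast ((n : ℝ) ^ ((1 : ℝ) / k)), ← Real.rpow_mul (by positivity)]
      norm_num
      ring_nf
    _ ≤ 64 * (n : ℝ) ^ ε := by
      gcongr
      rw [div_le_iff₀ hk']
      rwa [div_le_iff₀ hε0, mul_comm] at hε

theorem near_linear {k n B K m : ℕ} {ε : ℝ} (hk : 0 < k) (hε : 6 / ε ≤ k) (hε0 : 0 < ε)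
    (hn : 0 < n) (h : Radix k n B) (hm : m ≤ K * (n * B ^ 6)) :
    (m : ℝ) ≤ (64 * K : ℕ) * (n : ℝ) ^ (1 + ε) := by
  have hn0 : (0 : ℝ) < n := by exact_mod_cast hn
  have h6 := h.pow_six_le hk hε hε0 hn
  calc (m : ℝ) ≤ K * (n * (B : ℝ) ^ 6) := by exact_mod_cast hm
    _ ≤ K * (n * (64 * (n : ℝ) ^ ε)) := by gcongr
    _ = (64 * K : ℕ) * (n : ℝ) ^ (1 + ε) := by
      rw [Real.rpow_add hn0, Real.rpow_one]; push_cast; ring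

/-! ### The programs -/

/-- Preprocessing. -/
def buildProg (k : ℕ) : Prog :=
  -- Variable 1 lives in register 2, and register 1 must hold the base, `0` at first. Later
  -- registers 30 and 28, that is variables 15 and 14, supply base and width. Finally these are
  -- saved in cells 0 and 1, where the input is no longer needed.
  .seq (.move 2 1) <| .seq (.const 1 0) <| .seq (preCmd k).comp <| .seq (.move 1 30) <|
  .seq (.move 3 28) <| .seq (numberCmd ;; tableCmd).comp <| .seq (.const 5 0) <|
  .seq (.store 5 1) <| .seq (.const 5 1) (.store 5 3)

/-- Query. -/
def queryProg (k : ℕ) : Prog :=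
  -- Base and width are restored from cells 0 and 1. Registers 124 and 126 are variables 62 and 63,
  -- which hold node numbers plus one; subtracting one turns the value `0` into the answer `-1`.
  .seq (.move 2 1) <| .seq (.const 5 0) <| .seq (.load 1 5) <| .seq (.const 5 1) <|
  .seq (.load 3 5) <| .seq (queryCmd k).comp <| .seq (.const 5 1) <|
  .seq (.arith .sub 0 124 5) (.arith .sub 1 126 5)

theorem storeFree_queryProg (k : ℕ) : (queryProg k).StoreFree :=
  ⟨trivial, trivial, trivial, trivial, trivial,
    (queryCmd k).storeFree_comp (by simp [queryCmd, searchCmd, lookupCmd, improveCmd])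
      (by simp [queryCmd, searchCmd, lookupCmd, improveCmd]), trivial, trivial, trivial⟩

/-- `Built` speaks of arrays only, so it survives the loss of the registers between preprocessing
and query. -/
theorem Built.congr {cx : Ctx} {T₁ T₂ : WLTree} {k B : ℕ} {σ τ : St} (h : Built cx T₁ T₂ k B σ)
    (ha : τ.a = σ.a) (hz : τ.z = σ.z) : Built cx T₁ T₂ k B τ := by
  obtain ⟨v, a, z, i⟩ := τ
  obtain rfl := ha
  obtain rfl := hz
  exact ⟨h.pre, h.emb₁, h.emb₂, h.pos_le, h.org_pos, h.qry, h.trie, h.dict, h.prm₀, h.prm₁, h.prm₂⟩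

/-- The memory holds the data structure. -/
structure Stored (cx : Ctx) (T₁ T₂ : WLTree) (k B : ℕ) (D : ℕ → ℤ) (τ : St) : Prop where
  built : Built cx T₁ T₂ k B τ
  base : D 0 = cx.base
  width : D 1 = cx.Wd
  a : ∀ j < 20, ∀ r < cx.L, ∀ c < cx.Wd, D (cx.addr r c (2 * j)) = τ.a j r c
  z : ∀ j < 20, ∀ r < cx.L, D (cx.addr r 0 (2 * j + 1)) = τ.z j r

/-! ### Runs of the two programs. -/

theorem inputState_mem_of_le {T₁ T₂ : WLTree} {i : ℕ} (h : 3 * (T₁.size + T₂.size) ≤ i) :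
    (inputState T₁ T₂).mem i = 0 := by
  refine List.getD_eq_default _ _ ?_
  rw [List.length_append, T₁.length_encode, T₂.length_encode]
  omega

theorem run_buildProg {w k B : ℕ} {T₁ T₂ : WLTree} (hk : 0 < k)
    (hR : Radix k (T₁.size + T₂.size) B) (hw : 2 * numBound k (T₁.size + T₂.size) B ≤ 2 ^ w)
    (hf : FitsInWords w T₁ T₂) (hN1 : 0 < T₁.size) :
    ∃ t s τ, Run w (cellCount k (T₁.size + T₂.size) B) (buildProg k) (inputState T₁ T₂) t s ∧
      t ≤ (preCmd k).tm (constVal k T₁.size T₂.size B) +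
        (numberCmd ;; tableCmd).tm (constVal k T₁.size T₂.size B) + 8 ∧
      Stored (mainCtx w k T₁.size T₂.size B) T₁ T₂ k B s.mem τ := by
  have hV := mainCtx_valid hw
  have hV' := preCtx_valid hw
  have hE := mainCtx_env (w := w) hk hR
  set σ : St := ⟨fun x => if x = 0 then T₁.size else if x = 1 then T₂.size else 0,
    fun _ _ _ => 0, fun _ _ => 0, inputCells T₁ T₂⟩ with hσ
  set s₂ := ((inputState T₁ T₂).setReg 2 ((inputState T₁ T₂).reg 1)).setReg 1 0 with hs₂
  have m₂ : s₂.mem = (inputState T₁ T₂).mem := rfl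
  have rep₂ : Rep (preCtx w k T₁.size T₂.size B) s₂ σ := by
    refine ⟨fun x => ?_, ?_, ?_, ?_, ?_, ?_⟩
    · rcases Nat.lt_or_ge x 2 with h | h
      · interval_cases x <;> simp [hs₂, hσ, State.setReg, Function.update, inputState, args]
      · have h1 : x ≠ 0 := by omega
        have h2 : x ≠ 1 := by omega
        have h3 : 2 * x ≠ 1 := by omega
        simp [hs₂, hσ, State.setReg, Function.update, inputState, args, h1, h2, h3]
    · simp [hs₂, State.setReg, preCtx]
    · simp [hs₂, State.setReg, Function.update, preCtx, inputState, args]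
    · intro j _ r hr; simp [preCtx] at hr
    · intro j _ r hr; simp [preCtx] at hr
    · intro i hi; simp [preCtx] at hi
  obtain ⟨s₃, τ₃, t₃, r₃, ht₃, rep₃, A₃, c₃⟩ := Cmd.run_of_wp hV' (preCmd k)
    (preCmd_wp hk (by omega) hR (σ := σ) rfl rfl) s₂ rep₂
  have m₃ : s₃.mem = (inputState T₁ T₂).mem := (r₃.mem_eq ((preCmd k).storeFree_comp
    (by simp [preCmd, radixCmd, radixPowCmd, constCmd])
    (by simp [preCmd, radixCmd, radixPowCmd, constCmd]))).trans m₂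
  have a₃ : τ₃.a = σ.a := funext fun j => A₃.a j (by simp [preCmd, radixCmd, radixPowCmd, constCmd])
  have z₃ : τ₃.z = σ.z := funext fun j => A₃.z j (by simp [preCmd, radixCmd, radixPowCmd, constCmd])
  set s₅ := (s₃.setReg 1 (s₃.reg 30)).setReg 3 ((s₃.setReg 1 (s₃.reg 30)).reg 28) with hs₅
  have rep₅ : Rep (mainCtx w k T₁.size T₂.size B) s₅ τ₃ := by
    have e30 : s₃.reg 30 = τ₃.v 15 := rep₃.v 15
    have e28 : s₃.reg 28 = τ₃.v 14 := rep₃.v 14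
    refine ⟨fun x => ?_, ?_, ?_, ?_, ?_, ?_⟩
    · have h1 : 2 * x ≠ 1 := by omega
      have h3 : 2 * x ≠ 3 := by omega
      simp [hs₅, State.setReg, Function.update, h1, h3, rep₃.v]
    · simp [hs₅, State.setReg, Function.update, e30, c₃ 15 (by omega), constVal, mainCtx]
    · simp [hs₅, State.setReg, Function.update, e28, c₃ 14 (by omega), constVal, mainCtx]
    · intro j _ r _ c _
      rw [a₃]
      change s₃.mem _ = _
      rw [m₃, inputState_mem_of_le (by unfold Ctx.addr; simp only [mainCtx]; omega)]
      rfl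
    · intro j _ r _
      rw [z₃]
      change s₃.mem _ = _
      rw [m₃, inputState_mem_of_le (by unfold Ctx.addr; simp only [mainCtx]; omega)]
    · intro i _
      rw [A₃.inp]
      change s₃.mem _ = _
      rw [m₃]
      rfl
  obtain ⟨s₆, τ, t₆, r₆, ht₆, rep₆, -, built⟩ := Cmd.run_of_wp hV (numberCmd ;; tableCmd)
    (build_wp hE (σ := τ₃) c₃ hf (A₃.inp.trans rfl) (fun j r c => by rw [a₃])
      (fun j r => by rw [z₃])) s₅ rep₅
  have w0 : IsWord w 0 := hV.isWord (n := 0) (by have := hV.forty; omega)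
  have w1 : IsWord w 1 := hV.isWord (n := 1) (by have := hV.forty; omega)
  -- Cells 0 and 1 lie below the arrays, so saving base and width damages no array.
  have hbase : 3 ≤ (mainCtx w k T₁.size T₂.size B).base := by simp only [mainCtx]; omega
  have hS : 3 ≤ cellCount k (T₁.size + T₂.size) B := by unfold cellCount; omega
  refine ⟨_, _, τ, .seq (.move _ _ _) <| .seq (.const _ _ _ w0) <| .seq r₃ <|
    .seq (.move _ _ _) <| .seq (.move _ _ _) <| .seq r₆ <| .seq (.const _ _ _ w0) <|
    .seq (.store _ _ _ 0 (by omega) (by simp [State.setReg])) <| .seq (.const _ _ _ w1) <|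
    (.store _ _ _ 1 (by omega) (by simp [State.setReg])), ?_, built, ?_, ?_, ?_, ?_⟩
  · change t₃ ≤ (preCmd k).tm (constVal k T₁.size T₂.size B) at ht₃
    change t₆ ≤ (numberCmd ;; tableCmd).tm (constVal k T₁.size T₂.size B) at ht₆
    omega
  · simp [State.setReg, State.setMem, Function.update, rep₆.base]
  · simp [State.setReg, State.setMem, Function.update, rep₆.width]
  · intro j hj r hr c hc
    rw [← rep₆.a j hj r hr c hc]
    have h0 : (mainCtx w k T₁.size T₂.size B).addr r c (2 * j) ≠ 0 := by unfold Ctx.addr; omega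
    have h1 : (mainCtx w k T₁.size T₂.size B).addr r c (2 * j) ≠ 1 := by unfold Ctx.addr; omega
    simp [State.setReg, State.setMem, Function.update, h0, h1]
  · intro j hj r hr
    rw [← rep₆.z j hj r hr]
    have h0 : (mainCtx w k T₁.size T₂.size B).addr r 0 (2 * j + 1) ≠ 0 := by unfold Ctx.addr; omega
    have h1 : (mainCtx w k T₁.size T₂.size B).addr r 0 (2 * j + 1) ≠ 1 := by unfold Ctx.addr; omega
    simp [State.setReg, State.setMem, Function.update, h0, h1]

theorem run_queryProg {w k B : ℕ} {T₁ T₂ : WLTree} (hk : 0 < k)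
    (hR : Radix k (T₁.size + T₂.size) B) (hw : 2 * numBound k (T₁.size + T₂.size) B ≤ 2 ^ w)
    (hf : FitsInWords w T₁ T₂) {D : ℕ → ℤ} {τ : St}
    (hD : Stored (mainCtx w k T₁.size T₂.size B) T₁ T₂ k B D τ) (u : Fin T₁.size)
    (v : Fin T₂.size) :
    ∃ t s, Run w (cellCount k (T₁.size + T₂.size) B) (queryProg k) (queryState D u v) t s ∧
      t ≤ (queryCmd k).tm (constVal k T₁.size T₂.size B) + 8 ∧ s.mem = D ∧
      CorrectAnswer T₁ T₂ u v (s.reg 0) (s.reg 1) := by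
  have hV := mainCtx_valid hw
  have hE := mainCtx_env (w := w) hk hR
  have hu := u.2
  have hv := v.2
  have hS : 3 ≤ cellCount k (T₁.size + T₂.size) B := by unfold cellCount; omega
  have hW : cellCount k (T₁.size + T₂.size) B ≤ (mainCtx w k T₁.size T₂.size B).W := hV.space_le
  have hNW : T₁.size + T₂.size ≤ cellCount k (T₁.size + T₂.size) B := by unfold cellCount; omega
  have w0 : IsWord w 0 := hV.isWord (n := 0) (by have := hV.forty; omega)
  have w1 : IsWord w 1 := hV.isWord (n := 1) (by have := hV.forty; omega)
  have wneg : IsWord w (-1) := by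
    have h1 := w1.2
    exact ⟨by omega, by omega⟩
  -- The whole memory is declared as input: the query never reads input cells, so it does not matter
  -- that two of them are overwritten.
  set σ : St := ⟨fun x => if x = 0 then u else if x = 1 then v else 0, τ.a, τ.z, D⟩ with hσ
  set q := queryState D u v with hq
  set s₅ := ((((q.setReg 2 (q.reg 1)).setReg 5 0).setReg 1 (D 0)).setReg 5 1).setReg 3 (D 1)
    with hs₅
  have rep₅ : Rep (mainCtx w k T₁.size T₂.size B) s₅ σ := by
    refine ⟨fun x => ?_, ?_, ?_, hD.a, hD.z, fun i _ => rfl⟩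
    · rcases Nat.lt_or_ge x 2 with h | h
      · interval_cases x <;> simp [hs₅, hσ, hq, State.setReg, Function.update, queryState, args]
      · have h1 : x ≠ 0 := by omega
        have h2 : x ≠ 1 := by omega
        have h3 : 2 * x ≠ 1 := by omega
        have h4 : 2 * x ≠ 3 := by omega
        have h5 : 2 * x ≠ 5 := by omega
        simp [hs₅, hσ, hq, State.setReg, Function.update, queryState, args, h1, h2, h3, h4, h5]
    · simp [hs₅, State.setReg, Function.update, hD.base]
    · simp [hs₅, State.setReg, hD.width]
  obtain ⟨s₆, υ, t₆, r₆, ht₆, rep₆, -, ans⟩ := Cmd.run_of_wp hV (queryCmd k)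
    (queryCmd_wp hE hf (σ := σ) (hD.built.congr rfl rfl) rfl rfl) s₅ rep₅
  have e124 : s₆.reg 124 = υ.v 62 := rep₆.v 62
  have e126 : s₆.reg 126 = υ.v 63 := rep₆.v 63
  have hword : IsWord w ((υ.v 62 : ℤ) - 1) ∧ IsWord w ((υ.v 63 : ℤ) - 1) := by
    rcases ans with ⟨a, b, -, h1, h2⟩ | ⟨-, h1, h2⟩
    · have ha := a.2
      have hb := b.2
      rw [h1, h2]
      push_cast
      rw [add_sub_cancel_right, add_sub_cancel_right]
      exact ⟨hV.isWord (by omega), hV.isWord (by omega)⟩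
    · rw [h1, h2]
      exact ⟨wneg, wneg⟩
  have run : ∃ t s, Run w (cellCount k (T₁.size + T₂.size) B) (queryProg k) q t s ∧
      t ≤ (queryCmd k).tm (constVal k T₁.size T₂.size B) + 8 ∧ s.reg 0 = (υ.v 62 : ℤ) - 1 ∧
      s.reg 1 = (υ.v 63 : ℤ) - 1 := by
    refine ⟨_, _, .seq (.move _ _ _) <| .seq (.const _ _ _ w0) <|
      .seq (.load _ _ _ 0 (by omega) (by simp [State.setReg])) <| .seq (.const _ _ _ w1) <|
      .seq (.load _ _ _ 1 (by omega) (by simp [State.setReg])) <| .seq r₆ <|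
      .seq (.const _ _ _ w1) <| .seq (.arith _ _ _ _ _ ?_) (.arith _ _ _ _ _ ?_), ?_, ?_, ?_⟩
    · simpa [State.setReg, Function.update, ArithOp.eval, e124] using hword.1
    · simpa [State.setReg, Function.update, ArithOp.eval, e126] using hword.2
    · change t₆ ≤ (queryCmd k).tm (constVal k T₁.size T₂.size B) at ht₆
      omega
    · simp [State.setReg, Function.update, ArithOp.eval, e124]
    · simp [State.setReg, Function.update, ArithOp.eval, e126]
  obtain ⟨t, s, r, ht, h0, h1⟩ := run
  refine ⟨t, s, r, ht, r.mem_eq (storeFree_queryProg k), ?_⟩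
  rw [h0, h1]
  rcases ans with ⟨a, b, hab, h1, h2⟩ | ⟨hno, h1, h2⟩
  · exact .inl ⟨a, b, hab, by rw [h1]; push_cast; ring, by rw [h2]; push_cast; ring⟩
  · exact .inr ⟨hno, by rw [h1]; rfl, by rw [h2]; rfl⟩

end HIA

theorem mainTheorem6 (ε : ℝ) (hε : 0 < ε) :
    ∃ (build query : HIA.Prog) (C : ℕ),
      ∀ (T₁ T₂ : HIA.WLTree) (n : ℕ), n = T₁.size + T₂.size →
      ∀ w : ℕ, n ^ C ≤ 2 ^ w → HIA.FitsInWords w T₁ T₂ →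
      ∃ S : ℕ, (S : ℝ) ≤ C * (n : ℝ) ^ (1 + ε) ∧
      ∃ (t : ℕ) (s : HIA.State),
        HIA.Run w S build (HIA.inputState T₁ T₂) t s ∧
        (t : ℝ) ≤ C * (n : ℝ) ^ (1 + ε) ∧
        ∀ (u : Fin T₁.size) (v : Fin T₂.size),
          ∃ (t' : ℕ) (s' : HIA.State),
            HIA.Run w S query (HIA.queryState s.mem u v) t' s' ∧
            t' ≤ C ∧
            s'.mem = s.mem ∧
            HIA.CorrectAnswer T₁ T₂ u v (s'.reg 0) (s'.reg 1) := by
  -- The costs are of order `n * B ^ 6` with `B` of order `n ^ (1 / k)`.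
  obtain ⟨k, hk, hkε⟩ : ∃ k : ℕ, 0 < k ∧ 6 / ε ≤ k := by
    obtain ⟨k, h⟩ := exists_nat_ge (6 / ε)
    exact ⟨k, by exact_mod_cast (div_pos (by norm_num) hε).trans_le h, h⟩
  obtain ⟨K₀, hK₀⟩ := HIA.constVal_le k
  obtain ⟨K₁, hK₁⟩ := HIA.Cmd.tm_le HIA.degN HIA.degB K₀ (HIA.preCmd k)
  obtain ⟨K₂, hK₂⟩ := HIA.Cmd.tm_le HIA.degN HIA.degB K₀ (.seq HIA.numberCmd HIA.tableCmd)
  obtain ⟨K₃, hK₃⟩ := HIA.Cmd.tm_le HIA.degN HIA.degB K₀ (HIA.queryCmd k)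
  obtain ⟨K₄, hK₄⟩ := HIA.cellCount_le k
  obtain ⟨c, hc⟩ := HIA.polyBounded_numBound k
  -- The degrees are found by evaluation. The loops of the query have lengths that depend on `k`
  -- only, so both of its degrees are 0.
  have d₁ : (HIA.preCmd k).deg HIA.degN = 1 ∧ (HIA.preCmd k).deg HIA.degB ≤ 6 :=
    ⟨rfl, (Nat.zero_le 6 : 0 ≤ 6)⟩
  have d₂ : (HIA.Cmd.seq HIA.numberCmd HIA.tableCmd).deg HIA.degN = 1 ∧
    (HIA.Cmd.seq HIA.numberCmd HIA.tableCmd).deg HIA.degB ≤ 6 :=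
    ⟨by decide, by decide⟩
  have d₃ : (HIA.queryCmd k).deg HIA.degN = 0 ∧ (HIA.queryCmd k).deg HIA.degB = 0 :=
    ⟨rfl, rfl⟩
  -- The summands of the constant pay for the word length, the space, the preprocessing time and the
  -- query time, in this order.
  refine ⟨HIA.buildProg k, HIA.queryProg k, c + 64 * K₄ + 64 * (K₁ + K₂ + 8) + (K₃ + 8), ?_⟩
  rintro T₁ T₂ n rfl w hw hf
  have hN1 := T₁.root.pos
  have hN2 := T₂.root.pos
  obtain ⟨B, hB⟩ := HIA.exists_radix hk (T₁.size + T₂.size)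
  have hB0 : 0 < B := by have := hB.two_le; omega
  have hword : 2 * HIA.numBound k (T₁.size + T₂.size) B ≤ 2 ^ w :=
    (hc _ _ (by omega) (hB.le_add_two hk)).trans
      ((Nat.pow_le_pow_right (by omega) (by omega)).trans hw)
  have hconst := fun i => hK₀ T₁.size T₂.size B i (by omega) hB0 (hB.pow_le (by omega))
  have h₁ := hK₁ _ _ _ (by omega) hB0 hconst
  have h₂ := hK₂ _ _ _ (by omega) hB0 hconst
  have h₃ := hK₃ _ _ _ (by omega) hB0 hconst
  rw [d₁.1, pow_one] at h₁
  rw [d₂.1, pow_one] at h₂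
  rw [d₃.1, d₃.2, pow_zero, pow_zero, mul_one, mul_one] at h₃
  have hn0 : (0 : ℝ) ≤ ((T₁.size + T₂.size : ℕ) : ℝ) ^ (1 + ε) := by positivity
  obtain ⟨t, s, τ, hrun, ht, hD⟩ := HIA.run_buildProg hk hB hword hf hN1
  refine ⟨_, ?_, t, s, hrun, ?_, fun u v => ?_⟩
  · refine (HIA.near_linear hk hkε hε (by omega) hB (hK₄ _ _ (by omega) hB0)).trans ?_
    refine mul_le_mul_of_nonneg_right ?_ hn0
    exact_mod_cast (by omega)
  · have hpow : ∀ e ≤ 6, (T₁.size + T₂.size) * B ^ e ≤ (T₁.size + T₂.size) * B ^ 6 := fun e he =>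
      Nat.mul_le_mul_left _ (Nat.pow_le_pow_right hB0 he)
    have ht' : t ≤ (K₁ + K₂ + 8) * ((T₁.size + T₂.size) * B ^ 6) := by
      have g₁ := h₁.trans (Nat.mul_le_mul_left _ (hpow _ d₁.2))
      have g₂ := h₂.trans (Nat.mul_le_mul_left _ (hpow _ d₂.2))
      have g₃ : 0 < (T₁.size + T₂.size) * B ^ 6 := Nat.mul_pos (by omega) (Nat.pow_pos hB0)
      rw [add_mul, add_mul]
      omega
    refine (HIA.near_linear hk hkε hε (by omega) hB ht').trans ?_
    refine mul_le_mul_of_nonneg_right ?_ hn0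
    exact_mod_cast (by omega)
  · obtain ⟨t', s', hq, ht', hm, hans⟩ := HIA.run_queryProg hk hB hword hf hD u v
    exact ⟨t', s', hq, by omega, hm, hans⟩
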